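/- Let $n>4$, let $(M,g_0)$ be a compact smooth Riemannian manifold of dimension $n$ without boundary, let $p\in M$ and $R>0$, and let $B_R$ denote the open ball of radius $R$ about $p$ for the Riemannian distance of $g_0$ (a geodesic ball when $R$ is less than the injectivity radius). For $u\in C^\infty(M)$ put $g=e^{-2u}g_0$. With the Schouten tensor $A_g=\frac1{n-2}\bigl(\mathrm{Ric}_g-\frac{R_g}{2(n-1)}g\bigr)$, where $R_g$ is the scalar curvature, let $\sigma_k(g)$ be the $k$-th elementary symmetric function of the eigenvalues of $g^{-1}A_g$, and let $\mathcal C_1([g_0])$ be the set of metrics $g=e^{-2u}g_0$, $u\in C^\infty(M)$, with $\sigma_1(g)>0$ on $M$. For $\varepsilon\in[0,1)$ let $$r_\varepsilon(g)=\frac{\int_M\sigma_2(g)\,dvol(g)}{\int_M e^{2\varepsilon u}\,dvol(g)},$$ let $s_\varepsilon(g)\in\mathbb R$ be determined by $$\int_M e^{2\varepsilon u}\Bigl\{e^{-2u}\frac{\sigma_2(g)-r_\varepsilon(g)e^{2\varepsilon u}}{\sigma_1(g)}+s_\varepsilon(g)\Bigr\}dvol(g)=0,$$ and let $$Y_\varepsilon(M,[g_0])=\inf_{g\in\mathcal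 C_1([g_0])}\Bigl(\int_M e^{2\varepsilon u}dvol(g)\Bigr)^{-\frac{n-4}{n-2\varepsilon}}\int_M\sigma_2(g)\,dvol(g).$$ A solution on $[0,T]$ of the flow is a function $u\in C^\infty(M\times[0,T])$ such that, with $g=g(t)=e^{-2u(\cdot,t)}g_0$, one has $\sigma_1(g)\neq 0$ and $$\partial_t u=e^{-2u}\,\frac{\sigma_2(g)-r_\varepsilon(g)e^{2\varepsilon u}}{\sigma_1(g)}+s_\varepsilon(g)\qquad\text{on } M\times[0,T].$$ **Theorem.** For every $K>0$ there is a constant $C$, depending only on $(M,g_0)$, $B_R$ and $K$, with the following property. Let $\varepsilon\in[0,1)$ with $Y_\varepsilon(M,[g_0])\ge 1/K$, let $T>0$, and let $u$ be a solution of the flow on $[0,T]$ whose initial metric $g(0)=e^{-2u(\cdot,0)}g_0$ belongs to $\mathcal C_1([g_0])$ and satisfies $|u|+|\nabla u|+|\nabla^2u|\le K$ on $M$ at time $0$. Then for all $(x,t)\in B_{R/2}\times[0,T]$, $$\bigl(|\nabla u|^2+|\nabla^2u|\bigr)(x,t)\le C\Bigl(1+r_\varepsilon(g(t))\,e^{-(2-\varepsilon)\inf_{B_R\times[0,T]}u}\Bigr),$$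 where $\nabla$ and $|\cdot|$ are taken with respect to $g_0$. In particular, if $Y_\varepsilon(M,[g_0])>0$ and the initial metric $g(0)\in\mathcal C_1([g_0])$ is given, the estimate holds with a constant independent of $T$. -/

import Mathlib

open Set
open scoped Manifold ContDiff Bundle Topology

noncomputable section

namespace SigmaTwoFlow

/-! ### Riemannian geometry in local coordinates

`G y` is the matrix `(g_{ij}(y))` of a Riemannian metric in coordinates `y ∈ ℝⁿ`. -/

section Coordinates

variable {n : ℕ}

/-- The partial derivative `∂ₖ f (y)`. -/
def pd (k : Fin n) (f : EuclideanSpace ℝ (Fin n) → ℝ) (y : EuclideanSpace ℝ (Fin n)) : ℝ :=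
  fderiv ℝ f y (EuclideanSpace.single k 1)

/-- The Christoffel symbol `Γᵏᵢⱼ = ½ ∑ₗ gᵏˡ (∂ᵢ gⱼₗ + ∂ⱼ gᵢₗ - ∂ₗ gᵢⱼ)` of the Levi-Civita
connection. -/
def christoffel (G : EuclideanSpace ℝ (Fin n) → Matrix (Fin n) (Fin n) ℝ) (k i j : Fin n)
    (y : EuclideanSpace ℝ (Fin n)) : ℝ :=
  (1 / 2) * ∑ l, (G y)⁻¹ k l *
    (pd i (fun z => G z j l) y + pd j (fun z => G z i l) y - pd l (fun z => G z i j) y)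

/-- The Ricci tensor
`Ricᵢⱼ = ∑ₖ (∂ₖ Γᵏᵢⱼ - ∂ⱼ Γᵏₖᵢ + ∑ₗ (Γᵏₖₗ Γˡᵢⱼ - Γᵏⱼₗ Γˡₖᵢ))` (positive on round spheres). -/
def ricci (G : EuclideanSpace ℝ (Fin n) → Matrix (Fin n) (Fin n) ℝ)
    (y : EuclideanSpace ℝ (Fin n)) : Matrix (Fin n) (Fin n) ℝ :=
  Matrix.of fun i j => ∑ k, (pd k (christoffel G k i j) y - pd j (christoffel G k k i) y
    + ∑ l, (christoffel G k k l y * christoffel G l i j y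
        - christoffel G k j l y * christoffel G l k i y))

/-- The scalar curvature `∑ᵢⱼ gⁱʲ Ricᵢⱼ`. -/
def scalarCurvature (G : EuclideanSpace ℝ (Fin n) → Matrix (Fin n) (Fin n) ℝ)
    (y : EuclideanSpace ℝ (Fin n)) : ℝ :=
  ∑ i, ∑ j, (G y)⁻¹ i j * ricci G y i j

/-- The Schouten tensor `A = (Ric - R g / (2 (n - 1))) / (n - 2)`. -/
def schouten (G : EuclideanSpace ℝ (Fin n) → Matrix (Fin n) (Fin n) ℝ)
    (y : EuclideanSpace ℝ (Fin n)) : Matrix (Fin n) (Fin n) ℝ :=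
  (1 / ((n : ℝ) - 2)) • (ricci G y - (scalarCurvature G y / (2 * ((n : ℝ) - 1))) • G y)

/-- The endomorphism `g⁻¹ · A_g`. -/
def schoutenEndo (G : EuclideanSpace ℝ (Fin n) → Matrix (Fin n) (Fin n) ℝ)
    (y : EuclideanSpace ℝ (Fin n)) : Matrix (Fin n) (Fin n) ℝ :=
  (G y)⁻¹ * schouten G y

/-- The covariant Hessian `(∇²f)ᵢⱼ = ∂ᵢ∂ⱼ f - ∑ₖ Γᵏᵢⱼ ∂ₖ f`. -/
def hessian (G : EuclideanSpace ℝ (Fin n) → Matrix (Fin n) (Fin n) ℝ)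
    (f : EuclideanSpace ℝ (Fin n) → ℝ) (y : EuclideanSpace ℝ (Fin n)) (i j : Fin n) : ℝ :=
  pd i (pd j f) y - ∑ k, christoffel G k i j y * pd k f y

/-- First elementary symmetric function of the eigenvalues: `∑ᵢ λᵢ = tr B`. -/
def sigmaOne (B : Matrix (Fin n) (Fin n) ℝ) : ℝ := B.trace

/-- Second elementary symmetric function of the eigenvalues:
`∑_{i<j} λᵢ λⱼ = ((tr B)² - tr (B²)) / 2`. -/
def sigmaTwo (B : Matrix (Fin n) (Fin n) ℝ) : ℝ := (B.trace ^ 2 - (B * B).trace) / 2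

end Coordinates

/-! ### Conformal metrics `g = e^{-2u} g₀` on a manifold -/

/-- Smooth Riemannian metrics on the `n`-dimensional manifold `M` (without boundary). -/
abbrev SmoothMetric (n : ℕ) (M : Type*) [TopologicalSpace M]
    [ChartedSpace (EuclideanSpace ℝ (Fin n)) M] [IsManifold (𝓡 n) ∞ M] :=
  Bundle.ContMDiffRiemannianMetric (𝓡 n) ∞ (EuclideanSpace ℝ (Fin n))
    (fun x : M => TangentSpace (𝓡 n) x)

section Manifold

variable {n : ℕ} {M : Type*} [TopologicalSpace M] [ChartedSpace (EuclideanSpace ℝ (Fin n)) M]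
  [IsManifold (𝓡 n) ∞ M]

/-- The matrix `g₀(∂ᵢ, ∂ⱼ)` in the coordinates given by the chart at `c`, as a function of the
coordinates `y`; here `∂ᵢ` is the image of the `i`-th standard vector under the derivative of the
inverse chart. -/
def gram (g₀ : SmoothMetric n M) (c : M) (y : EuclideanSpace ℝ (Fin n)) :
    Matrix (Fin n) (Fin n) ℝ :=
  Matrix.of fun i j =>
    g₀.inner ((extChartAt (𝓡 n) c).symm y)
      (mfderiv 𝓘(ℝ, EuclideanSpace ℝ (Fin n)) (𝓡 n) (extChartAt (𝓡 n) c).symm y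
        (EuclideanSpace.single i (1 : ℝ)))
      (mfderiv 𝓘(ℝ, EuclideanSpace ℝ (Fin n)) (𝓡 n) (extChartAt (𝓡 n) c).symm y
        (EuclideanSpace.single j (1 : ℝ)))

/-- The matrix of the conformal metric `g = e^{-2u} g₀` in the chart at `c`. -/
def confGram (g₀ : SmoothMetric n M) (u : M → ℝ) (c : M) (y : EuclideanSpace ℝ (Fin n)) :
    Matrix (Fin n) (Fin n) ℝ :=
  Real.exp (-2 * u ((extChartAt (𝓡 n) c).symm y)) • gram g₀ c y

/-- `σ₁(g)` at the point `x`, for `g = e^{-2u} g₀`, computed in the chart at `x`. -/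
def sigma1 (g₀ : SmoothMetric n M) (u : M → ℝ) (x : M) : ℝ :=
  sigmaOne (schoutenEndo (confGram g₀ u x) (extChartAt (𝓡 n) x x))

/-- `σ₂(g)` at the point `x`, for `g = e^{-2u} g₀`, computed in the chart at `x`. -/
def sigma2 (g₀ : SmoothMetric n M) (u : M → ℝ) (x : M) : ℝ :=
  sigmaTwo (schoutenEndo (confGram g₀ u x) (extChartAt (𝓡 n) x x))

/-- `e^{-2u} g₀ ∈ 𝒞₁([g₀])`: the conformal factor is smooth and `σ₁(g) > 0` everywhere. -/
def IsC1 (g₀ : SmoothMetric n M) (u : M → ℝ) : Prop :=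
  ContMDiff (𝓡 n) 𝓘(ℝ, ℝ) ∞ u ∧ ∀ x, 0 < sigma1 g₀ u x

/-- `|∇f|²` at `x`, with respect to `g₀`. -/
def gradSq (g₀ : SmoothMetric n M) (f : M → ℝ) (x : M) : ℝ :=
  let y := extChartAt (𝓡 n) x x
  let F : EuclideanSpace ℝ (Fin n) → ℝ := fun z => f ((extChartAt (𝓡 n) x).symm z)
  ∑ i, ∑ j, (gram g₀ x y)⁻¹ i j * pd i F y * pd j F y

/-- `|∇²f|` at `x`, with respect to `g₀`. -/
def hessNorm (g₀ : SmoothMetric n M) (f : M → ℝ) (x : M) : ℝ :=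
  let y := extChartAt (𝓡 n) x x
  let F : EuclideanSpace ℝ (Fin n) → ℝ := fun z => f ((extChartAt (𝓡 n) x).symm z)
  let H : Fin n → Fin n → ℝ := hessian (gram g₀ x) F y
  Real.sqrt (∑ i, ∑ j, ∑ k, ∑ l,
    (gram g₀ x y)⁻¹ i k * (gram g₀ x y)⁻¹ j l * H i j * H k l)

/-- The open ball of radius `R` about `p` for the Riemannian distance of `g₀`. -/
def geodesicBall (g₀ : SmoothMetric n M) (p : M) (R : ℝ) : Set M :=
  letI : Bundle.RiemannianBundle (fun x : M => TangentSpace (𝓡 n) x) := ⟨g₀.toRiemannianMetric⟩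
  {x | Manifold.riemannianEDist (𝓡 n) p x < ENNReal.ofReal R}

variable [T2Space M] [CompactSpace M]

variable (n M) in
/-- A smooth partition of unity subordinate to the chart domains. -/
def chartPartition : SmoothPartitionOfUnity M (𝓡 n) M univ :=
  Classical.choose (SmoothPartitionOfUnity.exists_isSubordinate_chartAt_source (𝓡 n) M)

/-- `∫_M f dvol(g)` for `g = e^{-2u} g₀`, computed with a partition of unity subordinate to charts;
in a chart, `dvol(g) = √(det g) dy`. -/
def volIntegral (g₀ : SmoothMetric n M) (u f : M → ℝ) : ℝ :=
  ∑ᶠ c : M, ∫ y in (extChartAt (𝓡 n) c).target,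
    chartPartition n M c ((extChartAt (𝓡 n) c).symm y) * f ((extChartAt (𝓡 n) c).symm y)
      * Real.sqrt (confGram g₀ u c y).det

/-- `𝓕₂(g) = ∫_M σ₂(g) dvol(g)`. -/
def energy (g₀ : SmoothMetric n M) (u : M → ℝ) : ℝ :=
  volIntegral g₀ u (sigma2 g₀ u)

/-- The perturbed volume `𝓕_{0,ε}(g) = ∫_M e^{2εu} dvol(g)`. -/
def pertVol (g₀ : SmoothMetric n M) (ε : ℝ) (u : M → ℝ) : ℝ :=
  volIntegral g₀ u (fun x => Real.exp (2 * ε * u x))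

/-- `r_ε(g) = ∫_M σ₂(g) dvol(g) / ∫_M e^{2εu} dvol(g)`. -/
def rEps (g₀ : SmoothMetric n M) (ε : ℝ) (u : M → ℝ) : ℝ :=
  energy g₀ u / pertVol g₀ ε u

/-- `e^{-2u} (σ₂(g) - r_ε(g) e^{2εu}) / σ₁(g)`. -/
def speed (g₀ : SmoothMetric n M) (ε : ℝ) (u : M → ℝ) (x : M) : ℝ :=
  Real.exp (-2 * u x) *
    ((sigma2 g₀ u x - rEps g₀ ε u * Real.exp (2 * ε * u x)) / sigma1 g₀ u x)

/-- `s_ε(g)`, the number determined by `∫_M e^{2εu} (speed + s_ε(g)) dvol(g) = 0`. -/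
def sEps (g₀ : SmoothMetric n M) (ε : ℝ) (u : M → ℝ) : ℝ :=
  -volIntegral g₀ u (fun x => Real.exp (2 * ε * u x) * speed g₀ ε u x) / pertVol g₀ ε u

/-- The subcritical Yamabe constant
`Y_ε(M,[g₀]) = inf { 𝓕_{0,ε}(g)^{-(n-4)/(n-2ε)} ∫_M σ₂(g) dvol(g) | g ∈ 𝒞₁([g₀]) }`,
an extended real number. -/
def yamabeConst (g₀ : SmoothMetric n M) (ε : ℝ) : EReal :=
  ⨅ (u : M → ℝ) (_ : IsC1 g₀ u),
    ((pertVol g₀ ε u ^ (-(((n : ℝ) - 4) / ((n : ℝ) - 2 * ε))) * energy g₀ u : ℝ) : EReal)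

/-- `u` is a smooth solution on `M × [0,T]` of the flow
`∂ₜu = e^{-2u} (σ₂(g) - r_ε(g) e^{2εu}) / σ₁(g) + s_ε(g)`, where `g = e^{-2u} g₀`. The denominator
`σ₁(g)` is required not to vanish, so that the equation makes sense. -/
structure IsFlowSolution (g₀ : SmoothMetric n M) (ε T : ℝ) (u : ℝ → M → ℝ) : Prop where
  smooth : ContMDiffOn (𝓘(ℝ, ℝ).prod (𝓡 n)) 𝓘(ℝ, ℝ) ∞ (fun q : ℝ × M => u q.1 q.2)
    (Icc 0 T ×ˢ univ)
  sigma1_ne_zero : ∀ t ∈ Icc 0 T, ∀ x, sigma1 g₀ (u t) x ≠ 0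
  evolution : ∀ t ∈ Icc 0 T, ∀ x,
    HasDerivWithinAt (fun s => u s x) (speed g₀ ε (u t) x + sEps g₀ ε (u t)) (Icc 0 T) t

end Manifold

end SigmaTwoFlow

end

noncomputable section

namespace SigmaTwoFlow

/-! ### Calculus of partial derivatives -/

section PartialDerivatives

variable {n : ℕ} {U : Set (EuclideanSpace ℝ (Fin n))} {y : EuclideanSpace ℝ (Fin n)}
  {f g : EuclideanSpace ℝ (Fin n) → ℝ}

/-! The estimate is a maximum principle for the second derivatives of u, localized by a cutoff
function and run over the orthonormal frames of g₀. Put V = ∇²u + du⊗du and W = V - |du|² g₀/2 +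
A_{g₀}. Then W is the Schouten tensor of g = e^{-2u} g₀ (`IsMetricOn.schouten_conf`). With B =
g₀⁻¹W, r = r_ε(g(t)) and ψ = √r e^{-(2-ε)u}, the flow becomes ∂ₜu = (σ₂(B) - ψ²)/σ₁(B) + s
(`loc_velocity`).

Up to s the right-hand side is σ₁/2 - (|B|² + 2ψ²)/(2σ₁), which is concave in (B, ψ) where σ₁ > 0
(`pd_quotient`). Its derivative in B is a positive semidefinite matrix F = `linCoeff` whose trace T
is at least 1, dominates every entry of F (`abs_linCoeff_le`) and satisfies ψ²/σ₁ ≤ ψT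
(`sq_div_trace_le`). No lower bound for σ₁ and no uniform ellipticity are needed, because all error
terms carry the factor T.

The test function is Q(ξ) = V(ξ,ξ) + tr V for unit vectors ξ, multiplied by χ². At a maximum one
passes to coordinates in which the metric is Euclidean to first order. Commuting derivatives
(`IsNormal.abs_commutator_le`) shows that the term -|du|² g₀/2 of W produces the good term -T|∇²u|²;
the trace in Q makes it appear in all directions (`IsNormal.sum_testWeight_mul_le`). At an interior
maximum of χ²Q the gradient vanishes, the Hessian contracted with F is nonpositive and ∂ₜQ ≥ 0.
Positivity of σ₁ bounds |du|² by |∇²u|, so after division by T a quadratic inequality remains which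
gives χ²Q ≤ C(1 + ψ) (`exists_maximum_estimate`, `exists_localTest_bound`). A maximum at time 0 is
controlled by the initial bound. Where χ = 1, the upper bound of Q together with σ₁ > 0 gives back
|du|² and |∇²u| (`norm_le_of_frameTest_le`).

This yields √r where r is wanted, so r must be bounded above and below by positive constants
(`exists_rEps_bounds`). The metric stays in the cone σ₁ > 0 by continuity (`IsFlowSolution.isC1`).
The choice of s makes the perturbed volume constant (`IsFlowSolution.pertVol_eq`). The Newton tensor
σ₁g - A is divergence free by the contracted Bianchi identity (`IsNormal.contracted_bianchi`,
`integral_newtonLap`), so the derivative of ∫σ₂ is (4-n)∫ ∂ₜu σ₂; the choices of r and s make the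
last integral nonnegative, and n > 4 gives a decreasing energy (`IsFlowSolution.energy_le`). The
positive Yamabe constant supplies the lower bound.

Since curvature and integrals are given by coordinate formulas in charts, a large part of the
argument establishes their tensoriality, their behaviour under conformal change, and the divergence
theorem on M. -/

theorem smoothOn_differentiableAt (hU : IsOpen U) (hf : ContDiffOn ℝ ∞ f U) (hy : y ∈ U) :
    DifferentiableAt ℝ f y :=
  (hf.contDiffAt (hU.mem_nhds hy)).differentiableAt (by simp)

theorem pd_smoothOn (hU : IsOpen U) (hf : ContDiffOn ℝ ∞ f U) (k : Fin n) :
    ContDiffOn ℝ ∞ (pd k f) U :=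
  (hf.fderiv_of_isOpen hU (m := ∞) (by simp)).clm_apply contDiffOn_const

theorem pd_congr (h : f =ᶠ[𝓝 y] g) (k : Fin n) : pd k f y = pd k g y := by
  simp only [pd, h.fderiv_eq]

theorem pd_congr_on (hU : IsOpen U) (h : EqOn f g U) (hy : y ∈ U) (k : Fin n) :
    pd k f y = pd k g y :=
  pd_congr (h.eventuallyEq_of_mem (hU.mem_nhds hy)) k

theorem pd_const (c : ℝ) (k : Fin n) : pd k (fun _ => c) y = 0 := by simp [pd]

theorem pd_add (hU : IsOpen U) (hf : ContDiffOn ℝ ∞ f U) (hg : ContDiffOn ℝ ∞ g U) (hy : y ∈ U)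
    (k : Fin n) : pd k (fun z => f z + g z) y = pd k f y + pd k g y := by
  simp only [pd]
  rw [fderiv_fun_add (smoothOn_differentiableAt hU hf hy) (smoothOn_differentiableAt hU hg hy)]
  rfl

theorem pd_sub (hU : IsOpen U) (hf : ContDiffOn ℝ ∞ f U) (hg : ContDiffOn ℝ ∞ g U) (hy : y ∈ U)
    (k : Fin n) : pd k (fun z => f z - g z) y = pd k f y - pd k g y := by
  simp only [pd]
  rw [fderiv_fun_sub (smoothOn_differentiableAt hU hf hy) (smoothOn_differentiableAt hU hg hy)]
  rfl

theorem pd_neg (k : Fin n) : pd k (fun z => -f z) y = -pd k f y := by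
  simp only [pd, fderiv_fun_neg]
  rfl

theorem pd_mul (hU : IsOpen U) (hf : ContDiffOn ℝ ∞ f U) (hg : ContDiffOn ℝ ∞ g U) (hy : y ∈ U)
    (k : Fin n) : pd k (fun z => f z * g z) y = pd k f y * g y + f y * pd k g y := by
  simp only [pd]
  rw [fderiv_fun_mul (smoothOn_differentiableAt hU hf hy) (smoothOn_differentiableAt hU hg hy)]
  simp
  ring

theorem pd_const_mul (hU : IsOpen U) (hf : ContDiffOn ℝ ∞ f U) (hy : y ∈ U) (c : ℝ)
    (k : Fin n) : pd k (fun z => c * f z) y = c * pd k f y := by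
  rw [pd_mul hU contDiffOn_const hf hy, pd_const]
  ring

theorem pd_sum {ι : Type*} (s : Finset ι) {F : ι → EuclideanSpace ℝ (Fin n) → ℝ} (hU : IsOpen U)
    (hf : ∀ i ∈ s, ContDiffOn ℝ ∞ (F i) U) (hy : y ∈ U) (k : Fin n) :
    pd k (fun z => ∑ i ∈ s, F i z) y = ∑ i ∈ s, pd k (F i) y := by
  simp only [pd]
  rw [fderiv_fun_sum (fun i hi => smoothOn_differentiableAt hU (hf i hi) hy)]
  simp

theorem pd_real_comp (hU : IsOpen U) (hf : ContDiffOn ℝ ∞ f U) (hy : y ∈ U) {φ : ℝ → ℝ} {φ' : ℝ}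
    (hφ : HasDerivAt φ φ' (f y)) (k : Fin n) : pd k (fun z => φ (f z)) y = φ' * pd k f y := by
  have := hφ.comp_hasFDerivAt y (smoothOn_differentiableAt hU hf hy).hasFDerivAt
  simp only [pd]
  rw [show (fun z => φ (f z)) = φ ∘ f from rfl, this.fderiv]
  simp

theorem pd_inv (hU : IsOpen U) (hf : ContDiffOn ℝ ∞ f U) (hy : y ∈ U) (h0 : f y ≠ 0)
    (k : Fin n) : pd k (fun z => (f z)⁻¹) y = -(f y ^ 2)⁻¹ * pd k f y :=
  pd_real_comp hU hf hy (hasDerivAt_inv h0) k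

theorem pd_comm (hU : IsOpen U) (hf : ContDiffOn ℝ ∞ f U) (hy : y ∈ U) (k l : Fin n) :
    pd k (pd l f) y = pd l (pd k f) y := by
  have hc := hf.contDiffAt (hU.mem_nhds hy)
  have hs := hc.isSymmSndFDerivAt (by simp only [minSmoothness_of_isRCLikeNormedField]; exact WithTop.coe_le_coe.2 (le_top (a := (2 : ℕ∞))))
  have hd : DifferentiableAt ℝ (fderiv ℝ f) y :=
    (hc.fderiv_right (m := 1) (by norm_cast)).differentiableAt (by simp)
  have key : ∀ a b : Fin n, pd a (pd b f) y
      = fderiv ℝ (fderiv ℝ f) y (EuclideanSpace.single a 1) (EuclideanSpace.single b 1) := by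
    intro a b
    change fderiv ℝ (fun z => fderiv ℝ f z (EuclideanSpace.single b 1)) y _ = _
    rw [fderiv_clm_apply hd (differentiableAt_const _)]
    simp
  rw [key, key]
  exact hs _ _

theorem fderiv_eq_sum_pd (w : EuclideanSpace ℝ (Fin n)) :
    fderiv ℝ f y w = ∑ j, w j * pd j f y := by
  conv_lhs => rw [← (EuclideanSpace.basisFun (Fin n) ℝ).sum_repr w]
  simp [pd]

/-- The chain rule for partial derivatives. -/
theorem pd_comp {V : Set (EuclideanSpace ℝ (Fin n))} {Φ : EuclideanSpace ℝ (Fin n) →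
    EuclideanSpace ℝ (Fin n)} (hU : IsOpen U) (hV : IsOpen V) (hΦ : ContDiffOn ℝ ∞ Φ U)
    (hm : MapsTo Φ U V) (hf : ContDiffOn ℝ ∞ f V) (hy : y ∈ U) (k : Fin n) :
    pd k (fun z => f (Φ z)) y = ∑ j, pd k (fun z => Φ z j) y * pd j f (Φ y) := by
  have hΦd : DifferentiableAt ℝ Φ y :=
    (hΦ.contDiffAt (hU.mem_nhds hy)).differentiableAt (by simp)
  have hfd := smoothOn_differentiableAt hV hf (hm hy)
  have h1 : fderiv ℝ (fun z => f (Φ z)) y = (fderiv ℝ f (Φ y)).comp (fderiv ℝ Φ y) :=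
    fderiv_comp y hfd hΦd
  have h2 : ∀ j, pd k (fun z => Φ z j) y = fderiv ℝ Φ y (EuclideanSpace.single k 1) j := by
    intro j
    have := (hasFDerivAt_pi'.1 ((EuclideanSpace.equiv (Fin n) ℝ).hasFDerivAt.comp y
      hΦd.hasFDerivAt)) j
    simp only [pd]
    rw [show (fun z => Φ z j) = fun z => ((EuclideanSpace.equiv (Fin n) ℝ) ∘ Φ) z j from rfl,
      this.fderiv]
    rfl
  change fderiv ℝ (fun z => f (Φ z)) y _ = _
  rw [h1, ContinuousLinearMap.comp_apply, fderiv_eq_sum_pd]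
  simp only [h2]

theorem smoothOn_coord {Φ : EuclideanSpace ℝ (Fin n) → EuclideanSpace ℝ (Fin n)}
    (hΦ : ContDiffOn ℝ ∞ Φ U) (j : Fin n) : ContDiffOn ℝ ∞ (fun z => Φ z j) U :=
  contDiffOn_euclidean.1 hΦ j

end PartialDerivatives

/-! ### Matrix-valued functions -/

section MatrixFunctions

variable {n : ℕ} {X : Type*} [NormedAddCommGroup X] [NormedSpace ℝ X] {S : Set X}

/-- Smoothness of the entries of a matrix-valued function. -/
def MSmooth (S : Set X) (A : X → Matrix (Fin n) (Fin n) ℝ) : Prop :=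
  ∀ i j, ContDiffOn ℝ ∞ (fun y => A y i j) S

variable {A B : X → Matrix (Fin n) (Fin n) ℝ}

theorem MSmooth.add (hA : MSmooth S A) (hB : MSmooth S B) : MSmooth S (fun y => A y + B y) :=
  fun i j => (hA i j).add (hB i j)

theorem MSmooth.sub (hA : MSmooth S A) (hB : MSmooth S B) : MSmooth S (fun y => A y - B y) :=
  fun i j => (hA i j).sub (hB i j)

theorem MSmooth.mul (hA : MSmooth S A) (hB : MSmooth S B) : MSmooth S (fun y => A y * B y) := by
  intro i j
  simp only [Matrix.mul_apply]
  exact ContDiffOn.sum fun k _ => (hA i k).mul (hB k j)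

theorem MSmooth.smul {f : X → ℝ} (hf : ContDiffOn ℝ ∞ f S) (hA : MSmooth S A) :
    MSmooth S (fun y => f y • A y) :=
  fun i j => hf.mul (hA i j)

theorem MSmooth.sum {ι : Type*} (s : Finset ι) {A : ι → X → Matrix (Fin n) (Fin n) ℝ}
    (hA : ∀ i ∈ s, MSmooth S (A i)) : MSmooth S (fun y => ∑ i ∈ s, A i y) := by
  intro a b
  simp only [Matrix.sum_apply]
  exact ContDiffOn.sum fun k hk => hA k hk a b

theorem MSmooth.transpose (hA : MSmooth S A) : MSmooth S (fun y => (A y).transpose) :=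
  fun i j => hA j i

theorem MSmooth.trace (hA : MSmooth S A) : ContDiffOn ℝ ∞ (fun y => (A y).trace) S := by
  simp only [Matrix.trace, Matrix.diag_apply]
  exact ContDiffOn.sum fun k _ => hA k k

theorem MSmooth.det (hA : MSmooth S A) : ContDiffOn ℝ ∞ (fun y => (A y).det) S := by
  simp only [Matrix.det_apply']
  exact ContDiffOn.sum fun σ _ => contDiffOn_const.mul (contDiffOn_prod fun k _ => hA _ _)

/-- Cramer's rule: the entries of the adjugate are determinants of the matrix with one row replaced
by a constant one. -/
theorem MSmooth.inv (hA : MSmooth S A) (h0 : ∀ y ∈ S, (A y).det ≠ 0) :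
    MSmooth S (fun y => (A y)⁻¹) := by
  intro i j
  simp only [Matrix.inv_def, Ring.inverse_eq_inv', Matrix.smul_apply, smul_eq_mul]
  refine (hA.det.inv h0).mul ?_
  simp only [Matrix.adjugate_apply]
  refine MSmooth.det fun a b => ?_
  simp only [Matrix.updateRow_apply]
  split_ifs
  · exact contDiffOn_const
  · exact hA a b

theorem MSmooth.mono {T : Set X} (hA : MSmooth S A) (h : T ⊆ S) : MSmooth T A :=
  fun i j => (hA i j).mono h

end MatrixFunctions

/-! ### Entrywise differentiation of matrix-valued functions. -/

section MatrixDerivatives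

variable {n : ℕ} {U : Set (EuclideanSpace ℝ (Fin n))} {y : EuclideanSpace ℝ (Fin n)}
  {A B : EuclideanSpace ℝ (Fin n) → Matrix (Fin n) (Fin n) ℝ}

/-- The entrywise partial derivative of a matrix-valued function. -/
def pdM (k : Fin n) (A : EuclideanSpace ℝ (Fin n) → Matrix (Fin n) (Fin n) ℝ)
    (y : EuclideanSpace ℝ (Fin n)) : Matrix (Fin n) (Fin n) ℝ :=
  Matrix.of fun i j => pd k (fun z => A z i j) y

theorem pdM_apply (k i j : Fin n) : pdM k A y i j = pd k (fun z => A z i j) y := rfl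

theorem MSmooth.pdM (hU : IsOpen U) (hA : MSmooth U A) (k : Fin n) : MSmooth U (pdM k A) :=
  fun i j => pd_smoothOn hU (hA i j) k

theorem pdM_congr_on (hU : IsOpen U) (h : EqOn A B U) (hy : y ∈ U) (k : Fin n) :
    pdM k A y = pdM k B y := by
  ext i j
  exact pd_congr_on hU (fun z hz => by rw [h hz]) hy k

theorem pdM_add (hU : IsOpen U) (hA : MSmooth U A) (hB : MSmooth U B) (hy : y ∈ U) (k : Fin n) :
    pdM k (fun z => A z + B z) y = pdM k A y + pdM k B y := by
  ext i j
  exact pd_add hU (hA i j) (hB i j) hy k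

theorem pdM_mul (hU : IsOpen U) (hA : MSmooth U A) (hB : MSmooth U B) (hy : y ∈ U) (k : Fin n) :
    pdM k (fun z => A z * B z) y = pdM k A y * B y + A y * pdM k B y := by
  ext i j
  simp only [pdM_apply, Matrix.add_apply, Matrix.mul_apply]
  rw [pd_sum _ hU (fun l _ => (hA i l).mul (hB l j)) hy, ← Finset.sum_add_distrib]
  exact Finset.sum_congr rfl fun l _ => pd_mul hU (hA i l) (hB l j) hy k

theorem pdM_smul {f : EuclideanSpace ℝ (Fin n) → ℝ} (hU : IsOpen U) (hf : ContDiffOn ℝ ∞ f U)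
    (hA : MSmooth U A) (hy : y ∈ U) (k : Fin n) :
    pdM k (fun z => f z • A z) y = pd k f y • A y + f y • pdM k A y := by
  ext i j
  exact pd_mul hU hf (hA i j) hy k

theorem pdM_sum {ι : Type*} (s : Finset ι)
    {A : ι → EuclideanSpace ℝ (Fin n) → Matrix (Fin n) (Fin n) ℝ} (hU : IsOpen U)
    (hA : ∀ i ∈ s, MSmooth U (A i)) (hy : y ∈ U) (k : Fin n) :
    pdM k (fun z => ∑ i ∈ s, A i z) y = ∑ i ∈ s, pdM k (A i) y := by
  ext a b
  simp only [pdM_apply, Matrix.sum_apply]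
  exact pd_sum s hU (fun i hi => hA i hi a b) hy k

theorem pdM_transpose (k : Fin n) :
    pdM k (fun z => (A z).transpose) y = (pdM k A y).transpose := rfl

theorem pdM_comm (hU : IsOpen U) (hA : MSmooth U A) (hy : y ∈ U) (k l : Fin n) :
    pdM k (pdM l A) y = pdM l (pdM k A) y := by
  ext i j
  exact pd_comm hU (hA i j) hy k l

/-- Differentiate A⁻¹A = 1 and multiply by A⁻¹ from the right. -/
theorem pdM_inv (hU : IsOpen U) (hA : MSmooth U A) (h0 : ∀ y ∈ U, (A y).det ≠ 0) (hy : y ∈ U)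
    (k : Fin n) : pdM k (fun z => (A z)⁻¹) y = -((A y)⁻¹ * pdM k A y * (A y)⁻¹) := by
  have h1 := pdM_mul hU (hA.inv h0) hA hy k
  have h2 : pdM k (fun z => (A z)⁻¹ * A z) y = 0 := by
    rw [pdM_congr_on hU (B := fun _ => 1)
      (fun z hz => Matrix.nonsing_inv_mul _ (isUnit_iff_ne_zero.2 (h0 z hz))) hy]
    ext i j
    exact pd_const _ k
  rw [h2] at h1
  have h3 : A y * (A y)⁻¹ = 1 := Matrix.mul_nonsing_inv _ (isUnit_iff_ne_zero.2 (h0 y hy))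
  calc pdM k (fun z => (A z)⁻¹) y = pdM k (fun z => (A z)⁻¹) y * (A y * (A y)⁻¹) := by
        rw [h3, mul_one]
    _ = (pdM k (fun z => (A z)⁻¹) y * A y) * (A y)⁻¹ := by rw [mul_assoc]
    _ = _ := by rw [eq_neg_of_add_eq_zero_left h1.symm, neg_mul]

theorem pdM_comp {V : Set (EuclideanSpace ℝ (Fin n))} {Φ : EuclideanSpace ℝ (Fin n) →
    EuclideanSpace ℝ (Fin n)} (hU : IsOpen U) (hV : IsOpen V) (hΦ : ContDiffOn ℝ ∞ Φ U)
    (hm : MapsTo Φ U V) (hA : MSmooth V A) (hy : y ∈ U) (k : Fin n) :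
    pdM k (fun z => A (Φ z)) y = ∑ j, pd k (fun z => Φ z j) y • pdM j A (Φ y) := by
  ext a b
  simp only [pdM_apply, Matrix.sum_apply, Matrix.smul_apply, smul_eq_mul]
  exact pd_comp hU hV hΦ hm (hA a b) hy k

theorem MSmooth.comp {X : Type*} [NormedAddCommGroup X] [NormedSpace ℝ X] {S : Set X}
    {Φ : X → EuclideanSpace ℝ (Fin n)} (hA : MSmooth U A) (hΦ : ContDiffOn ℝ ∞ Φ S)
    (hm : MapsTo Φ S U) : MSmooth S (fun z => A (Φ z)) :=
  fun i j => (hA i j).comp hΦ hm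

end MatrixDerivatives

/-! ### Smooth families -/

section Families

variable {n : ℕ} {P : Type*} [NormedAddCommGroup P] [NormedSpace ℝ P]

/-- Sets of unique differentiability in `P × ℝⁿ` whose slices over `P` are neighbourhoods. -/
structure FamilyDomain (S : Set (P × EuclideanSpace ℝ (Fin n))) : Prop where
  uniqueDiffOn : UniqueDiffOn ℝ S
  slice : ∀ q ∈ S, {z | (q.1, z) ∈ S} ∈ 𝓝 q.2

theorem FamilyDomain.of_isOpen {S : Set (P × EuclideanSpace ℝ (Fin n))} (hS : IsOpen S) :
    FamilyDomain S where
  uniqueDiffOn := hS.uniqueDiffOn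
  slice q hq := by
    have hc : Continuous fun z : EuclideanSpace ℝ (Fin n) => (q.1, z) := by fun_prop
    exact (hS.preimage hc).mem_nhds hq

theorem FamilyDomain.prod {I : Set P} {U : Set (EuclideanSpace ℝ (Fin n))}
    (hI : UniqueDiffOn ℝ I) (hU : IsOpen U) : FamilyDomain (I ×ˢ U) where
  uniqueDiffOn := hI.prod hU.uniqueDiffOn
  slice q hq := by
    filter_upwards [hU.mem_nhds hq.2] with z hz using ⟨hq.1, hz⟩

variable {S : Set (P × EuclideanSpace ℝ (Fin n))}

/-- Partial derivatives in the second variable preserve smoothness of families. -/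
theorem FamilyDomain.pd (hS : FamilyDomain S) {f : P → EuclideanSpace ℝ (Fin n) → ℝ}
    (hf : ContDiffOn ℝ ∞ (fun q : P × EuclideanSpace ℝ (Fin n) => f q.1 q.2) S) (k : Fin n) :
    ContDiffOn ℝ ∞ (fun q : P × EuclideanSpace ℝ (Fin n) => pd k (f q.1) q.2) S := by
  have h1 := (hf.fderivWithin hS.uniqueDiffOn (m := ∞) (by simp)).clm_apply
    (contDiffOn_const (c := ((0 : P), EuclideanSpace.single k (1 : ℝ))))
  refine h1.congr fun q hq => ?_
  have h2 : HasFDerivWithinAt (fun q : P × EuclideanSpace ℝ (Fin n) => f q.1 q.2)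
      (fderivWithin ℝ (fun q : P × EuclideanSpace ℝ (Fin n) => f q.1 q.2) S q) S (q.1, q.2) :=
    (hf.differentiableOn (by simp) q hq).hasFDerivWithinAt
  have h3 : HasFDerivWithinAt (fun z : EuclideanSpace ℝ (Fin n) => (q.1, z))
      (ContinuousLinearMap.inr ℝ P (EuclideanSpace ℝ (Fin n))) {z | (q.1, z) ∈ S} q.2 :=
    (hasFDerivAt_prodMk_right q.1 q.2).hasFDerivWithinAt
  -- The slice is a neighbourhood of `q.2`, so a derivative within it is a genuine derivative. This
  -- is what the field `slice` is for, and it allows a closed time interval in the first factor.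
  have h4 := (h2.comp q.2 h3 (fun z hz => hz)).hasFDerivAt (hS.slice q hq)
  have h5 := h4.fderiv
  simp only [SigmaTwoFlow.pd]
  rw [show (f q.1) = (fun q : P × EuclideanSpace ℝ (Fin n) => f q.1 q.2) ∘ fun z => (q.1, z)
    from rfl, h5]
  simp

variable {G : P → EuclideanSpace ℝ (Fin n) → Matrix (Fin n) (Fin n) ℝ}

theorem FamilyDomain.christoffel (hS : FamilyDomain S)
    (hG : MSmooth S (fun q : P × EuclideanSpace ℝ (Fin n) => G q.1 q.2))
    (h0 : ∀ q ∈ S, (G q.1 q.2).det ≠ 0) (k i j : Fin n) :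
    ContDiffOn ℝ ∞ (fun q : P × EuclideanSpace ℝ (Fin n) => christoffel (G q.1) k i j q.2) S := by
  unfold SigmaTwoFlow.christoffel
  have hpd : ∀ a b c, ContDiffOn ℝ ∞ (fun q : P × EuclideanSpace ℝ (Fin n) =>
      SigmaTwoFlow.pd a (fun z => G q.1 z b c) q.2) S := fun a b c =>
    hS.pd (f := fun p z => G p z b c) (hG b c) a
  exact contDiffOn_const.mul (ContDiffOn.sum fun l _ =>
    (hG.inv h0 k l).mul (((hpd i j l).add (hpd j i l)).sub (hpd l i j)))

theorem FamilyDomain.ricci (hS : FamilyDomain S)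
    (hG : MSmooth S (fun q : P × EuclideanSpace ℝ (Fin n) => G q.1 q.2))
    (h0 : ∀ q ∈ S, (G q.1 q.2).det ≠ 0) :
    MSmooth S (fun q : P × EuclideanSpace ℝ (Fin n) => ricci (G q.1) q.2) := by
  intro i j
  have hΓ := hS.christoffel hG h0
  simp only [SigmaTwoFlow.ricci, Matrix.of_apply]
  refine ContDiffOn.sum fun k _ => ((hS.pd (f := fun p => SigmaTwoFlow.christoffel (G p) k i j)
    (hΓ k i j) k).sub (hS.pd (f := fun p => SigmaTwoFlow.christoffel (G p) k k i)
    (hΓ k k i) j)).add (ContDiffOn.sum fun l _ => ?_)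
  exact ((hΓ k k l).mul (hΓ l i j)).sub ((hΓ k j l).mul (hΓ l k i))

theorem FamilyDomain.schouten (hS : FamilyDomain S)
    (hG : MSmooth S (fun q : P × EuclideanSpace ℝ (Fin n) => G q.1 q.2))
    (h0 : ∀ q ∈ S, (G q.1 q.2).det ≠ 0) :
    MSmooth S (fun q : P × EuclideanSpace ℝ (Fin n) => schouten (G q.1) q.2) := by
  have hR := hS.ricci hG h0
  have hs : ContDiffOn ℝ ∞
      (fun q : P × EuclideanSpace ℝ (Fin n) => scalarCurvature (G q.1) q.2) S :=
    ContDiffOn.sum fun i _ => ContDiffOn.sum fun j _ => (hG.inv h0 i j).mul (hR i j)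
  exact MSmooth.smul contDiffOn_const (hR.sub (MSmooth.smul (hs.div_const _) hG))

theorem FamilyDomain.hessian (hS : FamilyDomain S)
    (hG : MSmooth S (fun q : P × EuclideanSpace ℝ (Fin n) => G q.1 q.2))
    (h0 : ∀ q ∈ S, (G q.1 q.2).det ≠ 0) {f : P → EuclideanSpace ℝ (Fin n) → ℝ}
    (hf : ContDiffOn ℝ ∞ (fun q : P × EuclideanSpace ℝ (Fin n) => f q.1 q.2) S) (i j : Fin n) :
    ContDiffOn ℝ ∞ (fun q : P × EuclideanSpace ℝ (Fin n) => hessian (G q.1) (f q.1) q.2 i j) S :=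
  (hS.pd (f := fun p => SigmaTwoFlow.pd j (f p)) (hS.pd hf j) i).sub
    (ContDiffOn.sum fun k _ => (hS.christoffel hG h0 k i j).mul (hS.pd hf k))

end Families

/-! ### Smoothness of the curvature of a single metric. -/

section SingleMetric

variable {n : ℕ} {U : Set (EuclideanSpace ℝ (Fin n))}
  {G : EuclideanSpace ℝ (Fin n) → Matrix (Fin n) (Fin n) ℝ}

/-- A single metric is treated as a family that does not depend on its parameter, so the smoothness
statements for families need not be proved a second time. -/
theorem contDiffOn_of_constant_family {f : EuclideanSpace ℝ (Fin n) → ℝ}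
    (h : ContDiffOn ℝ ∞ (fun q : ℝ × EuclideanSpace ℝ (Fin n) => f q.2) (univ ×ˢ U)) :
    ContDiffOn ℝ ∞ f U :=
  h.comp (f := fun z => ((0 : ℝ), z)) (by fun_prop) fun z hz => ⟨mem_univ _, hz⟩

theorem MSmooth.constant_family (hG : MSmooth U G) :
    MSmooth (univ ×ˢ U) (fun q : ℝ × EuclideanSpace ℝ (Fin n) => G q.2) :=
  fun i j => (hG i j).comp contDiffOn_snd fun _ hq => hq.2

theorem christoffel_smoothOn (hU : IsOpen U) (hG : MSmooth U G) (h0 : ∀ y ∈ U, (G y).det ≠ 0)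
    (k i j : Fin n) : ContDiffOn ℝ ∞ (christoffel G k i j) U :=
  contDiffOn_of_constant_family ((FamilyDomain.prod uniqueDiffOn_univ hU).christoffel
    (G := fun _ => G) hG.constant_family (fun q hq => h0 q.2 hq.2) k i j)

theorem ricci_smoothOn (hU : IsOpen U) (hG : MSmooth U G) (h0 : ∀ y ∈ U, (G y).det ≠ 0) :
    MSmooth U (ricci G) := fun i j =>
  contDiffOn_of_constant_family ((FamilyDomain.prod uniqueDiffOn_univ hU).ricci
    (G := fun _ => G) hG.constant_family (fun q hq => h0 q.2 hq.2) i j)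

theorem schouten_smoothOn (hU : IsOpen U) (hG : MSmooth U G) (h0 : ∀ y ∈ U, (G y).det ≠ 0) :
    MSmooth U (schouten G) := fun i j =>
  contDiffOn_of_constant_family ((FamilyDomain.prod uniqueDiffOn_univ hU).schouten
    (G := fun _ => G) hG.constant_family (fun q hq => h0 q.2 hq.2) i j)

theorem hessian_smoothOn (hU : IsOpen U) (hG : MSmooth U G) (h0 : ∀ y ∈ U, (G y).det ≠ 0)
    {f : EuclideanSpace ℝ (Fin n) → ℝ} (hf : ContDiffOn ℝ ∞ f U) :
    MSmooth U (fun y => Matrix.of (hessian G f y)) := fun i j =>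
  contDiffOn_of_constant_family ((FamilyDomain.prod uniqueDiffOn_univ hU).hessian
    (G := fun _ => G) (f := fun _ => f) hG.constant_family (fun q hq => h0 q.2 hq.2)
    (hf.comp contDiffOn_snd fun _ hq => hq.2) i j)

end SingleMetric

end SigmaTwoFlow

end

noncomputable section

namespace SigmaTwoFlow

/-! ### Tensoriality of the curvature quantities -/

section Tensoriality

variable {n : ℕ} {U V : Set (EuclideanSpace ℝ (Fin n))} {y : EuclideanSpace ℝ (Fin n)}
  {G : EuclideanSpace ℝ (Fin n) → Matrix (Fin n) (Fin n) ℝ}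
  {Φ : EuclideanSpace ℝ (Fin n) → EuclideanSpace ℝ (Fin n)}

/-- `G` is the coordinate matrix of a smooth Riemannian metric on the open set `U`. -/
structure IsMetricOn (U : Set (EuclideanSpace ℝ (Fin n)))
    (G : EuclideanSpace ℝ (Fin n) → Matrix (Fin n) (Fin n) ℝ) : Prop where
  isOpen : IsOpen U
  smooth : MSmooth U G
  symm : ∀ y ∈ U, (G y).transpose = G y
  det_ne_zero : ∀ y ∈ U, (G y).det ≠ 0

/-- The matrix `(Γ_j)^k_i`. -/
def chM (G : EuclideanSpace ℝ (Fin n) → Matrix (Fin n) (Fin n) ℝ) (j : Fin n)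
    (y : EuclideanSpace ℝ (Fin n)) : Matrix (Fin n) (Fin n) ℝ :=
  Matrix.of fun k i => christoffel G k j i y

theorem IsMetricOn.mul_inv (hG : IsMetricOn U G) (hy : y ∈ U) : G y * (G y)⁻¹ = 1 :=
  Matrix.mul_nonsing_inv _ (isUnit_iff_ne_zero.2 (hG.det_ne_zero y hy))

theorem IsMetricOn.inv_mul (hG : IsMetricOn U G) (hy : y ∈ U) : (G y)⁻¹ * G y = 1 :=
  Matrix.nonsing_inv_mul _ (isUnit_iff_ne_zero.2 (hG.det_ne_zero y hy))

theorem IsMetricOn.inv_symm (hG : IsMetricOn U G) (hy : y ∈ U) :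
    ((G y)⁻¹).transpose = (G y)⁻¹ := by
  rw [Matrix.transpose_nonsing_inv, hG.symm y hy]

theorem IsMetricOn.symm_apply (hG : IsMetricOn U G) (hy : y ∈ U) (i j : Fin n) :
    G y i j = G y j i := by
  conv_lhs => rw [← hG.symm y hy]
  rfl

theorem IsMetricOn.pd_symm (hG : IsMetricOn U G) (hy : y ∈ U) (k i j : Fin n) :
    pd k (fun z => G z i j) y = pd k (fun z => G z j i) y :=
  pd_congr_on hG.isOpen (fun _ hz => hG.symm_apply hz i j) hy k

theorem IsMetricOn.christoffel_symm (hG : IsMetricOn U G) (hy : y ∈ U) (k i j : Fin n) :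
    christoffel G k i j y = christoffel G k j i y := by
  unfold christoffel
  congr 1
  refine Finset.sum_congr rfl fun l _ => ?_
  rw [hG.pd_symm hy l i j]
  ring

theorem IsMetricOn.chM_smooth (hG : IsMetricOn U G) (j : Fin n) : MSmooth U (chM G j) :=
  fun _ _ => christoffel_smoothOn hG.isOpen hG.smooth hG.det_ne_zero _ _ _

/-- The Christoffel symbols with lowered index. -/
theorem IsMetricOn.mul_chM_apply (hG : IsMetricOn U G) (hy : y ∈ U) (b i j : Fin n) :
    (G y * chM G b y) i j = (1 / 2) * (pd b (fun z => G z j i) y + pd j (fun z => G z b i) y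
      - pd i (fun z => G z b j) y) := by
  have h : chM G b y = (G y)⁻¹ * Matrix.of fun i j => (1 / 2) * (pd b (fun z => G z j i) y
      + pd j (fun z => G z b i) y - pd i (fun z => G z b j) y) := by
    ext k j
    simp only [chM, christoffel, Matrix.of_apply, Matrix.mul_apply, Finset.mul_sum]
    exact Finset.sum_congr rfl fun l _ => by ring
  rw [h, ← mul_assoc, hG.mul_inv hy, one_mul]
  rfl

/-- The Levi-Civita connection is metric. -/
theorem IsMetricOn.pdM_eq (hG : IsMetricOn U G) (hy : y ∈ U) (b : Fin n) :
    pdM b G y = (chM G b y).transpose * G y + G y * chM G b y := by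
  have h : (chM G b y).transpose * G y = (G y * chM G b y).transpose := by
    rw [Matrix.transpose_mul, hG.symm y hy]
  ext i j
  rw [h, Matrix.add_apply, Matrix.transpose_apply, hG.mul_chM_apply hy, hG.mul_chM_apply hy,
    pdM_apply, hG.pd_symm hy b j i]
  ring

/-- The Levi-Civita connection is the only torsion-free metric connection. -/
theorem IsMetricOn.chM_unique (hG : IsMetricOn U G) (hy : y ∈ U)
    {C : Fin n → Matrix (Fin n) (Fin n) ℝ} (hs : ∀ b k i, C b k i = C i k b)
    (hC : ∀ b, pdM b G y = (C b).transpose * G y + G y * C b) (b : Fin n) :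
    chM G b y = C b := by
  have hL : ∀ b i j, (G y * C b) i j = (G y * C j) i b := by
    intro b i j
    simp only [Matrix.mul_apply]
    exact Finset.sum_congr rfl fun l _ => by rw [hs]
  have hD : ∀ b i j, pd b (fun z => G z i j) y = (G y * C b) j i + (G y * C b) i j := by
    intro b i j
    have h : (C b).transpose * G y = (G y * C b).transpose := by
      rw [Matrix.transpose_mul, hG.symm y hy]
    have := congrFun (congrFun (hC b) i) j
    rw [pdM_apply, h] at this
    exact this
  have h : G y * chM G b y = G y * C b := by
    ext i j
    -- Koszul's computation: in the signed sum of three derivatives of the metric, the torsion-free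
    -- condition `hL` cancels all lowered coefficients except the wanted one, which occurs twice.
    rw [hG.mul_chM_apply hy, hD, hD, hD, hL j i b, hL j b i, hL i j b]
    ring
  calc chM G b y = (G y)⁻¹ * (G y * chM G b y) := by rw [← mul_assoc, hG.inv_mul hy, one_mul]
    _ = C b := by rw [h, ← mul_assoc, hG.inv_mul hy, one_mul]

/-- The Jacobian matrix. -/
def jac (Φ : EuclideanSpace ℝ (Fin n) → EuclideanSpace ℝ (Fin n))
    (z : EuclideanSpace ℝ (Fin n)) : Matrix (Fin n) (Fin n) ℝ :=
  Matrix.of fun i a => pd a (fun z => Φ z i) z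

/-- `Φ` is a smooth map from `U` to `V` with invertible Jacobian. -/
structure IsCoordChange (U V : Set (EuclideanSpace ℝ (Fin n)))
    (Φ : EuclideanSpace ℝ (Fin n) → EuclideanSpace ℝ (Fin n)) : Prop where
  isOpen_source : IsOpen U
  isOpen_target : IsOpen V
  smooth : ContDiffOn ℝ ∞ Φ U
  mapsTo : MapsTo Φ U V
  det_ne_zero : ∀ z ∈ U, (jac Φ z).det ≠ 0

/-- The pullback of a `(0,2)`-tensor. -/
def pullback (Φ : EuclideanSpace ℝ (Fin n) → EuclideanSpace ℝ (Fin n))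
    (S : EuclideanSpace ℝ (Fin n) → Matrix (Fin n) (Fin n) ℝ) (z : EuclideanSpace ℝ (Fin n)) :
    Matrix (Fin n) (Fin n) ℝ :=
  (jac Φ z).transpose * S (Φ z) * jac Φ z

namespace IsCoordChange

variable (hΦ : IsCoordChange U V Φ)

include hΦ

theorem jac_smooth : MSmooth U (jac Φ) :=
  fun i a => pd_smoothOn hΦ.isOpen_source (smoothOn_coord hΦ.smooth i) a

theorem jac_mul_inv (hy : y ∈ U) : jac Φ y * (jac Φ y)⁻¹ = 1 :=
  Matrix.mul_nonsing_inv _ (isUnit_iff_ne_zero.2 (hΦ.det_ne_zero y hy))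

theorem jac_inv_mul (hy : y ∈ U) : (jac Φ y)⁻¹ * jac Φ y = 1 :=
  Matrix.nonsing_inv_mul _ (isUnit_iff_ne_zero.2 (hΦ.det_ne_zero y hy))

theorem pullback_smooth {S : EuclideanSpace ℝ (Fin n) → Matrix (Fin n) (Fin n) ℝ}
    (hS : MSmooth V S) : MSmooth U (pullback Φ S) :=
  (hΦ.jac_smooth.transpose.mul (hS.comp hΦ.smooth hΦ.mapsTo)).mul hΦ.jac_smooth

theorem isMetricOn (hG : IsMetricOn V G) : IsMetricOn U (pullback Φ G) where
  isOpen := hΦ.isOpen_source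
  smooth := hΦ.pullback_smooth hG.smooth
  symm z hz := by
    simp only [pullback, Matrix.transpose_mul, Matrix.transpose_transpose,
      hG.symm _ (hΦ.mapsTo hz), mul_assoc]
  det_ne_zero z hz := by
    simp only [pullback, Matrix.det_mul, Matrix.det_transpose]
    exact mul_ne_zero (mul_ne_zero (hΦ.det_ne_zero z hz) (hG.det_ne_zero _ (hΦ.mapsTo hz)))
      (hΦ.det_ne_zero z hz)

theorem pd_jac_symm (hy : y ∈ U) (a i b : Fin n) :
    pd a (fun z => jac Φ z i b) y = pd b (fun z => jac Φ z i a) y :=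
  pd_comm hΦ.isOpen_source (smoothOn_coord hΦ.smooth i) hy a b

theorem pdM_comp {A : EuclideanSpace ℝ (Fin n) → Matrix (Fin n) (Fin n) ℝ} (hA : MSmooth V A)
    (hy : y ∈ U) (b : Fin n) :
    pdM b (fun z => A (Φ z)) y = ∑ k, jac Φ y k b • pdM k A (Φ y) :=
  SigmaTwoFlow.pdM_comp hΦ.isOpen_source hΦ.isOpen_target hΦ.smooth hΦ.mapsTo hA hy b

theorem pd_comp {f : EuclideanSpace ℝ (Fin n) → ℝ} (hf : ContDiffOn ℝ ∞ f V)
    (hy : y ∈ U) (b : Fin n) :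
    pd b (fun z => f (Φ z)) y = ∑ k, jac Φ y k b * pd k f (Φ y) :=
  SigmaTwoFlow.pd_comp hΦ.isOpen_source hΦ.isOpen_target hΦ.smooth hΦ.mapsTo hf hy b

theorem pdM_pullback {S : EuclideanSpace ℝ (Fin n) → Matrix (Fin n) (Fin n) ℝ}
    (hS : MSmooth V S) (hy : y ∈ U) (b : Fin n) :
    pdM b (pullback Φ S) y = (pdM b (jac Φ) y).transpose * S (Φ y) * jac Φ y
      + (jac Φ y).transpose * (∑ k, jac Φ y k b • pdM k S (Φ y)) * jac Φ y
      + (jac Φ y).transpose * S (Φ y) * pdM b (jac Φ) y := by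
  have hJ := hΦ.jac_smooth
  have hSΦ := hS.comp hΦ.smooth hΦ.mapsTo
  have hU := hΦ.isOpen_source
  change pdM b (fun z => (jac Φ z).transpose * S (Φ z) * jac Φ z) y = _
  rw [pdM_mul hU (hJ.transpose.mul hSΦ) hJ hy, pdM_mul hU hJ.transpose hSΦ hy,
    pdM_transpose, hΦ.pdM_comp hS hy, add_mul]

/-- The transformation law of the Christoffel symbols. -/
theorem jac_mul_chM (hG : IsMetricOn V G) (hy : y ∈ U) (b : Fin n) :
    jac Φ y * chM (pullback Φ G) b y
      = (∑ j, jac Φ y j b • chM G j (Φ y)) * jac Φ y + pdM b (jac Φ) y := by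
  have hy' := hΦ.mapsTo hy
  -- The law is read off from uniqueness: the candidate on the right is torsion free, because second
  -- derivatives of the coordinate change commute, and it is compatible with the pulled-back metric.
  -- The inverse metric is never differentiated.
  have key := (hΦ.isMetricOn hG).chM_unique hy
    (C := fun b => (jac Φ y)⁻¹ * ((∑ j, jac Φ y j b • chM G j (Φ y)) * jac Φ y
      + pdM b (jac Φ) y)) ?_ ?_ b
  · rw [key, ← mul_assoc, hΦ.jac_mul_inv hy, one_mul]
  · intro b k i
    rw [Matrix.mul_apply, Matrix.mul_apply]
    refine Finset.sum_congr rfl fun l _ => ?_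
    congr 1
    rw [Matrix.add_apply, Matrix.add_apply, pdM_apply, pdM_apply, hΦ.pd_jac_symm hy b l i]
    congr 1
    simp only [Matrix.mul_apply, Matrix.sum_apply, Matrix.smul_apply, smul_eq_mul, Finset.sum_mul]
    rw [Finset.sum_comm]
    refine Finset.sum_congr rfl fun p _ => Finset.sum_congr rfl fun q _ => ?_
    simp only [chM, Matrix.of_apply]
    rw [hG.christoffel_symm hy' l q p]
    ring
  · intro b
    set J := jac Φ y with hJ
    set D := pdM b (jac Φ) y with hD
    set P := ∑ j, J j b • chM G j (Φ y) with hP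
    have hJJ : J * J⁻¹ = 1 := hΦ.jac_mul_inv hy
    have h1 : pullback Φ G y * (J⁻¹ * (P * J + D)) = J.transpose * G (Φ y) * (P * J + D) := by
      change J.transpose * G (Φ y) * J * (J⁻¹ * (P * J + D)) = _
      rw [mul_assoc _ J, ← mul_assoc J, hJJ, one_mul]
    have h2 : (J⁻¹ * (P * J + D)).transpose * pullback Φ G y
        = (P * J + D).transpose * G (Φ y) * J := by
      have := congrArg Matrix.transpose h1
      rw [Matrix.transpose_mul, (hΦ.isMetricOn hG).symm y hy] at this
      rw [this]
      simp only [Matrix.transpose_mul, Matrix.transpose_transpose, hG.symm _ hy', mul_assoc]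
    rw [h1, h2, hΦ.pdM_pullback hG.smooth hy, ← hJ, ← hD]
    have h3 : ∑ k, J k b • pdM k G (Φ y) = P.transpose * G (Φ y) + G (Φ y) * P := by
      rw [hP, Matrix.transpose_sum, Finset.sum_mul, Finset.mul_sum, ← Finset.sum_add_distrib]
      refine Finset.sum_congr rfl fun k _ => ?_
      rw [hG.pdM_eq hy', smul_add, Matrix.transpose_smul, smul_mul_assoc, mul_smul_comm]
    rw [h3, Matrix.transpose_add, Matrix.transpose_mul]
    noncomm_ring

end IsCoordChange

/-- The covariant derivative of a `(0,2)`-tensor in the direction `k`. -/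
def covM (G S : EuclideanSpace ℝ (Fin n) → Matrix (Fin n) (Fin n) ℝ) (k : Fin n)
    (y : EuclideanSpace ℝ (Fin n)) : Matrix (Fin n) (Fin n) ℝ :=
  pdM k S y - (chM G k y).transpose * S y - S y * chM G k y

/-- The transformation law writes the derivative of the Jacobian as D = JΓ' - PJ. After this
substitution the JΓ' part cancels against the connection terms upstairs, and the PJ part becomes the
connection terms downstairs. -/
theorem IsCoordChange.covM_pullback (hΦ : IsCoordChange U V Φ) (hG : IsMetricOn V G)
    {S : EuclideanSpace ℝ (Fin n) → Matrix (Fin n) (Fin n) ℝ} (hS : MSmooth V S)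
    (hy : y ∈ U) (b : Fin n) :
    covM (pullback Φ G) (pullback Φ S) b y = (jac Φ y).transpose
      * (∑ k, jac Φ y k b • covM G S k (Φ y)) * jac Φ y := by
  have h := hΦ.jac_mul_chM hG hy b
  unfold covM
  rw [hΦ.pdM_pullback hS hy]
  simp only [pullback]
  set J := jac Φ y with hJ
  set D := pdM b (jac Φ) y with hD
  set P := ∑ j, J j b • chM G j (Φ y) with hP
  set Γ := chM (pullback Φ G) b y
  have hD' : D = J * Γ - P * J := by rw [h]; abel
  have h3 : ∑ k, J k b • (pdM k S (Φ y) - (chM G k (Φ y)).transpose * S (Φ y)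
      - S (Φ y) * chM G k (Φ y))
      = ∑ k, J k b • pdM k S (Φ y) - P.transpose * S (Φ y) - S (Φ y) * P := by
    rw [hP, Matrix.transpose_sum, Finset.sum_mul, Finset.mul_sum, ← Finset.sum_sub_distrib,
      ← Finset.sum_sub_distrib]
    refine Finset.sum_congr rfl fun k _ => ?_
    rw [smul_sub, smul_sub, Matrix.transpose_smul, smul_mul_assoc, mul_smul_comm]
  rw [h3, hD', Matrix.transpose_sub, Matrix.transpose_mul, Matrix.transpose_mul]
  noncomm_ring

/-- The curvature matrices `(R_{kj})^a_i`. -/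
def curvM (G : EuclideanSpace ℝ (Fin n) → Matrix (Fin n) (Fin n) ℝ) (k j : Fin n)
    (y : EuclideanSpace ℝ (Fin n)) : Matrix (Fin n) (Fin n) ℝ :=
  pdM k (chM G j) y - pdM j (chM G k) y + chM G k y * chM G j y - chM G j y * chM G k y

/-- The Ricci tensor as a contraction of the curvature matrices. Only the symmetry of the
Christoffel symbols is needed to match the index order of the two formulas. -/
theorem IsMetricOn.ricci_eq (hG : IsMetricOn U G) (hy : y ∈ U) (i j : Fin n) :
    ricci G y i j = ∑ k, curvM G k j y k i := by
  simp only [ricci, Matrix.of_apply, curvM]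
  refine Finset.sum_congr rfl fun k _ => ?_
  simp only [Matrix.sub_apply, Matrix.add_apply, Matrix.mul_apply, pdM_apply, chM, Matrix.of_apply,
    Finset.sum_sub_distrib]
  rw [pd_congr_on hG.isOpen (fun z hz => hG.christoffel_symm hz k i j) hy k]
  simp only [hG.christoffel_symm hy _ i j]
  ring

namespace IsCoordChange

variable (hΦ : IsCoordChange U V Φ)

include hΦ

/-- Differentiate JΓ'_b = P_b J + ∂_b J in the direction a and antisymmetrize. The second
derivatives of J drop out, and its first derivatives are eliminated with the same law, leaving the
curvature matrices alone. Keeping J on the left avoids its inverse. -/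
theorem jac_mul_curvM (hG : IsMetricOn V G) (hy : y ∈ U) (a b : Fin n) :
    jac Φ y * curvM (pullback Φ G) a b y
      = (∑ j, ∑ k, (jac Φ y j b * jac Φ y k a) • curvM G k j (Φ y)) * jac Φ y := by
  have hy' := hΦ.mapsTo hy
  have hU := hΦ.isOpen_source
  have hG' := hΦ.isMetricOn hG
  have hJs := hΦ.jac_smooth
  have hPs : ∀ b, MSmooth U (fun z => ∑ j, jac Φ z j b • chM G j (Φ z)) := fun b =>
    MSmooth.sum _ fun j _ => MSmooth.smul (hJs j b)
      ((hG.chM_smooth j).comp hΦ.smooth hΦ.mapsTo)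
  have hdiff : ∀ a b, pdM a (jac Φ) y * chM (pullback Φ G) b y
      + jac Φ y * pdM a (chM (pullback Φ G) b) y
      = pdM a (fun z => ∑ j, jac Φ z j b • chM G j (Φ z)) y * jac Φ y
        + (∑ j, jac Φ y j b • chM G j (Φ y)) * pdM a (jac Φ) y + pdM a (pdM b (jac Φ)) y := by
    intro a b
    rw [← pdM_mul hU hJs (hG'.chM_smooth b) hy, ← pdM_mul hU (hPs b) hJs hy,
      ← pdM_add hU ((hPs b).mul hJs) (hJs.pdM hU b) hy]
    exact pdM_congr_on hU (fun z hz => hΦ.jac_mul_chM hG hz b) hy a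
  have hPd : ∀ a b, pdM a (fun z => ∑ j, jac Φ z j b • chM G j (Φ z)) y
      = ∑ j, pd a (fun z => jac Φ z j b) y • chM G j (Φ y)
        + ∑ j, ∑ k, (jac Φ y j b * jac Φ y k a) • pdM k (chM G j) (Φ y) := by
    intro a b
    rw [pdM_sum _ hU (fun j _ => MSmooth.smul (hJs j b)
      ((hG.chM_smooth j).comp hΦ.smooth hΦ.mapsTo)) hy, ← Finset.sum_add_distrib]
    refine Finset.sum_congr rfl fun j _ => ?_
    rw [pdM_smul hU (hJs j b) ((hG.chM_smooth j).comp hΦ.smooth hΦ.mapsTo) hy,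
      hΦ.pdM_comp (hG.chM_smooth j) hy, Finset.smul_sum]
    simp only [smul_smul]
  have hanti : pdM a (fun z => ∑ j, jac Φ z j b • chM G j (Φ z)) y
      - pdM b (fun z => ∑ j, jac Φ z j a • chM G j (Φ z)) y
      = ∑ j, ∑ k, (jac Φ y j b * jac Φ y k a) • (pdM k (chM G j) (Φ y) - pdM j (chM G k) (Φ y)) := by
    rw [hPd, hPd]
    simp only [fun j => hΦ.pd_jac_symm hy a j b, smul_sub, Finset.sum_sub_distrib]
    rw [Finset.sum_comm (f := fun j k => (jac Φ y j b * jac Φ y k a) • pdM j (chM G k) (Φ y))]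
    simp only [mul_comm (jac Φ y _ b)]
    abel
  have hprod : ∀ a b, (∑ j, jac Φ y j a • chM G j (Φ y)) * (∑ j, jac Φ y j b • chM G j (Φ y))
      = ∑ j, ∑ k, (jac Φ y j b * jac Φ y k a) • (chM G k (Φ y) * chM G j (Φ y)) := by
    intro a b
    rw [Finset.mul_sum]
    refine Finset.sum_congr rfl fun j _ => ?_
    rw [Finset.sum_mul]
    refine Finset.sum_congr rfl fun k _ => ?_
    rw [smul_mul_smul_comm, mul_comm (jac Φ y k a)]
  have hprod' : (∑ j, jac Φ y j b • chM G j (Φ y)) * (∑ j, jac Φ y j a • chM G j (Φ y))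
      = ∑ j, ∑ k, (jac Φ y j b * jac Φ y k a) • (chM G j (Φ y) * chM G k (Φ y)) := by
    rw [hprod, Finset.sum_comm]
    simp only [mul_comm (jac Φ y _ a)]
  have hsum : ∑ j, ∑ k, (jac Φ y j b * jac Φ y k a) • curvM G k j (Φ y)
      = (pdM a (fun z => ∑ j, jac Φ z j b • chM G j (Φ z)) y
        - pdM b (fun z => ∑ j, jac Φ z j a • chM G j (Φ z)) y)
        + (∑ j, jac Φ y j a • chM G j (Φ y)) * (∑ j, jac Φ y j b • chM G j (Φ y))
        - (∑ j, jac Φ y j b • chM G j (Φ y)) * (∑ j, jac Φ y j a • chM G j (Φ y)) := by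
    rw [hanti, hprod, hprod', ← Finset.sum_add_distrib, ← Finset.sum_sub_distrib]
    refine Finset.sum_congr rfl fun j _ => ?_
    rw [← Finset.sum_add_distrib, ← Finset.sum_sub_distrib]
    refine Finset.sum_congr rfl fun k _ => ?_
    rw [curvM, smul_sub, smul_add]
  have h1 := hdiff a b
  have h2 := hdiff b a
  rw [pdM_comm hU hJs hy b a] at h2
  have e1 := hΦ.jac_mul_chM hG hy a
  have e2 := hΦ.jac_mul_chM hG hy b
  rw [hsum, curvM]
  set J := jac Φ y
  set Pa := ∑ j, J j a • chM G j (Φ y)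
  set Pb := ∑ j, J j b • chM G j (Φ y)
  set Γa := chM (pullback Φ G) a y
  set Γb := chM (pullback Φ G) b y
  have d1 : pdM a (jac Φ) y = J * Γa - Pa * J := by rw [e1]; abel
  have d2 : pdM b (jac Φ) y = J * Γb - Pb * J := by rw [e2]; abel
  rw [d1] at h1
  rw [d2] at h2
  have h1' := sub_eq_zero.2 h1
  have h2' := sub_eq_zero.2 h2
  rw [← sub_eq_zero]
  have h12 := sub_eq_zero.2 (h1'.trans h2'.symm)
  rw [← h12]
  noncomm_ring

/-- The trace of the law for the curvature matrices: the Jacobian contributed by the contracted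
index meets its inverse and gives a Kronecker symbol. -/
theorem ricci_pullback (hG : IsMetricOn V G) (hy : y ∈ U) :
    ricci (pullback Φ G) y = pullback Φ (ricci G) y := by
  ext i b
  rw [(hΦ.isMetricOn hG).ricci_eq hy]
  have h : ∀ a, curvM (pullback Φ G) a b y = (jac Φ y)⁻¹
      * ((∑ j, ∑ k, (jac Φ y j b * jac Φ y k a) • curvM G k j (Φ y)) * jac Φ y) := by
    intro a
    rw [← hΦ.jac_mul_curvM hG hy, ← mul_assoc, hΦ.jac_inv_mul hy, one_mul]
  simp only [h, pullback, mul_assoc]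
  have hJ : ∀ k m, ∑ a, jac Φ y k a * (jac Φ y)⁻¹ a m = if k = m then 1 else 0 := by
    intro k m
    rw [← Matrix.mul_apply, hΦ.jac_mul_inv hy, Matrix.one_apply]
  simp only [Matrix.mul_apply, Matrix.transpose_apply, Matrix.sum_apply, Matrix.smul_apply,
    smul_eq_mul, hG.ricci_eq (hΦ.mapsTo hy)]
  calc ∑ a, ∑ m, (jac Φ y)⁻¹ a m * ∑ l, (∑ j, ∑ k, jac Φ y j b * jac Φ y k a
          * curvM G k j (Φ y) m l) * jac Φ y l i
      = ∑ a, ∑ m, ∑ l, ∑ j, ∑ k, (jac Φ y k a * (jac Φ y)⁻¹ a m)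
          * (jac Φ y j b * curvM G k j (Φ y) m l * jac Φ y l i) := by
        simp only [Finset.mul_sum, Finset.sum_mul]
        refine Finset.sum_congr rfl fun a _ => Finset.sum_congr rfl fun m _ =>
          Finset.sum_congr rfl fun l _ => Finset.sum_congr rfl fun j _ =>
          Finset.sum_congr rfl fun k _ => by ring
    _ = ∑ l, ∑ j, ∑ k, ∑ m, (∑ a, jac Φ y k a * (jac Φ y)⁻¹ a m)
          * (jac Φ y j b * curvM G k j (Φ y) m l * jac Φ y l i) := by
        simp only [Finset.sum_mul]
        have rot : ∀ F : Fin n → Fin n → Fin n → Fin n → ℝ,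
            ∑ a, ∑ l, ∑ j, ∑ k, F a l j k = ∑ l, ∑ j, ∑ k, ∑ a, F a l j k := by
          intro F
          rw [Finset.sum_comm]
          refine Finset.sum_congr rfl fun l _ => ?_
          rw [Finset.sum_comm]
          refine Finset.sum_congr rfl fun j _ => ?_
          rw [Finset.sum_comm]
        rw [Finset.sum_comm]
        refine Eq.trans ?_ (rot fun m l j k => ∑ a, jac Φ y k a * (jac Φ y)⁻¹ a m
          * (jac Φ y j b * curvM G k j (Φ y) m l * jac Φ y l i))
        exact Finset.sum_congr rfl fun m _ => rot _
    _ = ∑ l, jac Φ y l i * ∑ j, (∑ k, curvM G k j (Φ y) k l) * jac Φ y j b := by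
        simp only [hJ, ite_mul, one_mul, zero_mul, Finset.sum_ite_eq, Finset.mem_univ, if_true,
          Finset.mul_sum, Finset.sum_mul]
        refine Finset.sum_congr rfl fun l _ => Finset.sum_congr rfl fun j _ =>
          Finset.sum_congr rfl fun k _ => by ring

theorem inv_pullback (hG : IsMetricOn V G) (hy : y ∈ U) : (pullback Φ G y)⁻¹
    = (jac Φ y)⁻¹ * (G (Φ y))⁻¹ * ((jac Φ y)⁻¹).transpose := by
  refine Matrix.inv_eq_right_inv ?_
  have h1 : jac Φ y * (jac Φ y)⁻¹ = 1 := hΦ.jac_mul_inv hy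
  have h2 : (jac Φ y).transpose * ((jac Φ y)⁻¹).transpose = 1 := by
    rw [← Matrix.transpose_mul, hΦ.jac_inv_mul hy, Matrix.transpose_one]
  calc (jac Φ y).transpose * G (Φ y) * jac Φ y
        * ((jac Φ y)⁻¹ * (G (Φ y))⁻¹ * ((jac Φ y)⁻¹).transpose)
      = (jac Φ y).transpose * (G (Φ y) * ((jac Φ y * (jac Φ y)⁻¹) * (G (Φ y))⁻¹))
        * ((jac Φ y)⁻¹).transpose := by noncomm_ring
    _ = 1 := by rw [h1, one_mul, hG.mul_inv (hΦ.mapsTo hy), mul_one, h2]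

/-- A coordinate change conjugates the endomorphism g⁻¹S. Hence its trace, σ₁, σ₂ and the trace of
its square are scalars; every invariance statement on the manifold rests on this. -/
theorem inv_pullback_mul (hG : IsMetricOn V G)
    (S : EuclideanSpace ℝ (Fin n) → Matrix (Fin n) (Fin n) ℝ) (hy : y ∈ U) :
    (pullback Φ G y)⁻¹ * pullback Φ S y
      = (jac Φ y)⁻¹ * ((G (Φ y))⁻¹ * S (Φ y)) * jac Φ y := by
  have h2 : ((jac Φ y)⁻¹).transpose * (jac Φ y).transpose = 1 := by
    rw [← Matrix.transpose_mul, hΦ.jac_mul_inv hy, Matrix.transpose_one]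
  rw [hΦ.inv_pullback hG hy, pullback]
  calc _ = (jac Φ y)⁻¹ * (G (Φ y))⁻¹ * (((jac Φ y)⁻¹).transpose * (jac Φ y).transpose)
        * S (Φ y) * jac Φ y := by noncomm_ring
    _ = _ := by rw [h2]; noncomm_ring

theorem trace_conj (B : Matrix (Fin n) (Fin n) ℝ) (hy : y ∈ U) :
    ((jac Φ y)⁻¹ * B * jac Φ y).trace = B.trace := by
  rw [Matrix.trace_mul_comm, ← mul_assoc, hΦ.jac_mul_inv hy, one_mul]

theorem sigmaOne_conj (B : Matrix (Fin n) (Fin n) ℝ) (hy : y ∈ U) :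
    sigmaOne ((jac Φ y)⁻¹ * B * jac Φ y) = sigmaOne B := hΦ.trace_conj B hy

theorem sigmaTwo_conj (B : Matrix (Fin n) (Fin n) ℝ) (hy : y ∈ U) :
    sigmaTwo ((jac Φ y)⁻¹ * B * jac Φ y) = sigmaTwo B := by
  have h : (jac Φ y)⁻¹ * B * jac Φ y * ((jac Φ y)⁻¹ * B * jac Φ y)
      = (jac Φ y)⁻¹ * (B * B) * jac Φ y := by
    calc _ = (jac Φ y)⁻¹ * B * (jac Φ y * (jac Φ y)⁻¹) * B * jac Φ y := by noncomm_ring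
      _ = _ := by rw [hΦ.jac_mul_inv hy]; noncomm_ring
  rw [sigmaTwo, sigmaTwo, h, hΦ.trace_conj _ hy, hΦ.trace_conj _ hy]

end IsCoordChange

theorem IsMetricOn.scalarCurvature_eq (hG : IsMetricOn U G) (hy : y ∈ U) :
    scalarCurvature G y = ((G y)⁻¹ * ricci G y).trace := by
  rw [scalarCurvature, Finset.sum_comm]
  simp only [Matrix.trace, Matrix.diag_apply, Matrix.mul_apply]
  refine Finset.sum_congr rfl fun i _ => Finset.sum_congr rfl fun j _ => ?_
  conv_lhs => rw [← hG.inv_symm hy, Matrix.transpose_apply]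

namespace IsCoordChange

variable (hΦ : IsCoordChange U V Φ)

include hΦ

theorem scalarCurvature_pullback (hG : IsMetricOn V G) (hy : y ∈ U) :
    scalarCurvature (pullback Φ G) y = scalarCurvature G (Φ y) := by
  rw [(hΦ.isMetricOn hG).scalarCurvature_eq hy, hΦ.ricci_pullback hG hy,
    hΦ.inv_pullback_mul hG _ hy, hΦ.trace_conj _ hy, hG.scalarCurvature_eq (hΦ.mapsTo hy)]

theorem schouten_pullback (hG : IsMetricOn V G) (hy : y ∈ U) :
    schouten (pullback Φ G) y = pullback Φ (schouten G) y := by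
  rw [schouten, hΦ.ricci_pullback hG hy, hΦ.scalarCurvature_pullback hG hy]
  simp only [pullback, schouten, Matrix.mul_smul, Matrix.smul_mul, mul_sub, sub_mul]

/-- The second derivatives of Φ from the chain rule are exactly the inhomogeneous term in the
transformation law of the Christoffel symbols. -/
theorem hessian_pullback (hG : IsMetricOn V G) {f : EuclideanSpace ℝ (Fin n) → ℝ}
    (hf : ContDiffOn ℝ ∞ f V) (hy : y ∈ U) :
    Matrix.of (hessian (pullback Φ G) (fun z => f (Φ z)) y)
      = pullback Φ (fun y => Matrix.of (hessian G f y)) y := by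
  have hU := hΦ.isOpen_source
  have hJs := hΦ.jac_smooth
  have hfd : ∀ j, ContDiffOn ℝ ∞ (fun z => pd j f (Φ z)) U := fun j =>
    (pd_smoothOn hΦ.isOpen_target hf j).comp hΦ.smooth hΦ.mapsTo
  ext a b
  have h1 : pd a (pd b (fun z => f (Φ z))) y = ∑ j, (pd a (fun z => jac Φ z j b) y * pd j f (Φ y)
      + jac Φ y j b * ∑ k, jac Φ y k a * pd k (pd j f) (Φ y)) := by
    rw [pd_congr_on hU (fun z hz => hΦ.pd_comp hf hz b) hy a,
      pd_sum _ hU (fun j _ => (hJs j b).mul (hfd j)) hy]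
    refine Finset.sum_congr rfl fun j _ => ?_
    rw [pd_mul hU (hJs j b) (hfd j) hy, hΦ.pd_comp (pd_smoothOn hΦ.isOpen_target hf j) hy]
  have h2 : ∑ c, christoffel (pullback Φ G) c a b y * pd c (fun z => f (Φ z)) y
      = ∑ m, (jac Φ y * chM (pullback Φ G) a y) m b * pd m f (Φ y) := by
    simp only [hΦ.pd_comp hf hy, Matrix.mul_apply, Finset.mul_sum, Finset.sum_mul]
    rw [Finset.sum_comm]
    refine Finset.sum_congr rfl fun m _ => Finset.sum_congr rfl fun c _ => ?_
    simp only [chM, Matrix.of_apply]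
    ring
  rw [Matrix.of_apply, hessian, h1, h2, hΦ.jac_mul_chM hG hy]
  simp only [pullback, Matrix.add_apply, pdM_apply, Matrix.mul_apply,
    Matrix.transpose_apply, Matrix.of_apply, hessian, Matrix.sum_apply, Matrix.smul_apply,
    smul_eq_mul, add_mul, Finset.sum_add_distrib, chM]
  have h3 : ∑ m, (∑ l, (∑ k, jac Φ y k a * christoffel G m k l (Φ y)) * jac Φ y l b)
        * pd m f (Φ y)
      = ∑ l, (∑ k, jac Φ y k a * ∑ m, christoffel G m k l (Φ y) * pd m f (Φ y))
        * jac Φ y l b := by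
    simp only [Finset.sum_mul, Finset.mul_sum]
    rw [Finset.sum_comm]
    refine Finset.sum_congr rfl fun l _ => ?_
    rw [Finset.sum_comm]
    refine Finset.sum_congr rfl fun k _ => Finset.sum_congr rfl fun m _ => by ring
  rw [h3]
  simp only [mul_sub, Finset.sum_sub_distrib, sub_mul]
  simp only [fun j => mul_comm (jac Φ y j b)]
  ring

theorem grad_pullback {f : EuclideanSpace ℝ (Fin n) → ℝ} (hf : ContDiffOn ℝ ∞ f V) (hy : y ∈ U) :
    (fun b => pd b (fun z => f (Φ z)) y) = (jac Φ y).transpose.mulVec (fun k => pd k f (Φ y)) := by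
  ext b
  rw [hΦ.pd_comp hf hy]
  rfl

end IsCoordChange

end Tensoriality

end SigmaTwoFlow

end

noncomputable section

namespace SigmaTwoFlow

/-! ### Normal coordinates -/

section NormalCoordinates

variable {n : ℕ} {U V : Set (EuclideanSpace ℝ (Fin n))} {y : EuclideanSpace ℝ (Fin n)}
  {G : EuclideanSpace ℝ (Fin n) → Matrix (Fin n) (Fin n) ℝ}

/-- Jacobi's formula. -/
theorem pd_det {A : EuclideanSpace ℝ (Fin n) → Matrix (Fin n) (Fin n) ℝ} (hU : IsOpen U)
    (hA : MSmooth U A) (hy : y ∈ U) (h0 : (A y).det ≠ 0) (k : Fin n) :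
    pd k (fun z => (A z).det) y = (A y).det * ((A y)⁻¹ * pdM k A y).trace := by
  let F : (Fin n → Fin n → ℝ) → ℝ := fun M => (Matrix.of M).det
  have hF : ContDiff ℝ ∞ F := by
    simp only [F, Matrix.det_apply', Matrix.of_apply]
    fun_prop
  let a : EuclideanSpace ℝ (Fin n) → Fin n → Fin n → ℝ := fun z i j => A z i j
  let B : Fin n → Fin n → ℝ := fun i j => pdM k A y i j
  have ha : ContDiffOn ℝ ∞ a U := contDiffOn_pi.2 fun i => contDiffOn_pi.2 fun j => hA i j
  have had : DifferentiableAt ℝ a y :=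
    (ha.contDiffAt (hU.mem_nhds hy)).differentiableAt (by simp)
  have hFd : DifferentiableAt ℝ F (a y) := hF.contDiffAt.differentiableAt (by simp)
  have h1 : pd k (fun z => (A z).det) y = fderiv ℝ F (a y) B := by
    have : fderiv ℝ (fun z => F (a z)) y = (fderiv ℝ F (a y)).comp (fderiv ℝ a y) :=
      fderiv_comp y hFd had
    change fderiv ℝ (fun z => F (a z)) y _ = _
    rw [this, ContinuousLinearMap.comp_apply]
    congr 1
    ext i j
    have h2 := (hasFDerivAt_pi'.1 ((hasFDerivAt_pi'.1 had.hasFDerivAt) i)) j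
    change _ = fderiv ℝ (fun z => a z i j) y _
    rw [h2.fderiv]
    rfl
  have h2 : HasDerivAt (fun s : ℝ => F (a y + s • B))
      (fderiv ℝ F (a y) B) 0 := by
    have hl : HasDerivAt (fun s : ℝ => a y + s • B)
        B 0 := by
      simpa using ((hasDerivAt_id (0 : ℝ)).smul_const
        B).const_add (a y)
    have hFd' : HasFDerivAt F (fderiv ℝ F (a y))
        (a y + (0 : ℝ) • B) := by
      simpa using hFd.hasFDerivAt
    exact hFd'.comp_hasDerivAt (0 : ℝ) hl
  have h3 : HasDerivAt (fun s : ℝ => F (a y + s • B))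
      ((A y).det * ((A y)⁻¹ * pdM k A y).trace) 0 := by
    -- Along the line A + sA' the determinant is det A · det(1 + sA⁻¹A'), a polynomial in s whose
    -- linear coefficient is the trace.
    have he : ∀ s : ℝ, F (a y + s • B)
        = (A y).det * (1 + ((A y)⁻¹ * pdM k A y).trace * s
          + (Matrix.det (1 + (Polynomial.X : Polynomial ℝ) •
            ((A y)⁻¹ * pdM k A y).map Polynomial.C)).divX.divX.eval s * s ^ 2) := by
      intro s
      rw [← Matrix.det_one_add_smul, ← Matrix.det_mul, mul_add, mul_one, mul_smul_comm, ← mul_assoc,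
        Matrix.mul_nonsing_inv _ (isUnit_iff_ne_zero.2 h0), one_mul]
      rfl
    simp only [he]
    set p := (Matrix.det (1 + (Polynomial.X : Polynomial ℝ) •
            ((A y)⁻¹ * pdM k A y).map Polynomial.C)).divX.divX
    have := (((hasDerivAt_const (0 : ℝ) (1 : ℝ)).add ((hasDerivAt_id (0 : ℝ)).const_mul
      ((A y)⁻¹ * pdM k A y).trace)).add ((p.hasDerivAt 0).mul
        (hasDerivAt_pow 2 (0 : ℝ)))).const_mul (A y).det
    refine this.congr_deriv ?_
    norm_num
  rw [h1]
  exact h2.unique h3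

theorem pd_coord (k a : Fin n) :
    pd k (fun z : EuclideanSpace ℝ (Fin n) => z a) y = if a = k then 1 else 0 := by
  have : HasFDerivAt (fun z : EuclideanSpace ℝ (Fin n) => z a)
      (EuclideanSpace.proj a : EuclideanSpace ℝ (Fin n) →L[ℝ] ℝ) y :=
    (EuclideanSpace.proj a : EuclideanSpace ℝ (Fin n) →L[ℝ] ℝ).hasFDerivAt
  simp only [pd, this.fderiv]
  simp

theorem coord_smoothOn (a : Fin n) :
    ContDiffOn ℝ ∞ (fun z : EuclideanSpace ℝ (Fin n) => z a) U := by
  fun_prop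

/-- The quadratic map with coefficients `y₀`, `A`, `-q / 2`. -/
def quadMap (y₀ : EuclideanSpace ℝ (Fin n)) (A : Fin n → Fin n → ℝ)
    (q : Fin n → Fin n → Fin n → ℝ) (z : EuclideanSpace ℝ (Fin n)) : EuclideanSpace ℝ (Fin n) :=
  WithLp.toLp 2 fun i => y₀ i + ∑ a, A i a * z a - (1 / 2) * ∑ a, ∑ b, q i a b * (z a * z b)

theorem quadMap_smooth (y₀ : EuclideanSpace ℝ (Fin n)) (A : Fin n → Fin n → ℝ)
    (q : Fin n → Fin n → Fin n → ℝ) : ContDiff ℝ ∞ (quadMap y₀ A q) := by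
  refine contDiff_euclidean.2 fun i => ?_
  simp only [quadMap]
  fun_prop

theorem jac_quadMap (y₀ : EuclideanSpace ℝ (Fin n)) (A : Fin n → Fin n → ℝ)
    (q : Fin n → Fin n → Fin n → ℝ) (z : EuclideanSpace ℝ (Fin n)) (i k : Fin n) :
    jac (quadMap y₀ A q) z i k
      = A i k - (1 / 2) * (∑ b, q i k b * z b + ∑ a, q i a k * z a) := by
  have hU : IsOpen (univ : Set (EuclideanSpace ℝ (Fin n))) := isOpen_univ
  have hz := mem_univ z
  have s1 : ∀ a, ContDiffOn ℝ ∞ (fun z : EuclideanSpace ℝ (Fin n) => A i a * z a) univ :=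
    fun a => by fun_prop
  have s2 : ∀ a b, ContDiffOn ℝ ∞ (fun z : EuclideanSpace ℝ (Fin n) => z a * z b) univ :=
    fun a b => by fun_prop
  simp only [jac, Matrix.of_apply, quadMap]
  rw [pd_sub hU (by fun_prop) (by fun_prop) hz, pd_add hU (by fun_prop) (by fun_prop) hz, pd_const,
    pd_sum _ hU (fun a _ => s1 a) hz, pd_const_mul hU (by fun_prop) hz,
    pd_sum _ hU (fun a _ => by fun_prop) hz]
  have e1 : ∀ a, pd k (fun z : EuclideanSpace ℝ (Fin n) => A i a * z a) z
      = if a = k then A i k else 0 := by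
    intro a
    rw [pd_const_mul hU (coord_smoothOn a) hz, pd_coord]
    split_ifs with h
    · rw [h, mul_one]
    · rw [mul_zero]
  have e2 : ∀ a, pd k (fun z : EuclideanSpace ℝ (Fin n) => ∑ b, q i a b * (z a * z b)) z
      = (if a = k then ∑ b, q i k b * z b else 0) + q i a k * z a := by
    intro a
    rw [pd_sum _ hU (fun b _ => by fun_prop) hz]
    have : ∀ b, pd k (fun z : EuclideanSpace ℝ (Fin n) => q i a b * (z a * z b)) z
        = (if a = k then q i a b * z b else 0) + (if b = k then q i a b * z a else 0) := by
      intro b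
      rw [pd_const_mul hU (s2 a b) hz, pd_mul hU (coord_smoothOn a) (coord_smoothOn b) hz,
        pd_coord, pd_coord]
      split_ifs <;> ring
    simp only [this, Finset.sum_add_distrib, Finset.sum_ite_eq', Finset.mem_univ, if_true]
    split_ifs with h
    · rw [h]
    · simp
  simp only [e1, e2, Finset.sum_add_distrib, Finset.sum_ite_eq', Finset.mem_univ, if_true]
  ring

theorem pdM_jac_quadMap (y₀ : EuclideanSpace ℝ (Fin n)) (A : Fin n → Fin n → ℝ)
    (q : Fin n → Fin n → Fin n → ℝ) (b i k : Fin n) (hq : ∀ i a b, q i a b = q i b a) :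
    pdM b (jac (quadMap y₀ A q)) y i k = -q i k b := by
  have hU : IsOpen (univ : Set (EuclideanSpace ℝ (Fin n))) := isOpen_univ
  have hz := mem_univ y
  have s1 : ∀ a, ContDiffOn ℝ ∞ (fun z : EuclideanSpace ℝ (Fin n) => q i k a * z a) univ :=
    fun a => by fun_prop
  rw [pdM_apply, pd_congr_on hU (g := fun z => A i k - ∑ b, q i k b * z b) (fun z _ => ?_) hz,
    pd_sub hU contDiffOn_const (ContDiffOn.sum fun a _ => s1 a) hz, pd_const,
    pd_sum _ hU (fun a _ => s1 a) hz]
  · have : ∀ a, pd b (fun z : EuclideanSpace ℝ (Fin n) => q i k a * z a) y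
        = if a = b then q i k a else 0 := by
      intro a
      rw [pd_const_mul hU (coord_smoothOn a) hz, pd_coord]
      split_ifs <;> ring
    simp [this]
  · simp only [jac_quadMap, fun a => hq i a k]
    ring

/-- The coordinate matrix `G` is `1` at the origin, with vanishing first derivatives. -/
structure IsNormal (U : Set (EuclideanSpace ℝ (Fin n)))
    (G : EuclideanSpace ℝ (Fin n) → Matrix (Fin n) (Fin n) ℝ) : Prop where
  isMetricOn : IsMetricOn U G
  zero_mem : (0 : EuclideanSpace ℝ (Fin n)) ∈ U
  eq_one : G 0 = 1
  pdM_eq_zero : ∀ k, pdM k G 0 = 0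

/-- Quadratic coefficients that make the Christoffel symbols vanish. -/
def normalCoeff (G : EuclideanSpace ℝ (Fin n) → Matrix (Fin n) (Fin n) ℝ)
    (y₀ : EuclideanSpace ℝ (Fin n)) (A : Fin n → Fin n → ℝ) (i a b : Fin n) : ℝ :=
  ∑ j, ∑ k, christoffel G i j k y₀ * (A j a * A k b)

/-- Normal coordinates at `y₀` with frame `A`. -/
def normalMap (G : EuclideanSpace ℝ (Fin n) → Matrix (Fin n) (Fin n) ℝ)
    (y₀ : EuclideanSpace ℝ (Fin n)) (A : Fin n → Fin n → ℝ) :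
    EuclideanSpace ℝ (Fin n) → EuclideanSpace ℝ (Fin n) :=
  quadMap y₀ A (normalCoeff G y₀ A)

/-- The domain of the normal coordinates. -/
def normalDomain (V : Set (EuclideanSpace ℝ (Fin n)))
    (G : EuclideanSpace ℝ (Fin n) → Matrix (Fin n) (Fin n) ℝ)
    (y₀ : EuclideanSpace ℝ (Fin n)) (A : Fin n → Fin n → ℝ) : Set (EuclideanSpace ℝ (Fin n)) :=
  {z | normalMap G y₀ A z ∈ V ∧ (jac (normalMap G y₀ A) z).det ≠ 0}

theorem normalMap_zero (y₀ : EuclideanSpace ℝ (Fin n)) (A : Fin n → Fin n → ℝ) :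
    normalMap G y₀ A 0 = y₀ := by
  ext i
  simp [normalMap, quadMap]

theorem jac_normalMap_zero (y₀ : EuclideanSpace ℝ (Fin n)) (A : Fin n → Fin n → ℝ) :
    jac (normalMap G y₀ A) 0 = Matrix.of A := by
  ext i k
  rw [normalMap, jac_quadMap]
  simp

theorem jac_normalMap_smooth (y₀ : EuclideanSpace ℝ (Fin n)) (A : Fin n → Fin n → ℝ) :
    MSmooth univ (jac (normalMap G y₀ A)) :=
  fun i a => pd_smoothOn isOpen_univ
    (smoothOn_coord (quadMap_smooth y₀ A (normalCoeff G y₀ A)).contDiffOn i) a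

/-- All tensors are pulled back along the quadratic map, so only an invertible Jacobian on an open
set is required. Neither injectivity nor the inverse function theorem enters. -/
theorem isCoordChange_normalMap (hV : IsOpen V) (y₀ : EuclideanSpace ℝ (Fin n))
    (A : Fin n → Fin n → ℝ) :
    IsCoordChange (normalDomain V G y₀ A) V (normalMap G y₀ A) where
  isOpen_source := by
    have h1 : Continuous (normalMap G y₀ A) :=
      (quadMap_smooth y₀ A (normalCoeff G y₀ A)).continuous
    have h2 : Continuous fun z => (jac (normalMap G y₀ A) z).det :=
      continuousOn_univ.1 (jac_normalMap_smooth y₀ A).det.continuousOn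
    exact (hV.preimage h1).inter (isOpen_ne.preimage h2)
  isOpen_target := hV
  smooth := (quadMap_smooth y₀ A (normalCoeff G y₀ A)).contDiffOn
  mapsTo := fun _ hz => hz.1
  det_ne_zero := fun _ hz => hz.2

/-- The second derivatives of the quadratic map are chosen to cancel the Christoffel term in the
transformation law at the origin. The new symbols vanish there, and with them the first derivatives
of the metric, since the connection is metric. The relation `hA` says that the frame is orthonormal
and normalizes the metric at the origin. -/
theorem isNormal_pullback_normalMap (hG : IsMetricOn V G) {y₀ : EuclideanSpace ℝ (Fin n)}
    (hy₀ : y₀ ∈ V) {A : Fin n → Fin n → ℝ}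
    (hA : (Matrix.of A).transpose * G y₀ * Matrix.of A = 1) :
    IsNormal (normalDomain V G y₀ A) (pullback (normalMap G y₀ A) G) := by
  have hΦ := isCoordChange_normalMap (G := G) hG.isOpen y₀ A
  have hdet : (Matrix.of A).det ≠ 0 := by
    intro h
    have := congrArg Matrix.det hA
    rw [Matrix.det_mul, h, mul_zero, Matrix.det_one] at this
    exact zero_ne_one this
  have h0 : (0 : EuclideanSpace ℝ (Fin n)) ∈ normalDomain V G y₀ A := by
    refine ⟨?_, ?_⟩
    · rw [normalMap_zero]; exact hy₀
    · rw [jac_normalMap_zero]; exact hdet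
  refine ⟨hΦ.isMetricOn hG, h0, ?_, ?_⟩
  · rw [pullback, jac_normalMap_zero, normalMap_zero, hA]
  · intro b
    have h1 := hΦ.jac_mul_chM hG h0 b
    have hq : ∀ i a b, normalCoeff G y₀ A i a b = normalCoeff G y₀ A i b a := by
      intro i a b
      simp only [normalCoeff]
      rw [Finset.sum_comm]
      refine Finset.sum_congr rfl fun k _ => Finset.sum_congr rfl fun j _ => ?_
      rw [hG.christoffel_symm hy₀ i j k]
      ring
    have h2 : (∑ j, jac (normalMap G y₀ A) 0 j b • chM G j (normalMap G y₀ A 0))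
        * jac (normalMap G y₀ A) 0 + pdM b (jac (normalMap G y₀ A)) 0 = 0 := by
      ext i k
      rw [Matrix.add_apply, normalMap, pdM_jac_quadMap _ _ _ _ _ _ hq, ← normalMap,
        jac_normalMap_zero, normalMap_zero]
      simp only [Matrix.mul_apply, Matrix.sum_apply, Matrix.smul_apply, smul_eq_mul, chM,
        Matrix.of_apply, normalCoeff, Finset.sum_mul, Matrix.zero_apply]
      rw [Finset.sum_comm (γ := Fin n), ← sub_eq_add_neg, sub_eq_zero]
      rw [Finset.sum_comm]
      refine Finset.sum_congr rfl fun p _ => Finset.sum_congr rfl fun q _ => ?_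
      rw [hG.christoffel_symm hy₀ i p q]
      ring
    rw [h2] at h1
    have h3 : chM (pullback (normalMap G y₀ A) G) b 0 = 0 := by
      have := congrArg (fun X => (jac (normalMap G y₀ A) 0)⁻¹ * X) h1
      simpa only [← mul_assoc, hΦ.jac_inv_mul h0, one_mul, mul_zero] using this
    rw [(hΦ.isMetricOn hG).pdM_eq h0, h3]
    simp

end NormalCoordinates

end SigmaTwoFlow

end

noncomputable section

namespace SigmaTwoFlow

/-! ### Conformal change of the Schouten tensor -/

section Conformal

variable {n : ℕ} {U V : Set (EuclideanSpace ℝ (Fin n))} {y : EuclideanSpace ℝ (Fin n)}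
  {G : EuclideanSpace ℝ (Fin n) → Matrix (Fin n) (Fin n) ℝ} {f : EuclideanSpace ℝ (Fin n) → ℝ}

/-- The gradient in coordinates. -/
def grad (f : EuclideanSpace ℝ (Fin n) → ℝ) (y : EuclideanSpace ℝ (Fin n)) : Fin n → ℝ :=
  fun k => pd k f y

/-- The conformal metric `e^{-2f} G`. -/
def conf (f : EuclideanSpace ℝ (Fin n) → ℝ)
    (G : EuclideanSpace ℝ (Fin n) → Matrix (Fin n) (Fin n) ℝ) (y : EuclideanSpace ℝ (Fin n)) :
    Matrix (Fin n) (Fin n) ℝ :=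
  Real.exp (-2 * f y) • G y

/-- The tensor `∇²f + df ⊗ df`. -/
def vTensor (G : EuclideanSpace ℝ (Fin n) → Matrix (Fin n) (Fin n) ℝ)
    (f : EuclideanSpace ℝ (Fin n) → ℝ) (y : EuclideanSpace ℝ (Fin n)) :
    Matrix (Fin n) (Fin n) ℝ :=
  Matrix.of (hessian G f y) + Matrix.vecMulVec (grad f y) (grad f y)

/-- The squared norm of the gradient. -/
def gradNormSq (G : EuclideanSpace ℝ (Fin n) → Matrix (Fin n) (Fin n) ℝ)
    (f : EuclideanSpace ℝ (Fin n) → ℝ) (y : EuclideanSpace ℝ (Fin n)) : ℝ :=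
  grad f y ⬝ᵥ (G y)⁻¹.mulVec (grad f y)

/-- The tensor `∇²f + df ⊗ df - |df|² g / 2 + A_g`. -/
def wTensor (G : EuclideanSpace ℝ (Fin n) → Matrix (Fin n) (Fin n) ℝ)
    (f : EuclideanSpace ℝ (Fin n) → ℝ) (y : EuclideanSpace ℝ (Fin n)) :
    Matrix (Fin n) (Fin n) ℝ :=
  vTensor G f y - (gradNormSq G f y / 2) • G y + schouten G y

theorem exp_smoothOn (hf : ContDiffOn ℝ ∞ f U) (c : ℝ) :
    ContDiffOn ℝ ∞ (fun z => Real.exp (c * f z)) U :=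
  Real.contDiff_exp.comp_contDiffOn (contDiffOn_const.mul hf)

theorem pd_exp (hU : IsOpen U) (hf : ContDiffOn ℝ ∞ f U) (hy : y ∈ U) (c : ℝ) (k : Fin n) :
    pd k (fun z => Real.exp (c * f z)) y = Real.exp (c * f y) * (c * pd k f y) := by
  rw [pd_real_comp hU (contDiffOn_const.mul hf) hy (Real.hasDerivAt_exp _),
    pd_const_mul hU hf hy]

theorem IsMetricOn.conf (hG : IsMetricOn U G) (hf : ContDiffOn ℝ ∞ f U) :
    IsMetricOn U (conf f G) where
  isOpen := hG.isOpen
  smooth := MSmooth.smul (exp_smoothOn hf _) hG.smooth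
  symm y hy := by rw [SigmaTwoFlow.conf, Matrix.transpose_smul, hG.symm y hy]
  det_ne_zero y hy := by
    rw [SigmaTwoFlow.conf, Matrix.det_smul]
    exact mul_ne_zero (pow_ne_zero _ (Real.exp_pos _).ne') (hG.det_ne_zero y hy)

/-- Again by uniqueness of the Levi-Civita connection: the correction is symmetric in its lower
indices, and by `hsum` it contributes -2 ∂_b f G, which is what differentiating the factor e^{-2f}
requires. -/
theorem IsMetricOn.chM_conf (hG : IsMetricOn U G) (hf : ContDiffOn ℝ ∞ f U) (hy : y ∈ U)
    (j : Fin n) : chM (SigmaTwoFlow.conf f G) j y = chM G j y + Matrix.of fun k i =>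
      -(if k = j then pd i f y else 0) - (if k = i then pd j f y else 0)
        + G y i j * ∑ l, (G y)⁻¹ k l * pd l f y := by
  refine (hG.conf hf).chM_unique hy (C := fun j => chM G j y + Matrix.of fun k i =>
      -(if k = j then pd i f y else 0) - (if k = i then pd j f y else 0)
        + G y i j * ∑ l, (G y)⁻¹ k l * pd l f y) ?_ ?_ j
  · intro b k i
    simp only [Matrix.add_apply, chM, Matrix.of_apply]
    rw [hG.christoffel_symm hy k b i, hG.symm_apply hy i b]
    ring
  · intro b
    set D : Matrix (Fin n) (Fin n) ℝ := Matrix.of fun k i =>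
      -(if k = b then pd i f y else 0) - (if k = i then pd b f y else 0)
        + G y i b * ∑ l, (G y)⁻¹ k l * pd l f y with hD
    have hGD : ∀ i j, (G y * D) i j
        = -(G y i b * pd j f y) - G y i j * pd b f y + G y j b * pd i f y := by
      intro i j
      simp only [hD, Matrix.mul_apply, Matrix.of_apply, mul_add, mul_sub, mul_neg, mul_ite,
        mul_zero, Finset.sum_add_distrib, Finset.sum_sub_distrib, Finset.sum_neg_distrib,
        Finset.sum_ite_eq', Finset.mem_univ, if_true]
      congr 1
      calc ∑ k, G y i k * (G y j b * ∑ l, (G y)⁻¹ k l * pd l f y)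
          = G y j b * ∑ l, (G y * (G y)⁻¹) i l * pd l f y := by
            simp only [Matrix.mul_apply, Finset.mul_sum, Finset.sum_mul]
            rw [Finset.sum_comm]
            exact Finset.sum_congr rfl fun l _ => Finset.sum_congr rfl fun k _ => by ring
        _ = G y j b * pd i f y := by
            rw [hG.mul_inv hy]
            simp [Matrix.one_apply]
    have hGD' : D.transpose * G y = (G y * D).transpose := by
      rw [Matrix.transpose_mul, hG.symm y hy]
    have hsum : D.transpose * G y + G y * D = (-2 * pd b f y) • G y := by
      ext i j
      rw [hGD', Matrix.add_apply, Matrix.transpose_apply, hGD, hGD, Matrix.smul_apply, smul_eq_mul,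
        hG.symm_apply hy j i]
      ring
    change pdM b (fun z => Real.exp (-2 * f z) • G z) y = (chM G b y + D).transpose
      * (Real.exp (-2 * f y) • G y) + (Real.exp (-2 * f y) • G y) * (chM G b y + D)
    rw [pdM_smul hG.isOpen (exp_smoothOn hf _) hG.smooth hy, pd_exp hG.isOpen hf hy, hG.pdM_eq hy,
      mul_smul, ← hsum]
    simp only [Matrix.transpose_add, Matrix.mul_smul, Matrix.smul_mul, ← smul_add]
    congr 1
    noncomm_ring

/-- The quadratic terms in the conformal change of the Ricci tensor. -/
theorem sum_conformal_quadratic (p : Fin n → ℝ) (i j : Fin n) :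
    ∑ k : Fin n, ∑ l, (-(if k = j then p l else 0)
        - (if k = l then p j else 0) + (if j = l then p k else 0))
      * (-(if l = k then p i else 0) - (if l = i then p k else 0)
        + (if k = i then p l else 0))
        = (n + 2) * (p i * p j) - (if i = j then 2 * ∑ k, p k ^ 2 else 0) := by
  -- With the conditionals written as Kronecker factors, `ring` can expand the product into nine
  -- monomials, each of which then collapses under the sums.
  let d : Fin n → Fin n → ℝ := fun a b => if a = b then 1 else 0
  have hd : ∀ a b (x : ℝ), (if a = b then x else 0) = d a b * x := by
    intro a b x
    simp [d]
  have h1 : ∀ (a : Fin n) (F : Fin n → ℝ), ∑ k, d k a * F k = F a := by simp [d]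
  have h2 : ∀ (a : Fin n) (F : Fin n → ℝ), ∑ k, d a k * F k = F a := by simp [d]
  have h3 : ∀ a, d a a = 1 := by simp [d]
  have hs : ∀ a b, d a b = d b a := fun a b => by simp [d, eq_comm]
  have hexp : ∀ k l, (-(d k j * p l) - d k l * p j + d j l * p k)
      * (-(d l k * p i) - d l i * p k + d k i * p l)
      = d k j * (d l k * (p l * p i)) + d k j * (d l i * (p l * p k))
        - d k j * (d k i * (p l * p l)) + d l k * (d k l * (p j * p i))
        + d l i * (d k l * (p j * p k)) - d l k * (d k i * (p j * p l))
        - d l k * (d j l * (p k * p i)) - d l i * (d j l * (p k * p k))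
        + d k i * (d j l * (p k * p l)) := by
    intro k l
    rw [hs l k]
    ring
  simp only [hd, hexp, Finset.sum_add_distrib, Finset.sum_sub_distrib, h1]
  simp only [← Finset.mul_sum, h1, h2, h3, Finset.sum_const, Finset.card_univ, Fintype.card_fin,
    nsmul_eq_mul, ← pow_two, hs j i]
  ring

namespace IsNormal

variable (hG : IsNormal U G)

include hG

theorem pd_eq_zero (k i j : Fin n) : pd k (fun z => G z i j) 0 = 0 :=
  congrFun (congrFun (hG.pdM_eq_zero k) i) j

theorem inv_eq_one : (G 0)⁻¹ = 1 := by rw [hG.eq_one, inv_one]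

theorem christoffel_eq_zero (k i j : Fin n) : christoffel G k i j 0 = 0 := by
  simp [christoffel, hG.pd_eq_zero]

theorem pd_inv_eq_zero (k i j : Fin n) : pd k (fun z => (G z)⁻¹ i j) 0 = 0 := by
  have := pdM_inv hG.isMetricOn.isOpen hG.isMetricOn.smooth hG.isMetricOn.det_ne_zero
    hG.zero_mem k
  rw [hG.pdM_eq_zero, mul_zero, zero_mul, neg_zero] at this
  exact congrFun (congrFun this i) j

theorem inv_smooth : MSmooth U (fun z => (G z)⁻¹) :=
  hG.isMetricOn.smooth.inv hG.isMetricOn.det_ne_zero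

theorem christoffel_smooth (k i j : Fin n) : ContDiffOn ℝ ∞ (christoffel G k i j) U :=
  christoffel_smoothOn hG.isMetricOn.isOpen hG.isMetricOn.smooth hG.isMetricOn.det_ne_zero k i j

/-- The derivative at the origin of `G⁻¹` applied to a vector field. -/
theorem pd_inv_mul {X : Fin n → EuclideanSpace ℝ (Fin n) → ℝ}
    (hX : ∀ l, ContDiffOn ℝ ∞ (X l) U) (m k : Fin n) :
    pd m (fun z => ∑ l, (G z)⁻¹ k l * X l z) 0 = pd m (X k) 0 := by
  have hU := hG.isMetricOn.isOpen
  rw [pd_sum _ hU (fun l _ => (hG.inv_smooth k l).mul (hX l)) hG.zero_mem]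
  have : ∀ l, pd m (fun z => (G z)⁻¹ k l * X l z) 0 = if k = l then pd m (X l) 0 else 0 := by
    intro l
    rw [pd_mul hU (hG.inv_smooth k l) (hX l) hG.zero_mem, hG.pd_inv_eq_zero]
    beta_reduce
    rw [hG.inv_eq_one, Matrix.one_apply]
    split_ifs <;> ring
  simp [this]

theorem christoffel_conf (hf : ContDiffOn ℝ ∞ f U) (hy : y ∈ U) (k i j : Fin n) :
    christoffel (SigmaTwoFlow.conf f G) k i j y = christoffel G k i j y
      + (-(if k = i then pd j f y else 0) - (if k = j then pd i f y else 0)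
        + G y j i * ∑ l, (G y)⁻¹ k l * pd l f y) :=
  congrFun (congrFun (hG.isMetricOn.chM_conf hf hy i) k) j

theorem christoffel_conf_zero (hf : ContDiffOn ℝ ∞ f U) (k i j : Fin n) :
    christoffel (SigmaTwoFlow.conf f G) k i j 0 =
      -(if k = i then pd j f 0 else 0) - (if k = j then pd i f 0 else 0)
        + (if i = j then pd k f 0 else 0) := by
  rw [hG.christoffel_conf hf hG.zero_mem, hG.christoffel_eq_zero, hG.inv_eq_one, hG.eq_one]
  simp only [Matrix.one_apply, ite_mul, one_mul, zero_mul, Finset.sum_ite_eq, Finset.mem_univ,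
    if_true, zero_add, eq_comm (a := j) (b := i)]

theorem pd_christoffel_conf (hf : ContDiffOn ℝ ∞ f U) (m k i j : Fin n) :
    pd m (christoffel (SigmaTwoFlow.conf f G) k i j) 0 = pd m (christoffel G k i j) 0
      - (if k = i then pd m (pd j f) 0 else 0) - (if k = j then pd m (pd i f) 0 else 0)
        + (if i = j then pd m (pd k f) 0 else 0) := by
  have hU := hG.isMetricOn.isOpen
  have h0 := hG.zero_mem
  have hite : ∀ (p : Prop) [Decidable p] (j : Fin n),
      ContDiffOn ℝ ∞ (fun z => if p then pd j f z else 0) U := by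
    intro p _ j
    split_ifs
    · exact pd_smoothOn hU hf j
    · exact contDiffOn_const
  have hpite : ∀ (p : Prop) [Decidable p] (j : Fin n),
      pd m (fun z => if p then pd j f z else 0) 0 = if p then pd m (pd j f) 0 else 0 := by
    intro p _ j
    split_ifs
    · rfl
    · exact pd_const _ _
  have hs : ContDiffOn ℝ ∞ (fun z => ∑ l, (G z)⁻¹ k l * pd l f z) U :=
    ContDiffOn.sum fun l _ => (hG.inv_smooth k l).mul (pd_smoothOn hU hf l)
  rw [pd_congr_on hU (fun z hz => hG.christoffel_conf hf hz k i j) h0,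
    pd_add hU (hG.christoffel_smooth k i j)
      (((hite _ _).neg.sub (hite _ _)).add ((hG.isMetricOn.smooth j i).mul hs)) h0,
    pd_add hU ((hite _ _).neg.sub (hite _ _)) ((hG.isMetricOn.smooth j i).mul hs) h0,
    pd_sub hU (hite _ _).neg (hite _ _) h0, pd_neg, hpite, hpite,
    pd_mul hU (hG.isMetricOn.smooth j i) hs h0, hG.pd_eq_zero,
    hG.pd_inv_mul (fun l => pd_smoothOn hU hf l), hG.eq_one, Matrix.one_apply]
  simp only [eq_comm (a := j) (b := i), ite_mul, one_mul, zero_mul]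
  ring

/-- At the centre the symbols of G vanish, so the products contain only the conformal correction.
The derivative terms (`hlin`) give (n-2)∇²f + Δf g, and the quadratic terms (`hquad`) give
(n-2)(df⊗df - |df|² g). -/
theorem ricci_conf (hf : ContDiffOn ℝ ∞ f U) (i j : Fin n) :
    ricci (SigmaTwoFlow.conf f G) 0 i j = ricci G 0 i j
      + ((n : ℝ) - 2) * (pd i (pd j f) 0 + pd i f 0 * pd j f 0)
      + (if i = j then ∑ k, pd k (pd k f) 0 - ((n : ℝ) - 2) * ∑ k, pd k f 0 ^ 2 else 0) := by
  have hU := hG.isMetricOn.isOpen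
  simp only [ricci, Matrix.of_apply, hG.pd_christoffel_conf hf, hG.christoffel_conf_zero hf,
    hG.christoffel_eq_zero]
  simp only [mul_zero, sub_zero, Finset.sum_const_zero, add_zero]
  have hlin : ∑ k, ((pd k (christoffel G k i j) 0 - (if k = i then pd k (pd j f) 0 else 0)
      - (if k = j then pd k (pd i f) 0 else 0) + (if i = j then pd k (pd k f) 0 else 0))
      - (pd j (christoffel G k k i) 0 - (if True then pd j (pd i f) 0 else 0)
      - (if k = i then pd j (pd k f) 0 else 0) + (if k = i then pd j (pd k f) 0 else 0)))
      = ∑ k, (pd k (christoffel G k i j) 0 - pd j (christoffel G k k i) 0)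
        + ((n : ℝ) - 2) * pd i (pd j f) 0 + (if i = j then ∑ k, pd k (pd k f) 0 else 0) := by
    simp only [if_true, Finset.sum_add_distrib, Finset.sum_sub_distrib, Finset.sum_ite_eq',
      Finset.mem_univ, Finset.sum_const, Finset.card_univ, Fintype.card_fin, nsmul_eq_mul,
      pd_comm hU hf hG.zero_mem j i]
    split_ifs <;> simp <;> ring
  have hquad : ∑ k, ∑ l, ((-(if True then pd l f 0 else 0) - (if k = l then pd k f 0 else 0)
        + (if k = l then pd k f 0 else 0))
      * (-(if l = i then pd j f 0 else 0) - (if l = j then pd i f 0 else 0)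
        + (if i = j then pd l f 0 else 0))
      - (-(if k = j then pd l f 0 else 0) - (if k = l then pd j f 0 else 0)
        + (if j = l then pd k f 0 else 0))
      * (-(if l = k then pd i f 0 else 0) - (if l = i then pd k f 0 else 0)
        + (if k = i then pd l f 0 else 0)))
      = ((n : ℝ) - 2) * (pd i f 0 * pd j f 0)
        - (if i = j then ((n : ℝ) - 2) * ∑ k, pd k f 0 ^ 2 else 0) := by
    have a1 : ∑ k : Fin n, ∑ l, (-(if True then pd l f 0 else 0)
        - (if k = l then pd k f 0 else 0) + (if k = l then pd k f 0 else 0))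
      * (-(if l = i then pd j f 0 else 0) - (if l = j then pd i f 0 else 0)
        + (if i = j then pd l f 0 else 0))
        = 2 * n * (pd i f 0 * pd j f 0) - (if i = j then n * ∑ k, pd k f 0 ^ 2 else 0) := by
      have : ∀ l, (-(pd l f 0)) * (-(if l = i then pd j f 0 else 0)
          - (if l = j then pd i f 0 else 0) + (if i = j then pd l f 0 else 0))
          = (if l = i then pd i f 0 * pd j f 0 else 0) + (if l = j then pd i f 0 * pd j f 0 else 0)
            - (if i = j then pd l f 0 ^ 2 else 0) := by
        intro l
        split_ifs <;> subst_vars <;> ring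
      simp only [if_true, sub_add_cancel, this, Finset.sum_add_distrib, Finset.sum_sub_distrib,
        Finset.sum_ite_eq', Finset.mem_univ, Finset.sum_const, Finset.card_univ, Fintype.card_fin,
        nsmul_eq_mul]
      split_ifs <;> simp <;> ring
    simp only [Finset.sum_sub_distrib]
    rw [a1, sum_conformal_quadratic]
    split_ifs <;> ring
  rw [Finset.sum_add_distrib, hlin, hquad]
  split_ifs <;> ring

end IsNormal

end Conformal

end SigmaTwoFlow

end

noncomputable section

namespace SigmaTwoFlow

/-! ### The Schouten tensor under a conformal change. -/

section ConformalSchouten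

variable {n : ℕ} {U V : Set (EuclideanSpace ℝ (Fin n))} {y : EuclideanSpace ℝ (Fin n)}
  {G : EuclideanSpace ℝ (Fin n) → Matrix (Fin n) (Fin n) ℝ} {f : EuclideanSpace ℝ (Fin n) → ℝ}

theorem IsNormal.vTensor_apply (hG : IsNormal U G) (i j : Fin n) :
    vTensor G f 0 i j = pd i (pd j f) 0 + pd i f 0 * pd j f 0 := by
  simp [vTensor, hessian, hG.christoffel_eq_zero, Matrix.vecMulVec_apply, grad]

theorem IsNormal.gradNormSq_eq (hG : IsNormal U G) :
    gradNormSq G f 0 = ∑ k, pd k f 0 ^ 2 := by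
  simp [gradNormSq, hG.inv_eq_one, dotProduct, grad, pow_two]

/-- Subtracting R g/(2(n-1)) removes the Laplacian from the pure trace part of the Ricci formula and
halves the coefficient of |df|². Division by n - 2 leaves -|df|² g/2. -/
theorem IsNormal.schouten_conf (hn : 2 < n) (hG : IsNormal U G) (hf : ContDiffOn ℝ ∞ f U) :
    schouten (conf f G) 0 = wTensor G f 0 := by
  have hn2 : ((n : ℝ) - 2) ≠ 0 := by
    have : (2 : ℝ) < n := by exact_mod_cast hn
    linarith
  have hn1 : ((n : ℝ) - 1) ≠ 0 := by
    have : (2 : ℝ) < n := by exact_mod_cast hn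
    linarith
  have h0 := hG.zero_mem
  set Δ := ∑ k, pd k (pd k f) 0 with hΔ
  set q := ∑ k, pd k f 0 ^ 2 with hq
  have hR : ricci (conf f G) 0 = ricci G 0 + ((n : ℝ) - 2) • vTensor G f 0
      + (Δ - ((n : ℝ) - 2) * q) • (1 : Matrix (Fin n) (Fin n) ℝ) := by
    ext i j
    rw [hG.ricci_conf hf]
    simp only [Matrix.add_apply, Matrix.smul_apply, smul_eq_mul, hG.vTensor_apply,
      Matrix.one_apply, mul_ite, mul_one, mul_zero]
    rw [hΔ, hq]
  have he : Real.exp (-2 * f 0) ≠ 0 := (Real.exp_pos _).ne'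
  have hinv : (Real.exp (-2 * f 0) • (1 : Matrix (Fin n) (Fin n) ℝ))⁻¹
      = (Real.exp (-2 * f 0))⁻¹ • 1 := by
    refine Matrix.inv_eq_right_inv ?_
    rw [smul_mul_smul_comm, one_mul, mul_inv_cancel₀ he, one_smul]
  have htr : (vTensor G f 0).trace = Δ + q := by
    simp only [Matrix.trace, Matrix.diag_apply, hG.vTensor_apply, Finset.sum_add_distrib, ← pow_two,
      hΔ, hq]
  have hS : scalarCurvature (conf f G) 0 = (Real.exp (-2 * f 0))⁻¹ * (scalarCurvature G 0 + 2 * ((n : ℝ) - 1) * Δ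
        - ((n : ℝ) - 2) * ((n : ℝ) - 1) * q) := by
    rw [(hG.isMetricOn.conf hf).scalarCurvature_eq h0, hG.isMetricOn.scalarCurvature_eq h0, hR,
      conf, hG.eq_one, inv_one, hinv, Matrix.smul_mul, one_mul,
      Matrix.trace_smul, Matrix.trace_add, Matrix.trace_add, Matrix.trace_smul, Matrix.trace_smul,
      htr, Matrix.trace_one, one_mul]
    simp only [smul_eq_mul, Fintype.card_fin]
    ring
  have hc : (scalarCurvature (conf f G) 0 / (2 * ((n : ℝ) - 1))) • conf f G 0
      = ((scalarCurvature G 0 + 2 * ((n : ℝ) - 1) * Δ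
        - ((n : ℝ) - 2) * ((n : ℝ) - 1) * q) / (2 * ((n : ℝ) - 1)))
        • (1 : Matrix (Fin n) (Fin n) ℝ) := by
    rw [hS, conf, hG.eq_one, smul_smul]
    congr 1
    field_simp
  ext i j
  rw [schouten, hc, hR, wTensor, schouten, hG.gradNormSq_eq, hG.eq_one]
  simp only [Matrix.add_apply, Matrix.sub_apply, Matrix.smul_apply, smul_eq_mul]
  field_simp
  ring

theorem pullback_conf (Φ : EuclideanSpace ℝ (Fin n) → EuclideanSpace ℝ (Fin n)) :
    pullback Φ (conf f G) = conf (fun z => f (Φ z)) (pullback Φ G) := by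
  funext z
  simp only [pullback, conf, Matrix.mul_smul, Matrix.smul_mul]

namespace IsCoordChange

variable {Φ : EuclideanSpace ℝ (Fin n) → EuclideanSpace ℝ (Fin n)} (hΦ : IsCoordChange U V Φ)

include hΦ

theorem vTensor_pullback (hG : IsMetricOn V G) (hf : ContDiffOn ℝ ∞ f V) (hy : y ∈ U) :
    vTensor (pullback Φ G) (fun z => f (Φ z)) y = pullback Φ (vTensor G f) y := by
  have h : grad (fun z => f (Φ z)) y = (jac Φ y).transpose.mulVec (grad f (Φ y)) :=
    hΦ.grad_pullback hf hy
  rw [vTensor, hΦ.hessian_pullback hG hf hy, h]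
  simp only [pullback, vTensor, mul_add, add_mul, Matrix.mul_vecMulVec, Matrix.vecMulVec_mul,
    ← Matrix.mulVec_transpose]

theorem gradNormSq_pullback (hG : IsMetricOn V G) (hf : ContDiffOn ℝ ∞ f V) (hy : y ∈ U) :
    gradNormSq (pullback Φ G) (fun z => f (Φ z)) y = gradNormSq G f (Φ y) := by
  have h : grad (fun z => f (Φ z)) y = (jac Φ y).transpose.mulVec (grad f (Φ y)) :=
    hΦ.grad_pullback hf hy
  have h2 : ((jac Φ y)⁻¹).transpose * (jac Φ y).transpose = 1 := by
    rw [← Matrix.transpose_mul, hΦ.jac_mul_inv hy, Matrix.transpose_one]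
  rw [gradNormSq, gradNormSq, h, hΦ.inv_pullback hG hy, Matrix.mulVec_mulVec, mul_assoc, h2, mul_one,
    Matrix.dotProduct_mulVec, ← Matrix.mulVec_transpose, Matrix.mulVec_mulVec, Matrix.transpose_mul,
    mul_assoc, h2, mul_one, Matrix.mulVec_transpose, Matrix.dotProduct_mulVec]

theorem wTensor_pullback (hG : IsMetricOn V G) (hf : ContDiffOn ℝ ∞ f V) (hy : y ∈ U) :
    wTensor (pullback Φ G) (fun z => f (Φ z)) y = pullback Φ (wTensor G f) y := by
  rw [wTensor, hΦ.vTensor_pullback hG hf hy, hΦ.gradNormSq_pullback hG hf hy,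
    hΦ.schouten_pullback hG hy]
  simp only [pullback, wTensor, mul_add, add_mul, mul_sub, sub_mul, Matrix.mul_smul,
    Matrix.smul_mul]

end IsCoordChange

/-- The Schouten tensor of a conformal metric. -/
theorem IsMetricOn.schouten_conf (hn : 2 < n) (hG : IsMetricOn V G) (hf : ContDiffOn ℝ ∞ f V)
    (hy : y ∈ V) {A : Fin n → Fin n → ℝ}
    (hA : (Matrix.of A).transpose * G y * Matrix.of A = 1) :
    schouten (SigmaTwoFlow.conf f G) y = wTensor G f y := by
  have hΦ := isCoordChange_normalMap (G := G) hG.isOpen y A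
  have hN := isNormal_pullback_normalMap hG hy hA
  have hfΦ := hf.comp hΦ.smooth hΦ.mapsTo
  have h := hN.schouten_conf hn hfΦ
  rw [show f ∘ normalMap G y A = fun z => f (normalMap G y A z) from rfl, ← pullback_conf,
    hΦ.schouten_pullback (hG.conf hf) hN.zero_mem, hΦ.wTensor_pullback hG hf hN.zero_mem] at h
  simp only [pullback, normalMap_zero] at h
  set J := jac (normalMap G y A) 0
  have h1 : J * J⁻¹ = 1 := hΦ.jac_mul_inv hN.zero_mem
  have h2 : (J⁻¹).transpose * J.transpose = 1 := by
    rw [← Matrix.transpose_mul, h1, Matrix.transpose_one]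
  have h3 := congrArg (fun X => (J⁻¹).transpose * X * J⁻¹) h
  have h4 : ∀ X : Matrix (Fin n) (Fin n) ℝ,
      (J⁻¹).transpose * (J.transpose * X * J) * J⁻¹ = X := by
    intro X
    calc _ = ((J⁻¹).transpose * J.transpose) * X * (J * J⁻¹) := by noncomm_ring
      _ = X := by rw [h1, h2, one_mul, mul_one]
  simpa only [h4] using h3

end ConformalSchouten

/-! ### The contracted Bianchi identity -/

section Bianchi

variable {n : ℕ} {U V : Set (EuclideanSpace ℝ (Fin n))} {y : EuclideanSpace ℝ (Fin n)}
  {G : EuclideanSpace ℝ (Fin n) → Matrix (Fin n) (Fin n) ℝ}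

/-- The first Newton tensor `σ₁(A) g - A` of the Schouten tensor. -/
def newton (G : EuclideanSpace ℝ (Fin n) → Matrix (Fin n) (Fin n) ℝ)
    (y : EuclideanSpace ℝ (Fin n)) : Matrix (Fin n) (Fin n) ℝ :=
  ((G y)⁻¹ * schouten G y).trace • G y - schouten G y

/-- Up to the factor -1/(n-2) this is the Einstein tensor, which is why its divergence vanishes by
the contracted Bianchi identity. -/
theorem IsMetricOn.newton_eq (hn : 2 < n) (hG : IsMetricOn U G) (hy : y ∈ U) :
    newton G y = (1 / ((n : ℝ) - 2)) • ((1 / 2 * scalarCurvature G y) • G y - ricci G y) := by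
  have hn2 : ((n : ℝ) - 2) ≠ 0 := by
    have : (2 : ℝ) < n := by exact_mod_cast hn
    linarith
  have hn1 : ((n : ℝ) - 1) ≠ 0 := by
    have : (2 : ℝ) < n := by exact_mod_cast hn
    linarith
  have h : ((G y)⁻¹ * schouten G y).trace = scalarCurvature G y / (2 * ((n : ℝ) - 1)) := by
    rw [schouten, Matrix.mul_smul, mul_sub, Matrix.mul_smul, hG.inv_mul hy, Matrix.trace_smul,
      Matrix.trace_sub, ← hG.scalarCurvature_eq hy, Matrix.trace_smul, Matrix.trace_one]
    simp only [smul_eq_mul, Fintype.card_fin]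
    field_simp
    ring
  rw [newton, h]
  ext i j
  simp only [schouten, Matrix.sub_apply, Matrix.smul_apply, smul_eq_mul]
  field_simp
  ring

theorem IsMetricOn.newton_smooth (hG : IsMetricOn U G) : MSmooth U (newton G) := by
  have hA := schouten_smoothOn hG.isOpen hG.smooth hG.det_ne_zero
  exact (MSmooth.smul ((hG.smooth.inv hG.det_ne_zero).mul hA).trace hG.smooth).sub hA

theorem IsCoordChange.newton_pullback {Φ : EuclideanSpace ℝ (Fin n) → EuclideanSpace ℝ (Fin n)}
    (hΦ : IsCoordChange U V Φ) (hG : IsMetricOn V G) (hy : y ∈ U) :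
    newton (pullback Φ G) y = pullback Φ (newton G) y := by
  rw [newton, hΦ.schouten_pullback hG hy, hΦ.inv_pullback_mul hG _ hy, hΦ.trace_conj _ hy]
  simp only [pullback, newton, mul_sub, sub_mul, Matrix.mul_smul, Matrix.smul_mul]

/-- The divergence of the Newton tensor. -/
def divNewton (G : EuclideanSpace ℝ (Fin n) → Matrix (Fin n) (Fin n) ℝ)
    (y : EuclideanSpace ℝ (Fin n)) (b : Fin n) : ℝ :=
  ∑ i, ((G y)⁻¹ * covM G (newton G) i y) i b

/-- The divergence transforms as a one-form, so its vanishing may be checked at the centre of normal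
coordinates. -/
theorem IsCoordChange.divNewton_pullback
    {Φ : EuclideanSpace ℝ (Fin n) → EuclideanSpace ℝ (Fin n)}
    (hΦ : IsCoordChange U V Φ) (hG : IsMetricOn V G) (hy : y ∈ U) :
    divNewton (pullback Φ G) y = (jac Φ y).transpose.mulVec (divNewton G (Φ y)) := by
  have hcov : ∀ i, (pullback Φ G y)⁻¹ * covM (pullback Φ G) (newton (pullback Φ G)) i y
      = (jac Φ y)⁻¹ * ((G (Φ y))⁻¹ * ∑ k, jac Φ y k i • covM G (newton G) k (Φ y))
        * jac Φ y := by
    intro i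
    have h1 : covM (pullback Φ G) (newton (pullback Φ G)) i y
        = covM (pullback Φ G) (pullback Φ (newton G)) i y := by
      unfold covM
      rw [pdM_congr_on hΦ.isOpen_source (fun z hz => hΦ.newton_pullback hG hz) hy,
        hΦ.newton_pullback hG hy]
    have h2 : ((jac Φ y)⁻¹).transpose * (jac Φ y).transpose = 1 := by
      rw [← Matrix.transpose_mul, hΦ.jac_mul_inv hy, Matrix.transpose_one]
    rw [h1, hΦ.covM_pullback hG hG.newton_smooth hy, hΦ.inv_pullback hG hy]
    calc _ = (jac Φ y)⁻¹ * (G (Φ y))⁻¹ * (((jac Φ y)⁻¹).transpose * (jac Φ y).transpose)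
          * (∑ k, jac Φ y k i • covM G (newton G) k (Φ y)) * jac Φ y := by noncomm_ring
      _ = _ := by rw [h2]; noncomm_ring
  have hJ : ∀ k m, ∑ a, jac Φ y k a * (jac Φ y)⁻¹ a m = if k = m then 1 else 0 := by
    intro k m
    rw [← Matrix.mul_apply, hΦ.jac_mul_inv hy, Matrix.one_apply]
  ext b
  simp only [divNewton, hcov, Matrix.mulVec, dotProduct, Matrix.transpose_apply]
  have h3 : ∀ i, ((jac Φ y)⁻¹ * ((G (Φ y))⁻¹ * ∑ k, jac Φ y k i • covM G (newton G) k (Φ y))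
        * jac Φ y) i b
      = ∑ k, ∑ m, (jac Φ y k i * (jac Φ y)⁻¹ i m)
        * ((G (Φ y))⁻¹ * covM G (newton G) k (Φ y) * jac Φ y) m b := by
    intro i
    rw [Finset.mul_sum, Finset.mul_sum, Finset.sum_mul, Matrix.sum_apply]
    refine Finset.sum_congr rfl fun k _ => ?_
    rw [Matrix.mul_smul, Matrix.mul_smul, Matrix.smul_mul, mul_assoc, Matrix.smul_apply,
      Matrix.mul_apply, smul_eq_mul, Finset.mul_sum]
    exact Finset.sum_congr rfl fun m _ => by ring
  simp only [h3]
  rw [Finset.sum_comm]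
  calc ∑ k, ∑ i, ∑ m, (jac Φ y k i * (jac Φ y)⁻¹ i m)
        * ((G (Φ y))⁻¹ * covM G (newton G) k (Φ y) * jac Φ y) m b
      = ∑ k, ((G (Φ y))⁻¹ * covM G (newton G) k (Φ y) * jac Φ y) k b := by
        refine Finset.sum_congr rfl fun k _ => ?_
        rw [Finset.sum_comm]
        simp only [← Finset.sum_mul, hJ, ite_mul, one_mul, zero_mul, Finset.sum_ite_eq,
          Finset.mem_univ, if_true]
    _ = _ := by
        have h4 : ∀ k, ((G (Φ y))⁻¹ * covM G (newton G) k (Φ y) * jac Φ y) k b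
            = ∑ m, ((G (Φ y))⁻¹ * covM G (newton G) k (Φ y)) k m * jac Φ y m b :=
          fun k => Matrix.mul_apply
        rw [Finset.sum_congr rfl fun k _ => h4 k, Finset.sum_comm]
        simp only [Finset.mul_sum]
        exact Finset.sum_congr rfl fun m _ => Finset.sum_congr rfl fun k _ => mul_comm _ _

namespace IsNormal

variable (hG : IsNormal U G)

include hG

/-- At the origin G⁻¹ is the identity with zero derivative, and the first derivatives of G vanish.
Only the terms with both derivatives on the bracket survive. -/
theorem pd_pd_christoffel (m k p i j : Fin n) :
    pd m (pd k (christoffel G p i j)) 0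
      = (1 / 2) * (pd m (pd k (pd i fun z => G z j p)) 0 + pd m (pd k (pd j fun z => G z i p)) 0
        - pd m (pd k (pd p fun z => G z i j)) 0) := by
  have hU := hG.isMetricOn.isOpen
  have h0 := hG.zero_mem
  have hGs := hG.isMetricOn.smooth
  let X : Fin n → EuclideanSpace ℝ (Fin n) → ℝ := fun l z =>
    pd i (fun z => G z j l) z + pd j (fun z => G z i l) z - pd l (fun z => G z i j) z
  have s1 : ∀ a b c, ContDiffOn ℝ ∞ (pd a fun z => G z b c) U := fun a b c =>
    pd_smoothOn hU (hGs b c) a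
  have hX : ∀ l, ContDiffOn ℝ ∞ (X l) U := fun l => ((s1 _ _ _).add (s1 _ _ _)).sub (s1 _ _ _)
  have hX0 : ∀ l, X l 0 = 0 := fun l => by simp [X, hG.pd_eq_zero]
  have hIs : ∀ a b, ContDiffOn ℝ ∞ (fun z => (G z)⁻¹ a b) U := hG.inv_smooth
  have hprod : ∀ l, ContDiffOn ℝ ∞ (fun z => (G z)⁻¹ p l * X l z) U := fun l =>
    (hIs p l).mul (hX l)
  have hk : EqOn (pd k (christoffel G p i j)) (fun z => (1 / 2) * ∑ l,
      (pd k (fun z => (G z)⁻¹ p l) z * X l z + (G z)⁻¹ p l * pd k (X l) z)) U := by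
    intro z hz
    change pd k (fun z => (1 / 2) * ∑ l, (G z)⁻¹ p l * X l z) z = _
    rw [pd_const_mul hU (ContDiffOn.sum fun l _ => hprod l) hz,
      pd_sum _ hU (fun l _ => hprod l) hz]
    simp only [fun l => pd_mul hU (hIs p l) (hX l) hz k]
  have hXk : ∀ l, ContDiffOn ℝ ∞ (pd k (X l)) U := fun l => pd_smoothOn hU (hX l) k
  have hIk : ∀ l, ContDiffOn ℝ ∞ (pd k fun z => (G z)⁻¹ p l) U := fun l =>
    pd_smoothOn hU (hIs p l) k
  rw [pd_congr_on hU hk h0, pd_const_mul hU (ContDiffOn.sum fun l _ =>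
    ((hIk l).mul (hX l)).add ((hIs p l).mul (hXk l))) h0,
    pd_sum _ hU (fun l _ => ((hIk l).mul (hX l)).add ((hIs p l).mul (hXk l))) h0]
  have hterm : ∀ l, pd m (fun z => pd k (fun z => (G z)⁻¹ p l) z * X l z
      + (G z)⁻¹ p l * pd k (X l) z) 0 = if p = l then pd m (pd k (X l)) 0 else 0 := by
    intro l
    rw [pd_add hU ((hIk l).mul (hX l)) ((hIs p l).mul (hXk l)) h0, pd_mul hU (hIk l) (hX l) h0,
      pd_mul hU (hIs p l) (hXk l) h0, hX0, hG.pd_inv_eq_zero, hG.pd_inv_eq_zero]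
    beta_reduce
    rw [hG.inv_eq_one, Matrix.one_apply]
    split_ifs <;> ring
  simp only [hterm, Finset.sum_ite_eq, Finset.mem_univ, if_true]
  congr 1
  have hk2 : EqOn (pd k (X p)) (fun z => pd k (pd i fun z => G z j p) z
      + pd k (pd j fun z => G z i p) z - pd k (pd p fun z => G z i j) z) U := by
    intro z hz
    rw [pd_sub hU ((s1 _ _ _).add (s1 _ _ _)) (s1 _ _ _) hz, pd_add hU (s1 _ _ _) (s1 _ _ _) hz]
  have s2 : ∀ a b c, ContDiffOn ℝ ∞ (pd k (pd a fun z => G z b c)) U := fun a b c =>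
    pd_smoothOn hU (s1 a b c) k
  rw [pd_congr_on hU hk2 h0, pd_sub hU ((s2 _ _ _).add (s2 _ _ _)) (s2 _ _ _) h0,
    pd_add hU (s2 _ _ _) (s2 _ _ _) h0]

/-- The quadratic terms of the Ricci tensor are products of two functions that vanish at the origin,
so a single derivative does not see them. -/
theorem pd_ricci (m i j : Fin n) : pd m (fun z => ricci G z i j) 0
    = ∑ k, (pd m (pd k (christoffel G k i j)) 0 - pd m (pd j (christoffel G k k i)) 0) := by
  have hU := hG.isMetricOn.isOpen
  have h0 := hG.zero_mem
  have hΓ := hG.christoffel_smooth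
  have hΓd : ∀ a k i j, ContDiffOn ℝ ∞ (pd a (christoffel G k i j)) U := fun a k i j =>
    pd_smoothOn hU (hΓ k i j) a
  have hq : ∀ k l, ContDiffOn ℝ ∞ (fun z => christoffel G k k l z * christoffel G l i j z
        - christoffel G k j l z * christoffel G l k i z) U := fun k l =>
    ((hΓ _ _ _).mul (hΓ _ _ _)).sub ((hΓ _ _ _).mul (hΓ _ _ _))
  simp only [ricci, Matrix.of_apply]
  rw [pd_sum _ hU (fun k _ => ((hΓd _ _ _ _).sub (hΓd _ _ _ _)).add
    (ContDiffOn.sum fun l _ => hq k l)) h0]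
  refine Finset.sum_congr rfl fun k _ => ?_
  rw [pd_add hU ((hΓd _ _ _ _).sub (hΓd _ _ _ _)) (ContDiffOn.sum fun l _ => hq k l) h0,
    pd_sub hU (hΓd _ _ _ _) (hΓd _ _ _ _) h0, pd_sum _ hU (fun l _ => hq k l) h0]
  have : ∀ l, pd m (fun z => christoffel G k k l z * christoffel G l i j z
        - christoffel G k j l z * christoffel G l k i z) 0 = 0 := by
    intro l
    rw [pd_sub hU ((hΓ _ _ _).mul (hΓ _ _ _)) ((hΓ _ _ _).mul (hΓ _ _ _)) h0,
      pd_mul hU (hΓ _ _ _) (hΓ _ _ _) h0, pd_mul hU (hΓ _ _ _) (hΓ _ _ _) h0]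
    simp only [hG.christoffel_eq_zero]
    ring
  simp [this]

/-- In normal coordinates both sides are linear in the third derivatives of the metric. The identity
is then a relabelling of sums, using that partial derivatives commute and that G is symmetric; the
full Bianchi identity is not needed. -/
theorem contracted_bianchi (b : Fin n) :
    ∑ i, pd i (fun z => ricci G z i b) 0 = (1 / 2) * pd b (scalarCurvature G) 0 := by
  have hU := hG.isMetricOn.isOpen
  have h0 := hG.zero_mem
  have hGs := hG.isMetricOn.smooth
  have hRs : MSmooth U (ricci G) := ricci_smoothOn hU hGs hG.isMetricOn.det_ne_zero
  have hscal : pd b (scalarCurvature G) 0 = ∑ i, pd b (fun z => ricci G z i i) 0 := by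
    have : scalarCurvature G = fun z => ∑ i, ∑ l, (G z)⁻¹ i l * ricci G z i l := rfl
    rw [this, pd_sum _ hU (fun i _ => ContDiffOn.sum fun l _ =>
      (hG.inv_smooth i l).mul (hRs i l)) h0]
    exact Finset.sum_congr rfl fun i _ => hG.pd_inv_mul (fun l => hRs i l) b i
  -- Third derivatives at the origin. `D1`, `D2` and `D3` record their symmetry in the three
  -- differentiations and in the two matrix indices.
  let D : Fin n → Fin n → Fin n → Fin n → Fin n → ℝ := fun a b c d e =>
    pd a (pd b (pd c fun z => G z d e)) 0
  have s1 : ∀ a b c, ContDiffOn ℝ ∞ (pd a fun z => G z b c) U := fun a b c =>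
    pd_smoothOn hU (hGs b c) a
  have D1 : ∀ a b c d e, D a b c d e = D b a c d e := fun a b c d e => pd_comm hU (s1 c d e) h0 a b
  have D2 : ∀ a b c d e, D a b c d e = D a c b d e := fun a b c d e =>
    pd_congr_on hU (fun z hz => pd_comm hU (hGs d e) hz b c) h0 a
  have D3 : ∀ a b c d e, D a b c d e = D a b c e d := fun a b c d e =>
    pd_congr_on hU (fun z hz => pd_congr_on hU (fun z hz =>
      hG.isMetricOn.pd_symm hz c d e) hz b) h0 a
  have hric : ∀ m i j, pd m (fun z => ricci G z i j) 0
      = (1 / 2) * (∑ k, D m k i j k + ∑ k, D m k j i k - ∑ k, D m k k i j - ∑ k, D m j i k k) := by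
    intro m i j
    rw [hG.pd_ricci]
    simp only [hG.pd_pd_christoffel]
    simp only [← Finset.sum_add_distrib, ← Finset.sum_sub_distrib, Finset.mul_sum]
    refine Finset.sum_congr rfl fun k _ => ?_
    change 1 / 2 * (D m k i j k + D m k j i k - D m k k i j)
      - 1 / 2 * (D m j k i k + D m j i k k - D m j k k i) = _
    rw [D3 m j k k i]
    ring
  rw [hscal]
  simp only [hric, ← Finset.mul_sum, Finset.sum_add_distrib, Finset.sum_sub_distrib]
  have e1 : ∑ i, ∑ k, D i k i b k = ∑ i, ∑ k, D i k k i b := by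
    rw [Finset.sum_comm]
    refine Finset.sum_congr rfl fun i _ => Finset.sum_congr rfl fun k _ => ?_
    rw [D1, D3, D2]
  have e2 : ∑ i, ∑ k, D i k b i k = ∑ i, ∑ k, D b k i i k := by
    refine Finset.sum_congr rfl fun i _ => Finset.sum_congr rfl fun k _ => ?_
    rw [D2, D1, D2]
  have e3 : ∑ i, ∑ k, D i b i k k = ∑ i, ∑ k, D b k k i i := by
    rw [Finset.sum_comm]
    refine Finset.sum_congr rfl fun i _ => Finset.sum_congr rfl fun k _ => ?_
    rw [D1]
  have e4 : ∑ i, ∑ k, D b i i k k = ∑ i, ∑ k, D b k k i i := by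
    rw [Finset.sum_comm]
  rw [e1, e2, e3, e4]
  ring

theorem divNewton_eq_zero (hn : 2 < n) (b : Fin n) : divNewton G 0 b = 0 := by
  have hU := hG.isMetricOn.isOpen
  have h0 := hG.zero_mem
  have hGs := hG.isMetricOn.smooth
  have hRs : MSmooth U (ricci G) := ricci_smoothOn hU hGs hG.isMetricOn.det_ne_zero
  have hSs : ContDiffOn ℝ ∞ (scalarCurvature G) U :=
    ContDiffOn.sum fun i _ => ContDiffOn.sum fun l _ => (hG.inv_smooth i l).mul (hRs i l)
  have hΓ : ∀ i, chM G i 0 = 0 := by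
    intro i
    ext a c
    exact hG.christoffel_eq_zero _ _ _
  have h1 : ∀ i, covM G (newton G) i 0 = (1 / ((n : ℝ) - 2)) •
      ((1 / 2 * pd i (scalarCurvature G) 0) • (1 : Matrix (Fin n) (Fin n) ℝ)
        - pdM i (ricci G) 0) := by
    intro i
    rw [covM, hΓ, pdM_congr_on hU (fun z hz => hG.isMetricOn.newton_eq hn hz) h0]
    ext a c
    have s2 : ContDiffOn ℝ ∞ (fun z => 1 / 2 * scalarCurvature G z) U := contDiffOn_const.mul hSs
    simp only [Matrix.transpose_zero, zero_mul, mul_zero, sub_zero, pdM_apply, Matrix.smul_apply,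
      Matrix.sub_apply, smul_eq_mul]
    rw [pd_const_mul hU ((s2.mul (hGs a c)).sub (hRs a c)) h0,
      pd_sub hU (s2.mul (hGs a c)) (hRs a c) h0, pd_mul hU s2 (hGs a c) h0, hG.pd_eq_zero,
      pd_const_mul hU hSs h0, mul_zero, add_zero, hG.eq_one,
      Matrix.zero_apply, sub_zero]
  simp only [divNewton, hG.inv_eq_one, one_mul, h1, Matrix.smul_apply, Matrix.sub_apply,
    Matrix.one_apply, smul_eq_mul, ← Finset.mul_sum, Finset.sum_sub_distrib, pdM_apply,
    hG.contracted_bianchi]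
  simp

end IsNormal

/-- The Newton tensor of the Schouten tensor is divergence free. -/
theorem IsMetricOn.divNewton_eq_zero (hn : 2 < n) (hG : IsMetricOn V G)
    (hy : y ∈ V) {A : Fin n → Fin n → ℝ}
    (hA : (Matrix.of A).transpose * G y * Matrix.of A = 1) (b : Fin n) : divNewton G y b = 0 := by
  have hΦ := isCoordChange_normalMap (G := G) hG.isOpen y A
  have hN := isNormal_pullback_normalMap hG hy hA
  have h1 := hΦ.divNewton_pullback hG hN.zero_mem
  have h2 : divNewton (pullback (normalMap G y A) G) 0 = 0 := by
    ext b
    exact hN.divNewton_eq_zero hn b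
  rw [h2, normalMap_zero] at h1
  have h3 : ((jac (normalMap G y A) 0)⁻¹).transpose.mulVec
      ((jac (normalMap G y A) 0).transpose.mulVec (divNewton G y)) = 0 := by
    rw [← h1, Matrix.mulVec_zero]
  rw [Matrix.mulVec_mulVec, ← Matrix.transpose_mul, hΦ.jac_mul_inv hN.zero_mem,
    Matrix.transpose_one, Matrix.one_mulVec] at h3
  rw [h3]
  rfl

end Bianchi

end SigmaTwoFlow

end

noncomputable section

namespace SigmaTwoFlow

/-! ### Jets at the centre of normal coordinates -/

section SecondDerivatives

variable {n : ℕ} {U : Set (EuclideanSpace ℝ (Fin n))} {y : EuclideanSpace ℝ (Fin n)}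
  {f g : EuclideanSpace ℝ (Fin n) → ℝ}

theorem pd_pd_mul (hU : IsOpen U) (hf : ContDiffOn ℝ ∞ f U) (hg : ContDiffOn ℝ ∞ g U) (hy : y ∈ U)
    (l m : Fin n) : pd l (pd m fun z => f z * g z) y = pd l (pd m f) y * g y
      + pd m f y * pd l g y + pd l f y * pd m g y + f y * pd l (pd m g) y := by
  have hf' := pd_smoothOn hU hf m
  have hg' := pd_smoothOn hU hg m
  rw [pd_congr_on hU (fun z hz => pd_mul hU hf hg hz m) hy, pd_add hU (hf'.mul hg) (hf.mul hg') hy,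
    pd_mul hU hf' hg hy, pd_mul hU hf hg' hy]
  ring

theorem pd_pd_add (hU : IsOpen U) (hf : ContDiffOn ℝ ∞ f U) (hg : ContDiffOn ℝ ∞ g U) (hy : y ∈ U)
    (l m : Fin n) :
    pd l (pd m fun z => f z + g z) y = pd l (pd m f) y + pd l (pd m g) y := by
  rw [pd_congr_on hU (fun z hz => pd_add hU hf hg hz m) hy,
    pd_add hU (pd_smoothOn hU hf m) (pd_smoothOn hU hg m) hy]

theorem pd_pd_sub (hU : IsOpen U) (hf : ContDiffOn ℝ ∞ f U) (hg : ContDiffOn ℝ ∞ g U) (hy : y ∈ U)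
    (l m : Fin n) :
    pd l (pd m fun z => f z - g z) y = pd l (pd m f) y - pd l (pd m g) y := by
  rw [pd_congr_on hU (fun z hz => pd_sub hU hf hg hz m) hy,
    pd_sub hU (pd_smoothOn hU hf m) (pd_smoothOn hU hg m) hy]

theorem pd_pd_const (c : ℝ) (l m : Fin n) : pd l (pd m fun _ => c) y = 0 := by
  rw [show pd m (fun _ : EuclideanSpace ℝ (Fin n) => c) = fun _ => 0 from
    funext fun z => pd_const c m, pd_const]

theorem pd_pd_const_mul (hU : IsOpen U) (hf : ContDiffOn ℝ ∞ f U) (hy : y ∈ U) (c : ℝ)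
    (l m : Fin n) : pd l (pd m fun z => c * f z) y = c * pd l (pd m f) y := by
  rw [pd_congr_on hU (fun z hz => pd_const_mul hU hf hz c m) hy,
    pd_const_mul hU (pd_smoothOn hU hf m) hy]

theorem pd_pd_sum {ι : Type*} (s : Finset ι) {F : ι → EuclideanSpace ℝ (Fin n) → ℝ}
    (hU : IsOpen U) (hf : ∀ i ∈ s, ContDiffOn ℝ ∞ (F i) U) (hy : y ∈ U) (l m : Fin n) :
    pd l (pd m fun z => ∑ i ∈ s, F i z) y = ∑ i ∈ s, pd l (pd m (F i)) y := by
  rw [pd_congr_on hU (fun z hz => pd_sum s hU hf hz m) hy,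
    pd_sum s hU (fun i hi => pd_smoothOn hU (hf i hi) m) hy]

end SecondDerivatives

section Jets

variable {n : ℕ} {U : Set (EuclideanSpace ℝ (Fin n))}
  {G : EuclideanSpace ℝ (Fin n) → Matrix (Fin n) (Fin n) ℝ} {v : EuclideanSpace ℝ (Fin n) → ℝ}

theorem IsMetricOn.vTensor_smooth (hG : IsMetricOn U G) (hv : ContDiffOn ℝ ∞ v U) :
    MSmooth U (vTensor G v) :=
  (hessian_smoothOn hG.isOpen hG.smooth hG.det_ne_zero hv).add
    fun i j => (pd_smoothOn hG.isOpen hv i).mul (pd_smoothOn hG.isOpen hv j)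

theorem IsMetricOn.inv_smooth (hG : IsMetricOn U G) (i j : Fin n) :
    ContDiffOn ℝ ∞ (fun z => (G z)⁻¹ i j) U :=
  hG.smooth.inv hG.det_ne_zero i j

theorem gradNormSq_eq_sum (z : EuclideanSpace ℝ (Fin n)) :
    gradNormSq G v z = ∑ k, pd k v z * ∑ l, (G z)⁻¹ k l * pd l v z := rfl

theorem IsMetricOn.gradNormSq_smooth (hG : IsMetricOn U G) (hv : ContDiffOn ℝ ∞ v U) :
    ContDiffOn ℝ ∞ (gradNormSq G v) U := by
  rw [show gradNormSq G v = _ from funext gradNormSq_eq_sum]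
  exact ContDiffOn.sum fun k _ => (pd_smoothOn hG.isOpen hv k).mul
    (ContDiffOn.sum fun l _ => (hG.inv_smooth k l).mul (pd_smoothOn hG.isOpen hv l))

theorem IsMetricOn.wTensor_smooth (hG : IsMetricOn U G) (hv : ContDiffOn ℝ ∞ v U) :
    MSmooth U (wTensor G v) :=
  ((hG.vTensor_smooth hv).sub (MSmooth.smul ((hG.gradNormSq_smooth hv).div_const 2)
    hG.smooth)).add (schouten_smoothOn hG.isOpen hG.smooth hG.det_ne_zero)

namespace IsNormal

variable (hG : IsNormal U G) (hv : ContDiffOn ℝ ∞ v U)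

include hG

/-- The mixed terms vanish because the first derivatives of G⁻¹ do. The second derivatives of G⁻¹
remain, as a zeroth-order error in X with bounded coefficients. -/
theorem pd_pd_inv_mul {X : Fin n → EuclideanSpace ℝ (Fin n) → ℝ}
    (hX : ∀ l, ContDiffOn ℝ ∞ (X l) U) (a b k : Fin n) :
    pd a (pd b fun z => ∑ l, (G z)⁻¹ k l * X l z) 0
      = pd a (pd b (X k)) 0 + ∑ l, pd a (pd b fun z => (G z)⁻¹ k l) 0 * X l 0 := by
  have hU := hG.isMetricOn.isOpen
  have hI := hG.isMetricOn.inv_smooth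
  rw [pd_pd_sum _ hU (fun l _ => (hI k l).mul (hX l)) hG.zero_mem]
  have : ∀ l, pd a (pd b fun z => (G z)⁻¹ k l * X l z) 0
      = (if k = l then pd a (pd b (X l)) 0 else 0)
        + pd a (pd b fun z => (G z)⁻¹ k l) 0 * X l 0 := by
    intro l
    rw [pd_pd_mul hU (hI k l) (hX l) hG.zero_mem, hG.pd_inv_eq_zero, hG.pd_inv_eq_zero,
      hG.inv_eq_one, Matrix.one_apply]
    split_ifs <;> ring
  simp [this, Finset.sum_add_distrib]

include hv

theorem pd_vTensor (m i j : Fin n) : pd m (fun z => vTensor G v z i j) 0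
    = pd m (pd i (pd j v)) 0 - ∑ k, pd m (christoffel G k i j) 0 * pd k v 0
      + (pd m (pd i v) 0 * pd j v 0 + pd i v 0 * pd m (pd j v) 0) := by
  have hU := hG.isMetricOn.isOpen
  have h0 := hG.zero_mem
  have h1 := fun k => pd_smoothOn hU hv k
  have h2 : ∀ k, ContDiffOn ℝ ∞ (fun z => christoffel G k i j z * pd k v z) U := fun k =>
    (hG.christoffel_smooth k i j).mul (h1 k)
  have e : ∀ z, vTensor G v z i j
      = pd i (pd j v) z - ∑ k, christoffel G k i j z * pd k v z + pd i v z * pd j v z :=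
    fun z => rfl
  simp only [e]
  rw [pd_add hU ((pd_smoothOn hU (h1 j) i).sub (ContDiffOn.sum fun k _ => h2 k))
    ((h1 i).mul (h1 j)) h0, pd_sub hU (pd_smoothOn hU (h1 j) i) (ContDiffOn.sum fun k _ => h2 k) h0,
    pd_sum _ hU (fun k _ => h2 k) h0, pd_mul hU (h1 i) (h1 j) h0]
  congr 2
  refine Finset.sum_congr rfl fun k _ => ?_
  rw [pd_mul hU (hG.christoffel_smooth k i j) (h1 k) h0, hG.christoffel_eq_zero]
  ring

theorem pd_pd_vTensor (l m i j : Fin n) : pd l (pd m fun z => vTensor G v z i j) 0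
    = pd l (pd m (pd i (pd j v))) 0
      - ∑ k, (pd l (pd m (christoffel G k i j)) 0 * pd k v 0
        + pd m (christoffel G k i j) 0 * pd l (pd k v) 0
        + pd l (christoffel G k i j) 0 * pd m (pd k v) 0)
      + (pd l (pd m (pd i v)) 0 * pd j v 0 + pd m (pd i v) 0 * pd l (pd j v) 0
        + pd l (pd i v) 0 * pd m (pd j v) 0 + pd i v 0 * pd l (pd m (pd j v)) 0) := by
  have hU := hG.isMetricOn.isOpen
  have h0 := hG.zero_mem
  have h1 := fun k => pd_smoothOn hU hv k
  have h2 : ∀ k, ContDiffOn ℝ ∞ (fun z => christoffel G k i j z * pd k v z) U := fun k =>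
    (hG.christoffel_smooth k i j).mul (h1 k)
  have e : ∀ z, vTensor G v z i j
      = pd i (pd j v) z - ∑ k, christoffel G k i j z * pd k v z + pd i v z * pd j v z :=
    fun z => rfl
  simp only [e]
  rw [pd_pd_add hU ((pd_smoothOn hU (h1 j) i).sub (ContDiffOn.sum fun k _ => h2 k))
    ((h1 i).mul (h1 j)) h0,
    pd_pd_sub hU (pd_smoothOn hU (h1 j) i) (ContDiffOn.sum fun k _ => h2 k) h0,
    pd_pd_sum _ hU (fun k _ => h2 k) h0, pd_pd_mul hU (h1 i) (h1 j) h0]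
  congr 2
  refine Finset.sum_congr rfl fun k _ => ?_
  rw [pd_pd_mul hU (hG.christoffel_smooth k i j) (h1 k) h0, hG.christoffel_eq_zero]
  ring

theorem pd_gradNormSq (a : Fin n) :
    pd a (gradNormSq G v) 0 = 2 * ∑ k, pd k v 0 * pd a (pd k v) 0 := by
  have hU := hG.isMetricOn.isOpen
  have h0 := hG.zero_mem
  have h1 := fun k => pd_smoothOn hU hv k
  have h2 : ∀ k, ContDiffOn ℝ ∞ (fun z => ∑ l, (G z)⁻¹ k l * pd l v z) U := fun k =>
    ContDiffOn.sum fun l _ => (hG.isMetricOn.inv_smooth k l).mul (h1 l)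
  rw [show gradNormSq G v = _ from funext gradNormSq_eq_sum,
    pd_sum _ hU (fun k _ => (h1 k).mul (h2 k)) h0, Finset.mul_sum]
  refine Finset.sum_congr rfl fun k _ => ?_
  rw [pd_mul hU (h1 k) (h2 k) h0, hG.pd_inv_mul h1, hG.inv_eq_one]
  simp only [Matrix.one_apply, ite_mul, one_mul, zero_mul, Finset.sum_ite_eq, Finset.mem_univ,
    if_true]
  ring

theorem pd_pd_gradNormSq (a : Fin n) : pd a (pd a (gradNormSq G v)) 0
    = 2 * ∑ k, (pd a (pd k v) 0 ^ 2 + pd k v 0 * pd a (pd a (pd k v)) 0)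
      + ∑ k, ∑ l, pd a (pd a fun z => (G z)⁻¹ k l) 0 * (pd k v 0 * pd l v 0) := by
  have hU := hG.isMetricOn.isOpen
  have h0 := hG.zero_mem
  have h1 := fun k => pd_smoothOn hU hv k
  have h2 : ∀ k, ContDiffOn ℝ ∞ (fun z => ∑ l, (G z)⁻¹ k l * pd l v z) U := fun k =>
    ContDiffOn.sum fun l _ => (hG.isMetricOn.inv_smooth k l).mul (h1 l)
  rw [show gradNormSq G v = _ from funext gradNormSq_eq_sum,
    pd_pd_sum _ hU (fun k _ => (h1 k).mul (h2 k)) h0, Finset.mul_sum, ← Finset.sum_add_distrib]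
  refine Finset.sum_congr rfl fun k _ => ?_
  rw [pd_pd_mul hU (h1 k) (h2 k) h0, hG.pd_inv_mul h1, hG.pd_pd_inv_mul h1, hG.inv_eq_one]
  simp only [Matrix.one_apply, ite_mul, one_mul, zero_mul, Finset.sum_ite_eq, Finset.mem_univ,
    if_true, mul_add, Finset.mul_sum]
  have : ∀ l, pd k v 0 * (pd a (pd a fun z => (G z)⁻¹ k l) 0 * pd l v 0)
      = pd a (pd a fun z => (G z)⁻¹ k l) 0 * (pd k v 0 * pd l v 0) := fun l => by ring
  simp only [this]
  ring

theorem pd_wTensor (a i j : Fin n) : pd a (fun z => wTensor G v z i j) 0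
    = pd a (fun z => vTensor G v z i j) 0
      - (if i = j then ∑ k, pd k v 0 * pd a (pd k v) 0 else 0)
      + pd a (fun z => schouten G z i j) 0 := by
  have hU := hG.isMetricOn.isOpen
  have h0 := hG.zero_mem
  have hV := hG.isMetricOn.vTensor_smooth hv i j
  have hq := (hG.isMetricOn.gradNormSq_smooth hv).div_const 2
  have hg := hG.isMetricOn.smooth i j
  have hA := schouten_smoothOn hU hG.isMetricOn.smooth hG.isMetricOn.det_ne_zero i j
  have e : ∀ z, wTensor G v z i j
      = vTensor G v z i j - gradNormSq G v z / 2 * G z i j + schouten G z i j := fun z => rfl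
  simp only [e]
  rw [pd_add hU (hV.sub (hq.mul hg)) hA h0, pd_sub hU hV (hq.mul hg) h0, pd_mul hU hq hg h0,
    hG.pd_eq_zero, hG.eq_one, Matrix.one_apply]
  simp only [div_eq_inv_mul]
  rw [pd_const_mul hU (hG.isMetricOn.gradNormSq_smooth hv) h0, hG.pd_gradNormSq hv]
  split_ifs <;> ring

/-- The square of the Hessian in the diagonal part comes from differentiating -|dv|² g/2 twice. It
is the source of the good term in the whole estimate. -/
theorem pd_pd_wTensor (a i j : Fin n) : pd a (pd a fun z => wTensor G v z i j) 0
    = pd a (pd a fun z => vTensor G v z i j) 0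
      - (if i = j then ∑ k, (pd a (pd k v) 0 ^ 2 + pd k v 0 * pd a (pd a (pd k v)) 0)
        + (1 / 2) * ∑ k, ∑ l, pd a (pd a fun z => (G z)⁻¹ k l) 0 * (pd k v 0 * pd l v 0) else 0)
      - (∑ k, pd k v 0 ^ 2) / 2 * pd a (pd a fun z => G z i j) 0
      + pd a (pd a fun z => schouten G z i j) 0 := by
  have hU := hG.isMetricOn.isOpen
  have h0 := hG.zero_mem
  have hV := hG.isMetricOn.vTensor_smooth hv i j
  have hq := (hG.isMetricOn.gradNormSq_smooth hv).div_const 2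
  have hg := hG.isMetricOn.smooth i j
  have hA := schouten_smoothOn hU hG.isMetricOn.smooth hG.isMetricOn.det_ne_zero i j
  have e : ∀ z, wTensor G v z i j
      = vTensor G v z i j - gradNormSq G v z / 2 * G z i j + schouten G z i j := fun z => rfl
  simp only [e]
  rw [pd_pd_add hU (hV.sub (hq.mul hg)) hA h0, pd_pd_sub hU hV (hq.mul hg) h0,
    pd_pd_mul hU hq hg h0, hG.pd_eq_zero, hG.eq_one, Matrix.one_apply, hG.gradNormSq_eq]
  simp only [div_eq_inv_mul]
  rw [pd_pd_const_mul hU (hG.isMetricOn.gradNormSq_smooth hv) h0, hG.pd_pd_gradNormSq hv]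
  split_ifs <;> ring

omit hv

/-- Derivatives at the origin of `B = G⁻¹ S`, from `G B = S`. -/
theorem pd_inv_mul_matrix {S : EuclideanSpace ℝ (Fin n) → Matrix (Fin n) (Fin n) ℝ}
    (hS : MSmooth U S) (a i j : Fin n) :
    pd a (fun z => ((G z)⁻¹ * S z) i j) 0 = pd a (fun z => S z i j) 0 :=
  hG.pd_inv_mul (X := fun l z => S z l j) (fun l => hS l j) a i

theorem pd_pd_inv_mul_matrix {S : EuclideanSpace ℝ (Fin n) → Matrix (Fin n) (Fin n) ℝ}
    (hS : MSmooth U S) (a b i j : Fin n) :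
    pd a (pd b fun z => ((G z)⁻¹ * S z) i j) 0 = pd a (pd b fun z => S z i j) 0
      + ∑ l, pd a (pd b fun z => (G z)⁻¹ i l) 0 * S 0 l j :=
  hG.pd_pd_inv_mul (X := fun l z => S z l j) (fun l => hS l j) a b i

end IsNormal

end Jets

/-! ### Concavity -/

section Concavity

variable {n : ℕ} {U : Set (EuclideanSpace ℝ (Fin n))}

/-- The coefficients `½ (1 + (|B|² + 2ψ²) / σ₁²) δ - B / σ₁` of the linearized operator. -/
def linCoeff (B : Matrix (Fin n) (Fin n) ℝ) (ψ : ℝ) : Matrix (Fin n) (Fin n) ℝ :=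
  ((1 + ((B * B).trace + 2 * ψ ^ 2) / B.trace ^ 2) / 2) • 1 - (1 / B.trace) • B

variable {B : EuclideanSpace ℝ (Fin n) → Matrix (Fin n) (Fin n) ℝ}
  {ψ w : EuclideanSpace ℝ (Fin n) → ℝ} {s : ℝ}

theorem trace_mul_eq_sum (A B : Matrix (Fin n) (Fin n) ℝ) :
    (A * B).trace = ∑ i, ∑ j, A i j * B j i := rfl

theorem sum_linCoeff_mul (A X : Matrix (Fin n) (Fin n) ℝ) (c : ℝ) :
    ∑ i, ∑ j, linCoeff A c i j * X i j
      = ((1 + ((A * A).trace + 2 * c ^ 2) / A.trace ^ 2) / 2) * X.trace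
        - (1 / A.trace) * ∑ i, ∑ j, A i j * X i j := by
  simp only [linCoeff, Matrix.sub_apply, Matrix.smul_apply, Matrix.one_apply, smul_eq_mul, sub_mul,
    Finset.sum_sub_distrib, Finset.mul_sum, mul_assoc, ite_mul, one_mul, zero_mul, mul_ite,
    mul_zero, Finset.sum_ite_eq, Finset.mem_univ, if_true, Matrix.trace, Matrix.diag_apply]

theorem pd_trace (hU : IsOpen U) (h0 : (0 : EuclideanSpace ℝ (Fin n)) ∈ U) (hB : MSmooth U B)
    (a : Fin n) : pd a (fun z => (B z).trace) 0 = (pdM a B 0).trace :=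
  pd_sum _ hU (fun i _ => hB i i) h0 a

/-- First derivatives of `σ₂ / σ₁ - ψ² / σ₁ + s`, and concavity. -/
theorem pd_quotient (hU : IsOpen U) (h0 : (0 : EuclideanSpace ℝ (Fin n)) ∈ U) (hB : MSmooth U B)
    (hψ : ContDiffOn ℝ ∞ ψ U) (hwU : ContDiffOn ℝ ∞ w U) (hσ : 0 < (B 0).trace)
    (hw : ∀ z ∈ U, 2 * (w z - s) * (B z).trace = (B z).trace ^ 2
      - ((B z * B z).trace + 2 * ψ z ^ 2))
    (hB0 : ∀ i j, B 0 i j = B 0 j i) (a : Fin n)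
    (hB1 : ∀ i j, pd a (fun z => B z i j) 0 = pd a (fun z => B z j i) 0) :
    pd a w 0 = ∑ i, ∑ j, linCoeff (B 0) (ψ 0) i j * pd a (fun z => B z i j) 0
        - 2 * ψ 0 * pd a ψ 0 / (B 0).trace ∧
    pd a (pd a w) 0 ≤ ∑ i, ∑ j, linCoeff (B 0) (ψ 0) i j * pd a (pd a fun z => B z i j) 0
        - 2 * ψ 0 * pd a (pd a ψ) 0 / (B 0).trace := by
  set σ : EuclideanSpace ℝ (Fin n) → ℝ := fun z => (B z).trace with hσd
  set M : EuclideanSpace ℝ (Fin n) → ℝ := fun z => (B z * B z).trace + 2 * (ψ z * ψ z) with hMd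
  have hσs : ContDiffOn ℝ ∞ σ U := hB.trace
  have hBB : ∀ i j, ContDiffOn ℝ ∞ (fun z => B z i j * B z j i) U := fun i j =>
    (hB i j).mul (hB j i)
  have hBs : ContDiffOn ℝ ∞ (fun z => ∑ i, ∑ j, B z i j * B z j i) U :=
    ContDiffOn.sum fun i _ => ContDiffOn.sum fun j _ => hBB i j
  have hMs : ContDiffOn ℝ ∞ M U := hBs.add (contDiffOn_const.mul (hψ.mul hψ))
  have hMe : M = fun z => (∑ i, ∑ j, B z i j * B z j i) + 2 * (ψ z * ψ z) := rfl
  have hσ1 : pd a σ 0 = ∑ i, pd a (fun z => B z i i) 0 := pd_sum _ hU (fun i _ => hB i i) h0 a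
  have hσ2 : pd a (pd a σ) 0 = ∑ i, pd a (pd a fun z => B z i i) 0 :=
    pd_pd_sum _ hU (fun i _ => hB i i) h0 a a
  have hM1 : pd a M 0 = 2 * ∑ i, ∑ j, B 0 i j * pd a (fun z => B z i j) 0
      + 4 * ψ 0 * pd a ψ 0 := by
    rw [hMe, pd_add hU hBs (contDiffOn_const.mul (hψ.mul hψ)) h0,
      pd_sum _ hU (fun i _ => ContDiffOn.sum fun j _ => hBB i j) h0,
      pd_const_mul hU (hψ.mul hψ) h0, pd_mul hU hψ hψ h0]
    have : ∀ i, pd a (fun z => ∑ j, B z i j * B z j i) 0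
        = 2 * ∑ j, B 0 i j * pd a (fun z => B z i j) 0 := by
      intro i
      rw [pd_sum _ hU (fun j _ => hBB i j) h0, Finset.mul_sum]
      refine Finset.sum_congr rfl fun j _ => ?_
      rw [pd_mul hU (hB i j) (hB j i) h0, hB0 j i, hB1 j i]
      ring
    simp only [this, ← Finset.mul_sum]
    ring
  have hM2 : pd a (pd a M) 0 = 2 * ∑ i, ∑ j, (pd a (fun z => B z i j) 0) ^ 2
      + 2 * ∑ i, ∑ j, B 0 i j * pd a (pd a fun z => B z i j) 0
      + 4 * pd a ψ 0 ^ 2 + 4 * ψ 0 * pd a (pd a ψ) 0 := by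
    rw [hMe, pd_pd_add hU hBs (contDiffOn_const.mul (hψ.mul hψ)) h0,
      pd_pd_sum _ hU (fun i _ => ContDiffOn.sum fun j _ => hBB i j) h0,
      pd_pd_const_mul hU (hψ.mul hψ) h0, pd_pd_mul hU hψ hψ h0]
    have : ∀ i, pd a (pd a fun z => ∑ j, B z i j * B z j i) 0
        = ∑ j, (2 * (pd a (fun z => B z i j) 0) ^ 2 + B 0 i j * pd a (pd a fun z => B z j i) 0
          + B 0 i j * pd a (pd a fun z => B z i j) 0) := by
      intro i
      rw [pd_pd_sum _ hU (fun j _ => hBB i j) h0]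
      refine Finset.sum_congr rfl fun j _ => ?_
      rw [pd_pd_mul hU (hB i j) (hB j i) h0, hB0 j i, hB1 j i]
      ring
    simp only [this, Finset.sum_add_distrib, ← Finset.mul_sum]
    have hsw : ∑ i, ∑ j, B 0 i j * pd a (pd a fun z => B z j i) 0
        = ∑ i, ∑ j, B 0 i j * pd a (pd a fun z => B z i j) 0 := by
      rw [Finset.sum_comm]
      exact Finset.sum_congr rfl fun i _ => Finset.sum_congr rfl fun j _ => by rw [hB0 j i]
    rw [hsw]
    ring
  have hws : ContDiffOn ℝ ∞ (fun z => w z - s) U := hwU.sub contDiffOn_const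
  have hwsσ : ContDiffOn ℝ ∞ (fun z => (w z - s) * σ z) U := hws.mul hσs
  -- The equation is differentiated with its denominator cleared, as 2(w - s)σ = σ² - M. The
  -- derivatives of w are then solved for at the origin.
  have hid : EqOn (fun z => 2 * ((w z - s) * σ z)) (fun z => σ z * σ z - M z) U := by
    intro z hz
    have := hw z hz
    simp only [hMd]
    simp only [hσd] at *
    linarith
  have hw1 : pd a (fun z => w z - s) 0 = pd a w 0 := by
    rw [pd_sub hU hwU contDiffOn_const h0, pd_const, sub_zero]
  have hw2 : pd a (pd a fun z => w z - s) 0 = pd a (pd a w) 0 := by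
    rw [pd_pd_sub hU hwU contDiffOn_const h0, pd_pd_const, sub_zero]
  have id0 := hid h0
  have id1 : 2 * (pd a w 0 * σ 0 + (w 0 - s) * pd a σ 0) = 2 * σ 0 * pd a σ 0 - pd a M 0 := by
    have := pd_congr_on hU hid h0 a
    rw [pd_const_mul hU hwsσ h0, pd_mul hU hws hσs h0, pd_sub hU (hσs.mul hσs) hMs h0,
      pd_mul hU hσs hσs h0, hw1] at this
    linarith
  have id2 : 2 * (pd a (pd a w) 0 * σ 0 + 2 * pd a w 0 * pd a σ 0 + (w 0 - s) * pd a (pd a σ) 0)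
      = 2 * pd a σ 0 ^ 2 + 2 * σ 0 * pd a (pd a σ) 0 - pd a (pd a M) 0 := by
    have : pd a (pd a fun z => 2 * ((w z - s) * σ z)) 0
        = pd a (pd a fun z => σ z * σ z - M z) 0 :=
      pd_congr_on hU (fun z hz => pd_congr_on hU hid hz a) h0 a
    rw [pd_pd_const_mul hU hwsσ h0, pd_pd_mul hU hws hσs h0, pd_pd_sub hU (hσs.mul hσs) hMs h0,
      pd_pd_mul hU hσs hσs h0, hw1, hw2] at this
    linarith
  have hσ0 : 0 < σ 0 := hσ
  have hσne := hσ0.ne'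
  have hM0 : (B 0 * B 0).trace + 2 * ψ 0 ^ 2 = M 0 := by simp only [hMd]; ring
  have hws0 : w 0 - s = (σ 0 - M 0 / σ 0) / 2 := by
    field_simp
    simp only at id0
    linarith
  have e1 : ∑ i, ∑ j, linCoeff (B 0) (ψ 0) i j * pd a (fun z => B z i j) 0
      = ((1 + M 0 / σ 0 ^ 2) / 2) * pd a σ 0
        - (1 / σ 0) * ∑ i, ∑ j, B 0 i j * pd a (fun z => B z i j) 0 := by
    rw [hσ1, ← hM0]
    exact sum_linCoeff_mul (B 0) (pdM a B 0) (ψ 0)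
  have e2 : ∑ i, ∑ j, linCoeff (B 0) (ψ 0) i j * pd a (pd a fun z => B z i j) 0
      = ((1 + M 0 / σ 0 ^ 2) / 2) * pd a (pd a σ) 0
        - (1 / σ 0) * ∑ i, ∑ j, B 0 i j * pd a (pd a fun z => B z i j) 0 := by
    rw [hσ2, ← hM0]
    exact sum_linCoeff_mul (B 0) (Matrix.of fun i j => pd a (pd a fun z => B z i j) 0) (ψ 0)
  have r1 : pd a w 0 = (σ 0 * pd a σ 0 + M 0 * pd a σ 0 / σ 0 - pd a M 0) / (2 * σ 0) := by
    rw [hws0] at id1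
    field_simp
    field_simp at id1
    linarith
  refine ⟨?_, ?_⟩
  · rw [e1, r1, hM1]
    change _ = _ - 2 * ψ 0 * pd a ψ 0 / σ 0
    field_simp
    ring
  · rw [e2]
    change _ ≤ _ - 2 * ψ 0 * pd a (pd a ψ) 0 / σ 0
    -- Concavity. Up to a linear term w is -M/(2σ), a quadratic form over a linear one. Its second
    -- variation in the direction of differentiation is minus this sum of squares divided by σ.
    have hsq : 0 ≤ ∑ i, ∑ j, (pd a (fun z => B z i j) 0 - B 0 i j * (pd a σ 0 / σ 0)) ^ 2
        + 2 * (pd a ψ 0 - ψ 0 * (pd a σ 0 / σ 0)) ^ 2 := by positivity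
    have hexp : ∑ i, ∑ j, (pd a (fun z => B z i j) 0 - B 0 i j * (pd a σ 0 / σ 0)) ^ 2
        = ∑ i, ∑ j, (pd a (fun z => B z i j) 0) ^ 2
          - 2 * (pd a σ 0 / σ 0) * ∑ i, ∑ j, B 0 i j * pd a (fun z => B z i j) 0
          + (pd a σ 0 / σ 0) ^ 2 * (B 0 * B 0).trace := by
      rw [trace_mul_eq_sum]
      simp only [Finset.mul_sum, ← Finset.sum_add_distrib, ← Finset.sum_sub_distrib]
      refine Finset.sum_congr rfl fun i _ => Finset.sum_congr rfl fun j _ => ?_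
      rw [hB0 j i]
      ring
    have htr : (B 0 * B 0).trace = M 0 - 2 * ψ 0 ^ 2 := by linarith
    rw [hexp, htr] at hsq
    set X1 := ∑ i, ∑ j, B 0 i j * pd a (fun z => B z i j) 0
    set X2 := ∑ i, ∑ j, B 0 i j * pd a (pd a fun z => B z i j) 0
    set X3 := ∑ i, ∑ j, (pd a (fun z => B z i j) 0) ^ 2
    set τ := pd a σ 0 / σ 0 with hτ
    have hτ' : pd a σ 0 = τ * σ 0 := by rw [hτ]; field_simp
    have r2 : pd a (pd a w) 0 = ((1 + M 0 / σ 0 ^ 2) / 2) * pd a (pd a σ) 0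
        - pd a (pd a M) 0 / (2 * σ 0) + pd a M 0 * τ / σ 0 - M 0 * τ ^ 2 / σ 0 := by
      rw [hws0, r1, hτ'] at id2
      field_simp
      field_simp at id2
      linarith
    rw [r2, hM1, hM2]
    have hdiv : 0 ≤ (X3 - 2 * τ * X1 + τ ^ 2 * (M 0 - 2 * ψ 0 ^ 2)
        + 2 * (pd a ψ 0 - ψ 0 * τ) ^ 2) / σ 0 := div_nonneg hsq hσ0.le
    have hfin : (1 + M 0 / σ 0 ^ 2) / 2 * pd a (pd a σ) 0
        - (2 * X3 + 2 * X2 + 4 * pd a ψ 0 ^ 2 + 4 * ψ 0 * pd a (pd a ψ) 0) / (2 * σ 0)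
        + (2 * X1 + 4 * ψ 0 * pd a ψ 0) * τ / σ 0 - M 0 * τ ^ 2 / σ 0
        = (1 + M 0 / σ 0 ^ 2) / 2 * pd a (pd a σ) 0 - 1 / σ 0 * X2
          - 2 * ψ 0 * pd a (pd a ψ) 0 / σ 0
          - (X3 - 2 * τ * X1 + τ ^ 2 * (M 0 - 2 * ψ 0 ^ 2)
        + 2 * (pd a ψ 0 - ψ 0 * τ) ^ 2) / σ 0 := by
      field_simp
      ring
    rw [hfin]
    linarith

end Concavity

end SigmaTwoFlow

end

noncomputable section

namespace SigmaTwoFlow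

/-! ### The differential inequality at the centre of normal coordinates -/

section DifferentialInequality

variable {n : ℕ} {U : Set (EuclideanSpace ℝ (Fin n))}
  {G : EuclideanSpace ℝ (Fin n) → Matrix (Fin n) (Fin n) ℝ} {v : EuclideanSpace ℝ (Fin n) → ℝ}
  {K : ℝ}

/-- Bounds for the jets of the metric at the origin. -/
structure JetBound (G : EuclideanSpace ℝ (Fin n) → Matrix (Fin n) (Fin n) ℝ) (K : ℝ) : Prop where
  metric : ∀ a b i j, |pd a (pd b fun z => G z i j) 0| ≤ K
  inverse : ∀ a b i j, |pd a (pd b fun z => (G z)⁻¹ i j) 0| ≤ K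
  christoffel_one : ∀ a k i j, |pd a (christoffel G k i j) 0| ≤ K
  christoffel_two : ∀ a b k i j, |pd a (pd b (christoffel G k i j)) 0| ≤ K
  schouten_zero : ∀ i j, |schouten G 0 i j| ≤ K
  schouten_one : ∀ a i j, |pd a (fun z => schouten G z i j) 0| ≤ K
  schouten_two : ∀ a b i j, |pd a (pd b fun z => schouten G z i j) 0| ≤ K

/-- The quantity `1 + |∂v|² + |∂²v|` at the origin. -/
def jetSize (v : EuclideanSpace ℝ (Fin n) → ℝ) : ℝ :=
  1 + ∑ k, pd k v 0 ^ 2 + ∑ k, ∑ l, |pd k (pd l v) 0|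

theorem abs_sum_le_card_mul {c : ℝ} (x : Fin n → ℝ) (h : ∀ k, |x k| ≤ c) :
    |∑ k, x k| ≤ n * c := by
  calc |∑ k, x k| ≤ ∑ k, |x k| := Finset.abs_sum_le_sum_abs _ _
    _ ≤ ∑ _k : Fin n, c := Finset.sum_le_sum fun k _ => h k
    _ = n * c := by simp

theorem sum_sq_le_jetSize : ∑ k, pd k v 0 ^ 2 ≤ jetSize v := by
  have : 0 ≤ ∑ k, ∑ l, |pd k (pd l v) 0| :=
    Finset.sum_nonneg fun k _ => Finset.sum_nonneg fun l _ => abs_nonneg _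
  unfold jetSize
  linarith

theorem one_le_jetSize : 1 ≤ jetSize v := by
  have h1 : 0 ≤ ∑ k, ∑ l, |pd k (pd l v) 0| :=
    Finset.sum_nonneg fun k _ => Finset.sum_nonneg fun l _ => abs_nonneg _
  have h2 : 0 ≤ ∑ k, pd k v 0 ^ 2 := Finset.sum_nonneg fun k _ => sq_nonneg _
  unfold jetSize
  linarith

theorem abs_hess_add_sum_sq_le_jetSize (k l : Fin n) :
    |pd k (pd l v) 0| + ∑ k, pd k v 0 ^ 2 ≤ jetSize v := by
  have h1 : |pd k (pd l v) 0| ≤ ∑ k, ∑ l, |pd k (pd l v) 0| :=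
    (Finset.single_le_sum (f := fun l => |pd k (pd l v) 0|) (fun _ _ => abs_nonneg _)
      (Finset.mem_univ l)).trans (Finset.single_le_sum
        (f := fun k => ∑ l, |pd k (pd l v) 0|)
        (fun _ _ => Finset.sum_nonneg fun _ _ => abs_nonneg _) (Finset.mem_univ k))
  unfold jetSize
  linarith

theorem abs_hess_le_jetSize (k l : Fin n) : |pd k (pd l v) 0| ≤ jetSize v := by
  have h2 : 0 ≤ ∑ k, pd k v 0 ^ 2 := Finset.sum_nonneg fun k _ => sq_nonneg _
  linarith [abs_hess_add_sum_sq_le_jetSize (v := v) k l]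

theorem abs_mul_le_sum_sq (p : Fin n → ℝ) (k l : Fin n) : |p k * p l| ≤ ∑ k, p k ^ 2 := by
  have h1 := Finset.single_le_sum (f := fun k => p k ^ 2) (fun _ _ => sq_nonneg _)
    (Finset.mem_univ k)
  have h2 := Finset.single_le_sum (f := fun k => p k ^ 2) (fun _ _ => sq_nonneg _)
    (Finset.mem_univ l)
  rw [abs_mul]
  nlinarith [sq_nonneg (|p k| - |p l|), sq_abs (p k), sq_abs (p l)]

theorem abs_grad_mul_le_jetSize (k l : Fin n) : |pd k v 0 * pd l v 0| ≤ jetSize v :=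
  (abs_mul_le_sum_sq (fun k => pd k v 0) k l).trans sum_sq_le_jetSize

theorem abs_grad_le_jetSize (k : Fin n) : |pd k v 0| ≤ jetSize v := by
  have h1 := Finset.single_le_sum (f := fun k => pd k v 0 ^ 2) (fun _ _ => sq_nonneg _)
    (Finset.mem_univ k)
  have h3 : 0 ≤ ∑ k, ∑ l, |pd k (pd l v) 0| :=
    Finset.sum_nonneg fun k _ => Finset.sum_nonneg fun l _ => abs_nonneg _
  unfold jetSize
  nlinarith [sq_nonneg (|pd k v 0| - 1), sq_abs (pd k v 0)]

/-- The constant in the error terms of a single direction. -/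
def errConst (n : ℕ) (K : ℝ) : ℝ := K * (12 * n + 2 * n ^ 2 + 4 + n * K)

namespace IsNormal

variable (hG : IsNormal U G) (hb : JetBound G K) (hv : ContDiffOn ℝ ∞ v U)

include hG

theorem abs_vTensor_le (i j : Fin n) : |vTensor G v 0 i j| ≤ jetSize v := by
  rw [hG.vTensor_apply]
  have h1 := abs_mul_le_sum_sq (fun k => pd k v 0) i j
  have h2 := abs_hess_add_sum_sq_le_jetSize (v := v) i j
  exact (abs_add_le _ _).trans (by linarith)

include hb

theorem abs_wTensor_le (hK : 0 ≤ K) (i j : Fin n) :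
    |wTensor G v 0 i j| ≤ (2 + K) * jetSize v := by
  have h1 := hG.abs_vTensor_le (v := v) i j
  have h2 := sum_sq_le_jetSize (v := v)
  have h2' : 0 ≤ ∑ k, pd k v 0 ^ 2 := Finset.sum_nonneg fun k _ => sq_nonneg _
  have h3 := hb.schouten_zero i j
  have h4 := one_le_jetSize (v := v)
  have h5 : |gradNormSq G v 0 / 2 * G 0 i j| ≤ jetSize v := by
    rw [hG.gradNormSq_eq, hG.eq_one, Matrix.one_apply]
    split_ifs
    · rw [mul_one, abs_of_nonneg (by linarith)]
      linarith
    · rw [mul_zero, abs_zero]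
      linarith
  have h6 : K ≤ K * jetSize v := le_mul_of_one_le_right hK h4
  change |vTensor G v 0 i j - gradNormSq G v 0 / 2 * G 0 i j + schouten G 0 i j| ≤ _
  rw [abs_le] at *
  constructor <;> nlinarith

include hv

/-- Commutation of `∇_a ∇_a B` with `∇_i ∇_j V_aa`, up to controlled terms. -/
theorem abs_commutator_le (hK : 0 ≤ K) (a i j : Fin n) :
    |pd a (pd a fun z => ((G z)⁻¹ * wTensor G v z) i j) 0
        + 2 * pd a v 0 * pd a (fun z => ((G z)⁻¹ * wTensor G v z) i j) 0
      - (pd i (pd j fun z => vTensor G v z a a) 0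
        + pd j v 0 * pd i (fun z => vTensor G v z a a) 0
        + pd i v 0 * pd j (fun z => vTensor G v z a a) 0
        - (if i = j then ∑ k, pd k (pd a v) 0 ^ 2
          + ∑ k, pd k v 0 * pd k (fun z => vTensor G v z a a) 0 else 0))|
      ≤ errConst n K * jetSize v := by
  have hU := hG.isMetricOn.isOpen
  have h0 := hG.zero_mem
  have h1 := fun k => pd_smoothOn hU hv k
  have hW := hG.isMetricOn.wTensor_smooth hv
  set X := jetSize v with hX
  have hX1 : 1 ≤ X := one_le_jetSize
  have hKX : 0 ≤ K * X := by positivity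
  have hc2 : ∀ k l, pd k (pd l v) 0 = pd l (pd k v) 0 := fun k l => pd_comm hU hv h0 k l
  have hc3 : ∀ k l m, pd k (pd l (pd m v)) 0 = pd l (pd k (pd m v)) 0 := fun k l m =>
    pd_comm hU (h1 m) h0 k l
  have hc3' : ∀ k l m, pd k (pd l (pd m v)) 0 = pd k (pd m (pd l v)) 0 := fun k l m =>
    pd_congr_on hU (fun z hz => pd_comm hU hv hz l m) h0 k
  have hc4 : pd a (pd a (pd i (pd j v))) 0 = pd i (pd j (pd a (pd a v))) 0 := by
    have e1 : ∀ k l, EqOn (pd k (pd l v)) (pd l (pd k v)) U := fun k l z hz => pd_comm hU hv hz k l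
    have e2 : ∀ k l m, EqOn (pd k (pd l (pd m v))) (pd l (pd k (pd m v))) U :=
      fun k l m z hz => pd_comm hU (h1 m) hz k l
    have e3 : ∀ k l m, EqOn (pd k (pd l (pd m v))) (pd k (pd m (pd l v))) U :=
      fun k l m z hz => pd_congr_on hU (e1 l m) hz k
    calc pd a (pd a (pd i (pd j v))) 0 = pd a (pd i (pd a (pd j v))) 0 :=
          pd_congr_on hU (e2 a i j) h0 a
      _ = pd i (pd a (pd a (pd j v))) 0 := pd_comm hU (pd_smoothOn hU (h1 j) a) h0 a i
      _ = pd i (pd a (pd j (pd a v))) 0 := pd_congr_on hU (e3 a a j) h0 i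
      _ = pd i (pd j (pd a (pd a v))) 0 := pd_congr_on hU (e2 a j a) h0 i
  set p : Fin n → ℝ := fun k => pd k v 0 with hp
  have hpk : ∀ k, pd k v 0 = p k := fun k => rfl
  set s1 := ∑ k, pd a (pd a (christoffel G k i j)) 0 * p k with hs1
  set s2 := ∑ k, pd a (christoffel G k i j) 0 * pd a (pd k v) 0 with hs2
  set s3 := ∑ k, pd a (christoffel G k i j) 0 * (p a * p k) with hs3
  set s4 := ∑ k, pd i (pd j (christoffel G k a a)) 0 * p k with hs4
  set s5 := ∑ k, pd j (christoffel G k a a) 0 * pd i (pd k v) 0 with hs5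
  set s6 := ∑ k, pd i (christoffel G k a a) 0 * pd j (pd k v) 0 with hs6
  set s7 : Fin n → Fin n → ℝ := fun m r => ∑ k, pd m (christoffel G k a a) 0 * (p r * p k) with hs7
  set s9 := ∑ k, ∑ l, pd a (pd a fun z => (G z)⁻¹ k l) 0 * (p k * p l) with hs9
  set s10 := ∑ l, pd a (pd a fun z => (G z)⁻¹ i l) 0 * wTensor G v 0 l j with hs10
  set qq := ∑ k, p k ^ 2 with hqq
  have bd : ∀ {c d : ℝ}, |c| ≤ K → |d| ≤ X → |c * d| ≤ K * X := fun hc hd => by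
    rw [abs_mul]
    exact mul_le_mul hc hd (abs_nonneg _) hK
  have b1 : |s1| ≤ n * (K * X) := abs_sum_le_card_mul _ fun k =>
    bd (hb.christoffel_two _ _ _ _ _) (abs_grad_le_jetSize k)
  have b2 : |s2| ≤ n * (K * X) := abs_sum_le_card_mul _ fun k =>
    bd (hb.christoffel_one _ _ _ _) (abs_hess_le_jetSize a k)
  have b3 : |s3| ≤ n * (K * X) := abs_sum_le_card_mul _ fun k =>
    bd (hb.christoffel_one _ _ _ _) (abs_grad_mul_le_jetSize a k)
  have b4 : |s4| ≤ n * (K * X) := abs_sum_le_card_mul _ fun k =>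
    bd (hb.christoffel_two _ _ _ _ _) (abs_grad_le_jetSize k)
  have b5 : |s5| ≤ n * (K * X) := abs_sum_le_card_mul _ fun k =>
    bd (hb.christoffel_one _ _ _ _) (abs_hess_le_jetSize i k)
  have b6 : |s6| ≤ n * (K * X) := abs_sum_le_card_mul _ fun k =>
    bd (hb.christoffel_one _ _ _ _) (abs_hess_le_jetSize j k)
  have b7 : ∀ m r, |s7 m r| ≤ n * (K * X) := fun m r => abs_sum_le_card_mul _ fun k =>
    bd (hb.christoffel_one _ _ _ _) (abs_grad_mul_le_jetSize r k)
  have b8 : |∑ k, s7 k k| ≤ n * (n * (K * X)) := abs_sum_le_card_mul _ fun k => b7 k k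
  have b9 : |s9| ≤ n * (n * (K * X)) := abs_sum_le_card_mul _ fun k =>
    abs_sum_le_card_mul _ fun l => bd (hb.inverse _ _ _ _) (abs_grad_mul_le_jetSize k l)
  have b10 : |s10| ≤ n * (K * ((2 + K) * X)) := abs_sum_le_card_mul _ fun l => by
    rw [abs_mul]
    exact mul_le_mul (hb.inverse _ _ _ _) (hG.abs_wTensor_le hb hK l j) (abs_nonneg _) hK
  have b11 : |pd a (pd a fun z => G z i j) 0 * qq| ≤ K * X := bd (hb.metric _ _ _ _) (by
    rw [abs_of_nonneg (Finset.sum_nonneg fun k _ => sq_nonneg _)]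
    exact sum_sq_le_jetSize)
  have b12 : |pd a (pd a fun z => schouten G z i j) 0| ≤ K * X :=
    (hb.schouten_two _ _ _ _).trans (le_mul_of_one_le_right hK hX1)
  have b13 : |pd a (fun z => schouten G z i j) 0 * p a| ≤ K * X :=
    bd (hb.schouten_one _ _ _) (abs_grad_le_jetSize a)
  -- After full expansion, the terms containing only derivatives of v cancel identically once
  -- partial derivatives are commuted. Every remaining sum has a factor from the jet of the metric
  -- or of its Schouten tensor, bounded by K, and another factor bounded by a multiple of `jetSize`.
  rw [hG.pd_pd_inv_mul_matrix hW, hG.pd_inv_mul_matrix hW, hG.pd_pd_wTensor hv, hG.pd_wTensor hv,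
    hG.pd_pd_vTensor hv, hG.pd_vTensor hv]
  have f1 : ∀ m, pd m (fun z => vTensor G v z a a) 0 = pd m (pd a (pd a v)) 0
      - ∑ k, pd m (christoffel G k a a) 0 * p k + 2 * (pd m (pd a v) 0 * p a) := by
    intro m
    rw [hG.pd_vTensor hv]
    simp only [hp]
    ring
  have f2 : ∀ m r, p r * pd m (fun z => vTensor G v z a a) 0 = p r * pd m (pd a (pd a v)) 0
      - s7 m r + 2 * p r * (pd m (pd a v) 0 * p a) := by
    intro m r
    rw [f1]
    simp only [hs7]
    have : ∑ k, pd m (christoffel G k a a) 0 * (p r * p k)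
        = p r * ∑ k, pd m (christoffel G k a a) 0 * p k := by
      rw [Finset.mul_sum]
      exact Finset.sum_congr rfl fun k _ => by ring
    rw [this]
    ring
  have f3 : ∑ k, p k * pd k (fun z => vTensor G v z a a) 0
      = ∑ k, p k * pd a (pd a (pd k v)) 0 - ∑ k, s7 k k
        + 2 * p a * ∑ k, p k * pd a (pd k v) 0 := by
    simp only [f2, Finset.sum_add_distrib, Finset.sum_sub_distrib, Finset.mul_sum]
    congr 1
    · congr 1
      refine Finset.sum_congr rfl fun k _ => ?_
      rw [hc3 k a a, hc3' a k a]
    · refine Finset.sum_congr rfl fun k _ => ?_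
      rw [hc2 k a]
      ring
  have f4 : pd i (pd j fun z => vTensor G v z a a) 0
      = pd i (pd j (pd a (pd a v))) 0 - (s4 + s5 + s6)
        + (2 * p a * pd i (pd j (pd a v)) 0 + 2 * pd i (pd a v) 0 * pd j (pd a v) 0) := by
    rw [hG.pd_pd_vTensor hv]
    simp only [hs4, hs5, hs6, ← Finset.sum_add_distrib]
    simp only [hp]
    ring
  rw [f4, hpk j, hpk i, f2 i j, f2 j i]
  simp only [hpk]
  rw [f3]
  have f5 : ∑ k, (pd a (pd a (christoffel G k i j)) 0 * p k
        + pd a (christoffel G k i j) 0 * pd a (pd k v) 0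
        + pd a (christoffel G k i j) 0 * pd a (pd k v) 0) = s1 + s2 + s2 := by
    simp only [hs1, hs2, ← Finset.sum_add_distrib]
  have f6 : p a * ∑ k, pd a (christoffel G k i j) 0 * p k = s3 := by
    rw [hs3, Finset.mul_sum]
    exact Finset.sum_congr rfl fun k _ => by ring
  have f7 : ∑ k, pd k (pd a v) 0 ^ 2 = ∑ k, pd a (pd k v) 0 ^ 2 :=
    Finset.sum_congr rfl fun k _ => by rw [hc2 k a]
  rw [f5, f7, hc4, hc3 a i j, hc3' i a j, hc3' a a i, hc3 a i a, hc3' a a j, hc3 a j a, hc2 a i,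
    hc2 a j]
  rw [Finset.sum_add_distrib]
  set H := ∑ k, pd a (pd k v) 0 ^ 2
  set PT := ∑ k, p k * pd a (pd a (pd k v)) 0
  set PH := ∑ k, p k * pd a (pd k v) 0
  set S8 := ∑ k, s7 k k
  set S3 := ∑ k, pd a (christoffel G k i j) 0 * p k
  have b8' : |if i = j then -S8 - s9 / 2 else 0| ≤ n * (n * (K * X)) * (3 / 2) := by
    split_ifs
    · rw [abs_le] at *
      constructor <;> linarith
    · rw [abs_zero]
      positivity
  have hC : errConst n K * X = 12 * (n * (K * X)) + 2 * (n * (n * (K * X))) + 4 * (K * X)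
      + n * (K * ((2 + K) * X)) - 2 * (n * (K * X)) := by
    unfold errConst
    ring
  rw [hC]
  have hfin : ∀ Y : ℝ, |Y| ≤ n * (n * (K * X)) * (3 / 2) →
      |-s1 - 2 * s2 - 2 * s3 + s4 + s5 + s6 + s7 i j + s7 j i + Y
      - (pd a (pd a fun z => G z i j) 0 * qq) / 2 + pd a (pd a fun z => schouten G z i j) 0
      + 2 * (pd a (fun z => schouten G z i j) 0 * p a) + s10|
      ≤ 12 * (n * (K * X)) + 2 * (n * (n * (K * X))) + 4 * (K * X)
      + n * (K * ((2 + K) * X)) - 2 * (n * (K * X)) := by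
    intro Y hY
    have b7i := b7 i j
    have b7j := b7 j i
    have hn2 : 0 ≤ n * (n * (K * X)) := by positivity
    rw [abs_le] at *
    constructor <;> linarith
  refine le_trans (le_of_eq ?_) (hfin _ b8')
  congr 1
  rw [← f6]
  split_ifs <;> ring

end IsNormal

end DifferentialInequality

end SigmaTwoFlow

end

noncomputable section

namespace SigmaTwoFlow

/-! ### The linearized coefficients -/

section LinCoeff

variable {n : ℕ} {B : Matrix (Fin n) (Fin n) ℝ} {c : ℝ}

theorem linCoeff_apply (i j : Fin n) : linCoeff B c i j
    = (if i = j then (1 + ((B * B).trace + 2 * c ^ 2) / B.trace ^ 2) / 2 else 0)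
      - B i j / B.trace := by
  simp only [linCoeff, Matrix.sub_apply, Matrix.smul_apply, Matrix.one_apply, smul_eq_mul]
  split_ifs <;> ring

theorem linCoeff_symm (hB : ∀ i j, B i j = B j i) (i j : Fin n) :
    linCoeff B c i j = linCoeff B c j i := by
  rw [linCoeff_apply, linCoeff_apply, hB i j]
  simp only [eq_comm]

theorem trace_linCoeff (hσ : 0 < B.trace) : (linCoeff B c).trace
    = n * ((1 + ((B * B).trace + 2 * c ^ 2) / B.trace ^ 2) / 2) - 1 := by
  simp only [linCoeff, Matrix.trace_sub, Matrix.trace_smul, Matrix.trace_one, smul_eq_mul,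
    Fintype.card_fin, one_div, inv_mul_cancel₀ hσ.ne']
  ring

theorem trace_mul_self_eq (hB : ∀ i j, B i j = B j i) :
    (B * B).trace = ∑ i, ∑ j, B i j ^ 2 := by
  rw [trace_mul_eq_sum]
  exact Finset.sum_congr rfl fun i _ => Finset.sum_congr rfl fun j _ => by rw [hB j i, pow_two]

theorem sq_le_trace_mul_self (hB : ∀ i j, B i j = B j i) (i j : Fin n) :
    B i j ^ 2 ≤ (B * B).trace := by
  rw [trace_mul_self_eq hB]
  exact (Finset.single_le_sum (f := fun j => B i j ^ 2) (fun _ _ => sq_nonneg _)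
      (Finset.mem_univ j)).trans (Finset.single_le_sum (f := fun i => ∑ j, B i j ^ 2)
        (fun _ _ => Finset.sum_nonneg fun _ _ => sq_nonneg _) (Finset.mem_univ i))

/-- This is 2|x| ≤ 1 + x² with x = b/σ₁. It is applied to the entries of B for the bound on the
coefficients, and to Rayleigh quotients for semidefiniteness. -/
theorem linCoeff_weight_ge (hσ : 0 < B.trace) {b : ℝ}
    (hb : b ^ 2 ≤ (B * B).trace) :
    |b / B.trace| ≤ (1 + ((B * B).trace + 2 * c ^ 2) / B.trace ^ 2) / 2 := by
  have h1 : (b / B.trace) ^ 2 ≤ ((B * B).trace + 2 * c ^ 2) / B.trace ^ 2 := by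
    rw [div_pow]
    gcongr
    nlinarith [sq_nonneg c]
  rw [abs_le]
  constructor <;> nlinarith [sq_nonneg (b / B.trace - 1), sq_nonneg (b / B.trace + 1)]

variable (hn : 4 < n) (hB : ∀ i j, B i j = B j i) (hσ : 0 < B.trace)

include hB hσ in
theorem linCoeff_weight_pos :
    1 / 2 ≤ (1 + ((B * B).trace + 2 * c ^ 2) / B.trace ^ 2) / 2 := by
  have h : 0 ≤ (B * B).trace := by
    rw [trace_mul_self_eq hB]
    positivity
  have : 0 ≤ ((B * B).trace + 2 * c ^ 2) / B.trace ^ 2 := by positivity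
  linarith

include hn hB hσ

/-- The trace is nμ - 1 for the weight μ ≥ 1/2, and (n - 2)μ ≥ 1 in the dimensions considered. -/
theorem two_mul_weight_le_trace_linCoeff :
    2 * ((1 + ((B * B).trace + 2 * c ^ 2) / B.trace ^ 2) / 2) ≤ (linCoeff B c).trace := by
  rw [trace_linCoeff hσ]
  have h1 := linCoeff_weight_pos (c := c) hB hσ
  have h2 : (5 : ℝ) ≤ n := by exact_mod_cast hn
  nlinarith

theorem one_le_trace_linCoeff : 1 ≤ (linCoeff B c).trace := by
  linarith [two_mul_weight_le_trace_linCoeff (c := c) hn hB hσ, linCoeff_weight_pos (c := c) hB hσ]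

/-- It lets every error term be estimated with the factor T, which is cancelled at the end. The
coefficients themselves have no upper bound as σ₁ tends to 0. -/
theorem abs_linCoeff_le (i j : Fin n) : |linCoeff B c i j| ≤ (linCoeff B c).trace := by
  refine le_trans ?_ (two_mul_weight_le_trace_linCoeff hn hB hσ)
  have h1 := linCoeff_weight_pos (c := c) hB hσ
  have h2 := linCoeff_weight_ge (c := c) hσ (sq_le_trace_mul_self hB i j)
  rw [linCoeff_apply]
  rw [abs_le] at h2 ⊢
  split_ifs <;> constructor <;> linarith

/-- The weight μ contains ψ²/σ₁², so ψ/σ₁ is controlled by T although σ₁ has no lower bound. This is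
why the final estimate is linear in ψ. -/
theorem sq_div_trace_le (hc : 0 ≤ c) : c ^ 2 / B.trace ≤ c * (linCoeff B c).trace := by
  have h1 : c / B.trace ≤ 2 * ((1 + ((B * B).trace + 2 * c ^ 2) / B.trace ^ 2) / 2) := by
    have h3 : (c / B.trace) ^ 2 ≤ ((B * B).trace + 2 * c ^ 2) / B.trace ^ 2 := by
      have h : 0 ≤ (B * B).trace := by
        rw [trace_mul_self_eq hB]
        positivity
      rw [div_pow]
      gcongr
      nlinarith [sq_nonneg c]
    nlinarith [sq_nonneg (c / B.trace - 1)]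
  calc c ^ 2 / B.trace = c * (c / B.trace) := by ring
    _ ≤ _ := mul_le_mul_of_nonneg_left
      (h1.trans (two_mul_weight_le_trace_linCoeff hn hB hσ)) hc

-- By Cauchy–Schwarz a Rayleigh quotient of B is at most |B| in absolute value, and |B|/σ₁ is at
-- most the weight by `linCoeff_weight_ge`.
omit hn in
theorem linCoeff_posSemidef : (linCoeff B c).PosSemidef := by
  refine Matrix.PosSemidef.of_dotProduct_mulVec_nonneg ?_ fun x => ?_
  · ext i j
    simp [Matrix.conjTranspose_apply, linCoeff_symm hB j i]
  · set μ := (1 + ((B * B).trace + 2 * c ^ 2) / B.trace ^ 2) / 2 with hμ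
    have e : star x ⬝ᵥ (linCoeff B c).mulVec x
        = μ * ∑ i, x i ^ 2 - (∑ i, ∑ j, B i j * (x i * x j)) / B.trace := by
      have : star x ⬝ᵥ (linCoeff B c).mulVec x
          = ∑ i, ∑ j, linCoeff B c i j * Matrix.of (fun i j => x i * x j) i j := by
        simp only [dotProduct, Matrix.mulVec, Finset.mul_sum, star_trivial, Matrix.of_apply]
        exact Finset.sum_congr rfl fun i _ => Finset.sum_congr rfl fun j _ => by ring
      rw [this, sum_linCoeff_mul]
      simp only [Matrix.trace, Matrix.diag_apply, Matrix.of_apply, ← pow_two] at hμ ⊢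
      rw [← hμ]
      ring
    rw [e]
    set S := ∑ i, x i ^ 2
    have hS : 0 ≤ S := Finset.sum_nonneg fun i _ => sq_nonneg _
    have hcs : (∑ i, ∑ j, B i j * (x i * x j)) ^ 2 ≤ (B * B).trace * S ^ 2 := by
      have := Finset.sum_mul_sq_le_sq_mul_sq (Finset.univ : Finset (Fin n × Fin n))
        (fun q => B q.1 q.2) (fun q => x q.1 * x q.2)
      simp only [Fintype.sum_prod_type, ← trace_mul_self_eq hB, mul_pow] at this
      rw [← Finset.sum_mul_sum] at this
      exact this.trans_eq (by rw [pow_two S])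
    rcases hS.eq_or_lt with h0 | h0
    · rw [← h0] at hcs ⊢
      have : ∑ i, ∑ j, B i j * (x i * x j) = 0 := by nlinarith
      simp [this]
    · have hb : ((∑ i, ∑ j, B i j * (x i * x j)) / S) ^ 2 ≤ (B * B).trace := by
        rw [div_pow, div_le_iff₀ (by positivity)]
        exact hcs
      have := (le_abs_self _).trans (linCoeff_weight_ge (c := c) hσ hb)
      rw [div_right_comm, div_le_iff₀ h0, ← hμ] at this
      linarith

end LinCoeff

/-! ### The test function at the centre of normal coordinates. -/

section TestFunction

variable {n : ℕ} {U : Set (EuclideanSpace ℝ (Fin n))}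
  {G : EuclideanSpace ℝ (Fin n) → Matrix (Fin n) (Fin n) ℝ} {v : EuclideanSpace ℝ (Fin n) → ℝ}
  {K : ℝ}

/-- The quantity `V_{ξξ} / |ξ|² + tr_g V` with `ξ = ∂_i`. -/
def testFn (G : EuclideanSpace ℝ (Fin n) → Matrix (Fin n) (Fin n) ℝ)
    (v : EuclideanSpace ℝ (Fin n) → ℝ) (i : Fin n) (z : EuclideanSpace ℝ (Fin n)) : ℝ :=
  vTensor G v z i i * (G z i i)⁻¹ + ((G z)⁻¹ * vTensor G v z).trace

/-- The weights of the second derivatives in `testFn`. -/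
def testWeight (i a : Fin n) : ℝ := if a = i then 2 else 1

theorem sum_testWeight (i : Fin n) (x : Fin n → ℝ) :
    ∑ a, testWeight i a * x a = x i + ∑ a, x a := by
  have : ∀ a, testWeight i a * x a = (if a = i then x a else 0) + x a := fun a => by
    unfold testWeight
    split_ifs <;> ring
  simp [this, Finset.sum_add_distrib]

/-- This is the purpose of the trace in the test function: every direction has weight at least one,
so the good term contains all of |∇²v|² and not only the derivatives in the direction ξ. -/
theorem one_le_testWeight (i a : Fin n) : 1 ≤ testWeight i a := by
  unfold testWeight
  split_ifs <;> norm_num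

theorem testFn_smooth (hG : IsMetricOn U G) (hv : ContDiffOn ℝ ∞ v U) {i : Fin n}
    (hi : ∀ z ∈ U, G z i i ≠ 0) : ContDiffOn ℝ ∞ (testFn G v i) U :=
  ((hG.vTensor_smooth hv i i).mul ((hG.smooth i i).inv hi)).add
    (MSmooth.trace ((hG.smooth.inv hG.det_ne_zero).mul (hG.vTensor_smooth hv)))

namespace IsNormal

variable (hG : IsNormal U G) (hb : JetBound G K) (hv : ContDiffOn ℝ ∞ v U) {i : Fin n}
  (hi : ∀ z ∈ U, G z i i ≠ 0)

include hG

theorem testFn_eq : testFn G v i 0 = ∑ a, testWeight i a * vTensor G v 0 a a := by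
  rw [testFn, hG.eq_one, sum_testWeight]
  simp [Matrix.trace]

include hi

theorem pd_inv_diag (m : Fin n) : pd m (fun z => (G z i i)⁻¹) 0 = 0 := by
  rw [pd_inv hG.isMetricOn.isOpen (hG.isMetricOn.smooth i i) hG.zero_mem (hi 0 hG.zero_mem),
    hG.pd_eq_zero]
  simp

theorem pd_pd_inv_diag (l m : Fin n) : pd l (pd m fun z => (G z i i)⁻¹) 0
    = - pd l (pd m fun z => G z i i) 0 := by
  have hU := hG.isMetricOn.isOpen
  have hs := hG.isMetricOn.smooth i i
  have h : EqOn (fun z => G z i i * (G z i i)⁻¹) (fun _ => 1) U := fun z hz =>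
    mul_inv_cancel₀ (hi z hz)
  have := pd_congr_on hU (fun z hz => pd_congr_on hU h hz m) hG.zero_mem l
  have hI : ContDiffOn ℝ ∞ (fun z => (G z i i)⁻¹) U := hs.inv hi
  rw [pd_pd_mul hU hs hI hG.zero_mem, pd_pd_const, hG.pd_inv_diag hi, hG.pd_inv_diag hi,
    hG.eq_one, Matrix.one_apply_eq] at this
  linarith

include hv

theorem pd_testFn (m : Fin n) : pd m (testFn G v i) 0
    = ∑ a, testWeight i a * pd m (fun z => vTensor G v z a a) 0 := by
  have hU := hG.isMetricOn.isOpen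
  have h0 := hG.zero_mem
  have hV := hG.isMetricOn.vTensor_smooth hv
  have hI : ContDiffOn ℝ ∞ (fun z => (G z i i)⁻¹) U := (hG.isMetricOn.smooth i i).inv hi
  have hB : MSmooth U fun z => (G z)⁻¹ * vTensor G v z :=
    (hG.isMetricOn.smooth.inv hG.isMetricOn.det_ne_zero).mul hV
  have e : testFn G v i = fun z => vTensor G v z i i * (G z i i)⁻¹
      + ((G z)⁻¹ * vTensor G v z).trace := rfl
  rw [e, pd_add hU ((hV i i).mul hI) hB.trace h0, pd_mul hU (hV i i) hI h0, hG.pd_inv_diag hi,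
    hG.eq_one, pd_trace hU h0 hB, sum_testWeight]
  simp only [Matrix.trace, Matrix.diag_apply, pdM_apply, hG.pd_inv_mul_matrix hV,
    Matrix.one_apply_eq]
  ring

include hb

/-- The normalization of ξ and the inverse metric in the trace have zero first derivative at the
origin. Their second derivatives are bounded by K and multiply V, which is bounded by `jetSize`. -/
theorem abs_pd_pd_testFn_le (hK : 0 ≤ K) (l m : Fin n) :
    |pd l (pd m (testFn G v i)) 0
      - ∑ a, testWeight i a * pd l (pd m fun z => vTensor G v z a a) 0|
      ≤ K * (1 + n ^ 2) * jetSize v := by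
  have hU := hG.isMetricOn.isOpen
  have h0 := hG.zero_mem
  have hV := hG.isMetricOn.vTensor_smooth hv
  have hI : ContDiffOn ℝ ∞ (fun z => (G z i i)⁻¹) U := (hG.isMetricOn.smooth i i).inv hi
  have hB : MSmooth U fun z => (G z)⁻¹ * vTensor G v z :=
    (hG.isMetricOn.smooth.inv hG.isMetricOn.det_ne_zero).mul hV
  have key : pd l (pd m (testFn G v i)) 0
      - ∑ a, testWeight i a * pd l (pd m fun z => vTensor G v z a a) 0
      = - (vTensor G v 0 i i * pd l (pd m fun z => G z i i) 0)
        + ∑ a, ∑ b, pd l (pd m fun z => (G z)⁻¹ a b) 0 * vTensor G v 0 b a := by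
    have e : testFn G v i = fun z => vTensor G v z i i * (G z i i)⁻¹
        + ∑ a, ((G z)⁻¹ * vTensor G v z) a a := rfl
    rw [e, pd_pd_add (f := fun z => vTensor G v z i i * (G z i i)⁻¹)
        (g := fun z => ∑ a, ((G z)⁻¹ * vTensor G v z) a a) hU ((hV i i).mul hI)
        (ContDiffOn.sum fun a _ => hB a a) h0,
      pd_pd_mul hU (hV i i) hI h0, hG.pd_inv_diag hi, hG.pd_inv_diag hi, hG.pd_pd_inv_diag hi,
      hG.eq_one, pd_pd_sum _ hU (fun a _ => hB a a) h0, sum_testWeight]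
    simp only [hG.pd_pd_inv_mul_matrix hV, Finset.sum_add_distrib, Matrix.one_apply_eq]
    ring
  rw [key]
  have hX := one_le_jetSize (v := v)
  have hVb := hG.abs_vTensor_le (v := v)
  have hprod : ∀ {x y : ℝ}, |x| ≤ K → |y| ≤ jetSize v → |x * y| ≤ K * jetSize v := by
    intro x y hx hy
    rw [abs_mul]
    exact mul_le_mul hx hy (abs_nonneg _) hK
  have h1 : |vTensor G v 0 i i * pd l (pd m fun z => G z i i) 0| ≤ K * jetSize v := by
    rw [mul_comm]
    exact hprod (hb.metric l m i i) (hVb i i)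
  have h2 : |∑ a, ∑ b, pd l (pd m fun z => (G z)⁻¹ a b) 0 * vTensor G v 0 b a|
      ≤ n * (n * (K * jetSize v)) :=
    abs_sum_le_card_mul _ fun a => abs_sum_le_card_mul _ fun b =>
      hprod (hb.inverse l m a b) (hVb b a)
  refine (abs_add_le _ _).trans ?_
  rw [abs_neg]
  calc _ ≤ K * jetSize v + n * (n * (K * jetSize v)) := add_le_add h1 h2
    _ = _ := by ring

end IsNormal

end TestFunction

/-! ### Necessary conditions at a local maximum -/

section LocalMax

variable {n : ℕ} {U : Set (EuclideanSpace ℝ (Fin n))} {f : EuclideanSpace ℝ (Fin n) → ℝ}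
  {y : EuclideanSpace ℝ (Fin n)}

theorem IsLocalMax.pd_eq_zero (h : IsLocalMax f y) (k : Fin n) : pd k f y = 0 := by
  rw [pd, h.fderiv_eq_zero]
  rfl

theorem pd_line_eq_sum (hU : IsOpen U) (hf : ContDiffOn ℝ ∞ f U)
    (x : EuclideanSpace ℝ (Fin n)) {t : ℝ} (ht : y + t • x ∈ U) :
    HasDerivAt (fun s : ℝ => f (y + s • x)) (∑ k, x k * pd k f (y + t • x)) t := by
  have h1 : HasDerivAt (fun s : ℝ => y + s • x) x t := by
    simpa using ((hasDerivAt_id t).smul_const x).const_add y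
  have h2 := (smoothOn_differentiableAt hU hf ht).hasFDerivAt.comp_hasDerivAt t h1
  rwa [fderiv_eq_sum_pd] at h2

/-- Restrict to the line in direction x. A positive second derivative would make the point a local
minimum as well, so the function would be constant near it along the line, and its second derivative
zero. -/
theorem IsLocalMax.sum_pd_pd_nonpos (hU : IsOpen U) (hf : ContDiffOn ℝ ∞ f U) (hy : y ∈ U)
    (h : IsLocalMax f y) (x : EuclideanSpace ℝ (Fin n)) :
    ∑ k, ∑ l, x k * x l * pd k (pd l f) y ≤ 0 := by
  by_contra! hpos
  set φ : ℝ → ℝ := fun s => f (y + s • x) with hφ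
  have hcont : Continuous fun s : ℝ => y + s • x := by fun_prop
  have hev : ∀ᶠ s in 𝓝 (0 : ℝ), y + s • x ∈ U :=
    hcont.continuousAt.eventually_mem (hU.mem_nhds (by simpa using hy))
  have h0 : y + (0 : ℝ) • x ∈ U := by simpa using hy
  have hd : deriv φ =ᶠ[𝓝 0] fun s => ∑ k, x k * pd k f (y + s • x) :=
    hev.mono fun s hs => (pd_line_eq_sum hU hf x hs).deriv
  have hdd : deriv (deriv φ) 0 = ∑ k, ∑ l, x k * x l * pd k (pd l f) y := by
    rw [hd.deriv_eq]
    have : HasDerivAt (fun s : ℝ => ∑ l, x l * pd l f (y + s • x))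
        (∑ l, x l * ∑ k, x k * pd k (pd l f) (y + (0 : ℝ) • x)) 0 :=
      HasDerivAt.fun_sum fun l _ => (pd_line_eq_sum hU (pd_smoothOn hU hf l) x h0).const_mul (x l)
    rw [this.deriv, Finset.sum_comm]
    simp only [zero_smul, add_zero, Finset.mul_sum]
    exact Finset.sum_congr rfl fun l _ => Finset.sum_congr rfl fun k _ => by ring
  have hmax : IsLocalMax φ 0 := by
    have : Filter.Tendsto (fun s : ℝ => y + s • x) (𝓝 0) (𝓝 y) := by
      simpa using hcont.tendsto 0
    have := this.eventually h
    simpa [IsLocalMax, IsMaxFilter, hφ] using this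
  have hmin := isLocalMin_of_deriv_deriv_pos (hdd ▸ hpos) hmax.deriv_eq_zero
    (pd_line_eq_sum hU hf x h0).continuousAt
  have hconst : φ =ᶠ[𝓝 0] fun _ => φ 0 := by
    filter_upwards [hmax, hmin] with s h1 h2 using le_antisymm h1 h2
  have : deriv (deriv φ) 0 = 0 := by
    rw [hconst.deriv.deriv_eq]
    simp
  rw [← hdd, this] at hpos
  exact lt_irrefl _ hpos

/-- Factor F = CᵀC and apply the hypothesis to each row of C. -/
theorem sum_mul_nonpos_of_posSemidef {F P : Matrix (Fin n) (Fin n) ℝ} (hF : F.PosSemidef)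
    (hP : ∀ x : EuclideanSpace ℝ (Fin n), ∑ k, ∑ l, x k * x l * P k l ≤ 0) :
    ∑ k, ∑ l, F k l * P k l ≤ 0 := by
  obtain ⟨C, rfl⟩ : ∃ C : Matrix (Fin n) (Fin n) ℝ, F = C.transpose * C := by
    open scoped MatrixOrder Matrix.Norms.L2Operator in
    obtain ⟨C, hC⟩ := CStarAlgebra.nonneg_iff_eq_star_mul_self.mp hF.nonneg
    exact ⟨C, hC⟩
  have : ∀ m, ∑ k, ∑ l, C m k * C m l * P k l ≤ 0 := fun m => hP (WithLp.toLp 2 (C m))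
  refine le_trans (le_of_eq ?_) (Finset.sum_nonpos fun m (_ : m ∈ Finset.univ) => this m)
  simp only [Matrix.mul_apply, Matrix.transpose_apply, Finset.sum_mul]
  rw [Finset.sum_congr rfl fun k _ => Finset.sum_comm, Finset.sum_comm]

end LocalMax

end SigmaTwoFlow

end

noncomputable section

namespace SigmaTwoFlow

/-! ### The estimate at an interior maximum of the localized test function -/

section MaximumEstimate

variable {n : ℕ} {U : Set (EuclideanSpace ℝ (Fin n))}
  {G : EuclideanSpace ℝ (Fin n) → Matrix (Fin n) (Fin n) ℝ}
  {v w : EuclideanSpace ℝ (Fin n) → ℝ} {K β ρ s : ℝ} {i₀ : Fin n}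

theorem abs_sum_sum_mul_le {F X : Fin n → Fin n → ℝ} {T D : ℝ} (hF : ∀ i j, |F i j| ≤ T)
    (hX : ∀ i j, |X i j| ≤ D) : |∑ i, ∑ j, F i j * X i j| ≤ n ^ 2 * (T * D) := by
  refine (abs_sum_le_card_mul _ fun i => abs_sum_le_card_mul (c := T * D) _ fun j => ?_).trans
    (le_of_eq (by ring))
  rw [abs_mul]
  exact mul_le_mul (hF i j) (hX i j) (abs_nonneg _) ((abs_nonneg _).trans (hF i j))

/-- The constant in the differential inequality for `testFn`. -/
def ineqConst (n : ℕ) (K : ℝ) : ℝ := n ^ 2 * ((n + 1) * errConst n K + K * (1 + n ^ 2))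

theorem errConst_nonneg (hK : 0 ≤ K) : 0 ≤ errConst n K := by
  unfold errConst
  positivity

theorem ineqConst_nonneg (hK : 0 ≤ K) : 0 ≤ ineqConst n K := by
  have := errConst_nonneg (n := n) hK
  unfold ineqConst
  positivity

theorem IsNormal.pd_exp_direction (hG : IsNormal U G) (hv : ContDiffOn ℝ ∞ v U) (a : Fin n) :
    pd a (fun z => ρ * Real.exp (-β * v z)) 0 = -β * pd a v 0 * (ρ * Real.exp (-β * v 0)) ∧
    pd a (pd a fun z => ρ * Real.exp (-β * v z)) 0
      = (β ^ 2 * pd a v 0 ^ 2 - β * pd a (pd a v) 0) * (ρ * Real.exp (-β * v 0)) := by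
  have hU := hG.isMetricOn.isOpen
  have h0 := hG.zero_mem
  have hs : ContDiffOn ℝ ∞ (fun z => ρ * Real.exp (-β * v z)) U :=
    contDiffOn_const.mul (contDiffOn_const.mul hv).exp
  have h1 : ∀ z ∈ U, pd a (fun z => ρ * Real.exp (-β * v z)) z
      = -β * (pd a v z * (ρ * Real.exp (-β * v z))) := by
    intro z hz
    have hd := ((smoothOn_differentiableAt hU hv hz).hasFDerivAt.const_mul (-β)).exp.const_mul ρ
    rw [pd, hd.fderiv, pd]
    simp
    ring
  refine ⟨by rw [h1 0 h0]; ring, ?_⟩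
  rw [pd_congr_on hU h1 h0, pd_const_mul hU ((pd_smoothOn hU hv a).mul hs) h0,
    pd_mul hU (pd_smoothOn hU hv a) hs h0, h1 0 h0]
  ring

variable (hn : 4 < n) (hG : IsNormal U G) (hb : JetBound G K) (hK : 0 ≤ K)
  (hi : ∀ z ∈ U, G z i₀ i₀ ≠ 0) (hv : ContDiffOn ℝ ∞ v U) (hw : ContDiffOn ℝ ∞ w U)
  (hβ : 1 ≤ β ∧ β ≤ 2) (hσ : ∀ z ∈ U, 0 < ((G z)⁻¹ * wTensor G v z).trace)
  (hweq : ∀ z ∈ U, w z = sigmaTwo ((G z)⁻¹ * wTensor G v z) / ((G z)⁻¹ * wTensor G v z).trace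
    - (ρ * Real.exp (-β * v z)) ^ 2 / ((G z)⁻¹ * wTensor G v z).trace + s)

/-- The contracted symbol is half the logarithmic derivative of the determinant. It serves twice,
for the symmetry of the Ricci tensor and for the divergence of vector densities. -/
theorem IsMetricOn.sum_christoffel (hG : IsMetricOn U G) {z : EuclideanSpace ℝ (Fin n)}
    (hz : z ∈ U) (i : Fin n) :
    2 * ∑ k, christoffel G k k i z = (G z).det⁻¹ * pd i (fun y => (G y).det) z := by
  rw [pd_det hG.isOpen hG.smooth hz (hG.det_ne_zero z hz),
    inv_mul_cancel_left₀ (hG.det_ne_zero z hz),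
    trace_mul_eq_sum]
  have h1 : ∑ k, ∑ l, (G z)⁻¹ k l * pd k (fun y => G y i l) z
      = ∑ k, ∑ l, (G z)⁻¹ k l * pd l (fun y => G y k i) z := by
    rw [Finset.sum_comm]
    refine Finset.sum_congr rfl fun k _ => Finset.sum_congr rfl fun l _ => ?_
    have e : (G z)⁻¹ l k = (G z)⁻¹ k l := congrFun (congrFun (hG.inv_symm hz) k) l
    rw [e, hG.pd_symm hz]
  simp only [christoffel, mul_sub, mul_add, Finset.sum_sub_distrib, Finset.sum_add_distrib,
    ← Finset.mul_sum, h1, pdM_apply]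
  simp only [hG.pd_symm hz i]
  ring

/-- The one term whose symmetry needs an argument is ∂_jΓᵏ_{ki}. By the preceding formula it is a
second derivative of half the logarithm of |det|; working with det⁻¹ ∂det avoids the logarithm. -/
theorem IsMetricOn.ricci_symm (hG : IsMetricOn U G) {z : EuclideanSpace ℝ (Fin n)}
    (hz : z ∈ U) (i j : Fin n) : ricci G z i j = ricci G z j i := by
  have hU := hG.isOpen
  have hc := christoffel_smoothOn hU hG.smooth hG.det_ne_zero
  have hd : ContDiffOn ℝ ∞ (fun y => (G y).det) U := hG.smooth.det
  have hdi : ContDiffOn ℝ ∞ (fun y => (G y).det⁻¹) U := hd.inv hG.det_ne_zero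
  have hS : ∀ i j, 2 * ∑ k, pd j (christoffel G k k i) z
      = (G z).det⁻¹ * pd j (pd i fun y => (G y).det) z
        + pd j (fun y => (G y).det⁻¹) z * pd i (fun y => (G y).det) z := by
    intro i j
    have := pd_congr_on hU (fun y hy => hG.sum_christoffel hy i) hz j
    rw [pd_const_mul hU (ContDiffOn.sum fun k _ => hc k k i) hz,
      pd_sum _ hU (fun k _ => hc k k i) hz, pd_mul hU hdi (pd_smoothOn hU hd i) hz] at this
    linarith
  have hS' : ∑ k, pd j (christoffel G k k i) z = ∑ k, pd i (christoffel G k k j) z := by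
    have h1 := hS i j
    have h2 := hS j i
    have h3 := fun k => pd_inv hU hd hz (hG.det_ne_zero z hz) (k := k)
    rw [h3, pd_comm hU hd hz] at h1
    rw [h3] at h2
    linarith
  have h1 : ∀ k l, christoffel G k l i z = christoffel G k i l z := fun k l =>
    hG.christoffel_symm hz k l i
  have h2 : ∑ k, ∑ l, christoffel G k j l z * christoffel G l k i z
      = ∑ k, ∑ l, christoffel G k i l z * christoffel G l k j z := by
    rw [Finset.sum_comm]
    refine Finset.sum_congr rfl fun k _ => Finset.sum_congr rfl fun l _ => ?_
    rw [hG.christoffel_symm hz l j k, hG.christoffel_symm hz k l i, mul_comm]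
  simp only [ricci, Matrix.of_apply, Finset.sum_add_distrib, Finset.sum_sub_distrib, hS', h2]
  congr 1
  · congr 1
    exact Finset.sum_congr rfl fun k _ =>
      pd_congr_on hU (fun y hy => hG.christoffel_symm hy k i j) hz k
  · congr 1
    exact Finset.sum_congr rfl fun k _ => Finset.sum_congr rfl fun l _ => by
      rw [hG.christoffel_symm hz l i j]

theorem IsMetricOn.schouten_symm (hG : IsMetricOn U G) {z : EuclideanSpace ℝ (Fin n)}
    (hz : z ∈ U) (i j : Fin n) : schouten G z i j = schouten G z j i := by
  simp only [schouten, Matrix.smul_apply, Matrix.sub_apply, hG.ricci_symm hz i j,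
    hG.symm_apply hz i j]

theorem IsMetricOn.wTensor_symm (hG : IsMetricOn U G) (hv : ContDiffOn ℝ ∞ v U)
    {z : EuclideanSpace ℝ (Fin n)} (hz : z ∈ U) (i j : Fin n) :
    wTensor G v z i j = wTensor G v z j i := by
  have h1 : vTensor G v z i j = vTensor G v z j i := by
    change pd i (pd j v) z - _ + pd i v z * pd j v z = pd j (pd i v) z - _ + pd j v z * pd i v z
    rw [pd_comm hG.isOpen hv hz, mul_comm (pd i v z)]
    simp only [hG.christoffel_symm hz _ i j]
  have h2 : G z i j = G z j i := (hG.symm_apply hz i j)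
  change vTensor G v z i j - _ * G z i j + schouten G z i j = _ - _ * G z j i + _
  rw [h1, h2, hG.schouten_symm hz]

include hn hG hb hK hi hv hw hβ hσ hweq

/-- The differential inequality for `testFn` at the origin. -/
theorem IsNormal.sum_testWeight_mul_le :
    ∑ a, testWeight i₀ a * (pd a (pd a w) 0 + 2 * pd a v 0 * pd a w 0)
      ≤ ∑ i, ∑ j, linCoeff ((G 0)⁻¹ * wTensor G v 0) (ρ * Real.exp (-β * v 0)) i j
          * pd i (pd j (testFn G v i₀)) 0
        + 2 * ∑ i, ∑ j, linCoeff ((G 0)⁻¹ * wTensor G v 0) (ρ * Real.exp (-β * v 0)) i j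
          * (pd i v 0 * pd j (testFn G v i₀) 0)
        + (linCoeff ((G 0)⁻¹ * wTensor G v 0) (ρ * Real.exp (-β * v 0))).trace
          * (ineqConst n K * jetSize v - ∑ k, pd k v 0 * pd k (testFn G v i₀) 0
            - ∑ a, ∑ k, pd k (pd a v) 0 ^ 2)
        + 2 * β * ((ρ * Real.exp (-β * v 0)) ^ 2 / ((G 0)⁻¹ * wTensor G v 0).trace)
          * testFn G v i₀ 0 := by
  have hU := hG.isMetricOn.isOpen
  have h0 := hG.zero_mem
  have hW := hG.isMetricOn.wTensor_smooth hv
  set B : EuclideanSpace ℝ (Fin n) → Matrix (Fin n) (Fin n) ℝ :=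
    fun z => (G z)⁻¹ * wTensor G v z with hBd
  have hB : MSmooth U B := (hG.isMetricOn.smooth.inv hG.isMetricOn.det_ne_zero).mul hW
  set ψ : EuclideanSpace ℝ (Fin n) → ℝ := fun z => ρ * Real.exp (-β * v z) with hψd
  have hψ : ContDiffOn ℝ ∞ ψ U := contDiffOn_const.mul (contDiffOn_const.mul hv).exp
  have hσ0 : 0 < (B 0).trace := hσ 0 h0
  have hwq : ∀ z ∈ U, 2 * (w z - s) * (B z).trace = (B z).trace ^ 2
      - ((B z * B z).trace + 2 * ψ z ^ 2) := by
    intro z hz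
    have h1 : (B z).trace ≠ 0 := (hσ z hz).ne'
    have h2 : w z - s = sigmaTwo (B z) / (B z).trace - ψ z ^ 2 / (B z).trace := by
      rw [hweq z hz]
      ring
    rw [h2, sigmaTwo]
    field_simp
    ring
  have hB00 : B 0 = wTensor G v 0 := by simp only [hBd, hG.inv_eq_one, one_mul]
  have hB0 : ∀ i j, B 0 i j = B 0 j i := by
    rw [hB00]
    exact hG.isMetricOn.wTensor_symm hv h0
  have hB1 : ∀ a i j, pd a (fun z => B z i j) 0 = pd a (fun z => B z j i) 0 := by
    intro a i j
    simp only [hBd, hG.pd_inv_mul_matrix hW]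
    exact pd_congr_on hU (fun z hz => hG.isMetricOn.wTensor_symm hv hz i j) h0 a
  set F := linCoeff (B 0) (ψ 0) with hF
  set T := F.trace with hT
  have hT1 : 1 ≤ T := one_le_trace_linCoeff hn hB0 hσ0
  have hFT : ∀ i j, |F i j| ≤ T := abs_linCoeff_le hn hB0 hσ0
  have hFs : ∀ i j, F i j = F j i := linCoeff_symm hB0
  set X := jetSize v with hX
  have hX1 : 1 ≤ X := one_le_jetSize
  set V : Fin n → EuclideanSpace ℝ (Fin n) → ℝ := fun a z => vTensor G v z a a with hV
  set φ := ψ 0 ^ 2 / (B 0).trace with hφ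
  have hφ0 : 0 ≤ φ := by positivity
  -- One coordinate direction at a time: concavity bounds ∂_a∂_a w by F applied to ∂_a∂_a B, and the
  -- commutator estimate turns this into F applied to the Hessian of V_aa. The remainder costs n² T
  -- times `errConst` times `jetSize`.
  have hdir : ∀ a, pd a (pd a w) 0 + 2 * pd a v 0 * pd a w 0
      ≤ ∑ i, ∑ j, F i j * pd i (pd j (V a)) 0
        + 2 * ∑ i, ∑ j, F i j * (pd i v 0 * pd j (V a) 0)
        - T * (∑ k, pd k (pd a v) 0 ^ 2 + ∑ k, pd k v 0 * pd k (V a) 0)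
        + n ^ 2 * (T * (errConst n K * X)) + 2 * β * φ * V a 0 := by
    intro a
    obtain ⟨e1, e2⟩ := pd_quotient hU h0 hB hψ hw hσ0 hwq hB0 a (hB1 a)
    obtain ⟨p1, p2⟩ := hG.pd_exp_direction (β := β) (ρ := ρ) hv a
    have hψ1 : pd a ψ 0 = -β * pd a v 0 * ψ 0 := p1
    have hψ2 : pd a (pd a ψ) 0 = (β ^ 2 * pd a v 0 ^ 2 - β * pd a (pd a v) 0) * ψ 0 := p2
    have hVa : V a 0 = pd a (pd a v) 0 + pd a v 0 ^ 2 := by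
      simp only [hV, hG.vTensor_apply]
      ring
    have hcomm := fun i j => hG.abs_commutator_le hb hv hK a i j
    set R : Fin n → Fin n → ℝ := fun i j => pd a (pd a fun z => B z i j) 0
        + 2 * pd a v 0 * pd a (fun z => B z i j) 0
      - (pd i (pd j (V a)) 0 + pd j v 0 * pd i (V a) 0 + pd i v 0 * pd j (V a) 0
        - (if i = j then ∑ k, pd k (pd a v) 0 ^ 2 + ∑ k, pd k v 0 * pd k (V a) 0 else 0)) with hR
    have hRb : |∑ i, ∑ j, F i j * R i j| ≤ n ^ 2 * (T * (errConst n K * X)) :=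
      abs_sum_sum_mul_le hFT hcomm
    have hsum : ∑ i, ∑ j, F i j * pd a (pd a fun z => B z i j) 0
        + 2 * pd a v 0 * ∑ i, ∑ j, F i j * pd a (fun z => B z i j) 0
        = ∑ i, ∑ j, F i j * R i j + ∑ i, ∑ j, F i j * pd i (pd j (V a)) 0
          + ∑ i, ∑ j, F i j * (pd j v 0 * pd i (V a) 0)
          + ∑ i, ∑ j, F i j * (pd i v 0 * pd j (V a) 0)
          - T * (∑ k, pd k (pd a v) 0 ^ 2 + ∑ k, pd k v 0 * pd k (V a) 0) := by
      have hTe : T * (∑ k, pd k (pd a v) 0 ^ 2 + ∑ k, pd k v 0 * pd k (V a) 0)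
          = ∑ i, ∑ j, F i j * (if i = j then
            ∑ k, pd k (pd a v) 0 ^ 2 + ∑ k, pd k v 0 * pd k (V a) 0 else 0) := by
        simp only [mul_ite, mul_zero, Finset.sum_ite_eq, Finset.mem_univ, if_true, ← Finset.sum_mul]
        rfl
      rw [hTe]
      simp only [hR, Finset.mul_sum, ← Finset.sum_add_distrib, ← Finset.sum_sub_distrib]
      exact Finset.sum_congr rfl fun i _ => Finset.sum_congr rfl fun j _ => by ring
    have hsym : ∑ i, ∑ j, F i j * (pd j v 0 * pd i (V a) 0)
        = ∑ i, ∑ j, F i j * (pd i v 0 * pd j (V a) 0) := by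
      rw [Finset.sum_comm]
      exact Finset.sum_congr rfl fun i _ => Finset.sum_congr rfl fun j _ => by rw [hFs j i]
    -- The two ψ-terms combine to the coefficient 2β - β² of the squared derivative. It is at most β
    -- exactly because β ≥ 1, that is ε ≤ 1 for β = 2 - ε, and then V_aa is recovered.
    have hpsi : - 2 * ψ 0 * pd a (pd a ψ) 0 / (B 0).trace
        + 2 * pd a v 0 * (- 2 * ψ 0 * pd a ψ 0 / (B 0).trace) ≤ 2 * β * φ * V a 0 := by
      have : - 2 * ψ 0 * pd a (pd a ψ) 0 / (B 0).trace
          + 2 * pd a v 0 * (- 2 * ψ 0 * pd a ψ 0 / (B 0).trace)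
          = 2 * φ * (β * pd a (pd a v) 0 + (2 * β - β ^ 2) * pd a v 0 ^ 2) := by
        rw [hψ1, hψ2, hφ]
        ring
      rw [this, hVa]
      have h3 : (2 * β - β ^ 2) * pd a v 0 ^ 2 ≤ β * pd a v 0 ^ 2 :=
        mul_le_mul_of_nonneg_right (by nlinarith [hβ.1]) (sq_nonneg _)
      nlinarith
    have := le_abs_self (∑ i, ∑ j, F i j * R i j)
    have e3 : 2 * pd a v 0 * pd a w 0
        = 2 * pd a v 0 * ∑ i, ∑ j, F i j * pd a (fun z => B z i j) 0
          + 2 * pd a v 0 * (- 2 * ψ 0 * pd a ψ 0 / (B 0).trace) := by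
      rw [e1]
      ring
    have e4 : - 2 * ψ 0 * pd a (pd a ψ) 0 / (B 0).trace
      = - (2 * ψ 0 * pd a (pd a ψ) 0 / (B 0).trace) := by ring
    linarith
  have hw1 : ∀ a, 0 ≤ testWeight i₀ a := fun a => zero_le_one.trans (one_le_testWeight i₀ a)
  have hsumle := Finset.sum_le_sum fun a (_ : a ∈ Finset.univ) =>
    mul_le_mul_of_nonneg_left (hdir a) (hw1 a)
  refine hsumle.trans ?_
  have hQ1 := fun m => hG.pd_testFn hv hi m
  set E : Fin n → Fin n → ℝ := fun i j => pd i (pd j (testFn G v i₀)) 0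
    - ∑ a, testWeight i₀ a * pd i (pd j (V a)) 0 with hE
  have hEb : |∑ i, ∑ j, F i j * E i j| ≤ n ^ 2 * (T * (K * (1 + n ^ 2) * X)) :=
    abs_sum_sum_mul_le hFT fun i j => hG.abs_pd_pd_testFn_le hb hv hi hK i j
  have s1 : ∑ a, testWeight i₀ a * ∑ i, ∑ j, F i j * pd i (pd j (V a)) 0
      = ∑ i, ∑ j, F i j * pd i (pd j (testFn G v i₀)) 0 - ∑ i, ∑ j, F i j * E i j := by
    simp only [hE, ← Finset.sum_sub_distrib, Finset.mul_sum]
    rw [Finset.sum_comm]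
    refine Finset.sum_congr rfl fun i _ => ?_
    rw [Finset.sum_comm]
    refine Finset.sum_congr rfl fun j _ => ?_
    rw [← mul_sub, sub_sub_cancel, Finset.mul_sum]
    exact Finset.sum_congr rfl fun a _ => by ring
  have s2 : ∑ a, testWeight i₀ a * ∑ i, ∑ j, F i j * (pd i v 0 * pd j (V a) 0)
      = ∑ i, ∑ j, F i j * (pd i v 0 * pd j (testFn G v i₀) 0) := by
    simp only [hQ1, Finset.mul_sum]
    rw [Finset.sum_comm]
    refine Finset.sum_congr rfl fun i _ => ?_
    rw [Finset.sum_comm]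
    exact Finset.sum_congr rfl fun j _ => Finset.sum_congr rfl fun a _ => by ring
  have s3 : ∑ a, testWeight i₀ a * ∑ k, pd k v 0 * pd k (V a) 0
      = ∑ k, pd k v 0 * pd k (testFn G v i₀) 0 := by
    simp only [hQ1, Finset.mul_sum]
    rw [Finset.sum_comm]
    exact Finset.sum_congr rfl fun j _ => Finset.sum_congr rfl fun a _ => by ring
  have s4 : ∑ a, ∑ k, pd k (pd a v) 0 ^ 2
      ≤ ∑ a, testWeight i₀ a * ∑ k, pd k (pd a v) 0 ^ 2 :=
    Finset.sum_le_sum fun a _ => le_mul_of_one_le_left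
      (Finset.sum_nonneg fun _ _ => sq_nonneg _) (one_le_testWeight i₀ a)
  have s5 : ∑ a, testWeight i₀ a * V a 0 = testFn G v i₀ 0 := hG.testFn_eq.symm
  have s6 : ∑ a, testWeight i₀ a = n + 1 := by
    have := sum_testWeight i₀ (fun _ => (1 : ℝ))
    simp only [mul_one, Finset.sum_const, Finset.card_univ, Fintype.card_fin, nsmul_eq_mul] at this
    linarith
  have hexp : ∑ a, testWeight i₀ a * (∑ i, ∑ j, F i j * pd i (pd j (V a)) 0
        + 2 * ∑ i, ∑ j, F i j * (pd i v 0 * pd j (V a) 0)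
        - T * (∑ k, pd k (pd a v) 0 ^ 2 + ∑ k, pd k v 0 * pd k (V a) 0)
        + n ^ 2 * (T * (errConst n K * X)) + 2 * β * φ * V a 0)
      = ∑ a, testWeight i₀ a * ∑ i, ∑ j, F i j * pd i (pd j (V a)) 0
        + 2 * ∑ a, testWeight i₀ a * ∑ i, ∑ j, F i j * (pd i v 0 * pd j (V a) 0)
        - T * ∑ a, testWeight i₀ a * ∑ k, pd k (pd a v) 0 ^ 2
        - T * ∑ a, testWeight i₀ a * ∑ k, pd k v 0 * pd k (V a) 0
        + (∑ a, testWeight i₀ a) * (n ^ 2 * (T * (errConst n K * X)))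
        + 2 * β * φ * ∑ a, testWeight i₀ a * V a 0 := by
    rw [Finset.mul_sum (a := T), Finset.mul_sum (a := T), Finset.mul_sum (a := 2),
      Finset.mul_sum (a := 2 * β * φ), Finset.sum_mul]
    simp only [← Finset.sum_add_distrib, ← Finset.sum_sub_distrib]
    exact Finset.sum_congr rfl fun a _ => by
      rw [Finset.sum_add_distrib]
      ring
  rw [hexp, s1, s2, s3, s5, s6]
  have s7 := mul_le_mul_of_nonneg_left s4 (by linarith : 0 ≤ T)
  have s8 := neg_le_of_abs_le hEb
  have s9 : T * (ineqConst n K * X - ∑ k, pd k v 0 * pd k (testFn G v i₀) 0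
      - ∑ a, ∑ k, pd k (pd a v) 0 ^ 2)
      = (n + 1) * (n ^ 2 * (T * (errConst n K * X))) + n ^ 2 * (T * (K * (1 + n ^ 2) * X))
        - T * ∑ k, pd k v 0 * pd k (testFn G v i₀) 0 - T * ∑ a, ∑ k, pd k (pd a v) 0 ^ 2 := by
    unfold ineqConst
    ring
  rw [s9]
  linarith

end MaximumEstimate

/-! ### From the differential inequality to the bound at an interior maximum. -/

section MaximumBound

/-- The elementary inequality behind the estimate: `y` bounds the localized second derivatives. -/
theorem exists_bound_of_quadratic (n : ℕ) (K L C₁ : ℝ) (hL : 0 ≤ L)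
    (hC₁ : 0 ≤ C₁) (hn : 0 < n) : ∃ C : ℝ, 0 ≤ C ∧ ∀ y b ψ : ℝ, 0 ≤ y → b ≤ 4 * y → 0 ≤ ψ →
      (∀ δ : ℝ, 0 < δ → (y - n * K) ^ 2 / n ^ 2 ≤ 3 * n ^ 2 * L * (4 * y)
        + 3 * n ^ 2 * (4 * y) * (δ * y + L / (4 * δ)) + 4 * ψ * (4 * y) + C₁ * (1 + 2 * y)) →
      b ≤ C * (1 + ψ) := by
  have hn' : (0 : ℝ) < n := by exact_mod_cast hn
  set N : ℝ := (n : ℝ) ^ 2 with hN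
  have hN0 : 0 < N := by positivity
  set A := K ^ 2 + C₁ with hA
  set D := 12 * N * L + 144 * N ^ 3 * L + 2 * C₁ with hD
  have hA0 : 0 ≤ A := by positivity
  have hD0 : 0 ≤ D := by positivity
  refine ⟨4 * (1 + 4 * N * (A + D + 16)), by positivity, fun y b ψ hy hb hψ h => ?_⟩
  -- This δ turns the term 12Nδy² into y²/(4N), half of the y²/(2N) that the left-hand side provides
  -- by `e3`.
  have h1 := h (1 / (48 * N ^ 2)) (by positivity)
  have e1 : L / (4 * (1 / (48 * N ^ 2))) = 12 * N ^ 2 * L := by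
    field_simp
    ring
  have e2 : 3 * N * (4 * y) * (1 / (48 * N ^ 2) * y + 12 * N ^ 2 * L)
      = y ^ 2 / (4 * N) + 144 * N ^ 3 * L * y := by
    field_simp
    ring
  rw [e1, e2] at h1
  have e3 : y ^ 2 / (2 * N) - K ^ 2 ≤ (y - n * K) ^ 2 / N := by
    have : (y - n * K) ^ 2 / N - (y ^ 2 / (2 * N) - K ^ 2)
        = (y - 2 * (n * K)) ^ 2 / (2 * N) := by
      rw [hN]
      field_simp
      ring
    have : 0 ≤ (y - 2 * (n * K)) ^ 2 / (2 * N) := by positivity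
    linarith
  have e4 : y ^ 2 / (2 * N) = y ^ 2 / (4 * N) + y ^ 2 / (4 * N) := by
    field_simp
    ring
  have h2 : y ^ 2 / (4 * N) ≤ A + (D + 16 * ψ) * y := by
    rw [hA, hD]
    linarith
  rw [div_le_iff₀ (by positivity)] at h2
  have hy1 : y ≤ 1 + 4 * N * (A + D + 16) * (1 + ψ) := by
    rcases le_or_gt y 1 with h3 | h3
    · have : 0 ≤ 4 * N * (A + D + 16) * (1 + ψ) := by positivity
      linarith
    · have h4 : y * y ≤ y * ((A + (D + 16 * ψ)) * (4 * N)) := by nlinarith [mul_nonneg hA0 hN0.le]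
      have h5 := le_of_mul_le_mul_left h4 (by linarith)
      have h6 : (A + (D + 16 * ψ)) * (4 * N) ≤ 4 * N * (A + D + 16) * (1 + ψ) := by
        nlinarith [mul_nonneg (mul_nonneg hN0.le hA0) hψ, mul_nonneg (mul_nonneg hN0.le hD0) hψ]
      linarith
  nlinarith

variable {n : ℕ} {U : Set (EuclideanSpace ℝ (Fin n))}
  {G : EuclideanSpace ℝ (Fin n) → Matrix (Fin n) (Fin n) ℝ}
  {v w η : EuclideanSpace ℝ (Fin n) → ℝ} {K L β ρ s : ℝ} {i₀ : Fin n}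

/-- The sum of the absolute values of the second derivatives at the origin. -/
def hessSum (v : EuclideanSpace ℝ (Fin n) → ℝ) : ℝ := ∑ k, ∑ l, |pd k (pd l v) 0|

theorem hessSum_nonneg : 0 ≤ hessSum v :=
  Finset.sum_nonneg fun _ _ => Finset.sum_nonneg fun _ _ => abs_nonneg _

theorem hessSum_sq_le : hessSum v ^ 2 ≤ n ^ 2 * ∑ a, ∑ k, pd k (pd a v) 0 ^ 2 := by
  have := sq_sum_le_card_mul_sum_sq (s := (Finset.univ : Finset (Fin n × Fin n)))
    (f := fun q => |pd q.1 (pd q.2 v) 0|)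
  simp only [Fintype.sum_prod_type, sq_abs, Finset.card_univ, Fintype.card_prod,
    Fintype.card_fin] at this
  rw [Finset.sum_comm (s := (Finset.univ : Finset (Fin n)))]
  rw [hessSum, pow_two (n : ℝ)]
  exact_mod_cast this

theorem abs_diag_sum_le : |∑ k, pd k (pd k v) 0| ≤ hessSum v :=
  (Finset.abs_sum_le_sum_abs _ _).trans (Finset.sum_le_sum fun k _ =>
    Finset.single_le_sum (f := fun l => |pd k (pd l v) 0|) (fun _ _ => abs_nonneg _)
      (Finset.mem_univ k))

theorem abs_hess_le_hessSum (k l : Fin n) : |pd k (pd l v) 0| ≤ hessSum v :=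
  (Finset.single_le_sum (f := fun l => |pd k (pd l v) 0|) (fun _ _ => abs_nonneg _)
      (Finset.mem_univ l)).trans (Finset.single_le_sum
        (f := fun k => ∑ l, |pd k (pd l v) 0|)
        (fun _ _ => Finset.sum_nonneg fun _ _ => abs_nonneg _) (Finset.mem_univ k))

/-- Positivity of `σ₁` bounds the gradient by the second derivatives. -/
theorem IsNormal.sum_sq_le_hessSum (hn : 4 < n) (hG : IsNormal U G) (hb : JetBound G K)
    (hσ : 0 < ((G 0)⁻¹ * wTensor G v 0).trace) :
    ∑ k, pd k v 0 ^ 2 ≤ hessSum v + n * K := by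
  have hn' : (5 : ℝ) ≤ n := by exact_mod_cast hn
  have h1 : ((G 0)⁻¹ * wTensor G v 0).trace = ∑ k, pd k (pd k v) 0 + ∑ k, pd k v 0 ^ 2
      - n * ((∑ k, pd k v 0 ^ 2) / 2) + ∑ k, schouten G 0 k k := by
    rw [hG.inv_eq_one, one_mul]
    simp only [wTensor, hG.eq_one, hG.gradNormSq_eq, Matrix.trace_add, Matrix.trace_sub,
      Matrix.trace_smul, Matrix.trace_one, Fintype.card_fin, smul_eq_mul]
    simp only [Matrix.trace, Matrix.diag_apply, hG.vTensor_apply, Finset.sum_add_distrib, ← pow_two]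
    ring
  have h2 := le_of_abs_le (abs_diag_sum_le (v := v))
  have h3 : ∑ k, schouten G 0 k k ≤ n * K :=
    le_of_abs_le (abs_sum_le_card_mul _ fun k => hb.schouten_zero k k)
  have h4 : 0 ≤ ∑ k, pd k v 0 ^ 2 := Finset.sum_nonneg fun _ _ => sq_nonneg _
  nlinarith

theorem IsNormal.testFn_le (hG : IsNormal U G) :
    testFn G v i₀ 0 ≤ 2 * hessSum v + 2 * ∑ k, pd k v 0 ^ 2 := by
  rw [hG.testFn_eq, sum_testWeight]
  simp only [hG.vTensor_apply, Finset.sum_add_distrib, ← pow_two]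
  have h1 := le_of_abs_le (abs_diag_sum_le (v := v))
  have h2 := le_of_abs_le (abs_hess_le_hessSum (v := v) i₀ i₀)
  have h3 := Finset.single_le_sum (f := fun k => pd k v 0 ^ 2) (fun _ _ => sq_nonneg _)
    (Finset.mem_univ i₀)
  linarith

set_option maxHeartbeats 1000000 in
/-- The bound at an interior maximum of `η Q`, where `Q` is `testFn`. -/
theorem exists_maximum_estimate (n : ℕ) (hn : 4 < n) (K L : ℝ) (hK : 0 ≤ K) (hL : 0 ≤ L) :
    ∃ C : ℝ, 0 ≤ C ∧ ∀ (U : Set (EuclideanSpace ℝ (Fin n)))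
      (G : EuclideanSpace ℝ (Fin n) → Matrix (Fin n) (Fin n) ℝ)
      (v w η : EuclideanSpace ℝ (Fin n) → ℝ) (β ρ s : ℝ) (i₀ : Fin n),
      IsNormal U G → JetBound G K → (∀ z ∈ U, G z i₀ i₀ ≠ 0) →
      ContDiffOn ℝ ∞ v U → ContDiffOn ℝ ∞ w U → ContDiffOn ℝ ∞ η U → 1 ≤ β ∧ β ≤ 2 → 0 ≤ ρ →
      (∀ z ∈ U, 0 < ((G z)⁻¹ * wTensor G v z).trace) →
      (∀ z ∈ U, w z = sigmaTwo ((G z)⁻¹ * wTensor G v z) / ((G z)⁻¹ * wTensor G v z).trace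
        - (ρ * Real.exp (-β * v z)) ^ 2 / ((G z)⁻¹ * wTensor G v z).trace + s) →
      0 < η 0 → η 0 ≤ 1 → (∀ m, pd m η 0 ^ 2 ≤ L * η 0) → (∀ l m, |pd l (pd m η) 0| ≤ L) →
      IsLocalMax (fun z => η z * testFn G v i₀ z) 0 →
      0 ≤ ∑ a, testWeight i₀ a * (pd a (pd a w) 0 + 2 * pd a v 0 * pd a w 0) →
      η 0 * testFn G v i₀ 0 ≤ C * (1 + ρ * Real.exp (-β * v 0)) := by
  obtain ⟨C, hC, hbound⟩ := exists_bound_of_quadratic n K L (ineqConst n K) hL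
    (ineqConst_nonneg hK) (by omega)
  refine ⟨C, hC, ?_⟩
  intro U G v w η β ρ s i₀ hG hb hi hv hw hη hβ hρ hσ hweq hη0 hη1 hηd hηdd hmax hpos
  have hU := hG.isMetricOn.isOpen
  have h0 := hG.zero_mem
  have hQ := testFn_smooth hG.isMetricOn hv hi
  have hDI := hG.sum_testWeight_mul_le hn hb hK hi hv hw hβ hσ hweq
  have hB00 : (G 0)⁻¹ * wTensor G v 0 = wTensor G v 0 := by rw [hG.inv_eq_one, one_mul]
  have hB0 : ∀ i j, ((G 0)⁻¹ * wTensor G v 0) i j = ((G 0)⁻¹ * wTensor G v 0) j i := by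
    rw [hB00]
    exact hG.isMetricOn.wTensor_symm hv h0
  have hσ0 := hσ 0 h0
  set ψ := ρ * Real.exp (-β * v 0) with hψ
  have hψ0 : 0 ≤ ψ := by positivity
  set F := linCoeff ((G 0)⁻¹ * wTensor G v 0) ψ with hF
  set T := F.trace with hT
  have hT1 : 1 ≤ T := one_le_trace_linCoeff hn hB0 hσ0
  have hT0 : 0 < T := by linarith
  have hFT : ∀ i j, |F i j| ≤ T := abs_linCoeff_le hn hB0 hσ0
  have hφ := sq_div_trace_le hn hB0 hσ0 hψ0
  have hp := hG.sum_sq_le_hessSum hn hb hσ0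
  have hq := hG.testFn_le (v := v) (i₀ := i₀)
  set Q := testFn G v i₀ with hQd
  set e := η 0 with he
  set H := hessSum v with hH
  have hH0 : 0 ≤ H := hessSum_nonneg
  set P2 := ∑ k, pd k v 0 ^ 2 with hP2
  have hP20 : 0 ≤ P2 := Finset.sum_nonneg fun _ _ => sq_nonneg _
  -- A single unknown for the quadratic inequality. By positivity of σ₁ it dominates both e|∇²v| and
  -- e|dv|², and hence a quarter of e times the test function.
  set y := e * H + n * K with hy
  have hnK : 0 ≤ (n : ℝ) * K := by positivity
  have hy0 : 0 ≤ y := by positivity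
  have heP : e * P2 ≤ y := by nlinarith only [hη1, hη0, hp, hnK, hy]
  have hb4 : e * Q 0 ≤ 4 * y := by nlinarith only [hη1, hη0, hp, hnK, hy, hq]
  rcases le_or_gt (Q 0) 0 with hQ0 | hQ0
  · have h1 : e * Q 0 ≤ 0 := mul_nonpos_of_nonneg_of_nonpos hη0.le hQ0
    have h2 : 0 ≤ C * (1 + ψ) := by positivity
    linarith
  refine hbound y (e * Q 0) ψ hy0 hb4 hψ0 fun δ hδ => ?_
  set b := e * Q 0 with hbd
  have hb0 : 0 < b := mul_pos hη0 hQ0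
  have hfirst : ∀ m, e * pd m Q 0 = - (pd m η 0 * Q 0) := by
    intro m
    have := IsLocalMax.pd_eq_zero hmax m
    rw [pd_mul hU hη hQ h0] at this
    linarith
  have hsecond : ∑ l, ∑ m, F l m * pd l (pd m fun z => η z * Q z) 0 ≤ 0 :=
    sum_mul_nonpos_of_posSemidef (P := Matrix.of fun l m => pd l (pd m fun z => η z * Q z) 0)
      (linCoeff_posSemidef hB0 hσ0) (IsLocalMax.sum_pd_pd_nonpos hU (hη.mul hQ) h0 hmax)
  -- At the maximum e ∂Q = -Q ∂η, so derivatives of Q are traded for derivatives of the cutoff. The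
  -- factor e² is what is needed to clear the divisions by e.
  have hS : e ^ 2 * ∑ l, ∑ m, F l m * pd l (pd m Q) 0
      = e * ∑ l, ∑ m, F l m * pd l (pd m fun z => η z * Q z) 0
        + b * (2 * ∑ l, ∑ m, F l m * (pd l η 0 * pd m η 0 / e)
          - ∑ l, ∑ m, F l m * pd l (pd m η) 0) := by
    simp only [Finset.mul_sum, ← Finset.sum_add_distrib, ← Finset.sum_sub_distrib]
    refine Finset.sum_congr rfl fun l _ => Finset.sum_congr rfl fun m _ => ?_
    rw [pd_pd_mul hU hη hQ h0]
    have h1 := hfirst l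
    have h2 := hfirst m
    have h3 : e * (pd l η 0 * pd m η 0 / e) = pd l η 0 * pd m η 0 := by field_simp
    rw [hbd]
    linear_combination (F l m) * (-(pd l η 0) * h2 - pd m η 0 * h1 - 2 * Q 0 * h3)
  have hS1 : |∑ l, ∑ m, F l m * (pd l η 0 * pd m η 0 / e)| ≤ n ^ 2 * (T * L) := by
    refine abs_sum_sum_mul_le hFT fun l m => ?_
    rw [abs_div, abs_of_pos hη0, div_le_iff₀ hη0, abs_mul]
    nlinarith only [sq_nonneg (|pd l η 0| - |pd m η 0|), sq_abs (pd l η 0), sq_abs (pd m η 0), hηd l,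
      hηd m]
  have hS2 : |∑ l, ∑ m, F l m * pd l (pd m η) 0| ≤ n ^ 2 * (T * L) :=
    abs_sum_sum_mul_le hFT hηdd
  -- Young's inequality with free δ. This product is later multiplied by b, itself of size y, so the
  -- part δy has to be small relative to the good term y²/n². The hypothesis |∂η|² ≤ Lη keeps the
  -- other part bounded.
  have hpη : ∀ k m, |pd k v 0 * pd m η 0| ≤ δ * y + L / (4 * δ) := by
    intro k m
    have h1 : pd k v 0 ^ 2 ≤ P2 := Finset.single_le_sum (f := fun k => pd k v 0 ^ 2)
      (fun _ _ => sq_nonneg _) (Finset.mem_univ k)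
    have h2 : e * pd k v 0 ^ 2 ≤ y := (mul_le_mul_of_nonneg_left h1 hη0.le).trans heP
    have h3 : pd m η 0 ^ 2 / e ≤ L := by
      rw [div_le_iff₀ hη0]
      exact hηd m
    have h4 : |pd k v 0 * pd m η 0| ≤ δ * (e * pd k v 0 ^ 2) + pd m η 0 ^ 2 / e / (4 * δ) := by
      have : δ * (e * pd k v 0 ^ 2) + pd m η 0 ^ 2 / e / (4 * δ) - |pd k v 0| * |pd m η 0|
          = (2 * δ * e * |pd k v 0| - |pd m η 0|) ^ 2 / (4 * δ * e) := by
        rw [← sq_abs (pd k v 0), ← sq_abs (pd m η 0)]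
        field_simp
        ring
      have : 0 ≤ (2 * δ * e * |pd k v 0| - |pd m η 0|) ^ 2 / (4 * δ * e) := by positivity
      rw [abs_mul]
      linarith
    refine h4.trans (add_le_add (mul_le_mul_of_nonneg_left h2 hδ.le) ?_)
    gcongr
  set Z := δ * y + L / (4 * δ) with hZ
  have hZ0 : 0 ≤ Z := by positivity
  have hG1 : e ^ 2 * ∑ l, ∑ m, F l m * (pd l v 0 * pd m Q 0)
      = - (b * ∑ l, ∑ m, F l m * (pd l v 0 * pd m η 0)) := by
    rw [← mul_neg, ← Finset.sum_neg_distrib]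
    simp only [← Finset.sum_neg_distrib, Finset.mul_sum]
    refine Finset.sum_congr rfl fun l _ => Finset.sum_congr rfl fun m _ => ?_
    rw [hbd]
    linear_combination (e * F l m * pd l v 0) * hfirst m
  have hG1b : |∑ l, ∑ m, F l m * (pd l v 0 * pd m η 0)| ≤ n ^ 2 * (T * Z) :=
    abs_sum_sum_mul_le hFT hpη
  have hG2 : e ^ 2 * ∑ k, pd k v 0 * pd k Q 0 = - (b * ∑ k, pd k v 0 * pd k η 0) := by
    rw [← mul_neg, ← Finset.sum_neg_distrib]
    simp only [Finset.mul_sum]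
    refine Finset.sum_congr rfl fun k _ => ?_
    rw [hbd]
    linear_combination (e * pd k v 0) * hfirst k
  have hG2b : |∑ k, pd k v 0 * pd k η 0| ≤ n * Z := abs_sum_le_card_mul _ fun k => hpη k k
  -- The good term bounds the square of the sum of the absolute second derivatives, at the cost of
  -- the factor n² from Cauchy–Schwarz.
  have hN : (y - n * K) ^ 2 / n ^ 2 ≤ e ^ 2 * ∑ a, ∑ k, pd k (pd a v) 0 ^ 2 := by
    have hn' : (0 : ℝ) < n := by exact_mod_cast (by omega : 0 < n)
    rw [div_le_iff₀ (by positivity), hy, add_sub_cancel_right, mul_pow, mul_assoc, mul_comm _ ((n : ℝ) ^ 2)]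
    exact mul_le_mul_of_nonneg_left hessSum_sq_le (sq_nonneg e)
  have hX : jetSize v = 1 + P2 + H := rfl
  have hI := ineqConst_nonneg (n := n) hK
  have hXe : e ^ 2 * (ineqConst n K * jetSize v) ≤ ineqConst n K * (1 + 2 * y) := by
    have h1 : e ^ 2 * jetSize v ≤ 1 + 2 * y := by
      have h2 : e ^ 2 ≤ e := by nlinarith only [hη0, hη1]
      have h3 : e ^ 2 * jetSize v ≤ e * jetSize v :=
        mul_le_mul_of_nonneg_right h2 (by rw [hX]; linarith)
      rw [hX] at h3 ⊢
      have : e * H ≤ y := by linarith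
      linarith
    calc _ = ineqConst n K * (e ^ 2 * jetSize v) := by ring
      _ ≤ _ := mul_le_mul_of_nonneg_left h1 hI
  have hφe : e ^ 2 * (2 * β * (ψ ^ 2 / ((G 0)⁻¹ * wTensor G v 0).trace) * Q 0)
      ≤ T * (4 * ψ * b) := by
    have h1 : 2 * β * (ψ ^ 2 / ((G 0)⁻¹ * wTensor G v 0).trace) ≤ 4 * (ψ * T) := by
      have : 0 ≤ ψ ^ 2 / ((G 0)⁻¹ * wTensor G v 0).trace := by positivity
      nlinarith only [hβ.2, hφ, this]
    have h2 : e ^ 2 * Q 0 ≤ b := by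
      rw [hbd]
      nlinarith only [hη1, hb0, hbd]
    have h3 : 0 ≤ e ^ 2 * Q 0 := by positivity
    calc _ = (2 * β * (ψ ^ 2 / ((G 0)⁻¹ * wTensor G v 0).trace)) * (e ^ 2 * Q 0) := by ring
      _ ≤ (4 * (ψ * T)) * b := mul_le_mul h1 h2 h3 (by positivity)
      _ = _ := by ring
  have htotal := mul_nonneg (sq_nonneg e) (hpos.trans hDI)
  have hbS1 := mul_le_mul_of_nonneg_left (le_of_abs_le hS1) hb0.le
  have hbS2 := mul_le_mul_of_nonneg_left (neg_le_of_abs_le hS2) hb0.le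
  have hbG1 := mul_le_mul_of_nonneg_left (neg_le_of_abs_le hG1b) hb0.le
  have hbG2 := mul_le_mul_of_nonneg_left (le_of_abs_le hG2b) (mul_pos hT0 hb0).le
  have heF := mul_nonpos_of_nonneg_of_nonpos hη0.le hsecond
  have hXeT := mul_le_mul_of_nonneg_left hXe hT0.le
  have hNT := mul_le_mul_of_nonneg_left hN hT0.le
  -- Every term now has the factor T, whose size is unknown; the estimate closes because it can be
  -- divided out.
  have hTe : T * ((y - n * K) ^ 2 / n ^ 2) ≤ T * (3 * n ^ 2 * L * b
      + (2 * n ^ 2 + n) * b * Z + 4 * ψ * b + ineqConst n K * (1 + 2 * y)) := by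
    have hexp : e ^ 2 * (∑ i, ∑ j, F i j * pd i (pd j Q) 0
        + 2 * ∑ i, ∑ j, F i j * (pd i v 0 * pd j Q 0)
        + T * (ineqConst n K * jetSize v - ∑ k, pd k v 0 * pd k Q 0
            - ∑ a, ∑ k, pd k (pd a v) 0 ^ 2)
        + 2 * β * (ψ ^ 2 / ((G 0)⁻¹ * wTensor G v 0).trace) * Q 0)
        = e ^ 2 * ∑ i, ∑ j, F i j * pd i (pd j Q) 0
          + 2 * (e ^ 2 * ∑ i, ∑ j, F i j * (pd i v 0 * pd j Q 0))
          + T * (e ^ 2 * (ineqConst n K * jetSize v)) - T * (e ^ 2 * ∑ k, pd k v 0 * pd k Q 0)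
          - T * (e ^ 2 * ∑ a, ∑ k, pd k (pd a v) 0 ^ 2)
          + e ^ 2 * (2 * β * (ψ ^ 2 / ((G 0)⁻¹ * wTensor G v 0).trace) * Q 0) := by ring
    rw [hexp, hS, hG1, hG2] at htotal
    linarith only [htotal, hbS1, hbS2, hbG1, hbG2, heF, hXeT, hNT, hφe]
  have hfin := le_of_mul_le_mul_left hTe hT0
  have hnn : (n : ℝ) ≤ n ^ 2 := by
    have : (1 : ℝ) ≤ n := by exact_mod_cast (by omega : 1 ≤ n)
    exact le_self_pow₀ this two_ne_zero
  clear_value Z b y P2 H e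
  have hbZ : (2 * n ^ 2 + n) * b * Z ≤ 3 * n ^ 2 * (4 * y) * Z := by
    refine mul_le_mul_of_nonneg_right ?_ hZ0
    exact mul_le_mul (by linarith only [hnn]) hb4 hb0.le (by positivity)
  have hbL : 3 * n ^ 2 * L * b ≤ 3 * n ^ 2 * L * (4 * y) :=
    mul_le_mul_of_nonneg_left hb4 (by positivity)
  have hbψ : 4 * ψ * b ≤ 4 * ψ * (4 * y) := mul_le_mul_of_nonneg_left hb4 (by positivity)
  linarith only [hfin, hbZ, hbL, hbψ]

end MaximumBound

end SigmaTwoFlow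

end

noncomputable section

namespace SigmaTwoFlow

/-! ### The metric in charts -/

section Charts

variable {n : ℕ} {M : Type*} [TopologicalSpace M] [ChartedSpace (EuclideanSpace ℝ (Fin n)) M]
  [IsManifold (𝓡 n) ∞ M]

/-- The scalar product at `x`, on the model space. -/
def metricAt (g₀ : SmoothMetric n M) (x : M) :
    EuclideanSpace ℝ (Fin n) →L[ℝ] EuclideanSpace ℝ (Fin n) →L[ℝ] ℝ := g₀.inner x

/-- The derivative of the inverse chart, on the model space. -/
def chartDeriv (c : M) (y : EuclideanSpace ℝ (Fin n)) :
    EuclideanSpace ℝ (Fin n) →L[ℝ] EuclideanSpace ℝ (Fin n) :=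
  mfderiv 𝓘(ℝ, EuclideanSpace ℝ (Fin n)) (𝓡 n) (extChartAt (𝓡 n) c).symm y

/-- The coordinate change from the chart at `c` to the chart at `c'`. -/
def transition (c c' : M) (y : EuclideanSpace ℝ (Fin n)) : EuclideanSpace ℝ (Fin n) :=
  extChartAt (𝓡 n) c' ((extChartAt (𝓡 n) c).symm y)

/-- The part of the chart at `c` that lies in the chart at `c'`. -/
def overlap (n : ℕ) {M : Type*} [TopologicalSpace M] [ChartedSpace (EuclideanSpace ℝ (Fin n)) M]
    (c c' : M) : Set (EuclideanSpace ℝ (Fin n)) :=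
  (extChartAt (𝓡 n) c).target ∩ (extChartAt (𝓡 n) c).symm ⁻¹' (extChartAt (𝓡 n) c').source

variable (g₀ : SmoothMetric n M) (c c' : M)

theorem gram_apply (y : EuclideanSpace ℝ (Fin n)) (i j : Fin n) :
    gram g₀ c y i j = metricAt g₀ ((extChartAt (𝓡 n) c).symm y)
      (chartDeriv c y (EuclideanSpace.single i 1)) (chartDeriv c y (EuclideanSpace.single j 1)) :=
  rfl

theorem metricAt_symm (x : M) (v w : EuclideanSpace ℝ (Fin n)) :
    metricAt g₀ x v w = metricAt g₀ x w v := g₀.symm x v w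

theorem metricAt_pos (x : M) {v : EuclideanSpace ℝ (Fin n)} (hv : v ≠ 0) :
    0 < metricAt g₀ x v v := g₀.pos x v hv

omit [IsManifold (𝓡 n) ∞ M] in
theorem isOpen_target : IsOpen (extChartAt (𝓡 n) c).target :=
  isOpen_extChartAt_target c

omit [IsManifold (𝓡 n) ∞ M] in
theorem isOpen_overlap : IsOpen (overlap n c c') :=
  (continuousOn_extChartAt_symm c).isOpen_inter_preimage (isOpen_target c)
    (isOpen_extChartAt_source c')

theorem symm_smooth : ContMDiffOn 𝓘(ℝ, EuclideanSpace ℝ (Fin n)) (𝓡 n) ∞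
    (extChartAt (𝓡 n) c).symm (extChartAt (𝓡 n) c).target :=
  contMDiffOn_extChartAt_symm c

theorem symm_mdifferentiableAt {y : EuclideanSpace ℝ (Fin n)}
    (hy : y ∈ (extChartAt (𝓡 n) c).target) :
    MDifferentiableAt 𝓘(ℝ, EuclideanSpace ℝ (Fin n)) (𝓡 n) (extChartAt (𝓡 n) c).symm y :=
  ((symm_smooth c).contMDiffAt ((isOpen_target c).mem_nhds hy)).mdifferentiableAt (by simp)

theorem chart_mdifferentiableAt {x : M} (hx : x ∈ (extChartAt (𝓡 n) c).source) :
    MDifferentiableAt (𝓡 n) 𝓘(ℝ, EuclideanSpace ℝ (Fin n)) (extChartAt (𝓡 n) c) x :=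
  mdifferentiableAt_extChartAt (by simpa using hx)

theorem smooth_in_chart {f : M → ℝ} (hf : ContMDiff (𝓡 n) 𝓘(ℝ, ℝ) ∞ f) :
    ContDiffOn ℝ ∞ (fun y => f ((extChartAt (𝓡 n) c).symm y)) (extChartAt (𝓡 n) c).target :=
  (hf.comp_contMDiffOn (symm_smooth c)).contDiffOn

theorem transition_smooth : ContDiffOn ℝ ∞ (transition c c') (overlap n c c') := by
  have h1 : ContMDiffOn (𝓡 n) 𝓘(ℝ, EuclideanSpace ℝ (Fin n)) ∞ (extChartAt (𝓡 n) c')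
      (extChartAt (𝓡 n) c').source := by
    rw [extChartAt_source]
    exact contMDiffOn_extChartAt
  exact (h1.comp ((symm_smooth c).mono inter_subset_left) fun y hy => hy.2).contDiffOn

omit [IsManifold (𝓡 n) ∞ M] in
theorem transition_mapsTo : MapsTo (transition c c') (overlap n c c') (overlap n c' c) := by
  intro y hy
  refine ⟨(extChartAt (𝓡 n) c').map_source hy.2, ?_⟩
  rw [mem_preimage, transition, (extChartAt (𝓡 n) c').left_inv hy.2]
  exact (extChartAt (𝓡 n) c).map_target hy.1

omit [IsManifold (𝓡 n) ∞ M] in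
theorem transition_transition {y : EuclideanSpace ℝ (Fin n)} (hy : y ∈ overlap n c c') :
    transition c' c (transition c c' y) = y := by
  rw [transition, transition, (extChartAt (𝓡 n) c').left_inv hy.2,
    (extChartAt (𝓡 n) c).right_inv hy.1]

omit [IsManifold (𝓡 n) ∞ M] in
theorem symm_transition {y : EuclideanSpace ℝ (Fin n)} (hy : y ∈ overlap n c c') :
    (extChartAt (𝓡 n) c').symm (transition c c' y) = (extChartAt (𝓡 n) c).symm y := by
  rw [transition, (extChartAt (𝓡 n) c').left_inv hy.2]

theorem fderiv_single_eq_sum {Φ : EuclideanSpace ℝ (Fin n) → EuclideanSpace ℝ (Fin n)}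
    {y : EuclideanSpace ℝ (Fin n)} (h : DifferentiableAt ℝ Φ y) (a : Fin n) :
    fderiv ℝ Φ y (EuclideanSpace.single a 1)
      = ∑ i, jac Φ y i a • EuclideanSpace.single i (1 : ℝ) := by
  ext i
  have h1 : jac Φ y i a = fderiv ℝ Φ y (EuclideanSpace.single a 1) i := by
    have := ((EuclideanSpace.proj (𝕜 := ℝ) i).hasFDerivAt.comp y h.hasFDerivAt).fderiv
    change fderiv ℝ (fun z => Φ z i) y (EuclideanSpace.single a 1) = _
    rw [show (fun z => Φ z i) = (EuclideanSpace.proj (𝕜 := ℝ) i) ∘ Φ from rfl, this]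
    rfl
  rw [WithLp.ofLp_sum, Finset.sum_apply]
  simp [h1]

theorem isCoordChange_transition :
    IsCoordChange (overlap n c c') (extChartAt (𝓡 n) c').target (transition c c') where
  isOpen_source := isOpen_overlap c c'
  isOpen_target := isOpen_target c'
  smooth := transition_smooth c c'
  mapsTo := fun _ hy => (transition_mapsTo c c' hy).1
  det_ne_zero y hy := by
    have h1 := ((transition_smooth c c').contDiffAt ((isOpen_overlap c c').mem_nhds hy))
      |>.differentiableAt (by simp)
    have hy' := transition_mapsTo c c' hy
    have h2 := ((transition_smooth c' c).contDiffAt ((isOpen_overlap c' c).mem_nhds hy'))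
      |>.differentiableAt (by simp)
    have h3 : fderiv ℝ (transition c' c ∘ transition c c') y = ContinuousLinearMap.id ℝ _ := by
      have : transition c' c ∘ transition c c' =ᶠ[𝓝 y] id :=
        Filter.eventually_of_mem ((isOpen_overlap c c').mem_nhds hy)
          fun z hz => transition_transition c c' hz
      rw [this.fderiv_eq, fderiv_id]
    have h4 : jac (transition c' c) (transition c c' y) * jac (transition c c') y = 1 := by
      ext i a
      have h5 := congrArg (fun L => (L (EuclideanSpace.single a (1 : ℝ))) i) h3
      simp only [fderiv_comp y h2 h1, ContinuousLinearMap.comp_apply, fderiv_single_eq_sum h1,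
        map_sum, map_smul, fderiv_single_eq_sum h2, ContinuousLinearMap.id_apply] at h5
      rw [WithLp.ofLp_sum, Finset.sum_apply] at h5
      simp only [WithLp.ofLp_smul, WithLp.ofLp_sum, Pi.smul_apply, Finset.sum_apply, smul_eq_mul]
        at h5
      rw [Matrix.mul_apply, Matrix.one_apply]
      simpa [PiLp.single_apply, mul_comm, eq_comm] using h5
    exact right_ne_zero_of_mul (a := (jac (transition c' c) (transition c c' y)).det)
      (by rw [← Matrix.det_mul, h4, Matrix.det_one]; exact one_ne_zero)

theorem chartDeriv_transition {y : EuclideanSpace ℝ (Fin n)} (hy : y ∈ overlap n c c')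
    (v : EuclideanSpace ℝ (Fin n)) :
    chartDeriv c y v = chartDeriv c' (transition c c' y) (fderiv ℝ (transition c c') y v) := by
  have h1 := ((transition_smooth c c').contDiffAt ((isOpen_overlap c c').mem_nhds hy))
      |>.differentiableAt (by simp)
  have h2 : (extChartAt (𝓡 n) c).symm =ᶠ[𝓝 y]
      (extChartAt (𝓡 n) c').symm ∘ transition c c' :=
    Filter.eventually_of_mem ((isOpen_overlap c c').mem_nhds hy)
      fun z hz => (symm_transition c c' hz).symm
  have h3 := mfderiv_comp y (symm_mdifferentiableAt c' (transition_mapsTo c c' hy).1)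
    h1.mdifferentiableAt
  unfold chartDeriv
  rw [h2.mfderiv_eq, h3, mfderiv_eq_fderiv]
  rfl

theorem gram_eq_pullback {y : EuclideanSpace ℝ (Fin n)} (hy : y ∈ overlap n c c') :
    gram g₀ c y = pullback (transition c c') (gram g₀ c') y := by
  have h1 := ((transition_smooth c c').contDiffAt ((isOpen_overlap c c').mem_nhds hy))
      |>.differentiableAt (by simp)
  ext a b
  rw [gram_apply, chartDeriv_transition c c' hy, chartDeriv_transition c c' hy,
    fderiv_single_eq_sum h1, fderiv_single_eq_sum h1, ← symm_transition c c' hy]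
  simp only [map_sum, map_smul, sum_apply, smul_apply,
    smul_eq_mul, pullback, Matrix.mul_apply, Matrix.transpose_apply, ← gram_apply, Finset.sum_mul]
  exact Finset.sum_congr rfl fun i _ => by
    rw [Finset.mul_sum]
    exact Finset.sum_congr rfl fun j _ => by ring

theorem chartDeriv_injective {y : EuclideanSpace ℝ (Fin n)}
    (hy : y ∈ (extChartAt (𝓡 n) c).target) {v : EuclideanSpace ℝ (Fin n)} (hv : v ≠ 0) :
    chartDeriv c y v ≠ 0 := by
  intro h
  have h2 : (extChartAt (𝓡 n) c) ∘ (extChartAt (𝓡 n) c).symm =ᶠ[𝓝 y] id :=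
    Filter.eventually_of_mem ((isOpen_target c).mem_nhds hy)
      fun z hz => (extChartAt (𝓡 n) c).right_inv hz
  have h3 := mfderiv_comp y (chart_mdifferentiableAt c ((extChartAt (𝓡 n) c).map_target hy))
    (symm_mdifferentiableAt c hy)
  rw [h2.mfderiv_eq, mfderiv_id] at h3
  apply hv
  have h4 := congrArg (fun L : EuclideanSpace ℝ (Fin n) →L[ℝ] EuclideanSpace ℝ (Fin n) => L v) h3
  change v = mfderiv _ _ _ _ (chartDeriv c y v) at h4
  rw [h4, h]
  exact map_zero _

/-- The coordinate fields are images of constant fields under the tangent map of the inverse chart,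
hence smooth sections along it. The inner product of smooth sections is smooth. -/
theorem gram_smooth : MSmooth (extChartAt (𝓡 n) c).target (gram g₀ c) := by
  intro i j
  let : Bundle.RiemannianBundle (fun x : M => TangentSpace (𝓡 n) x) := ⟨g₀.toRiemannianMetric⟩
  have hs : ∀ i : Fin n, ContMDiffOn 𝓘(ℝ, EuclideanSpace ℝ (Fin n)) (𝓡 n).tangent ∞
      (fun y => (⟨(extChartAt (𝓡 n) c).symm y,
        mfderiv 𝓘(ℝ, EuclideanSpace ℝ (Fin n)) (𝓡 n) (extChartAt (𝓡 n) c).symm y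
        (EuclideanSpace.single i (1 : ℝ))⟩ : TangentBundle (𝓡 n) M))
      (extChartAt (𝓡 n) c).target := by
    intro i
    have h1 := (symm_smooth (n := n) c).contMDiffOn_tangentMapWithin (m := ∞) (by simp)
      (isOpen_target c).uniqueMDiffOn
    have h2 : ContMDiffOn 𝓘(ℝ, EuclideanSpace ℝ (Fin n))
        𝓘(ℝ, EuclideanSpace ℝ (Fin n)).tangent ∞
        (fun y => (⟨y, (EuclideanSpace.single i (1 : ℝ) : EuclideanSpace ℝ (Fin n))⟩ :
          TangentBundle 𝓘(ℝ, EuclideanSpace ℝ (Fin n)) (EuclideanSpace ℝ (Fin n))))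
        (extChartAt (𝓡 n) c).target := fun y _ =>
      contMDiffWithinAt_vectorSpace_iff_contDiffWithinAt.2 contDiffWithinAt_const
    refine (h1.comp h2 fun y hy => hy).congr fun y hy => ?_
    simp only [Function.comp_apply, tangentMapWithin]
    rw [mfderivWithin_of_isOpen (isOpen_target c) hy]
  have := ContMDiffOn.inner_bundle (n := ∞) (hs i) (hs j)
  exact this.contDiffOn

theorem metricAt_eq_sum (y v w : EuclideanSpace ℝ (Fin n)) :
    metricAt g₀ ((extChartAt (𝓡 n) c).symm y) (chartDeriv c y v) (chartDeriv c y w)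
      = ∑ i, ∑ j, gram g₀ c y i j * (v i * w j) := by
  have hv : ∀ v : EuclideanSpace ℝ (Fin n), v = ∑ i, v i • EuclideanSpace.single i (1 : ℝ) := by
    intro v
    ext j
    rw [WithLp.ofLp_sum, Finset.sum_apply]
    simp
  conv_lhs => rw [hv v, hv w]
  simp only [map_sum, map_smul, sum_apply, smul_apply,
    smul_eq_mul, ← gram_apply, Finset.mul_sum]
  rw [Finset.sum_comm]
  exact Finset.sum_congr rfl fun i _ => Finset.sum_congr rfl fun j _ => by ring

theorem gram_pos {y : EuclideanSpace ℝ (Fin n)} (hy : y ∈ (extChartAt (𝓡 n) c).target)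
    {v : EuclideanSpace ℝ (Fin n)} (hv : v ≠ 0) :
    0 < ∑ i, ∑ j, gram g₀ c y i j * (v i * v j) := by
  rw [← metricAt_eq_sum]
  exact metricAt_pos g₀ _ (chartDeriv_injective c hy hv)

theorem gram_posDef {y : EuclideanSpace ℝ (Fin n)} (hy : y ∈ (extChartAt (𝓡 n) c).target) :
    (gram g₀ c y).PosDef := by
  refine Matrix.PosDef.of_dotProduct_mulVec_pos ?_ fun x hx => ?_
  · ext i j
    rw [Matrix.conjTranspose_apply, star_trivial, gram_apply, gram_apply, metricAt_symm]
  · have h1 : (WithLp.toLp 2 x : EuclideanSpace ℝ (Fin n)) ≠ 0 := fun h => hx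
      (by simpa using congrArg WithLp.ofLp h)
    refine lt_of_lt_of_eq (gram_pos g₀ c hy h1) ?_
    simp only [dotProduct, Matrix.mulVec, Finset.mul_sum, star_trivial]
    exact Finset.sum_congr rfl fun i _ => Finset.sum_congr rfl fun j _ => by ring

theorem isMetricOn_gram : IsMetricOn (extChartAt (𝓡 n) c).target (gram g₀ c) where
  isOpen := isOpen_target c
  smooth := gram_smooth g₀ c
  symm y _ := by
    ext i j
    rw [Matrix.transpose_apply, gram_apply, gram_apply, metricAt_symm]
  det_ne_zero y hy := (gram_posDef g₀ c hy).det_pos.ne'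

end Charts

/-! ### Orthonormal frames -/

section Frames

variable {n : ℕ}

/-- A positive definite matrix has an orthonormal frame, with prescribed first vector. -/
theorem exists_frame {G : Matrix (Fin n) (Fin n) ℝ} (hG : G.PosDef) (i₀ : Fin n) (ξ : Fin n → ℝ)
    (hξ : ξ ⬝ᵥ G.mulVec ξ = 1) :
    ∃ A : Fin n → Fin n → ℝ, (Matrix.of A).transpose * G * Matrix.of A = 1 ∧
      ∀ j, A j i₀ = ξ j := by
  obtain ⟨C, rfl⟩ : ∃ C : Matrix (Fin n) (Fin n) ℝ, G = C.transpose * C := by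
    open scoped MatrixOrder Matrix.Norms.L2Operator in
    obtain ⟨C, hC⟩ := CStarAlgebra.nonneg_iff_eq_star_mul_self.mp hG.posSemidef.nonneg
    exact ⟨C, hC⟩
  have hC : C.det ≠ 0 := by
    have := hG.det_pos
    rw [Matrix.det_mul, Matrix.det_transpose] at this
    exact fun h => by simp [h] at this
  have hCu : IsUnit C.det := hC.isUnit
  set e : EuclideanSpace ℝ (Fin n) := WithLp.toLp 2 (C.mulVec ξ) with he
  have hnorm : ‖e‖ = 1 := by
    have : ‖e‖ ^ 2 = 1 := by
      rw [EuclideanSpace.real_norm_sq_eq, ← hξ, ← Matrix.mulVec_mulVec, Matrix.dotProduct_mulVec,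
        ← Matrix.mulVec_transpose, Matrix.transpose_transpose]
      simp [dotProduct, pow_two, he]
    nlinarith [norm_nonneg e]
  have horth : Orthonormal ℝ (({i₀} : Set (Fin n)).domRestrict fun _ : Fin n => e) := by
    rw [orthonormal_iff_ite]
    intro i j
    have : i = j := Subsingleton.elim i j
    simp only [this, if_true]
    change inner ℝ e e = 1
    rw [real_inner_self_eq_norm_sq, hnorm, one_pow]
  obtain ⟨b, hb⟩ := horth.exists_orthonormalBasis_extension_of_card_eq (by simp)
  set O : Matrix (Fin n) (Fin n) ℝ := Matrix.of fun i j => b j i with hO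
  have hOO : O.transpose * O = 1 := by
    ext i j
    have := orthonormal_iff_ite.1 b.orthonormal i j
    rw [Matrix.one_apply, ← this, Matrix.mul_apply]
    simp [hO, PiLp.inner_apply, mul_comm]
  refine ⟨fun i j => (C⁻¹ * O) i j, ?_, fun j => ?_⟩
  · change (C⁻¹ * O).transpose * (C.transpose * C) * (C⁻¹ * O) = 1
    have h1 : C * C⁻¹ = 1 := Matrix.mul_nonsing_inv C hCu
    have h2 : (C⁻¹).transpose * C.transpose = 1 := by
      rw [← Matrix.transpose_mul, h1, Matrix.transpose_one]
    calc _ = O.transpose * ((C⁻¹).transpose * C.transpose) * (C * C⁻¹) * O := by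
          rw [Matrix.transpose_mul]
          noncomm_ring
      _ = 1 := by rw [h1, h2, mul_one, mul_one, hOO]
  · have h1 : ∀ i, O i i₀ = C.mulVec ξ i := fun i => by
      rw [hO, Matrix.of_apply, hb i₀ rfl]
    have : (C⁻¹ * O) j i₀ = C⁻¹.mulVec (C.mulVec ξ) j := by
      simp only [Matrix.mul_apply, h1]
      rfl
    change (C⁻¹ * O) j i₀ = ξ j
    rw [this, Matrix.mulVec_mulVec, Matrix.nonsing_inv_mul C hCu, Matrix.one_mulVec]

theorem exists_unit_vector {G : Matrix (Fin n) (Fin n) ℝ} (hG : G.PosDef) (i₀ : Fin n) :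
    ∃ ξ : Fin n → ℝ, ξ ⬝ᵥ G.mulVec ξ = 1 := by
  have h : 0 < G i₀ i₀ := hG.diag_pos
  refine ⟨Pi.single i₀ (Real.sqrt (G i₀ i₀))⁻¹, ?_⟩
  rw [single_dotProduct, Matrix.mulVec, dotProduct_single, mul_left_comm, ← mul_inv,
    Real.mul_self_sqrt h.le, mul_inv_cancel₀ h.ne']

end Frames

end SigmaTwoFlow

end

noncomputable section

namespace SigmaTwoFlow

/-! ### Locality of the curvature operators -/

section Locality

variable {n : ℕ} {U V : Set (EuclideanSpace ℝ (Fin n))} {y : EuclideanSpace ℝ (Fin n)}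
  {G G' : EuclideanSpace ℝ (Fin n) → Matrix (Fin n) (Fin n) ℝ}
  {f f' : EuclideanSpace ℝ (Fin n) → ℝ}

theorem christoffel_congr_on (hU : IsOpen U) (h : EqOn G G' U) (k i j : Fin n) :
    EqOn (christoffel G k i j) (christoffel G' k i j) U := by
  intro z hz
  have hp : ∀ a b c, pd a (fun z => G z b c) z = pd a (fun z => G' z b c) z := fun a b c =>
    pd_congr_on hU (fun x hx => by simp only [h hx]) hz a
  simp only [christoffel, hp, h hz]

theorem ricci_congr_on (hU : IsOpen U) (h : EqOn G G' U) : EqOn (ricci G) (ricci G') U := by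
  intro z hz
  have hΓ := fun k i j => christoffel_congr_on hU h k i j
  ext i j
  simp only [ricci, Matrix.of_apply, fun a k i j => pd_congr_on hU (hΓ k i j) hz a,
    fun k i j => hΓ k i j hz]

theorem schouten_congr_on (hU : IsOpen U) (h : EqOn G G' U) :
    EqOn (schouten G) (schouten G') U := by
  intro z hz
  simp only [schouten, scalarCurvature, ricci_congr_on hU h hz, h hz]

theorem hessian_congr_on (hU : IsOpen U) (h : EqOn G G' U) (hf : EqOn f f' U) (hy : y ∈ U) :
    hessian G f y = hessian G' f' y := by
  ext i j
  simp only [hessian, fun k i j => christoffel_congr_on hU h k i j hy,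
    fun k => pd_congr_on hU hf hy k,
    pd_congr_on hU (fun z hz => pd_congr_on hU hf hz j) hy i]

theorem gradNormSq_congr_on (hU : IsOpen U) (h : EqOn G G' U) (hf : EqOn f f' U) (hy : y ∈ U) :
    gradNormSq G f y = gradNormSq G' f' y := by
  have : grad f y = grad f' y := funext fun k => pd_congr_on hU hf hy k
  rw [gradNormSq, gradNormSq, this, h hy]

theorem vTensor_congr_on (hU : IsOpen U) (h : EqOn G G' U) (hf : EqOn f f' U) (hy : y ∈ U) :
    vTensor G f y = vTensor G' f' y := by
  unfold vTensor grad
  simp only [hessian_congr_on hU h hf hy, fun k => pd_congr_on hU hf hy k]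

theorem wTensor_congr_on (hU : IsOpen U) (h : EqOn G G' U) (hf : EqOn f f' U) (hy : y ∈ U) :
    wTensor G f y = wTensor G' f' y := by
  simp only [wTensor, vTensor_congr_on hU h hf hy, gradNormSq_congr_on hU h hf hy, h hy,
    schouten_congr_on hU h hy]

/-- The squared norm of the Hessian. -/
def hessNormSq (G : EuclideanSpace ℝ (Fin n) → Matrix (Fin n) (Fin n) ℝ)
    (f : EuclideanSpace ℝ (Fin n) → ℝ) (y : EuclideanSpace ℝ (Fin n)) : ℝ :=
  (((G y)⁻¹ * Matrix.of (hessian G f y)) * ((G y)⁻¹ * Matrix.of (hessian G f y))).trace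

/-- For a symmetric Hessian the fourfold contraction is the trace of (g⁻¹H)², whose invariance under
coordinate changes is again a conjugation. -/
theorem hessNormSq_eq (hG : IsMetricOn U G) (hf : ContDiffOn ℝ ∞ f U) (hy : y ∈ U) :
    ∑ i, ∑ j, ∑ k, ∑ l, (G y)⁻¹ i k * (G y)⁻¹ j l * hessian G f y i j * hessian G f y k l
      = hessNormSq G f y := by
  have hs : ∀ i j, hessian G f y i j = hessian G f y j i := by
    intro i j
    simp only [hessian, pd_comm hG.isOpen hf hy i j, fun k => hG.christoffel_symm hy k i j]
  have hI : ∀ i j, (G y)⁻¹ i j = (G y)⁻¹ j i := fun i j =>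
    congrFun (congrFun (hG.inv_symm hy) j) i
  rw [hessNormSq, trace_mul_eq_sum]
  simp only [Matrix.mul_apply, Matrix.of_apply, Finset.sum_mul_sum]
  rw [Finset.sum_comm, Finset.sum_congr rfl fun j _ => Finset.sum_comm, Finset.sum_comm]
  refine Finset.sum_congr rfl fun k _ => Finset.sum_congr rfl fun j _ =>
    Finset.sum_congr rfl fun i _ => Finset.sum_congr rfl fun l _ => ?_
  rw [hI k i, hs k l]
  ring

theorem IsCoordChange.hessNormSq_pullback {Φ : EuclideanSpace ℝ (Fin n) → EuclideanSpace ℝ (Fin n)}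
    (hΦ : IsCoordChange U V Φ) (hG : IsMetricOn V G) (hf : ContDiffOn ℝ ∞ f V) (hy : y ∈ U) :
    hessNormSq (pullback Φ G) (fun z => f (Φ z)) y = hessNormSq G f (Φ y) := by
  have h : (pullback Φ G y)⁻¹ * Matrix.of (hessian (pullback Φ G) (fun z => f (Φ z)) y)
      = (jac Φ y)⁻¹ * ((G (Φ y))⁻¹ * Matrix.of (hessian G f (Φ y))) * jac Φ y := by
    rw [hΦ.hessian_pullback hG hf hy]
    exact hΦ.inv_pullback_mul hG (S := fun z => Matrix.of (hessian G f z)) hy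
  have h1 : jac Φ y * (jac Φ y)⁻¹ = 1 := hΦ.jac_mul_inv hy
  rw [hessNormSq, h, hessNormSq]
  set J := jac Φ y
  set B := (G (Φ y))⁻¹ * Matrix.of (hessian G f (Φ y))
  have : J⁻¹ * B * J * (J⁻¹ * B * J) = J⁻¹ * (B * B) * J := by
    calc _ = J⁻¹ * B * (J * J⁻¹) * B * J := by noncomm_ring
      _ = _ := by rw [h1]; noncomm_ring
  rw [this]
  exact hΦ.trace_conj _ hy

end Locality

/-! ### Functions on the manifold in charts -/

section Invariance

variable {n : ℕ} {M : Type*} [TopologicalSpace M] [ChartedSpace (EuclideanSpace ℝ (Fin n)) M]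
  [IsManifold (𝓡 n) ∞ M]

/-- The function `f` in the chart at `c`. -/
def loc (n : ℕ) {M : Type*} [TopologicalSpace M] [ChartedSpace (EuclideanSpace ℝ (Fin n)) M]
    (c : M) (f : M → ℝ) (y : EuclideanSpace ℝ (Fin n)) : ℝ := f ((extChartAt (𝓡 n) c).symm y)

variable (g₀ : SmoothMetric n M) (c : M) {u : M → ℝ}

/-- The endomorphism `g₀⁻¹ W` in the chart at `c`. -/
def wEndo (u : M → ℝ) (y : EuclideanSpace ℝ (Fin n)) : Matrix (Fin n) (Fin n) ℝ :=
  (gram g₀ c y)⁻¹ * wTensor (gram g₀ c) (loc n c u) y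

theorem loc_smooth (hu : ContMDiff (𝓡 n) 𝓘(ℝ, ℝ) ∞ u) :
    ContDiffOn ℝ ∞ (loc n c u) (extChartAt (𝓡 n) c).target := smooth_in_chart c hu

omit [IsManifold (𝓡 n) ∞ M] in
theorem chart_mem_target {x : M} (hx : x ∈ (extChartAt (𝓡 n) c).source) :
    extChartAt (𝓡 n) c x ∈ (extChartAt (𝓡 n) c).target := (extChartAt (𝓡 n) c).map_source hx

omit [IsManifold (𝓡 n) ∞ M] in
theorem loc_chart {x : M} (hx : x ∈ (extChartAt (𝓡 n) c).source) (f : M → ℝ) :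
    loc n c f (extChartAt (𝓡 n) c x) = f x := by
  rw [loc, (extChartAt (𝓡 n) c).left_inv hx]

omit [IsManifold (𝓡 n) ∞ M] in
theorem chart_mem_overlap {x : M} (hx : x ∈ (extChartAt (𝓡 n) c).source) :
    extChartAt (𝓡 n) x x ∈ overlap n x c := by
  refine ⟨chart_mem_target x (mem_extChartAt_source x), ?_⟩
  rw [mem_preimage, (extChartAt (𝓡 n) x).left_inv (mem_extChartAt_source x)]
  exact hx

omit [IsManifold (𝓡 n) ∞ M] in
theorem transition_chart {x : M} :
    transition (n := n) x c (extChartAt (𝓡 n) x x) = extChartAt (𝓡 n) c x := by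
  rw [transition, (extChartAt (𝓡 n) x).left_inv (mem_extChartAt_source x)]

omit [IsManifold (𝓡 n) ∞ M] in
theorem loc_eq_comp (c' : M) (f : M → ℝ) :
    EqOn (loc n c f) (fun y => loc n c' f (transition c c' y)) (overlap n c c') := fun y hy => by
  simp only [loc, symm_transition c c' hy]

theorem gram_eqOn_pullback (c' : M) :
    EqOn (gram g₀ c) (pullback (transition c c') (gram g₀ c')) (overlap n c c') :=
  fun _ hy => gram_eq_pullback g₀ c c' hy

theorem wEndo_overlap (hu : ContMDiff (𝓡 n) 𝓘(ℝ, ℝ) ∞ u) (c' : M)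
    {y : EuclideanSpace ℝ (Fin n)} (hy : y ∈ overlap n c c') :
    wEndo g₀ c u y = (jac (transition c c') y)⁻¹ * wEndo g₀ c' u (transition c c' y)
      * jac (transition c c') y := by
  have hΦ := isCoordChange_transition (n := n) c c'
  rw [wEndo, gram_eq_pullback g₀ c c' hy, wTensor_congr_on hΦ.isOpen_source
    (gram_eqOn_pullback g₀ c c') (loc_eq_comp c c' u) hy,
    hΦ.wTensor_pullback (isMetricOn_gram g₀ c') (loc_smooth c' hu) hy]
  exact hΦ.inv_pullback_mul (isMetricOn_gram g₀ c') _ hy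

/-- The Schouten tensor of the conformal metric is W with no conformal weight; the factor e^{2u}
comes from the inverse metric alone. -/
theorem schoutenEndo_confGram (hn : 4 < n) (hu : ContMDiff (𝓡 n) 𝓘(ℝ, ℝ) ∞ u)
    {y : EuclideanSpace ℝ (Fin n)} (hy : y ∈ (extChartAt (𝓡 n) c).target) :
    schoutenEndo (confGram g₀ u c) y = Real.exp (2 * loc n c u y) • wEndo g₀ c u y := by
  have hG := isMetricOn_gram g₀ c
  have hP := gram_posDef g₀ c hy
  obtain ⟨ξ, hξ⟩ := exists_unit_vector hP ⟨0, by omega⟩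
  obtain ⟨A, hA, -⟩ := exists_frame hP ⟨0, by omega⟩ ξ hξ
  have h1 : confGram g₀ u c = conf (loc n c u) (gram g₀ c) := rfl
  rw [schoutenEndo, h1, hG.schouten_conf (by omega) (loc_smooth c hu) hy hA, conf, wEndo]
  have h2 : (Real.exp (-2 * loc n c u y) • gram g₀ c y)⁻¹
      = Real.exp (2 * loc n c u y) • (gram g₀ c y)⁻¹ := by
    refine Matrix.inv_eq_right_inv ?_
    rw [Matrix.smul_mul, Matrix.mul_smul, smul_smul, ← Real.exp_add, hG.mul_inv hy]
    simp
  rw [h2, Matrix.smul_mul]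

theorem sigmaOne_smul (a : ℝ) (B : Matrix (Fin n) (Fin n) ℝ) :
    sigmaOne (a • B) = a * sigmaOne B := by
  rw [sigmaOne, Matrix.trace_smul, smul_eq_mul, sigmaOne]

theorem sigmaTwo_smul (a : ℝ) (B : Matrix (Fin n) (Fin n) ℝ) :
    sigmaTwo (a • B) = a ^ 2 * sigmaTwo B := by
  rw [sigmaTwo, sigmaTwo, Matrix.smul_mul, Matrix.mul_smul, Matrix.trace_smul, Matrix.trace_smul,
    Matrix.trace_smul, smul_eq_mul, smul_eq_mul, smul_eq_mul]
  ring

variable {x : M} (hx : x ∈ (extChartAt (𝓡 n) c).source)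

include hx

/-- The definition uses the preferred chart at x, which varies with x. To differentiate or
integrate, the quantity must be computed in one fixed chart around x. -/
theorem sigma1_eq (hn : 4 < n) (hu : ContMDiff (𝓡 n) 𝓘(ℝ, ℝ) ∞ u) :
    sigma1 g₀ u x = Real.exp (2 * u x) * (wEndo g₀ c u (extChartAt (𝓡 n) c x)).trace := by
  rw [sigma1, schoutenEndo_confGram g₀ x hn hu (chart_mem_target x (mem_extChartAt_source x)),
    sigmaOne_smul, loc_chart x (mem_extChartAt_source x),
    wEndo_overlap g₀ x hu c (chart_mem_overlap c hx),
    (isCoordChange_transition (n := n) x c).sigmaOne_conj _ (chart_mem_overlap c hx),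
    transition_chart, sigmaOne]

theorem sigma2_eq (hn : 4 < n) (hu : ContMDiff (𝓡 n) 𝓘(ℝ, ℝ) ∞ u) :
    sigma2 g₀ u x = Real.exp (4 * u x) * sigmaTwo (wEndo g₀ c u (extChartAt (𝓡 n) c x)) := by
  rw [sigma2, schoutenEndo_confGram g₀ x hn hu (chart_mem_target x (mem_extChartAt_source x)),
    sigmaTwo_smul, loc_chart x (mem_extChartAt_source x),
    wEndo_overlap g₀ x hu c (chart_mem_overlap c hx),
    (isCoordChange_transition (n := n) x c).sigmaTwo_conj _ (chart_mem_overlap c hx),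
    transition_chart, ← Real.exp_nat_mul]
  congr 2
  push_cast
  ring

theorem gradSq_eq (hu : ContMDiff (𝓡 n) 𝓘(ℝ, ℝ) ∞ u) :
    gradSq g₀ u x = gradNormSq (gram g₀ c) (loc n c u) (extChartAt (𝓡 n) c x) := by
  have hΦ := isCoordChange_transition (n := n) x c
  have hy := chart_mem_overlap c hx
  have h1 : gradSq g₀ u x = gradNormSq (gram g₀ x) (loc n x u) (extChartAt (𝓡 n) x x) := by
    simp only [gradSq, gradNormSq, dotProduct, Matrix.mulVec, grad, Finset.mul_sum]
    exact Finset.sum_congr rfl fun i _ => Finset.sum_congr rfl fun j _ => by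
      unfold loc
      ring
  rw [h1, gradNormSq_congr_on hΦ.isOpen_source (gram_eqOn_pullback g₀ x c) (loc_eq_comp x c u) hy,
    hΦ.gradNormSq_pullback (isMetricOn_gram g₀ c) (loc_smooth c hu) hy, transition_chart]

theorem hessNorm_eq (hu : ContMDiff (𝓡 n) 𝓘(ℝ, ℝ) ∞ u) :
    hessNorm g₀ u x
      = Real.sqrt (hessNormSq (gram g₀ c) (loc n c u) (extChartAt (𝓡 n) c x)) := by
  have hΦ := isCoordChange_transition (n := n) x c
  have hy := chart_mem_overlap c hx
  have h1 : hessNorm g₀ u x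
      = Real.sqrt (hessNormSq (gram g₀ x) (loc n x u) (extChartAt (𝓡 n) x x)) := by
    rw [← hessNormSq_eq (isMetricOn_gram g₀ x) (loc_smooth x hu) hy.1]
    rfl
  have h2 : hessNormSq (gram g₀ x) (loc n x u) (extChartAt (𝓡 n) x x)
      = hessNormSq (pullback (transition x c) (gram g₀ c))
        (fun y => loc n c u (transition x c y)) (extChartAt (𝓡 n) x x) := by
    rw [hessNormSq, hessian_congr_on hΦ.isOpen_source (gram_eqOn_pullback g₀ x c)
      (loc_eq_comp x c u) hy, gram_eq_pullback g₀ x c hy, hessNormSq]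
  rw [h1, h2, hΦ.hessNormSq_pullback (isMetricOn_gram g₀ c) (loc_smooth c hu) hy,
    transition_chart]

end Invariance

/-! ### Commuting time and space derivatives -/

section TimeDerivative

variable {n : ℕ} {U : Set (EuclideanSpace ℝ (Fin n))} {I : Set ℝ}
  {v w : ℝ → EuclideanSpace ℝ (Fin n) → ℝ}

/-- Time derivatives of smooth families are smooth and commute with space derivatives. -/
theorem hasDerivAt_pd (hI : IsOpen I) (hU : IsOpen U)
    (hv : ContDiffOn ℝ ∞ (fun q : ℝ × EuclideanSpace ℝ (Fin n) => v q.1 q.2) (I ×ˢ U))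
    (hw : ∀ t ∈ I, ∀ z ∈ U, HasDerivAt (fun s => v s z) (w t z) t) :
    ContDiffOn ℝ ∞ (fun q : ℝ × EuclideanSpace ℝ (Fin n) => w q.1 q.2) (I ×ˢ U) ∧
    ∀ k, ∀ t ∈ I, ∀ z ∈ U, HasDerivAt (fun s => pd k (v s) z) (pd k (w t) z) t := by
  set f : ℝ × EuclideanSpace ℝ (Fin n) → ℝ := fun q => v q.1 q.2 with hf
  have hO : IsOpen (I ×ˢ U) := hI.prod hU
  have hd : ∀ q ∈ I ×ˢ U, HasFDerivAt f (fderiv ℝ f q) q := fun q hq =>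
    ((hv.contDiffAt (hO.mem_nhds hq)).differentiableAt (by simp)).hasFDerivAt
  have hd1 := hv.fderiv_of_isOpen hO (m := ∞) (by simp)
  have hdd : ∀ q ∈ I ×ˢ U, HasFDerivAt (fderiv ℝ f) (fderiv ℝ (fderiv ℝ f) q) q := fun q hq =>
    ((hd1.contDiffAt (hO.mem_nhds hq)).differentiableAt (by simp)).hasFDerivAt
  have hline : ∀ t (z : EuclideanSpace ℝ (Fin n)),
      HasDerivAt (fun s : ℝ => (s, z)) ((1 : ℝ), (0 : EuclideanSpace ℝ (Fin n))) t :=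
    fun t z => (hasDerivAt_id t).prodMk (hasDerivAt_const t z)
  have hslice : ∀ t (z : EuclideanSpace ℝ (Fin n)),
      HasFDerivAt (fun x : EuclideanSpace ℝ (Fin n) => (t, x))
        (ContinuousLinearMap.inr ℝ ℝ (EuclideanSpace ℝ (Fin n))) z :=
    fun t z => hasFDerivAt_prodMk_right t z
  have hwt : ∀ t ∈ I, ∀ z ∈ U, w t z = fderiv ℝ f (t, z) (1, 0) := fun t ht z hz =>
    (hw t ht z hz).unique (HasFDerivAt.comp_hasDerivAt (l := f) t (hd (t, z) ⟨ht, hz⟩) (hline t z))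
  have hpd : ∀ k, ∀ t ∈ I, ∀ z ∈ U,
      pd k (v t) z = fderiv ℝ f (t, z) (0, EuclideanSpace.single k 1) := fun k t ht z hz => by
    have := ((hd (t, z) ⟨ht, hz⟩).comp z (hslice t z)).fderiv
    change fderiv ℝ (v t) z _ = _
    rw [show v t = f ∘ fun x => (t, x) from rfl, this]
    simp
  refine ⟨(hd1.clm_apply contDiffOn_const).congr fun q hq => hwt q.1 hq.1 q.2 hq.2,
    fun k t ht z hz => ?_⟩
  have hq : (t, z) ∈ I ×ˢ U := ⟨ht, hz⟩
  set L := fderiv ℝ (fderiv ℝ f) (t, z) with hL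
  have hLd : HasFDerivAt (fderiv ℝ f) L (t, z) := hdd _ hq
  have h1 : HasDerivAt (fun s => fderiv ℝ f (s, z) (0, EuclideanSpace.single k 1))
      (L (1, 0) (0, EuclideanSpace.single k 1)) t := by
    have h := (HasFDerivAt.comp_hasDerivAt (l := fderiv ℝ f) t hLd (hline t z)).clm_apply
      (hasDerivAt_const t ((0 : ℝ), (EuclideanSpace.single k 1 : EuclideanSpace ℝ (Fin n))))
    simpa using h
  have h2 : pd k (w t) z = L (0, EuclideanSpace.single k 1) (1, 0) := by
    have h3 : pd k (w t) z = pd k (fun x => fderiv ℝ f (t, x) (1, 0)) z :=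
      pd_congr_on hU (fun x hx => hwt t ht x hx) hz k
    have h4 := ((HasFDerivAt.comp (g := fderiv ℝ f) z hLd (hslice t z)).clm_apply
      (hasFDerivAt_const ((1 : ℝ), (0 : EuclideanSpace ℝ (Fin n))) z)).fderiv
    rw [h3, pd]
    refine (congrArg (fun L : EuclideanSpace ℝ (Fin n) →L[ℝ] ℝ => L (EuclideanSpace.single k 1))
      h4).trans ?_
    simp
  have hsymm : IsSymmSndFDerivAt ℝ f (t, z) :=
    (hv.contDiffAt (hO.mem_nhds hq)).isSymmSndFDerivAt (by
      simp only [minSmoothness_of_isRCLikeNormedField]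
      exact WithTop.coe_le_coe.2 (le_top (a := (2 : ℕ∞))))
  rw [h2, hsymm.eq]
  refine h1.congr_of_eventuallyEq ?_
  filter_upwards [hI.mem_nhds ht] with s hs using hpd k s hs z hz

end TimeDerivative

end SigmaTwoFlow

end

noncomputable section

namespace SigmaTwoFlow

/-! ### Integration on the manifold -/

section Integration

open MeasureTheory

variable {n : ℕ} {M : Type*} [TopologicalSpace M] [ChartedSpace (EuclideanSpace ℝ (Fin n)) M]
  [IsManifold (𝓡 n) ∞ M]

/-- The integral of `f` over the chart at `c`, for a function `f` supported in the chart. -/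
def chartInt (g₀ : SmoothMetric n M) (u : M → ℝ) (c : M) (f : M → ℝ) : ℝ :=
  ∫ y in (extChartAt (𝓡 n) c).target, loc n c f y * Real.sqrt (confGram g₀ u c y).det

variable (g₀ : SmoothMetric n M) (c c' : M) {u f : M → ℝ}

theorem det_confGram (y : EuclideanSpace ℝ (Fin n)) : Real.sqrt (confGram g₀ u c y).det
    = Real.exp (-n * loc n c u y) * Real.sqrt (gram g₀ c y).det := by
  rw [confGram, Matrix.det_smul, Fintype.card_fin, Real.sqrt_mul (by positivity), ← Real.exp_nat_mul,
    show (n : ℝ) * (-2 * u ((extChartAt (𝓡 n) c).symm y)) = (-n * loc n c u y) + (-n * loc n c u y)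
    by unfold loc; ring, Real.exp_add, Real.sqrt_mul_self (Real.exp_pos _).le]

theorem sqrt_det_overlap {y : EuclideanSpace ℝ (Fin n)} (hy : y ∈ overlap n c c') :
    Real.sqrt (confGram g₀ u c y).det = |(fderiv ℝ (transition c c') y).det|
      * Real.sqrt (confGram g₀ u c' (transition c c' y)).det := by
  have h1 := ((transition_smooth c c').contDiffAt ((isOpen_overlap c c').mem_nhds hy))
      |>.differentiableAt (by simp)
  have h2 : (fderiv ℝ (transition c c') y).det = (jac (transition c c') y).det := by
    rw [ContinuousLinearMap.det, ← LinearMap.det_toMatrix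
      (EuclideanSpace.basisFun (Fin n) ℝ).toBasis]
    congr 1
    ext i j
    rw [LinearMap.toMatrix_apply]
    simp only [OrthonormalBasis.coe_toBasis, EuclideanSpace.basisFun_apply,
      ContinuousLinearMap.coe_coe, fderiv_single_eq_sum h1, OrthonormalBasis.coe_toBasis_repr_apply,
      EuclideanSpace.basisFun_repr]
    rw [WithLp.ofLp_sum, Finset.sum_apply]
    simp
  rw [det_confGram, det_confGram, gram_eq_pullback g₀ c c' hy, pullback, Matrix.det_mul,
    Matrix.det_mul, Matrix.det_transpose, h2,
    show (jac (transition c c') y).det * (gram g₀ c' (transition c c' y)).det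
      * (jac (transition c c') y).det = (jac (transition c c') y).det ^ 2
      * (gram g₀ c' (transition c c' y)).det by ring, Real.sqrt_mul (sq_nonneg _),
    Real.sqrt_sq_eq_abs, loc_eq_comp c c' u hy]
  ring

/-- Integrals in charts do not depend on the chart. -/
theorem chartInt_eq_chartInt (hf : Function.support f ⊆
    (extChartAt (𝓡 n) c).source ∩ (extChartAt (𝓡 n) c').source) :
    chartInt g₀ u c f = chartInt g₀ u c' f := by
  have hzero : ∀ a b : M, Function.support f ⊆ (extChartAt (𝓡 n) b).source →
      ∀ y ∈ (extChartAt (𝓡 n) a).target \ overlap n a b,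
      loc n a f y * Real.sqrt (confGram g₀ u a y).det = 0 := by
    intro a b hb y hy
    have : loc n a f y = 0 := by
      by_contra h
      exact hy.2 ⟨hy.1, hb h⟩
    rw [this, zero_mul]
  have hsub : ∀ a b : M, overlap n a b ⊆ (extChartAt (𝓡 n) a).target := fun a b =>
    inter_subset_left
  have himage : transition c c' '' overlap n c c' = overlap n c' c := by
    refine Subset.antisymm (mapsTo_iff_image_subset.1 (transition_mapsTo c c')) fun y hy =>
      ⟨transition c' c y, transition_mapsTo c' c hy, transition_transition c' c hy⟩
  -- Outside the overlap the integrand vanishes by the support condition. On the overlap this is the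
  -- change of variables formula for the transition map.
  rw [chartInt, chartInt,
    setIntegral_eq_of_subset_of_forall_sdiff_eq_zero (isOpen_target c).measurableSet
      (hsub c c') (hzero c c' (hf.trans inter_subset_right)),
    setIntegral_eq_of_subset_of_forall_sdiff_eq_zero (isOpen_target c').measurableSet
      (hsub c' c) (hzero c' c (hf.trans inter_subset_left)), ← himage,
    integral_image_eq_integral_abs_det_fderiv_smul volume (isOpen_overlap c c').measurableSet
      (f' := fderiv ℝ (transition c c'))
      (fun y hy => ((((transition_smooth c c').contDiffAt ((isOpen_overlap c c').mem_nhds hy))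
        |>.differentiableAt (by simp)).hasFDerivAt).hasFDerivWithinAt)
      (fun y hy z hz h => by
        rw [← transition_transition c c' hy, h, transition_transition c c' hz])]
  refine setIntegral_congr_fun (isOpen_overlap c c').measurableSet fun y hy => ?_
  rw [sqrt_det_overlap g₀ c c' hy, loc_eq_comp c c' f hy, smul_eq_mul]
  ring

omit [IsManifold (𝓡 n) ∞ M] in
theorem loc_continuousOn (hf : Continuous f) :
    ContinuousOn (loc n c f) (extChartAt (𝓡 n) c).target :=
  hf.comp_continuousOn (continuousOn_extChartAt_symm c)

variable [CompactSpace M]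

omit [IsManifold (𝓡 n) ∞ M] in
theorem isCompact_image_tsupport (hs : tsupport f ⊆ (extChartAt (𝓡 n) c).source) :
    IsCompact (extChartAt (𝓡 n) c '' tsupport f) :=
  (isClosed_tsupport f).isCompact.image_of_continuousOn ((continuousOn_extChartAt c).mono hs)

omit [IsManifold (𝓡 n) ∞ M] [CompactSpace M] in
theorem image_tsupport_subset (hs : tsupport f ⊆ (extChartAt (𝓡 n) c).source) :
    extChartAt (𝓡 n) c '' tsupport f ⊆ (extChartAt (𝓡 n) c).target := by
  rintro _ ⟨x, hx, rfl⟩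
  exact chart_mem_target c (hs hx)

omit [IsManifold (𝓡 n) ∞ M] [CompactSpace M] in
theorem loc_eq_zero {y : EuclideanSpace ℝ (Fin n)} (hy : y ∈ (extChartAt (𝓡 n) c).target)
    (h : y ∉ extChartAt (𝓡 n) c '' tsupport f) : loc n c f y = 0 := by
  by_contra h0
  exact h ⟨_, subset_tsupport f h0, (extChartAt (𝓡 n) c).right_inv hy⟩

omit [IsManifold (𝓡 n) ∞ M] in
theorem integrableOn_chart (hs : tsupport f ⊆ (extChartAt (𝓡 n) c).source) (hf : Continuous f)
    {d : EuclideanSpace ℝ (Fin n) → ℝ} (hd : ContinuousOn d (extChartAt (𝓡 n) c).target) :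
    IntegrableOn (fun y => loc n c f y * d y) (extChartAt (𝓡 n) c).target := by
  have hsub := image_tsupport_subset c hs
  have h1 : IntegrableOn (fun y => loc n c f y * d y) (extChartAt (𝓡 n) c '' tsupport f) :=
    (((loc_continuousOn c hf).mul hd).mono hsub).integrableOn_compact
      (isCompact_image_tsupport c hs)
  refine h1.of_forall_sdiff_eq_zero (isOpen_target c).measurableSet fun y hy => ?_
  rw [loc_eq_zero c hy.1 hy.2, zero_mul]

omit [CompactSpace M] in
theorem gram_det_continuousOn :
    ContinuousOn (fun y => Real.sqrt (gram g₀ c y).det) (extChartAt (𝓡 n) c).target :=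
  (gram_smooth g₀ c).det.continuousOn.sqrt

omit [CompactSpace M] in
theorem confGram_det_continuousOn (hu : Continuous u) :
    ContinuousOn (fun y => Real.sqrt (confGram g₀ u c y).det) (extChartAt (𝓡 n) c).target := by
  simp only [det_confGram]
  exact (((continuousOn_const.mul (loc_continuousOn c hu))).rexp).mul (gram_det_continuousOn g₀ c)

variable [T2Space M]

theorem chartPartition_subordinate : tsupport (chartPartition n M c)
    ⊆ (extChartAt (𝓡 n) c).source := by
  rw [extChartAt_source]
  exact Classical.choose_spec (SmoothPartitionOfUnity.exists_isSubordinate_chartAt_source (𝓡 n) M) c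

variable (n M) in
/-- The finitely many charts on which the partition of unity lives. -/
def chartIndex : Finset M :=
  ((chartPartition n M).locallyFinite.finite_nonempty_of_compact).toFinset

theorem chartPartition_eq_zero {c : M} (hc : c ∉ chartIndex n M) (x : M) :
    chartPartition n M c x = 0 := by
  by_contra h
  exact hc ((Set.Finite.mem_toFinset _).2 ⟨x, h⟩)

theorem sum_chartPartition (x : M) : ∑ c ∈ chartIndex n M, chartPartition n M c x = 1 := by
  rw [← (chartPartition n M).sum_eq_one (mem_univ x)]
  refine (finsum_eq_sum_of_support_subset _ fun c hc => ?_).symm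
  by_contra h
  exact hc (chartPartition_eq_zero h x)

theorem chartPartition_continuous : Continuous (chartPartition n M c) :=
  (chartPartition n M c).contMDiff.continuous

theorem volIntegral_eq_sum (u f : M → ℝ) : volIntegral g₀ u f
    = ∑ c ∈ chartIndex n M, chartInt g₀ u c (fun x => chartPartition n M c x * f x) := by
  refine finsum_eq_sum_of_support_subset _ fun c hc => ?_
  by_contra h
  refine hc ?_
  simp [chartPartition_eq_zero h]

omit [T2Space M] [CompactSpace M] [IsManifold (𝓡 n) ∞ M] in
theorem tsupport_mul_subset_of_left {χ : M → ℝ} {s : Set M} (h : tsupport χ ⊆ s) (f : M → ℝ) :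
    tsupport (fun x => χ x * f x) ⊆ s :=
  (tsupport_mul_subset_left (f := χ) (g := f)).trans h

/-- The integral of a function supported in a chart can be computed in this chart. -/
theorem volIntegral_eq_chartInt (hu : Continuous u) (hf : Continuous f)
    (hs : tsupport f ⊆ (extChartAt (𝓡 n) c).source) :
    volIntegral g₀ u f = chartInt g₀ u c f := by
  have h1 : ∀ c' ∈ chartIndex n M, chartInt g₀ u c' (fun x => chartPartition n M c' x * f x)
      = chartInt g₀ u c (fun x => chartPartition n M c' x * f x) := by
    intro c' _
    refine chartInt_eq_chartInt g₀ c' c fun x hx => ⟨?_, ?_⟩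
    · exact chartPartition_subordinate c' (subset_tsupport _ (left_ne_zero_of_mul hx))
    · exact hs (subset_tsupport _ (right_ne_zero_of_mul hx))
  rw [volIntegral_eq_sum, Finset.sum_congr rfl h1]
  unfold chartInt
  rw [← integral_finsetSum]
  · refine setIntegral_congr_fun (isOpen_target c).measurableSet fun y _ => ?_
    simp only [loc, ← Finset.sum_mul, sum_chartPartition, one_mul]
  · intro c' _
    refine integrableOn_chart c ?_ ((chartPartition_continuous c').mul hf)
      (confGram_det_continuousOn g₀ c hu)
    exact (tsupport_mul_subset_right (f := chartPartition n M c') (g := f)).trans hs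

variable [MeasurableSpace M] [BorelSpace M]

/-- The part of the volume measure of `g₀` in the chart at `c`. -/
def chartMeasure (c : M) : Measure M :=
  ((volume.restrict (extChartAt (𝓡 n) c).target).withDensity fun y =>
    ENNReal.ofReal (loc n c (chartPartition n M c) y * Real.sqrt (gram g₀ c y).det)).map
    (extChartAt (𝓡 n) c).symm

/-- The volume measure of `g₀`. -/
def volMeasure : Measure M := ∑ c ∈ chartIndex n M, chartMeasure g₀ c

omit [MeasurableSpace M] [BorelSpace M] in
theorem integrableOn_density : IntegrableOn
    (fun y => loc n c (chartPartition n M c) y * Real.sqrt (gram g₀ c y).det)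
    (extChartAt (𝓡 n) c).target :=
  integrableOn_chart c (chartPartition_subordinate c) (chartPartition_continuous c)
    (gram_det_continuousOn g₀ c)

instance : IsFiniteMeasure (chartMeasure g₀ c) := by
  have := isFiniteMeasure_withDensity_ofReal (integrableOn_density g₀ c).2
  unfold chartMeasure
  infer_instance

instance : IsFiniteMeasure (volMeasure g₀) := by
  unfold volMeasure
  infer_instance

theorem integral_chartMeasure (hf : Continuous f) : ∫ x, f x ∂(chartMeasure g₀ c)
    = ∫ y in (extChartAt (𝓡 n) c).target,
      loc n c (fun x => chartPartition n M c x * f x) y * Real.sqrt (gram g₀ c y).det := by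
  have hm : AEMeasurable (extChartAt (𝓡 n) c).symm
      (volume.restrict (extChartAt (𝓡 n) c).target) :=
    (continuousOn_extChartAt_symm c).aemeasurable (isOpen_target c).measurableSet
  rw [chartMeasure, integral_map (hm.mono_ac (withDensity_absolutelyContinuous _ _))
    hf.measurable.aestronglyMeasurable, integral_withDensity_eq_integral_toReal_smul₀
    (integrableOn_density g₀ c).1.aemeasurable.ennreal_ofReal (by simp)]
  refine setIntegral_congr_fun (isOpen_target c).measurableSet fun y _ => ?_
  have h0 : 0 ≤ loc n c (chartPartition n M c) y := (chartPartition n M).nonneg c _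
  simp only [smul_eq_mul]
  rw [ENNReal.toReal_ofReal (by positivity)]
  simp only [loc]
  ring

omit [T2Space M] [IsManifold (𝓡 n) ∞ M] [ChartedSpace (EuclideanSpace ℝ (Fin n)) M] in
theorem integrable_of_continuous {μ : Measure M} [IsFiniteMeasure μ] (hf : Continuous f) :
    Integrable f μ := by
  obtain ⟨C, hC⟩ := isCompact_univ.exists_bound_of_continuousOn hf.continuousOn
  exact Integrable.of_bound hf.measurable.aestronglyMeasurable C
    (Filter.Eventually.of_forall fun x => hC x (mem_univ x))

/-- `volIntegral` is the integral against `e^{-nu}` times the volume measure of `g₀`. -/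
theorem volIntegral_eq_integral (hu : Continuous u) (hf : Continuous f) :
    volIntegral g₀ u f = ∫ x, Real.exp (-n * u x) * f x ∂(volMeasure g₀) := by
  have hc : Continuous fun x => Real.exp (-n * u x) * f x := by fun_prop
  rw [volIntegral_eq_sum, volMeasure, integral_finsetSum_measure fun c _ =>
    integrable_of_continuous hc]
  refine Finset.sum_congr rfl fun c _ => ?_
  rw [integral_chartMeasure g₀ c hc, chartInt]
  refine setIntegral_congr_fun (isOpen_target c).measurableSet fun y _ => ?_
  simp only [det_confGram, loc]
  ring

/-- Some partition function is positive at a given point. In its chart the density is continuous and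
positive there, hence nonzero on a nonempty open set. -/
theorem volMeasure_univ_ne_zero [Nonempty M] : volMeasure g₀ univ ≠ 0 := by
  obtain ⟨x⟩ := ‹Nonempty M›
  obtain ⟨c, hc, hpos⟩ : ∃ c ∈ chartIndex n M, 0 < chartPartition n M c x := by
    by_contra! h
    have := Finset.sum_nonpos h
    rw [sum_chartPartition] at this
    linarith
  have hxs : x ∈ (extChartAt (𝓡 n) c).source :=
    chartPartition_subordinate c (subset_tsupport _ hpos.ne')
  have h1 : 0 < ∫ z, (1 : ℝ) ∂(chartMeasure g₀ c) := by
    rw [integral_chartMeasure g₀ c continuous_const]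
    have hcont : ContinuousOn (fun y => loc n c (fun x => chartPartition n M c x * 1) y
        * Real.sqrt (gram g₀ c y).det) (extChartAt (𝓡 n) c).target :=
      (loc_continuousOn c ((chartPartition_continuous c).mul continuous_const)).mul
        (gram_det_continuousOn g₀ c)
    rw [setIntegral_pos_iff_support_of_nonneg_ae]
    · have hopen := hcont.isOpen_inter_preimage (isOpen_target c)
        (isOpen_compl_singleton (x := (0 : ℝ)))
      rw [inter_comm] at hopen
      refine hopen.measure_pos volume ⟨extChartAt (𝓡 n) c x, ?_, chart_mem_target c hxs⟩
      have h2 := (gram_posDef g₀ c (chart_mem_target c hxs)).det_pos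
      rw [mem_preimage, mem_compl_singleton_iff, loc_chart c hxs, mul_one]
      exact (mul_pos hpos (Real.sqrt_pos.2 h2)).ne'
    · refine Filter.Eventually.of_forall fun y => ?_
      have h0 : 0 ≤ chartPartition n M c ((extChartAt (𝓡 n) c).symm y) :=
        (chartPartition n M).nonneg c _
      simp only [loc, mul_one, Pi.zero_apply]
      positivity
    · simpa using integrableOn_density g₀ c
  intro h
  have h3 : chartMeasure g₀ c univ = 0 := by
    rw [volMeasure, Measure.finsetSum_apply] at h
    exact (Finset.sum_eq_zero_iff.1 h) c hc
  rw [integral_const, Measure.real, h3] at h1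
  simp at h1

end Integration

end SigmaTwoFlow

end

noncomputable section

namespace SigmaTwoFlow

/-! ### The divergence theorem -/

section Divergence

open MeasureTheory

variable {n : ℕ} {U V : Set (EuclideanSpace ℝ (Fin n))} {y : EuclideanSpace ℝ (Fin n)}
  {G : EuclideanSpace ℝ (Fin n) → Matrix (Fin n) (Fin n) ℝ} {f : EuclideanSpace ℝ (Fin n) → ℝ}

/-- The contravariant Newton tensor `g⁻¹ T g⁻¹`. -/
def newtonUp (G : EuclideanSpace ℝ (Fin n) → Matrix (Fin n) (Fin n) ℝ)
    (y : EuclideanSpace ℝ (Fin n)) : Matrix (Fin n) (Fin n) ℝ := (G y)⁻¹ * newton G y * (G y)⁻¹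

/-- The contraction `⟨T, ∇²f⟩`. -/
def newtonHess (G : EuclideanSpace ℝ (Fin n) → Matrix (Fin n) (Fin n) ℝ)
    (f : EuclideanSpace ℝ (Fin n) → ℝ) (y : EuclideanSpace ℝ (Fin n)) : ℝ :=
  (newtonUp G y * Matrix.of (hessian G f y)).trace

theorem IsMetricOn.newtonUp_smooth (hG : IsMetricOn U G) : MSmooth U (newtonUp G) :=
  ((hG.smooth.inv hG.det_ne_zero).mul hG.newton_smooth).mul (hG.smooth.inv hG.det_ne_zero)

theorem IsMetricOn.newtonHess_smooth (hG : IsMetricOn U G) (hf : ContDiffOn ℝ ∞ f U) :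
    ContDiffOn ℝ ∞ (newtonHess G f) U :=
  (hG.newtonUp_smooth.mul (hessian_smoothOn hG.isOpen hG.smooth hG.det_ne_zero hf)).trace

theorem IsMetricOn.pdM_inv_eq (hG : IsMetricOn U G) (hy : y ∈ U) (b : Fin n) :
    pdM b (fun z => (G z)⁻¹) y
      = -(chM G b y * (G y)⁻¹) - (G y)⁻¹ * (chM G b y).transpose := by
  rw [pdM_inv hG.isOpen hG.smooth hG.det_ne_zero hy, hG.pdM_eq hy]
  have h1 := hG.inv_mul hy
  have h2 := hG.mul_inv hy
  calc _ = -((G y)⁻¹ * (chM G b y).transpose * (G y * (G y)⁻¹))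
        - ((G y)⁻¹ * G y) * chM G b y * (G y)⁻¹ := by noncomm_ring
    _ = _ := by
      rw [h1, h2]
      noncomm_ring

/-- Since the inverse metric is parallel, raising indices commutes with covariant differentiation;
only the connection terms of a contravariant tensor remain. -/
theorem IsMetricOn.pdM_newtonUp (hG : IsMetricOn U G) (hy : y ∈ U) (b : Fin n) :
    pdM b (newtonUp G) y = (G y)⁻¹ * covM G (newton G) b y * (G y)⁻¹
      - chM G b y * newtonUp G y - newtonUp G y * (chM G b y).transpose := by
  have hI := hG.smooth.inv hG.det_ne_zero
  have hT := hG.newton_smooth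
  have h1 : pdM b (newtonUp G) y = pdM b (fun z => (G z)⁻¹) y * newton G y * (G y)⁻¹
      + (G y)⁻¹ * pdM b (newton G) y * (G y)⁻¹
      + (G y)⁻¹ * newton G y * pdM b (fun z => (G z)⁻¹) y := by
    change pdM b (fun z => (G z)⁻¹ * newton G z * (G z)⁻¹) y = _
    rw [pdM_mul hG.isOpen (hI.mul hT) hI hy, pdM_mul hG.isOpen hI hT hy]
    noncomm_ring
  rw [h1, hG.pdM_inv_eq hy, newtonUp, covM]
  noncomm_ring

/-- The vector density `√(det g) g⁻¹ T g⁻¹ ∇f`. -/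
def newtonFlux (G : EuclideanSpace ℝ (Fin n) → Matrix (Fin n) (Fin n) ℝ)
    (f : EuclideanSpace ℝ (Fin n) → ℝ) (i : Fin n) (y : EuclideanSpace ℝ (Fin n)) : ℝ :=
  Real.sqrt (G y).det * ∑ j, newtonUp G y i j * pd j f y

theorem IsMetricOn.sqrt_det_smooth (hG : IsMetricOn U G) (hpos : ∀ z ∈ U, 0 < (G z).det) :
    ContDiffOn ℝ ∞ (fun z => Real.sqrt (G z).det) U :=
  hG.smooth.det.sqrt fun z hz => (hpos z hz).ne'

theorem IsMetricOn.newtonFlux_smooth (hG : IsMetricOn U G) (hpos : ∀ z ∈ U, 0 < (G z).det)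
    (hf : ContDiffOn ℝ ∞ f U) (i : Fin n) : ContDiffOn ℝ ∞ (newtonFlux G f i) U :=
  (hG.sqrt_det_smooth hpos).mul (ContDiffOn.sum fun j _ =>
    (hG.newtonUp_smooth i j).mul (pd_smoothOn hG.isOpen hf j))

theorem IsMetricOn.pd_sqrt_det (hG : IsMetricOn U G) (hpos : ∀ z ∈ U, 0 < (G z).det)
    (hy : y ∈ U) (i : Fin n) : pd i (fun z => Real.sqrt (G z).det) y
      = Real.sqrt (G y).det * ∑ k, christoffel G k k i y := by
  have hd := hpos y hy
  have hs := Real.sqrt_pos.2 hd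
  have h1 := hG.sum_christoffel hy i
  have h2 : pd i (fun z => Real.sqrt (G z).det) y
      = 1 / (2 * Real.sqrt (G y).det) * pd i (fun z => (G z).det) y :=
    pd_real_comp hG.isOpen hG.smooth.det hy (Real.hasDerivAt_sqrt hd.ne') i
  have h3 : ∑ k, christoffel G k k i y = (G y).det⁻¹ * pd i (fun z => (G z).det) y / 2 := by
    linarith
  rw [h2, h3]
  nth_rewrite 3 [← Real.mul_self_sqrt hd.le]
  field_simp

/-- The contracted symbols from the derivative of √det cancel one connection term of ∂P. The other
connection term turns ∂²f into the covariant Hessian. What is left pairs the divergence of the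
Newton tensor with df, and that divergence is zero. -/
theorem IsMetricOn.sum_pd_newtonFlux (hG : IsMetricOn U G) (hpos : ∀ z ∈ U, 0 < (G z).det)
    (hf : ContDiffOn ℝ ∞ f U) (hy : y ∈ U) (hdiv : ∀ b, divNewton G y b = 0) :
    ∑ i, pd i (newtonFlux G f i) y = newtonHess G f y * Real.sqrt (G y).det := by
  have hU := hG.isOpen
  have hP := hG.newtonUp_smooth
  have h1 := fun j => pd_smoothOn hU hf j
  set P := newtonUp G y with hPd
  set r := Real.sqrt (G y).det with hr
  set Γ := fun i => chM G i y with hΓ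
  have hpd : ∀ i, pd i (newtonFlux G f i) y
      = r * ((∑ k, christoffel G k k i y) * ∑ j, P i j * pd j f y
        + ∑ j, (pdM i (newtonUp G) y i j * pd j f y + P i j * pd i (pd j f) y)) := by
    intro i
    have hs : ContDiffOn ℝ ∞ (fun z => ∑ j, newtonUp G z i j * pd j f z) U :=
      ContDiffOn.sum fun j _ => (hP i j).mul (h1 j)
    have e : newtonFlux G f i = fun z => Real.sqrt (G z).det
      * ∑ j, newtonUp G z i j * pd j f z := rfl
    rw [e, pd_mul hU (hG.sqrt_det_smooth hpos) hs hy, hG.pd_sqrt_det hpos hy,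
      pd_sum _ hU (fun j _ => (hP i j).mul (h1 j)) hy]
    simp only [fun j => pd_mul hU (hP i j) (h1 j) hy i, ← pdM_apply]
    rw [← hr, ← hPd]
    ring
  have hcov : ∑ i, ∑ j, ((G y)⁻¹ * covM G (newton G) i y * (G y)⁻¹) i j * pd j f y = 0 := by
    have : ∀ j, ∑ i, ((G y)⁻¹ * covM G (newton G) i y * (G y)⁻¹) i j
        = ∑ b, divNewton G y b * (G y)⁻¹ b j := by
      intro j
      simp only [divNewton, Finset.sum_mul]
      rw [Finset.sum_comm]
      exact Finset.sum_congr rfl fun i _ => Matrix.mul_apply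
    rw [Finset.sum_comm]
    simp [← Finset.sum_mul, this, hdiv]
  have hch : ∑ i, ∑ j, (Γ i * P) i j * pd j f y
      = ∑ i, (∑ k, christoffel G k k i y) * ∑ j, P i j * pd j f y := by
    have e : ∀ i, ∑ j, (Γ i * P) i j * pd j f y
        = ∑ l, christoffel G i i l y * ∑ j, P l j * pd j f y := by
      intro i
      simp only [Matrix.mul_apply, Finset.sum_mul, Finset.mul_sum]
      rw [Finset.sum_comm]
      exact Finset.sum_congr rfl fun l _ => Finset.sum_congr rfl fun j _ => by
        rw [← mul_assoc]
        rfl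
    simp only [e, Finset.sum_mul]
    rw [Finset.sum_comm]
  have hlast : ∑ i, ∑ j, (P * (Γ i).transpose) i j * pd j f y
      = ∑ i, ∑ j, P i j * ∑ k, christoffel G k i j y * pd k f y := by
    refine Finset.sum_congr rfl fun i _ => ?_
    simp only [Matrix.mul_apply, Finset.sum_mul, Finset.mul_sum]
    rw [Finset.sum_comm]
    exact Finset.sum_congr rfl fun l _ => Finset.sum_congr rfl fun j _ => by
      rw [mul_assoc]
      rfl
  have hPs : ∀ i j, P i j = P j i := by
    have ht : (newtonUp G y).transpose = newtonUp G y := by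
      have hn : (newton G y).transpose = newton G y := by
        ext i j
        simp only [newton, Matrix.transpose_apply, Matrix.sub_apply, Matrix.smul_apply,
          hG.symm_apply hy j i, hG.schouten_symm hy j i]
      rw [newtonUp, Matrix.transpose_mul, Matrix.transpose_mul, hG.inv_symm hy, hn, mul_assoc]
    exact fun i j => congrFun (congrFun ht j) i
  have hH : newtonHess G f y = ∑ i, ∑ j, P i j * pd i (pd j f) y
      - ∑ i, ∑ j, P i j * ∑ k, christoffel G k i j y * pd k f y := by
    rw [newtonHess, trace_mul_eq_sum, ← Finset.sum_sub_distrib, Finset.sum_comm]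
    refine Finset.sum_congr rfl fun i _ => ?_
    rw [← Finset.sum_sub_distrib]
    refine Finset.sum_congr rfl fun j _ => ?_
    rw [← mul_sub, ← hPd, hPs i j]
    rfl
  have hexp : ∀ i, ∑ j, (pdM i (newtonUp G) y i j * pd j f y + P i j * pd i (pd j f) y)
      = ∑ j, ((G y)⁻¹ * covM G (newton G) i y * (G y)⁻¹) i j * pd j f y
        - ∑ j, (Γ i * P) i j * pd j f y - ∑ j, (P * (Γ i).transpose) i j * pd j f y
        + ∑ j, P i j * pd i (pd j f) y := by
    intro i
    rw [hG.pdM_newtonUp hy]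
    simp only [← Finset.sum_sub_distrib, ← Finset.sum_add_distrib]
    refine Finset.sum_congr rfl fun j _ => ?_
    simp only [Matrix.sub_apply]
    ring
  simp only [hpd, hexp, ← Finset.mul_sum, Finset.sum_add_distrib, Finset.sum_sub_distrib]
  rw [hcov, hch, hlast, hH]
  ring

/-- The integral of a divergence with compact support vanishes. -/
theorem integral_sum_pd_eq_zero (hU : IsOpen U) {Y : Fin n → EuclideanSpace ℝ (Fin n) → ℝ}
    (hY : ∀ i, ContDiffOn ℝ ∞ (Y i) U) {K : Set (EuclideanSpace ℝ (Fin n))} (hK : IsCompact K)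
    (hKU : K ⊆ U) (h0 : ∀ i, ∀ z ∈ U, z ∉ K → Y i z = 0) :
    ∫ z in U, ∑ i, pd i (Y i) z = 0 := by
  -- Extension by zero is smooth on the whole space because the field vanishes outside a compact
  -- subset of U. Integration by parts against the constant 1 then applies.
  set Z : Fin n → EuclideanSpace ℝ (Fin n) → ℝ := fun i => U.indicator (Y i) with hZ
  have hZU : ∀ i, EqOn (Z i) (Y i) U := fun i z hz => indicator_of_mem hz _
  have hZK : ∀ i, ∀ z ∉ K, Z i z = 0 := by
    intro i z hz
    by_cases h : z ∈ U
    · rw [hZU i h, h0 i z h hz]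
    · exact indicator_of_notMem h _
  have hcs : ∀ i, HasCompactSupport (Z i) := fun i => HasCompactSupport.intro hK (hZK i)
  have hZs : ∀ i, ContDiff ℝ ∞ (Z i) := by
    intro i
    rw [contDiff_iff_contDiffAt]
    intro z
    by_cases hz : z ∈ U
    · exact ((hY i).contDiffAt (hU.mem_nhds hz)).congr_of_eventuallyEq
        ((hZU i).eventuallyEq_of_mem (hU.mem_nhds hz))
    · have hzK : z ∈ Kᶜ := fun h => hz (hKU h)
      exact contDiffAt_const.congr_of_eventuallyEq
        (Filter.eventually_of_mem (hK.isClosed.isOpen_compl.mem_nhds hzK) (hZK i))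
  have hzero : ∀ i, ∫ z, fderiv ℝ (Z i) z (EuclideanSpace.single i 1) = 0 := by
    intro i
    have hd : Continuous fun z => fderiv ℝ (Z i) z (EuclideanSpace.single i 1) :=
      ((hZs i).continuous_fderiv (by simp)).clm_apply continuous_const
    have hdc : HasCompactSupport fun z => fderiv ℝ (Z i) z (EuclideanSpace.single i 1) :=
      (hcs i).fderiv_apply ℝ _
    have := integral_mul_fderiv_eq_neg_fderiv_mul_of_integrable (μ := volume)
      (f := fun _ : EuclideanSpace ℝ (Fin n) => (1 : ℝ)) (g := Z i)
      (v := EuclideanSpace.single i 1) (by simp)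
      (by simpa using hd.integrable_of_hasCompactSupport hdc)
      (by simpa using (hZs i).continuous.integrable_of_hasCompactSupport (hcs i))
      (fun _ _ => differentiableAt_const _)
      (fun z _ => (hZs i).differentiable (by simp) z)
    simpa using this
  have hI : ∀ i, Integrable fun z => fderiv ℝ (Z i) z (EuclideanSpace.single i 1) := fun i =>
    (((hZs i).continuous_fderiv (by simp)).clm_apply
      continuous_const).integrable_of_hasCompactSupport ((hcs i).fderiv_apply ℝ _)
  calc ∫ z in U, ∑ i, pd i (Y i) z
      = ∫ z in U, ∑ i, fderiv ℝ (Z i) z (EuclideanSpace.single i 1) :=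
        setIntegral_congr_fun hU.measurableSet fun z hz => Finset.sum_congr rfl fun i _ =>
          (pd_congr_on hU (hZU i) hz i).symm
    _ = ∫ z, ∑ i, fderiv ℝ (Z i) z (EuclideanSpace.single i 1) := by
        refine setIntegral_eq_integral_of_forall_compl_eq_zero fun z hz => ?_
        refine Finset.sum_eq_zero fun i _ => ?_
        have hzK : z ∈ Kᶜ := fun h => hz (hKU h)
        have : Z i =ᶠ[𝓝 z] fun _ => 0 :=
          Filter.eventually_of_mem (hK.isClosed.isOpen_compl.mem_nhds hzK) (hZK i)
        rw [this.fderiv_eq]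
        simp
    _ = 0 := by
        rw [integral_finsetSum _ fun i _ => hI i]
        exact Finset.sum_eq_zero fun i _ => hzero i

end Divergence

end SigmaTwoFlow

end

noncomputable section

namespace SigmaTwoFlow

/-! ### The second-order operator defined by the Newton tensor, in coordinates. -/

section NewtonHess

variable {n : ℕ} {U V : Set (EuclideanSpace ℝ (Fin n))} {y : EuclideanSpace ℝ (Fin n)}
  {G G' : EuclideanSpace ℝ (Fin n) → Matrix (Fin n) (Fin n) ℝ}
  {f f' : EuclideanSpace ℝ (Fin n) → ℝ}

theorem newtonUp_congr_on (hU : IsOpen U) (h : EqOn G G' U) (hy : y ∈ U) :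
    newtonUp G y = newtonUp G' y := by
  simp only [newtonUp, newton, schouten_congr_on hU h hy, h hy]

theorem newtonHess_congr_on (hU : IsOpen U) (h : EqOn G G' U) (hf : EqOn f f' U) (hy : y ∈ U) :
    newtonHess G f y = newtonHess G' f' y := by
  rw [newtonHess, newtonHess, newtonUp_congr_on hU h hy, hessian_congr_on hU h hf hy]

theorem IsCoordChange.newtonHess_pullback
    {Φ : EuclideanSpace ℝ (Fin n) → EuclideanSpace ℝ (Fin n)} (hΦ : IsCoordChange U V Φ)
    (hG : IsMetricOn V G) (hf : ContDiffOn ℝ ∞ f V) (hy : y ∈ U) :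
    newtonHess (pullback Φ G) (fun z => f (Φ z)) y = newtonHess G f (Φ y) := by
  have h1 : (pullback Φ G y)⁻¹ * newton (pullback Φ G) y
      = (jac Φ y)⁻¹ * ((G (Φ y))⁻¹ * newton G (Φ y)) * jac Φ y := by
    rw [hΦ.newton_pullback hG hy]
    exact hΦ.inv_pullback_mul hG _ hy
  have h2 : (pullback Φ G y)⁻¹ * Matrix.of (hessian (pullback Φ G) (fun z => f (Φ z)) y)
      = (jac Φ y)⁻¹ * ((G (Φ y))⁻¹ * Matrix.of (hessian G f (Φ y))) * jac Φ y := by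
    rw [hΦ.hessian_pullback hG hf hy]
    exact hΦ.inv_pullback_mul hG (S := fun z => Matrix.of (hessian G f z)) hy
  have h3 : jac Φ y * (jac Φ y)⁻¹ = 1 := hΦ.jac_mul_inv hy
  have h4 := hΦ.trace_conj ((G (Φ y))⁻¹ * newton G (Φ y)
    * ((G (Φ y))⁻¹ * Matrix.of (hessian G f (Φ y)))) hy
  rw [newtonHess, newtonHess, newtonUp, newtonUp, mul_assoc, h1, h2, mul_assoc (_ * newton G (Φ y)),
    ← h4]
  congr 1
  calc _ = (jac Φ y)⁻¹ * ((G (Φ y))⁻¹ * newton G (Φ y)) * (jac Φ y * (jac Φ y)⁻¹)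
        * ((G (Φ y))⁻¹ * Matrix.of (hessian G f (Φ y))) * jac Φ y := by noncomm_ring
    _ = _ := by
      rw [h3]
      noncomm_ring

theorem newtonHess_sum {ι : Type*} (s : Finset ι) {F : ι → EuclideanSpace ℝ (Fin n) → ℝ}
    (hU : IsOpen U) (hF : ∀ i ∈ s, ContDiffOn ℝ ∞ (F i) U) (hy : y ∈ U) :
    newtonHess G (fun z => ∑ i ∈ s, F i z) y = ∑ i ∈ s, newtonHess G (F i) y := by
  have h : Matrix.of (hessian G (fun z => ∑ i ∈ s, F i z) y)
      = ∑ i ∈ s, Matrix.of (hessian G (F i) y) := by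
    ext a b
    rw [Matrix.sum_apply]
    simp only [Matrix.of_apply, hessian]
    rw [pd_congr_on hU (fun z hz => pd_sum s hU hF hz b) hy a,
      pd_sum s hU (fun i hi => pd_smoothOn hU (hF i hi) b) hy,
      Finset.sum_sub_distrib]
    congr 1
    rw [Finset.sum_comm]
    refine Finset.sum_congr rfl fun k _ => ?_
    rw [pd_sum s hU hF hy, Finset.mul_sum]
  rw [newtonHess, h, Finset.mul_sum, Matrix.trace_sum]
  rfl

theorem newtonHess_eq_zero (hU : IsOpen U) (hf : ∀ z ∈ U, f z = 0) (hy : y ∈ U) :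
    newtonHess G f y = 0 := by
  have h1 : ∀ k, ∀ z ∈ U, pd k f z = 0 := fun k z hz => by
    rw [pd_congr_on hU hf hz k, pd_const]
  have h : Matrix.of (hessian G f y) = 0 := by
    ext a b
    simp only [Matrix.of_apply, hessian, Matrix.zero_apply, h1 _ _ hy, mul_zero,
      Finset.sum_const_zero, sub_zero]
    rw [pd_congr_on hU (h1 b) hy a, pd_const]
  rw [newtonHess, h, mul_zero, Matrix.trace_zero]

end NewtonHess

/-! ### The integral of the Newton operator over the manifold. -/

section Manifold

open MeasureTheory

variable {n : ℕ} {M : Type*} [TopologicalSpace M] [ChartedSpace (EuclideanSpace ℝ (Fin n)) M]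
  [IsManifold (𝓡 n) ∞ M] (g₀ : SmoothMetric n M) (c : M) {u w f : M → ℝ}

/-- The contraction of the Newton tensor of `g = e^{-2u} g₀` with the Hessian of `w`. -/
def newtonLap (g₀ : SmoothMetric n M) (u w : M → ℝ) (x : M) : ℝ :=
  newtonHess (confGram g₀ u x) (loc n x w) (extChartAt (𝓡 n) x x)

theorem confGram_posDef {y : EuclideanSpace ℝ (Fin n)} (hy : y ∈ (extChartAt (𝓡 n) c).target) :
    (confGram g₀ u c y).PosDef :=
  (gram_posDef g₀ c hy).smul (Real.exp_pos _)

theorem isMetricOn_confGram (hu : ContMDiff (𝓡 n) 𝓘(ℝ, ℝ) ∞ u) :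
    IsMetricOn (extChartAt (𝓡 n) c).target (confGram g₀ u c) :=
  (isMetricOn_gram g₀ c).conf (loc_smooth c hu)

theorem confGram_eqOn_pullback (c' : M) : EqOn (confGram g₀ u c)
    (pullback (transition c c') (confGram g₀ u c')) (overlap n c c') := by
  intro y hy
  change _ = pullback (transition c c') (conf (loc n c' u) (gram g₀ c')) y
  have h : loc n c u y = loc n c' u (transition c c' y) := loc_eq_comp c c' u hy
  rw [pullback_conf, conf, ← gram_eq_pullback g₀ c c' hy, ← h]
  rfl

theorem newtonLap_eq (hu : ContMDiff (𝓡 n) 𝓘(ℝ, ℝ) ∞ u) (hw : ContMDiff (𝓡 n) 𝓘(ℝ, ℝ) ∞ w)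
    {x : M} (hx : x ∈ (extChartAt (𝓡 n) c).source) :
    newtonLap g₀ u w x
      = newtonHess (confGram g₀ u c) (loc n c w) (extChartAt (𝓡 n) c x) := by
  have hΦ := isCoordChange_transition (n := n) x c
  have hy := chart_mem_overlap c hx
  rw [newtonLap, newtonHess_congr_on hΦ.isOpen_source (confGram_eqOn_pullback g₀ x c)
    (loc_eq_comp x c w) hy, hΦ.newtonHess_pullback (isMetricOn_confGram g₀ c hu)
    (loc_smooth c hw) hy, transition_chart]

omit [IsManifold (𝓡 n) ∞ M] in
theorem continuous_of_loc
    (h : ∀ c : M, ContinuousOn (loc n c f) (extChartAt (𝓡 n) c).target) : Continuous f := by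
  rw [continuous_iff_continuousAt]
  intro x
  have h1 := ((h x).comp (continuousOn_extChartAt x) (extChartAt (𝓡 n) x).mapsTo).continuousAt
    (extChartAt_source_mem_nhds (I := 𝓡 n) x)
  refine h1.congr ?_
  filter_upwards [extChartAt_source_mem_nhds (I := 𝓡 n) x] with z hz
  exact loc_chart x hz f

theorem loc_newtonLap (hu : ContMDiff (𝓡 n) 𝓘(ℝ, ℝ) ∞ u) (hw : ContMDiff (𝓡 n) 𝓘(ℝ, ℝ) ∞ w) :
    EqOn (loc n c (newtonLap g₀ u w)) (newtonHess (confGram g₀ u c) (loc n c w))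
      (extChartAt (𝓡 n) c).target := by
  intro y hy
  rw [loc, newtonLap_eq g₀ c hu hw ((extChartAt (𝓡 n) c).map_target hy),
    (extChartAt (𝓡 n) c).right_inv hy]

theorem newtonLap_continuous (hu : ContMDiff (𝓡 n) 𝓘(ℝ, ℝ) ∞ u)
    (hw : ContMDiff (𝓡 n) 𝓘(ℝ, ℝ) ∞ w) : Continuous (newtonLap g₀ u w) :=
  continuous_of_loc fun c => ((isMetricOn_confGram g₀ c hu).newtonHess_smooth
    (loc_smooth c hw)).continuousOn.congr (loc_newtonLap g₀ c hu hw)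

theorem newtonLap_eq_zero {x : M} (hx : x ∉ tsupport w) : newtonLap g₀ u w x = 0 := by
  have hO := (continuousOn_extChartAt_symm (I := 𝓡 n) x).isOpen_inter_preimage (isOpen_target x)
    (isClosed_tsupport w).isOpen_compl
  refine newtonHess_eq_zero hO (fun z hz => image_eq_zero_of_notMem_tsupport (f := w) hz.2)
    ⟨chart_mem_target x (mem_extChartAt_source x), ?_⟩
  rw [mem_preimage, (extChartAt (𝓡 n) x).left_inv (mem_extChartAt_source x)]
  exact hx

variable [CompactSpace M] [T2Space M]

theorem newtonLap_eq_sum (hw : ContMDiff (𝓡 n) 𝓘(ℝ, ℝ) ∞ w) (x : M) :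
    newtonLap g₀ u w x
      = ∑ c ∈ chartIndex n M, newtonLap g₀ u (fun x => chartPartition n M c x * w x) x := by
  have h : loc n x w = fun z => ∑ c ∈ chartIndex n M,
      loc n x (fun x => chartPartition n M c x * w x) z := by
    funext z
    simp only [loc, ← Finset.sum_mul, sum_chartPartition, one_mul]
  rw [newtonLap, h]
  exact newtonHess_sum _ (isOpen_target x)
    (fun c _ => loc_smooth x ((chartPartition n M c).contMDiff.mul hw))
    (chart_mem_target x (mem_extChartAt_source x))

omit [T2Space M] in
/-- The Newton tensor is divergence free, for functions supported in a chart. -/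
theorem chartInt_newtonLap (hn : 4 < n) (hu : ContMDiff (𝓡 n) 𝓘(ℝ, ℝ) ∞ u)
    (hw : ContMDiff (𝓡 n) 𝓘(ℝ, ℝ) ∞ w) (hs : tsupport w ⊆ (extChartAt (𝓡 n) c).source) :
    chartInt g₀ u c (newtonLap g₀ u w) = 0 := by
  set U := (extChartAt (𝓡 n) c).target with hUd
  have hU : IsOpen U := isOpen_target c
  have hG := isMetricOn_confGram g₀ c hu
  have hf := loc_smooth c hw
  have hpos : ∀ z ∈ U, 0 < (confGram g₀ u c z).det := fun z hz =>
    (confGram_posDef g₀ c hz).det_pos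
  have hdiv : ∀ z ∈ U, ∀ b, divNewton (confGram g₀ u c) z b = 0 := by
    intro z hz b
    have hP := confGram_posDef g₀ (u := u) c hz
    obtain ⟨ξ, hξ⟩ := exists_unit_vector hP ⟨0, by omega⟩
    obtain ⟨A, hA, -⟩ := exists_frame hP ⟨0, by omega⟩ ξ hξ
    exact hG.divNewton_eq_zero (by omega) hz hA b
  have hK := isCompact_image_tsupport c hs
  rw [chartInt, ← integral_sum_pd_eq_zero hU (fun i => hG.newtonFlux_smooth hpos hf i) hK
    (image_tsupport_subset c hs)]
  · refine setIntegral_congr_fun hU.measurableSet fun z hz => ?_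
    rw [loc_newtonLap g₀ c hu hw hz, hG.sum_pd_newtonFlux hpos hf hz (hdiv z hz)]
  · intro i z hz hzK
    have hz0 : ∀ j, pd j (loc n c w) z = 0 := fun j => by
      rw [pd_congr_on (hU.sdiff hK.isClosed) (fun y hy => loc_eq_zero c hy.1 hy.2) ⟨hz, hzK⟩ j,
        pd_const]
    simp [newtonFlux, hz0]

/-- The partition of unity is applied to w and not to the integrand. Each piece is then still an
exact divergence, and it is supported in a single chart. -/
theorem integral_newtonLap [MeasurableSpace M] [BorelSpace M] (hn : 4 < n)
    (hu : ContMDiff (𝓡 n) 𝓘(ℝ, ℝ) ∞ u) (hw : ContMDiff (𝓡 n) 𝓘(ℝ, ℝ) ∞ w) :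
    ∫ x, Real.exp (-n * u x) * newtonLap g₀ u w x ∂(volMeasure g₀) = 0 := by
  have hw' : ∀ c, ContMDiff (𝓡 n) 𝓘(ℝ, ℝ) ∞ (fun x => chartPartition n M c x * w x) :=
    fun c => (chartPartition n M c).contMDiff.mul hw
  have hc := fun c => newtonLap_continuous g₀ hu (hw' c)
  have huc := hu.continuous
  simp only [newtonLap_eq_sum g₀ hw, Finset.mul_sum]
  rw [integral_finsetSum _ fun c _ => integrable_of_continuous
    (by have := hc c; fun_prop)]
  refine Finset.sum_eq_zero fun c _ => ?_
  have hs : tsupport (fun x => chartPartition n M c x * w x) ⊆ (extChartAt (𝓡 n) c).source :=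
    tsupport_mul_subset_of_left (chartPartition_subordinate c) w
  have hs' : tsupport (newtonLap g₀ u (fun x => chartPartition n M c x * w x))
      ⊆ (extChartAt (𝓡 n) c).source := by
    refine (closure_minimal (fun x hx => ?_) (isClosed_tsupport _)).trans hs
    by_contra h
    exact hx (newtonLap_eq_zero g₀ h)
  rw [← volIntegral_eq_integral g₀ huc (hc c), volIntegral_eq_chartInt g₀ c huc (hc c) hs',
    chartInt_newtonLap g₀ c hn hu (hw' c) hs]

end Manifold

end SigmaTwoFlow

end

noncomputable section

namespace SigmaTwoFlow

/-! ### Variation of the curvature along a family of conformal factors -/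

section Variation

variable {n : ℕ} {U : Set (EuclideanSpace ℝ (Fin n))} {y : EuclideanSpace ℝ (Fin n)}
  {G : EuclideanSpace ℝ (Fin n) → Matrix (Fin n) (Fin n) ℝ}
  {f v : EuclideanSpace ℝ (Fin n) → ℝ}

theorem hasDerivAt_sigmaTwo {B : ℝ → Matrix (Fin n) (Fin n) ℝ} {B' : Matrix (Fin n) (Fin n) ℝ}
    {t : ℝ} (h : ∀ i j, HasDerivAt (fun s => B s i j) (B' i j) t) :
    HasDerivAt (fun s => sigmaTwo (B s)) ((B t).trace * B'.trace - (B t * B').trace) t := by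
  have h1 : HasDerivAt (fun s => (B s).trace) B'.trace t := HasDerivAt.fun_sum fun i _ => h i i
  have h2 : HasDerivAt (fun s => (B s * B s).trace)
      (∑ i, ∑ j, (B' i j * B t j i + B t i j * B' j i)) t := by
    simp only [trace_mul_eq_sum]
    exact HasDerivAt.fun_sum fun i _ => HasDerivAt.fun_sum fun j _ => (h i j).fun_mul (h j i)
  have h3 : ∑ i, ∑ j, (B' i j * B t j i + B t i j * B' j i) = 2 * (B t * B').trace := by
    simp only [Finset.sum_add_distrib, trace_mul_eq_sum]
    rw [Finset.sum_comm, two_mul]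
    congr 1
    exact Finset.sum_congr rfl fun i _ => Finset.sum_congr rfl fun j _ => mul_comm _ _
  refine (((h1.fun_pow 2).sub h2).div_const 2).congr_deriv ?_
  rw [h3]
  push_cast
  ring

theorem IsMetricOn.hessian_conf (hG : IsMetricOn U G) (hf : ContDiffOn ℝ ∞ f U) (hy : y ∈ U)
    (i j : Fin n) : hessian (SigmaTwoFlow.conf f G) v y i j = hessian G v y i j
      + (pd i v y * pd j f y + pd i f y * pd j v y)
      - (grad f y ⬝ᵥ (G y)⁻¹.mulVec (grad v y)) * G y i j := by
  have h := fun k => congrFun (congrFun (hG.chM_conf hf hy i) k) j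
  have h1 : ∀ k, christoffel (SigmaTwoFlow.conf f G) k i j y = christoffel G k i j y
      + (-(if k = i then pd j f y else 0) - (if k = j then pd i f y else 0)
        + G y j i * ∑ l, (G y)⁻¹ k l * pd l f y) := h
  have h2 : grad f y ⬝ᵥ (G y)⁻¹.mulVec (grad v y)
      = ∑ k, (∑ l, (G y)⁻¹ k l * pd l f y) * pd k v y := by
    simp only [dotProduct, Matrix.mulVec, grad, Finset.mul_sum, Finset.sum_mul]
    rw [Finset.sum_comm]
    refine Finset.sum_congr rfl fun k _ => Finset.sum_congr rfl fun l _ => ?_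
    rw [show (G y)⁻¹ l k = (G y)⁻¹ k l from congrFun (congrFun (hG.inv_symm hy) k) l]
    ring
  have h3 : ∀ (a : ℝ) (X : Fin n → ℝ), ∑ k, (-(if k = i then pd j f y else 0)
        - (if k = j then pd i f y else 0) + a * X k) * pd k v y
      = -(pd j f y * pd i v y) - pd i f y * pd j v y + a * ∑ k, X k * pd k v y := by
    intro a X
    simp only [add_mul, sub_mul, neg_mul, ite_mul, zero_mul, Finset.sum_add_distrib,
      Finset.sum_sub_distrib, Finset.sum_neg_distrib, Finset.sum_ite_eq', Finset.mem_univ, if_true,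
      Finset.mul_sum, mul_assoc]
  have h4 : ∑ k, christoffel (SigmaTwoFlow.conf f G) k i j y * pd k v y
      = ∑ k, christoffel G k i j y * pd k v y
        + (-(pd j f y * pd i v y) - pd i f y * pd j v y
          + G y j i * ∑ k, (∑ l, (G y)⁻¹ k l * pd l f y) * pd k v y) := by
    rw [← h3, ← Finset.sum_add_distrib]
    exact Finset.sum_congr rfl fun k _ => by rw [h1, add_mul]
  rw [hessian, hessian, h4, h2, hG.symm_apply hy j i]
  ring

/-- For B = g⁻¹W the expression tr B tr H - tr(BH) is the derivative of σ₂ at B in the direction H.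
So the Newton operator of the conformal metric is the linearization of σ₂. -/
theorem IsMetricOn.newtonHess_conf (hn : 2 < n) (hG : IsMetricOn U G) (hf : ContDiffOn ℝ ∞ f U)
    (hy : y ∈ U) {A : Fin n → Fin n → ℝ}
    (hA : (Matrix.of A).transpose * G y * Matrix.of A = 1) :
    newtonHess (SigmaTwoFlow.conf f G) v y = Real.exp (4 * f y)
      * (((G y)⁻¹ * wTensor G f y).trace
          * ((G y)⁻¹ * Matrix.of (hessian (SigmaTwoFlow.conf f G) v y)).trace
        - ((G y)⁻¹ * wTensor G f y * ((G y)⁻¹ * Matrix.of (hessian (SigmaTwoFlow.conf f G) v y))).trace) := by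
  have hI : (SigmaTwoFlow.conf f G y)⁻¹ = Real.exp (2 * f y) • (G y)⁻¹ := by
    refine Matrix.inv_eq_right_inv ?_
    rw [SigmaTwoFlow.conf, Matrix.smul_mul, Matrix.mul_smul, smul_smul, ← Real.exp_add,
      hG.mul_inv hy]
    simp
  have h4 : Real.exp (4 * f y) = Real.exp (2 * f y) * Real.exp (2 * f y) := by
    rw [← Real.exp_add]
    ring_nf
  have hU : newtonUp (SigmaTwoFlow.conf f G) y = ((SigmaTwoFlow.conf f G y)⁻¹
      * wTensor G f y).trace • (SigmaTwoFlow.conf f G y)⁻¹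
      - (SigmaTwoFlow.conf f G y)⁻¹ * wTensor G f y * (SigmaTwoFlow.conf f G y)⁻¹ := by
    rw [newtonUp, newton, hG.schouten_conf hn hf hy hA, mul_sub, sub_mul, Matrix.mul_smul,
      (hG.conf hf).inv_mul hy, Matrix.smul_mul, one_mul]
  rw [newtonHess, hU, hI]
  simp only [sub_mul, Matrix.smul_mul, Matrix.mul_smul, Matrix.trace_sub, Matrix.trace_smul,
    smul_eq_mul, h4, mul_assoc]
  ring

variable {I : Set ℝ} {v w : ℝ → EuclideanSpace ℝ (Fin n) → ℝ}

theorem IsMetricOn.hasDerivAt_vTensor (hG : IsMetricOn U G) (hI : IsOpen I)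
    (hv : ContDiffOn ℝ ∞ (fun q : ℝ × EuclideanSpace ℝ (Fin n) => v q.1 q.2) (I ×ˢ U))
    (hw : ∀ t ∈ I, ∀ z ∈ U, HasDerivAt (fun s => v s z) (w t z) t) {t : ℝ} (ht : t ∈ I)
    (hy : y ∈ U) (i j : Fin n) : HasDerivAt (fun s => vTensor G (v s) y i j)
      (hessian G (w t) y i j + (pd i (w t) y * pd j (v t) y + pd i (v t) y * pd j (w t) y)) t := by
  have h1 := (hasDerivAt_pd hI hG.isOpen hv hw).2
  have hF : FamilyDomain (I ×ˢ U) := FamilyDomain.of_isOpen (hI.prod hG.isOpen)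
  have h2 := fun k => (hasDerivAt_pd hI hG.isOpen (v := fun s => pd k (v s))
    (w := fun s => pd k (w s)) (hF.pd hv k) (h1 k)).2
  refine HasDerivAt.fun_add (HasDerivAt.fun_sub (h2 j i t ht y hy) (HasDerivAt.fun_sum fun k _ =>
    (h1 k t ht y hy).const_mul _)) ?_
  exact (h1 i t ht y hy).fun_mul (h1 j t ht y hy)

/-- The gradient terms produced by V and by |dv|² are exactly the change of connection between G and
the moving metric e^{-2v}G. The variation of W is therefore a pure Hessian for the moving metric,
and integration by parts needs no lower-order correction. -/
theorem IsMetricOn.hasDerivAt_wTensor (hG : IsMetricOn U G) (hI : IsOpen I)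
    (hv : ContDiffOn ℝ ∞ (fun q : ℝ × EuclideanSpace ℝ (Fin n) => v q.1 q.2) (I ×ˢ U))
    (hw : ∀ t ∈ I, ∀ z ∈ U, HasDerivAt (fun s => v s z) (w t z) t) {t : ℝ} (ht : t ∈ I)
    (hvt : ContDiffOn ℝ ∞ (v t) U) (hy : y ∈ U) (i j : Fin n) :
    HasDerivAt (fun s => wTensor G (v s) y i j) (hessian (SigmaTwoFlow.conf (v t) G) (w t) y i j) t := by
  have h1 := (hasDerivAt_pd hI hG.isOpen hv hw).2
  have h2 := hG.hasDerivAt_vTensor hI hv hw ht hy i j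
  have h3 : HasDerivAt (fun s => gradNormSq G (v s) y)
      (2 * (grad (v t) y ⬝ᵥ (G y)⁻¹.mulVec (grad (w t) y))) t := by
    have h4 : HasDerivAt (fun s => gradNormSq G (v s) y)
        (∑ k, (pd k (w t) y * (∑ l, (G y)⁻¹ k l * pd l (v t) y)
          + pd k (v t) y * ∑ l, (G y)⁻¹ k l * pd l (w t) y)) t := by
      simp only [gradNormSq, dotProduct, Matrix.mulVec, grad]
      exact HasDerivAt.fun_sum fun k _ => (h1 k t ht y hy).fun_mul
        (HasDerivAt.fun_sum fun l _ => (h1 l t ht y hy).const_mul _)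
    refine h4.congr_deriv ?_
    have h5 : ∑ k, pd k (w t) y * (∑ l, (G y)⁻¹ k l * pd l (v t) y)
        = ∑ k, pd k (v t) y * ∑ l, (G y)⁻¹ k l * pd l (w t) y := by
      simp only [Finset.mul_sum]
      rw [Finset.sum_comm]
      refine Finset.sum_congr rfl fun k _ => Finset.sum_congr rfl fun l _ => ?_
      rw [show (G y)⁻¹ l k = (G y)⁻¹ k l from congrFun (congrFun (hG.inv_symm hy) k) l]
      ring
    rw [Finset.sum_add_distrib, h5, ← two_mul]
    rfl
  have h6 := (h2.fun_sub ((h3.div_const 2).mul_const (G y i j))).add_const (schouten G y i j)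
  refine h6.congr_deriv ?_
  rw [hG.hessian_conf hvt hy]
  ring

theorem IsMetricOn.hasDerivAt_sigmaTwo (hn : 2 < n) (hG : IsMetricOn U G) (hI : IsOpen I)
    (hv : ContDiffOn ℝ ∞ (fun q : ℝ × EuclideanSpace ℝ (Fin n) => v q.1 q.2) (I ×ˢ U))
    (hw : ∀ t ∈ I, ∀ z ∈ U, HasDerivAt (fun s => v s z) (w t z) t) {t : ℝ} (ht : t ∈ I)
    (hvt : ContDiffOn ℝ ∞ (v t) U) (hy : y ∈ U) {A : Fin n → Fin n → ℝ}
    (hA : (Matrix.of A).transpose * G y * Matrix.of A = 1) :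
    HasDerivAt (fun s => sigmaTwo ((G y)⁻¹ * wTensor G (v s) y))
      (Real.exp (-4 * v t y) * newtonHess (SigmaTwoFlow.conf (v t) G) (w t) y) t := by
  have h1 : ∀ i j, HasDerivAt (fun s => ((G y)⁻¹ * wTensor G (v s) y) i j)
      (((G y)⁻¹ * Matrix.of (hessian (SigmaTwoFlow.conf (v t) G) (w t) y)) i j) t := by
    intro i j
    simp only [Matrix.mul_apply, Matrix.of_apply]
    exact HasDerivAt.fun_sum fun k _ =>
      (hG.hasDerivAt_wTensor hI hv hw ht hvt hy k j).const_mul _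
  refine (SigmaTwoFlow.hasDerivAt_sigmaTwo h1).congr_deriv ?_
  rw [hG.newtonHess_conf hn hvt hy hA, ← mul_assoc (Real.exp _), ← Real.exp_add]
  simp

theorem FamilyDomain.gradNormSq {S : Set (ℝ × EuclideanSpace ℝ (Fin n))} (hS : FamilyDomain S)
    (hG : IsMetricOn U G) (hSU : ∀ q ∈ S, q.2 ∈ U)
    (hv : ContDiffOn ℝ ∞ (fun q : ℝ × EuclideanSpace ℝ (Fin n) => v q.1 q.2) S) :
    ContDiffOn ℝ ∞ (fun q : ℝ × EuclideanSpace ℝ (Fin n) => SigmaTwoFlow.gradNormSq G (v q.1) q.2)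
      S := by
  simp only [SigmaTwoFlow.gradNormSq, dotProduct, Matrix.mulVec, grad]
  exact ContDiffOn.sum fun i _ => (hS.pd hv i).mul (ContDiffOn.sum fun j _ =>
    ((hG.smooth.inv hG.det_ne_zero).comp contDiffOn_snd hSU i j).mul (hS.pd hv j))

theorem FamilyDomain.vTensor {S : Set (ℝ × EuclideanSpace ℝ (Fin n))} (hS : FamilyDomain S)
    (hG : IsMetricOn U G) (hSU : ∀ q ∈ S, q.2 ∈ U)
    (hv : ContDiffOn ℝ ∞ (fun q : ℝ × EuclideanSpace ℝ (Fin n) => v q.1 q.2) S) :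
    MSmooth S (fun q : ℝ × EuclideanSpace ℝ (Fin n) => SigmaTwoFlow.vTensor G (v q.1) q.2) := fun i j =>
  (hS.hessian (G := fun _ => G) (hG.smooth.comp contDiffOn_snd hSU)
    (fun q hq => hG.det_ne_zero _ (hSU q hq)) hv i j).add ((hS.pd hv i).mul (hS.pd hv j))

theorem FamilyDomain.wTensor {S : Set (ℝ × EuclideanSpace ℝ (Fin n))} (hS : FamilyDomain S)
    (hG : IsMetricOn U G) (hSU : ∀ q ∈ S, q.2 ∈ U)
    (hv : ContDiffOn ℝ ∞ (fun q : ℝ × EuclideanSpace ℝ (Fin n) => v q.1 q.2) S) :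
    MSmooth S (fun q : ℝ × EuclideanSpace ℝ (Fin n) => SigmaTwoFlow.wTensor G (v q.1) q.2) :=
  ((hS.vTensor hG hSU hv).sub (MSmooth.smul ((hS.gradNormSq hG hSU hv).div_const 2)
    (hG.smooth.comp contDiffOn_snd hSU))).add
    ((schouten_smoothOn hG.isOpen hG.smooth hG.det_ne_zero).comp contDiffOn_snd hSU)

theorem FamilyDomain.hessian_of_metric {S : Set (ℝ × EuclideanSpace ℝ (Fin n))}
    (hS : FamilyDomain S) (hG : IsMetricOn U G) (hSU : ∀ q ∈ S, q.2 ∈ U)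
    (hv : ContDiffOn ℝ ∞ (fun q : ℝ × EuclideanSpace ℝ (Fin n) => v q.1 q.2) S) (i j : Fin n) :
    ContDiffOn ℝ ∞ (fun q : ℝ × EuclideanSpace ℝ (Fin n) =>
      SigmaTwoFlow.hessian G (v q.1) q.2 i j) S :=
  hS.hessian (G := fun _ => G) (hG.smooth.comp contDiffOn_snd hSU)
    (fun q hq => hG.det_ne_zero _ (hSU q hq)) hv i j

end Variation

end SigmaTwoFlow

end

noncomputable section

namespace SigmaTwoFlow

/-! ### Families of functions on the manifold -/

section Families

open MeasureTheory

variable {n : ℕ} {M : Type*} [TopologicalSpace M] [ChartedSpace (EuclideanSpace ℝ (Fin n)) M]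
  [IsManifold (𝓡 n) ∞ M] (g₀ : SmoothMetric n M) (c : M) {I : Set ℝ} {u : ℝ → M → ℝ}

theorem loc_family_smooth (hu : ContMDiffOn (𝓘(ℝ, ℝ).prod (𝓡 n)) 𝓘(ℝ, ℝ) ∞
      (fun q : ℝ × M => u q.1 q.2) (I ×ˢ univ)) :
    ContDiffOn ℝ ∞ (fun q : ℝ × EuclideanSpace ℝ (Fin n) => loc n c (u q.1) q.2)
      (I ×ˢ (extChartAt (𝓡 n) c).target) := by
  have h1 : ContMDiffOn 𝓘(ℝ, ℝ × EuclideanSpace ℝ (Fin n)) (𝓘(ℝ, ℝ).prod (𝓡 n)) ∞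
      (fun q : ℝ × EuclideanSpace ℝ (Fin n) => (q.1, (extChartAt (𝓡 n) c).symm q.2))
      (I ×ˢ (extChartAt (𝓡 n) c).target) :=
    (contDiff_fst.contMDiff.contMDiffOn).prodMk
      ((symm_smooth c).comp contDiff_snd.contMDiff.contMDiffOn fun q hq => hq.2)
  exact (hu.comp h1 fun q hq => ⟨hq.1, mem_univ _⟩).contDiffOn

omit [IsManifold (𝓡 n) ∞ M] in
theorem slice_smooth (hu : ContMDiffOn (𝓘(ℝ, ℝ).prod (𝓡 n)) 𝓘(ℝ, ℝ) ∞
      (fun q : ℝ × M => u q.1 q.2) (I ×ˢ univ)) {t : ℝ} (ht : t ∈ I) :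
    ContMDiff (𝓡 n) 𝓘(ℝ, ℝ) ∞ (u t) := by
  have h1 : ContMDiff (𝓡 n) (𝓘(ℝ, ℝ).prod (𝓡 n)) ∞ (fun x : M => (t, x)) :=
    contMDiff_const.prodMk contMDiff_id
  exact contMDiffOn_univ.1 (hu.comp h1.contMDiffOn fun x _ => ⟨ht, mem_univ _⟩)

omit [IsManifold (𝓡 n) ∞ M] in
theorem continuousOn_of_loc_family {F : ℝ → M → ℝ}
    (h : ∀ c : M, ContinuousOn (fun q : ℝ × EuclideanSpace ℝ (Fin n) => loc n c (F q.1) q.2)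
      (I ×ˢ (extChartAt (𝓡 n) c).target)) :
    ContinuousOn (fun q : ℝ × M => F q.1 q.2) (I ×ˢ univ) := by
  rintro ⟨t, x⟩ ⟨ht, -⟩
  have h1 : ContinuousOn (fun q : ℝ × M => loc n x (F q.1) (extChartAt (𝓡 n) x q.2))
      (I ×ˢ (extChartAt (𝓡 n) x).source) :=
    (h x).comp (f := fun q : ℝ × M => (q.1, extChartAt (𝓡 n) x q.2))
      (continuousOn_fst.prodMk ((continuousOn_extChartAt x).comp continuousOn_snd
        fun q hq => hq.2)) fun q hq => ⟨hq.1, chart_mem_target x hq.2⟩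
  have h2 : ContinuousOn (fun q : ℝ × M => F q.1 q.2) (I ×ˢ (extChartAt (𝓡 n) x).source) :=
    h1.congr fun q hq => (loc_chart x hq.2 (F q.1)).symm
  have h3 : ContinuousWithinAt (fun q : ℝ × M => F q.1 q.2)
      (I ×ˢ univ ∩ univ ×ˢ (extChartAt (𝓡 n) x).source) (t, x) := by
    rw [prod_inter_prod, inter_univ, univ_inter]
    exact h2 (t, x) ⟨ht, mem_extChartAt_source x⟩
  exact (continuousWithinAt_inter (((isOpen_univ.prod
    (isOpen_extChartAt_source (I := 𝓡 n) x)).mem_nhds ⟨mem_univ _, mem_extChartAt_source x⟩))).1 h3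

omit [IsManifold (𝓡 n) ∞ M] in
theorem contMDiff_of_loc {f : M → ℝ}
    (h : ∀ c : M, ContDiffOn ℝ ∞ (loc n c f) (extChartAt (𝓡 n) c).target) :
    ContMDiff (𝓡 n) 𝓘(ℝ, ℝ) ∞ f := by
  intro x
  have h1 : ContMDiffAt (𝓡 n) 𝓘(ℝ, ℝ) ∞ (fun z => loc n x f (extChartAt (𝓡 n) x z)) x :=
    (((h x).contDiffAt ((isOpen_target x).mem_nhds
      (chart_mem_target x (mem_extChartAt_source x)))).contMDiffAt).comp x contMDiffAt_extChartAt
  refine h1.congr_of_eventuallyEq ?_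
  filter_upwards [extChartAt_source_mem_nhds (I := 𝓡 n) x] with z hz
  exact (loc_chart x hz f).symm

theorem wEndo_family_smooth (hI : UniqueDiffOn ℝ I)
    (hu : ContMDiffOn (𝓘(ℝ, ℝ).prod (𝓡 n)) 𝓘(ℝ, ℝ) ∞ (fun q : ℝ × M => u q.1 q.2) (I ×ˢ univ)) :
    MSmooth (I ×ˢ (extChartAt (𝓡 n) c).target)
      (fun q : ℝ × EuclideanSpace ℝ (Fin n) => wEndo g₀ c (u q.1) q.2) := by
  have hG := isMetricOn_gram g₀ c
  have hF := FamilyDomain.prod hI (isOpen_target (n := n) c)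
  exact ((hG.smooth.inv hG.det_ne_zero).comp contDiffOn_snd fun q hq => hq.2).mul
    (hF.wTensor hG (fun q hq => hq.2) (v := fun t => loc n c (u t)) (loc_family_smooth c hu))

theorem MSmooth.sigmaTwo {X : Type*} [NormedAddCommGroup X] [NormedSpace ℝ X] {S : Set X}
    {A : X → Matrix (Fin n) (Fin n) ℝ} (hA : MSmooth S A) :
    ContDiffOn ℝ ∞ (fun z => sigmaTwo (A z)) S :=
  ((hA.trace.pow 2).sub (hA.mul hA).trace).div_const 2

theorem loc_sigma1 (hn : 4 < n) {v : M → ℝ} (hv : ContMDiff (𝓡 n) 𝓘(ℝ, ℝ) ∞ v)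
    {y : EuclideanSpace ℝ (Fin n)} (hy : y ∈ (extChartAt (𝓡 n) c).target) :
    loc n c (sigma1 g₀ v) y = Real.exp (2 * loc n c v y) * (wEndo g₀ c v y).trace := by
  rw [loc, sigma1_eq g₀ c ((extChartAt (𝓡 n) c).map_target hy) hn hv,
    (extChartAt (𝓡 n) c).right_inv hy, loc]

theorem loc_sigma2 (hn : 4 < n) {v : M → ℝ} (hv : ContMDiff (𝓡 n) 𝓘(ℝ, ℝ) ∞ v)
    {y : EuclideanSpace ℝ (Fin n)} (hy : y ∈ (extChartAt (𝓡 n) c).target) :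
    loc n c (sigma2 g₀ v) y = Real.exp (4 * loc n c v y) * sigmaTwo (wEndo g₀ c v y) := by
  rw [loc, sigma2_eq g₀ c ((extChartAt (𝓡 n) c).map_target hy) hn hv,
    (extChartAt (𝓡 n) c).right_inv hy, loc]

theorem sigma1_continuousOn (hn : 4 < n) (hI : UniqueDiffOn ℝ I)
    (hu : ContMDiffOn (𝓘(ℝ, ℝ).prod (𝓡 n)) 𝓘(ℝ, ℝ) ∞ (fun q : ℝ × M => u q.1 q.2) (I ×ˢ univ)) :
    ContinuousOn (fun q : ℝ × M => sigma1 g₀ (u q.1) q.2) (I ×ˢ univ) :=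
  continuousOn_of_loc_family (F := fun t => sigma1 g₀ (u t)) fun c =>
    (((loc_family_smooth c hu).continuousOn.const_mul 2).rexp.mul
    (wEndo_family_smooth g₀ c hI hu).trace.continuousOn).congr fun _ hq =>
      loc_sigma1 g₀ c hn (slice_smooth hu hq.1) hq.2

theorem sigma2_continuousOn (hn : 4 < n) (hI : UniqueDiffOn ℝ I)
    (hu : ContMDiffOn (𝓘(ℝ, ℝ).prod (𝓡 n)) 𝓘(ℝ, ℝ) ∞ (fun q : ℝ × M => u q.1 q.2) (I ×ˢ univ)) :
    ContinuousOn (fun q : ℝ × M => sigma2 g₀ (u q.1) q.2) (I ×ˢ univ) :=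
  continuousOn_of_loc_family (F := fun t => sigma2 g₀ (u t)) fun c =>
    (((loc_family_smooth c hu).continuousOn.const_mul 4).rexp.mul
    (wEndo_family_smooth g₀ c hI hu).sigmaTwo.continuousOn).congr fun _ hq =>
      loc_sigma2 g₀ c hn (slice_smooth hu hq.1) hq.2

omit [ChartedSpace (EuclideanSpace ℝ (Fin n)) M] [IsManifold (𝓡 n) ∞ M] in
theorem continuous_slice {F : ℝ × M → ℝ} (hF : ContinuousOn F (I ×ˢ univ)) {t : ℝ} (ht : t ∈ I) :
    Continuous fun x => F (t, x) :=
  continuousOn_univ.1 (hF.comp (f := fun x => (t, x)) (by fun_prop) fun x _ => ⟨ht, mem_univ x⟩)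

theorem sigma1_continuous (hn : 4 < n) {v : M → ℝ} (hv : ContMDiff (𝓡 n) 𝓘(ℝ, ℝ) ∞ v) :
    Continuous (sigma1 g₀ v) :=
  continuous_slice (I := univ) (t := 0) (sigma1_continuousOn g₀ (u := fun _ => v) hn
    uniqueDiffOn_univ (hv.comp contMDiff_snd).contMDiffOn) (mem_univ _)

theorem sigma2_continuous (hn : 4 < n) {v : M → ℝ} (hv : ContMDiff (𝓡 n) 𝓘(ℝ, ℝ) ∞ v) :
    Continuous (sigma2 g₀ v) :=
  continuous_slice (I := univ) (t := 0) (sigma2_continuousOn g₀ (u := fun _ => v) hn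
    uniqueDiffOn_univ (hv.comp contMDiff_snd).contMDiffOn) (mem_univ _)

/-! ### Integrals of continuous families over a compact space. -/

section Integrals

omit [ChartedSpace (EuclideanSpace ℝ (Fin n)) M] [IsManifold (𝓡 n) ∞ M]

variable [CompactSpace M] [MeasurableSpace M] [BorelSpace M] {μ : Measure M} [IsFiniteMeasure μ]
  {F F' : ℝ → M → ℝ}

theorem continuousOn_integral_family (hF : ContinuousOn (fun q : ℝ × M => F q.1 q.2) (I ×ˢ univ)) :
    ContinuousOn (fun t => ∫ x, F t x ∂μ) I :=
  continuousOn_integral_of_compact_support isCompact_univ hF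
    fun _ x _ hx => (hx (mem_univ x)).elim

theorem hasDerivAt_integral_family {a b t : ℝ}
    (hF : ContinuousOn (fun q : ℝ × M => F q.1 q.2) (Ioo a b ×ˢ univ))
    (hF' : ContinuousOn (fun q : ℝ × M => F' q.1 q.2) (Ioo a b ×ˢ univ))
    (hd : ∀ t ∈ Ioo a b, ∀ x, HasDerivAt (fun s => F s x) (F' t x) t) (ht : t ∈ Ioo a b) :
    HasDerivAt (fun t => ∫ x, F t x ∂μ) (∫ x, F' t x ∂μ) t := by
  -- A compact neighbourhood of t inside the open interval. The time derivative is only continuous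
  -- on the open interval, and on J it has the bound needed for dominated convergence.
  set J := Icc ((a + t) / 2) ((b + t) / 2) with hJ
  have hsub : J ⊆ Ioo a b := fun s hs => ⟨by linarith [hs.1, ht.1], by linarith [hs.2, ht.2]⟩
  have hJt : J ∈ 𝓝 t := Icc_mem_nhds (by linarith [ht.1]) (by linarith [ht.2])
  obtain ⟨C, hC⟩ := (isCompact_Icc.prod (isCompact_univ (X := M))).exists_bound_of_continuousOn
    (hF'.mono (prod_mono hsub Subset.rfl))
  refine (hasDerivAt_integral_of_dominated_loc_of_deriv_le (bound := fun _ => C) hJt ?_ ?_ ?_ ?_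
    (integrable_const C) ?_).2
  · filter_upwards [hJt] with s hs
    exact (continuous_slice hF (hsub hs)).measurable.aestronglyMeasurable
  · exact integrable_of_continuous (continuous_slice hF ht)
  · exact (continuous_slice hF' ht).measurable.aestronglyMeasurable
  · exact Filter.Eventually.of_forall fun x s hs => hC (s, x) ⟨hs, mem_univ x⟩
  · exact Filter.Eventually.of_forall fun x s hs => hd s (hsub hs) x

theorem mul_le_integral {f : M → ℝ} (hf : Continuous f) {a : ℝ} (h : ∀ x, a ≤ f x) :
    a * μ.real univ ≤ ∫ x, f x ∂μ := by
  have := integral_mono (μ := μ) (integrable_const a) (integrable_of_continuous hf) h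
  rwa [integral_const, smul_eq_mul, mul_comm] at this

theorem integral_le_mul {f : M → ℝ} (hf : Continuous f) {a : ℝ} (h : ∀ x, f x ≤ a) :
    ∫ x, f x ∂μ ≤ a * μ.real univ := by
  have := integral_mono (μ := μ) (integrable_of_continuous hf) (integrable_const a) h
  rwa [integral_const, smul_eq_mul, mul_comm] at this

theorem integral_pos_of_continuous [Nonempty M] (hμ : μ univ ≠ 0) {f : M → ℝ} (hf : Continuous f)
    (h : ∀ x, 0 < f x) : 0 < ∫ x, f x ∂μ := by
  obtain ⟨x, -, hx⟩ := isCompact_univ.exists_isMinOn univ_nonempty hf.continuousOn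
  refine lt_of_lt_of_le ?_ (mul_le_integral hf fun z => hx (mem_univ z))
  exact mul_pos (h x) (ENNReal.toReal_pos hμ (measure_ne_top _ _))

end Integrals

end Families

end SigmaTwoFlow

end

noncomputable section

namespace SigmaTwoFlow

/-! ### Monotonicity of the energy along the flow -/

section Flow

open MeasureTheory

variable {n : ℕ} {M : Type*} [TopologicalSpace M] [ChartedSpace (EuclideanSpace ℝ (Fin n)) M]
  [IsManifold (𝓡 n) ∞ M] [CompactSpace M] [T2Space M] {g₀ : SmoothMetric n M} {ε : ℝ}

/-- The right-hand side of the flow. -/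
def velocity (g₀ : SmoothMetric n M) (ε : ℝ) (v : M → ℝ) (x : M) : ℝ :=
  speed g₀ ε v x + sEps g₀ ε v

/-! ### Integral identities at a fixed time. -/

section SingleFactor

variable {v : M → ℝ}

theorem speed_continuous (hn : 4 < n) (hv : IsC1 g₀ v) : Continuous (speed g₀ ε v) := by
  have h1 := hv.1.continuous
  have h2 := sigma1_continuous g₀ hn hv.1
  have h3 := sigma2_continuous g₀ hn hv.1
  exact (continuous_const.mul h1).rexp.mul ((h3.sub (continuous_const.mul
    (continuous_const.mul h1).rexp)).div h2 fun x => (hv.2 x).ne')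

variable [MeasurableSpace M] [BorelSpace M]

theorem energy_eq_integral (hn : 4 < n) (hv : ContMDiff (𝓡 n) 𝓘(ℝ, ℝ) ∞ v) :
    energy g₀ v = ∫ x, Real.exp (-n * v x) * sigma2 g₀ v x ∂(volMeasure g₀) :=
  volIntegral_eq_integral g₀ hv.continuous (sigma2_continuous g₀ hn hv)

theorem pertVol_eq_integral (hv : Continuous v) :
    pertVol g₀ ε v = ∫ x, Real.exp ((2 * ε - n) * v x) ∂(volMeasure g₀) := by
  rw [pertVol, volIntegral_eq_integral g₀ hv (by fun_prop)]
  refine integral_congr_ae (Filter.Eventually.of_forall fun x => ?_)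
  simp only [← Real.exp_add]
  ring_nf

theorem pertVol_pos [Nonempty M] (hv : Continuous v) : 0 < pertVol g₀ ε v := by
  rw [pertVol_eq_integral hv]
  exact integral_pos_of_continuous (volMeasure_univ_ne_zero g₀) (by fun_prop)
    fun x => Real.exp_pos _

/-- This is the defining property of s, read as the vanishing of the first variation of the
perturbed volume up to the factor 2ε - n. -/
theorem integral_velocity [Nonempty M] (hn : 4 < n) (hv : IsC1 g₀ v) :
    ∫ x, Real.exp ((2 * ε - n) * v x) * velocity g₀ ε v x ∂(volMeasure g₀) = 0 := by
  have hc := hv.1.continuous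
  have hs := speed_continuous (ε := ε) hn hv
  have h1 : ∀ x, Real.exp ((2 * ε - n) * v x) * velocity g₀ ε v x
      = Real.exp (-n * v x) * (Real.exp (2 * ε * v x) * speed g₀ ε v x)
        + Real.exp ((2 * ε - n) * v x) * sEps g₀ ε v := by
    intro x
    rw [velocity, ← mul_assoc, ← Real.exp_add, mul_add]
    ring_nf
  simp only [h1]
  rw [integral_add (integrable_of_continuous (by fun_prop))
      (integrable_of_continuous (by fun_prop)), integral_mul_const,
    ← volIntegral_eq_integral g₀ hc (by fun_prop), ← pertVol_eq_integral hc, sEps,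
    mul_div_cancel₀ _ (pertVol_pos hc).ne', add_neg_cancel]

/-- Write σ₂ = (σ₂ - r e^{2εu}) + r e^{2εu}. The second part integrates to zero against the velocity
by the choice of s. Against the first part, the constant s integrates to zero by the choice of r,
and the rest is e^{-2u}(σ₂ - r e^{2εu})²/σ₁. -/
theorem integral_velocity_mul_sigma2_nonneg [Nonempty M] (hn : 4 < n) (hv : IsC1 g₀ v) :
    0 ≤ ∫ x, velocity g₀ ε v x * (Real.exp (-n * v x) * sigma2 g₀ v x) ∂(volMeasure g₀) := by
  have hc := hv.1.continuous
  have hs := speed_continuous (ε := ε) hn hv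
  have h1 := sigma1_continuous g₀ hn hv.1
  have h2 := sigma2_continuous g₀ hn hv.1
  have hw : Continuous (velocity g₀ ε v) := hs.add continuous_const
  set r := rEps g₀ ε v with hr
  set s := sEps g₀ ε v with hsd
  have hV := pertVol_pos (g₀ := g₀) (ε := ε) hc
  have hq : Continuous fun x => Real.exp (-n * v x) * (Real.exp (-2 * v x)
      * (sigma2 g₀ v x - r * Real.exp (2 * ε * v x)) ^ 2 / sigma1 g₀ v x) :=
    (by fun_prop : Continuous fun x => Real.exp (-n * v x)).mul
      (Continuous.div (by fun_prop) h1 fun x => (hv.2 x).ne')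
  have hpt : ∀ x, velocity g₀ ε v x * (Real.exp (-n * v x) * sigma2 g₀ v x)
      = Real.exp (-n * v x) * (Real.exp (-2 * v x)
        * (sigma2 g₀ v x - r * Real.exp (2 * ε * v x)) ^ 2 / sigma1 g₀ v x)
        + (r * (Real.exp ((2 * ε - n) * v x) * velocity g₀ ε v x)
        + (s * (Real.exp (-n * v x) * sigma2 g₀ v x)
          + -(s * r) * Real.exp ((2 * ε - n) * v x))) := by
    intro x
    have he : Real.exp ((2 * ε - n) * v x) = Real.exp (-n * v x) * Real.exp (2 * ε * v x) := by
      rw [← Real.exp_add]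
      ring_nf
    have h0 := (hv.2 x).ne'
    rw [he, velocity, speed]
    field_simp
    ring
  have hz : r * pertVol g₀ ε v = energy g₀ v := by
    rw [hr, rEps, div_mul_cancel₀ _ hV.ne']
  simp only [hpt]
  rw [integral_add (integrable_of_continuous hq) (integrable_of_continuous (by fun_prop)),
    integral_add (integrable_of_continuous (by fun_prop)) (integrable_of_continuous (by fun_prop)),
    integral_add (integrable_of_continuous (by fun_prop)) (integrable_of_continuous (by fun_prop)),
    integral_const_mul, integral_const_mul, integral_const_mul, integral_velocity hn hv,
    ← energy_eq_integral hn hv.1, ← pertVol_eq_integral hc, ← hz, mul_zero, zero_add,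
    show s * (r * pertVol g₀ ε v) + -(s * r) * pertVol g₀ ε v = 0 by ring, add_zero]
  refine integral_nonneg fun x => ?_
  have := hv.2 x
  simp only [Pi.zero_apply]
  positivity

end SingleFactor

/-! ### Evolution of volume and energy along a solution. -/

namespace IsFlowSolution

variable {T : ℝ} {u : ℝ → M → ℝ} (h : IsFlowSolution g₀ ε T u)

include h

/-- At each point σ₁ is continuous in time and never zero, so it keeps its initial positive sign by
the intermediate value theorem. -/
theorem isC1 (hn : 4 < n) (hT : 0 < T) (h0 : IsC1 g₀ (u 0)) {t : ℝ} (ht : t ∈ Icc 0 T) :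
    IsC1 g₀ (u t) := by
  refine ⟨slice_smooth h.smooth ht, fun x => ?_⟩
  have hc : ContinuousOn (fun s => sigma1 g₀ (u s) x) (Icc 0 T) :=
    (sigma1_continuousOn g₀ hn (uniqueDiffOn_Icc hT) h.smooth).comp (f := fun s : ℝ => (s, x))
      (by fun_prop) fun s hs => ⟨hs, mem_univ _⟩
  by_contra! hneg
  obtain ⟨s, hs, hs0⟩ := (isPreconnected_Icc.intermediate_value ht (left_mem_Icc.2 hT.le) hc)
    ⟨hneg, (h0.2 x).le⟩
  exact h.sigma1_ne_zero s hs x hs0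

theorem continuousOn : ContinuousOn (fun q : ℝ × M => u q.1 q.2) (Icc 0 T ×ˢ univ) :=
  h.smooth.continuousOn

theorem hasDerivAt {t : ℝ} (ht : t ∈ Ioo 0 T) (x : M) :
    HasDerivAt (fun s => u s x) (velocity g₀ ε (u t) x) t :=
  (h.evolution t (Ioo_subset_Icc_self ht) x).hasDerivAt (Icc_mem_nhds ht.1 ht.2)

/-- In charts, the velocity is smooth in space and time. -/
theorem loc_velocity_smooth (c : M) : ContDiffOn ℝ ∞
    (fun q : ℝ × EuclideanSpace ℝ (Fin n) => loc n c (velocity g₀ ε (u q.1)) q.2)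
    (Ioo 0 T ×ˢ (extChartAt (𝓡 n) c).target) :=
  (hasDerivAt_pd isOpen_Ioo (isOpen_target c) (v := fun t => loc n c (u t))
    (w := fun t => loc n c (velocity g₀ ε (u t)))
    ((loc_family_smooth c h.smooth).mono (prod_mono Ioo_subset_Icc_self Subset.rfl))
    fun _ ht _ _ => h.hasDerivAt ht _).1

theorem velocity_smooth {t : ℝ} (ht : t ∈ Ioo 0 T) :
    ContMDiff (𝓡 n) 𝓘(ℝ, ℝ) ∞ (velocity g₀ ε (u t)) :=
  contMDiff_of_loc fun c => (h.loc_velocity_smooth c).comp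
    (f := fun z : EuclideanSpace ℝ (Fin n) => (t, z))
    (contDiff_const.prodMk contDiff_id).contDiffOn fun _ hz => ⟨ht, hz⟩

theorem hasDerivAt_sigmaTwo_wEndo (hn : 4 < n) (c : M) {t : ℝ} (ht : t ∈ Ioo 0 T)
    {y : EuclideanSpace ℝ (Fin n)} (hy : y ∈ (extChartAt (𝓡 n) c).target) :
    HasDerivAt (fun s => sigmaTwo (wEndo g₀ c (u s) y))
      (Real.exp (-4 * loc n c (u t) y)
        * newtonHess (confGram g₀ (u t) c) (loc n c (velocity g₀ ε (u t))) y) t := by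
  have hP := gram_posDef g₀ c hy
  obtain ⟨ξ, hξ⟩ := exists_unit_vector hP ⟨0, by omega⟩
  obtain ⟨A, hA, -⟩ := exists_frame hP ⟨0, by omega⟩ ξ hξ
  exact (isMetricOn_gram g₀ c).hasDerivAt_sigmaTwo (by omega) isOpen_Ioo
    (v := fun t => loc n c (u t)) (w := fun t => loc n c (velocity g₀ ε (u t)))
    ((loc_family_smooth c h.smooth).mono (prod_mono Ioo_subset_Icc_self Subset.rfl))
    (fun _ ht _ _ => h.hasDerivAt ht _) ht
    (loc_smooth c (slice_smooth h.smooth (Ioo_subset_Icc_self ht))) hy hA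

theorem newtonLap_continuousOn (hn : 4 < n) (hT : 0 < T) : ContinuousOn
    (fun q : ℝ × M => Real.exp (-4 * u q.1 q.2)
      * newtonLap g₀ (u q.1) (velocity g₀ ε (u q.1)) q.2) (Ioo 0 T ×ˢ univ) := by
  refine continuousOn_of_loc_family (n := n) (F := fun t x => Real.exp (-4 * u t x)
      * newtonLap g₀ (u t) (velocity g₀ ε (u t)) x) fun c => ?_
  have h1 := (hasDerivAt_pd isOpen_Ioo (isOpen_target c)
    (v := fun t y => sigmaTwo (wEndo g₀ c (u t) y))
    (((wEndo_family_smooth g₀ c (uniqueDiffOn_Icc hT) h.smooth).sigmaTwo).mono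
      (prod_mono Ioo_subset_Icc_self Subset.rfl))
    fun t ht y hy => h.hasDerivAt_sigmaTwo_wEndo hn c ht hy).1
  refine h1.continuousOn.congr fun q hq => ?_
  have h2 := loc_newtonLap g₀ c (slice_smooth h.smooth (Ioo_subset_Icc_self hq.1))
    (h.velocity_smooth hq.1) hq.2
  simp only [← h2]
  rfl

/-- In terms of B the density is e^{(4-n)u} σ₂(B). The exponent accounts for the factor 4 - n, and
the variation of σ₂(B) is the Newton operator applied to the velocity. -/
theorem hasDerivAt_exp_mul_sigma2 (hn : 4 < n) {t : ℝ} (ht : t ∈ Ioo 0 T) (x : M) :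
    HasDerivAt (fun s => Real.exp (-n * u s x) * sigma2 g₀ (u s) x)
      ((4 - n) * (velocity g₀ ε (u t) x * (Real.exp (-n * u t x) * sigma2 g₀ (u t) x))
        + Real.exp (-n * u t x) * newtonLap g₀ (u t) (velocity g₀ ε (u t)) x) t := by
  have hx : x ∈ (extChartAt (𝓡 n) x).source := mem_extChartAt_source x
  have h1 : ∀ s ∈ Ioo 0 T, Real.exp (-n * u s x) * sigma2 g₀ (u s) x
      = Real.exp ((4 - n) * u s x) * sigmaTwo (wEndo g₀ x (u s) (extChartAt (𝓡 n) x x)) := by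
    intro s hs
    rw [sigma2_eq g₀ x hx hn (slice_smooth h.smooth (Ioo_subset_Icc_self hs)), ← mul_assoc,
      ← Real.exp_add]
    ring_nf
  have h2 := (((h.hasDerivAt ht x).const_mul (4 - (n : ℝ))).exp).fun_mul
    (h.hasDerivAt_sigmaTwo_wEndo hn x ht (chart_mem_target x hx))
  refine (h2.congr_of_eventuallyEq ?_).congr_deriv ?_
  · filter_upwards [isOpen_Ioo.mem_nhds ht] with s hs using h1 s hs
  · rw [h1 t ht, loc_chart x hx, ← mul_assoc (Real.exp ((4 - n) * u t x)) (Real.exp _),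
      ← Real.exp_add, newtonLap]
    ring_nf

variable [MeasurableSpace M] [BorelSpace M]

theorem energy_continuousOn (hn : 4 < n) (hT : 0 < T) :
    ContinuousOn (fun t => energy g₀ (u t)) (Icc 0 T) := by
  have h1 := sigma2_continuousOn g₀ hn (uniqueDiffOn_Icc hT) h.smooth
  have h2 := h.continuousOn
  refine (continuousOn_integral_family (μ := volMeasure g₀)
    (F := fun t x => Real.exp (-n * u t x) * sigma2 g₀ (u t) x)
    ((h2.const_mul _).rexp.mul h1)).congr fun t ht =>
      energy_eq_integral hn (slice_smooth h.smooth ht)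

theorem pertVol_continuousOn : ContinuousOn (fun t => pertVol g₀ ε (u t)) (Icc 0 T) :=
  (continuousOn_integral_family (μ := volMeasure g₀)
    (F := fun t x => Real.exp ((2 * ε - n) * u t x))
    (h.continuousOn.const_mul _).rexp).congr fun _ ht =>
      pertVol_eq_integral (slice_smooth h.smooth ht).continuous

omit [MeasurableSpace M] [BorelSpace M] in
theorem velocity_continuousOn : ContinuousOn
    (fun q : ℝ × M => velocity g₀ ε (u q.1) q.2) (Ioo 0 T ×ˢ univ) :=
  continuousOn_of_loc_family (F := fun t => velocity g₀ ε (u t)) fun c =>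
    (h.loc_velocity_smooth c).continuousOn

/-- The derivative vanishes on the open interval by `integral_velocity`; continuity extends
constancy to the closed interval. -/
theorem pertVol_eq [Nonempty M] (hn : 4 < n) (hT : 0 < T) (h0 : IsC1 g₀ (u 0)) {t : ℝ}
    (ht : t ∈ Icc 0 T) : pertVol g₀ ε (u t) = pertVol g₀ ε (u 0) := by
  have hsub : Ioo 0 T ×ˢ (univ : Set M) ⊆ Icc 0 T ×ˢ univ :=
    prod_mono Ioo_subset_Icc_self Subset.rfl
  have hu := h.continuousOn.mono hsub
  have hw := h.velocity_continuousOn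
  have hF : ContinuousOn (fun q : ℝ × M => Real.exp ((2 * ε - n) * u q.1 q.2))
      (Ioo 0 T ×ˢ univ) := (hu.const_mul _).rexp
  have hd : ∀ t ∈ Ioo 0 T, HasDerivAt (fun t => pertVol g₀ ε (u t)) 0 t := by
    intro t ht
    have h1 := hasDerivAt_integral_family (μ := volMeasure g₀)
      (F := fun t x => Real.exp ((2 * ε - n) * u t x))
      (F' := fun t x => (2 * ε - n) * (Real.exp ((2 * ε - n) * u t x) * velocity g₀ ε (u t) x))
      hF ((hF.mul hw).const_mul _)
      (fun t ht x => ((h.hasDerivAt ht x).const_mul (2 * ε - n)).exp.congr_deriv (by ring)) ht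
    rw [integral_const_mul, integral_velocity hn (h.isC1 hn hT h0 (Ioo_subset_Icc_self ht)),
      mul_zero] at h1
    refine h1.congr_of_eventuallyEq ?_
    filter_upwards [isOpen_Ioo.mem_nhds ht] with s hs using
      pertVol_eq_integral (slice_smooth h.smooth (Ioo_subset_Icc_self hs)).continuous
  have hi : interior (Icc 0 T) = Ioo 0 T := interior_Icc
  have hdiff : DifferentiableOn ℝ (fun t => pertVol g₀ ε (u t)) (interior (Icc 0 T)) := by
    rw [hi]
    exact fun t ht => (hd t ht).differentiableAt.differentiableWithinAt
  have ha := antitoneOn_of_deriv_nonpos (convex_Icc 0 T) h.pertVol_continuousOn hdiff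
    (by rw [hi]; exact fun t ht => (hd t ht).deriv.le)
  have hm := monotoneOn_of_deriv_nonneg (convex_Icc 0 T) h.pertVol_continuousOn hdiff
    (by rw [hi]; exact fun t ht => (hd t ht).deriv.ge)
  exact le_antisymm (ha (left_mem_Icc.2 hT.le) ht ht.1) (hm (left_mem_Icc.2 hT.le) ht ht.1)

/-- The Newton operator integrates to zero, so the derivative is (4 - n) times a nonnegative
integral. This is where the sign of 4 - n is essential. -/
theorem energy_le [Nonempty M] (hn : 4 < n) (hT : 0 < T) (h0 : IsC1 g₀ (u 0)) {t : ℝ}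
    (ht : t ∈ Icc 0 T) : energy g₀ (u t) ≤ energy g₀ (u 0) := by
  have hsub : Ioo 0 T ×ˢ (univ : Set M) ⊆ Icc 0 T ×ˢ univ :=
    prod_mono Ioo_subset_Icc_self Subset.rfl
  have hu := h.continuousOn.mono hsub
  have hw := h.velocity_continuousOn
  have hF : ContinuousOn (fun q : ℝ × M => Real.exp (-n * u q.1 q.2) * sigma2 g₀ (u q.1) q.2)
      (Ioo 0 T ×ˢ univ) := (hu.const_mul _).rexp.mul
        ((sigma2_continuousOn g₀ hn (uniqueDiffOn_Icc hT) h.smooth).mono hsub)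
  have hN : ContinuousOn (fun q : ℝ × M => Real.exp (-n * u q.1 q.2)
      * newtonLap g₀ (u q.1) (velocity g₀ ε (u q.1)) q.2) (Ioo 0 T ×ˢ univ) := by
    refine ((hu.const_mul (4 - (n : ℝ))).rexp.mul (h.newtonLap_continuousOn hn hT)).congr
      fun q _ => ?_
    rw [Pi.mul_apply, ← mul_assoc, ← Real.exp_add]
    ring_nf
  have hd : ∀ t ∈ Ioo 0 T, HasDerivAt (fun t => energy g₀ (u t)) ((4 - n)
      * ∫ x, velocity g₀ ε (u t) x * (Real.exp (-n * u t x) * sigma2 g₀ (u t) x)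
        ∂(volMeasure g₀)) t := by
    intro t ht
    have h1 := hasDerivAt_integral_family (μ := volMeasure g₀)
      (F := fun t x => Real.exp (-n * u t x) * sigma2 g₀ (u t) x)
      (F' := fun t x => (4 - n) * (velocity g₀ ε (u t) x
          * (Real.exp (-n * u t x) * sigma2 g₀ (u t) x))
        + Real.exp (-n * u t x) * newtonLap g₀ (u t) (velocity g₀ ε (u t)) x)
      hF (((hw.mul hF).const_mul _).add hN) (fun t ht x => h.hasDerivAt_exp_mul_sigma2 hn ht x) ht
    have hc1 : Continuous fun x => (4 - (n : ℝ)) * (velocity g₀ ε (u t) x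
        * (Real.exp (-n * u t x) * sigma2 g₀ (u t) x)) :=
      continuous_slice ((hw.mul hF).const_mul _) ht
    have hc2 : Continuous fun x => Real.exp (-n * u t x)
        * newtonLap g₀ (u t) (velocity g₀ ε (u t)) x := continuous_slice hN ht
    rw [integral_add (integrable_of_continuous hc1) (integrable_of_continuous hc2), integral_const_mul,
      integral_newtonLap g₀ hn (slice_smooth h.smooth (Ioo_subset_Icc_self ht))
      (h.velocity_smooth ht), add_zero] at h1
    refine h1.congr_of_eventuallyEq ?_
    filter_upwards [isOpen_Ioo.mem_nhds ht] with s hs using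
      energy_eq_integral hn (slice_smooth h.smooth (Ioo_subset_Icc_self hs))
  have hi : interior (Icc 0 T) = Ioo 0 T := interior_Icc
  have ha := antitoneOn_of_deriv_nonpos (convex_Icc 0 T) (h.energy_continuousOn hn hT)
    (by rw [hi]; exact fun t ht => (hd t ht).differentiableAt.differentiableWithinAt)
    (by
      rw [hi]
      intro t ht
      rw [(hd t ht).deriv]
      have h4 : (4 : ℝ) < n := by exact_mod_cast hn
      exact mul_nonpos_of_nonpos_of_nonneg (by linarith) (integral_velocity_mul_sigma2_nonneg hn
        (h.isC1 hn hT h0 (Ioo_subset_Icc_self ht))))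
  exact ha (left_mem_Icc.2 hT.le) ht ht.1

end IsFlowSolution

end Flow

end SigmaTwoFlow

end

noncomputable section

namespace SigmaTwoFlow

/-! ### Bounds for the normalizing constant -/

section Traces

variable {n : ℕ}

theorem sum_sq_diag_le_trace_mul_self {Q : Matrix (Fin n) (Fin n) ℝ} (hQ : Q.transpose = Q) :
    ∑ i, Q i i ^ 2 ≤ (Q * Q).trace := by
  rw [trace_mul_eq_sum]
  refine Finset.sum_le_sum fun i _ => ?_
  have h : ∀ j, Q i j * Q j i = Q i j ^ 2 := fun j => by
    rw [show Q j i = Q i j from congrFun (congrFun hQ i) j, sq]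
  simp only [h]
  exact Finset.single_le_sum (f := fun j => Q i j ^ 2) (fun j _ => sq_nonneg _) (Finset.mem_univ i)

theorem inv_eq_mul_transpose {G A : Matrix (Fin n) (Fin n) ℝ} (hA : A.transpose * G * A = 1) :
    G⁻¹ = A * A.transpose := by
  refine Matrix.inv_eq_left_inv ?_
  rw [mul_assoc]
  exact mul_eq_one_comm.1 hA

/-- Cauchy–Schwarz for the diagonal entries in an orthonormal frame. It also supplies the
nonnegativity of tr (G⁻¹S)². -/
theorem sq_trace_le_trace_mul_self {G S : Matrix (Fin n) (Fin n) ℝ} (hG : G.PosDef)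
    (hS : S.transpose = S) (hn : 0 < n) :
    (G⁻¹ * S).trace ^ 2 ≤ n * (G⁻¹ * S * (G⁻¹ * S)).trace := by
  obtain ⟨ξ, hξ⟩ := exists_unit_vector hG ⟨0, hn⟩
  obtain ⟨A, hA, -⟩ := exists_frame hG ⟨0, hn⟩ ξ hξ
  set B : Matrix (Fin n) (Fin n) ℝ := Matrix.of A
  set Q := B.transpose * S * B with hQd
  have hQ : Q.transpose = Q := by
    rw [hQd, Matrix.transpose_mul, Matrix.transpose_mul, hS, Matrix.transpose_transpose, mul_assoc]
  have h1 : (G⁻¹ * S).trace = Q.trace := by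
    rw [inv_eq_mul_transpose hA, mul_assoc, Matrix.trace_mul_comm]
  have h2 : (G⁻¹ * S * (G⁻¹ * S)).trace = (Q * Q).trace := by
    rw [inv_eq_mul_transpose hA, hQd,
      show B * B.transpose * S * (B * B.transpose * S)
        = B * (B.transpose * S * B * (B.transpose * S)) by noncomm_ring, Matrix.trace_mul_comm]
    congr 1
    noncomm_ring
  rw [h1, h2]
  refine le_trans ?_ (mul_le_mul_of_nonneg_left (sum_sq_diag_le_trace_mul_self hQ)
    (Nat.cast_nonneg n))
  have := sq_sum_le_card_mul_sum_sq (s := Finset.univ) (f := fun i => Q i i)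
  simpa [Matrix.trace] using this

end Traces

/-! ### Two-sided bounds for r_ε. -/

section Bounds

open MeasureTheory

variable {n : ℕ} {M : Type*} [TopologicalSpace M] [ChartedSpace (EuclideanSpace ℝ (Fin n)) M]
  [IsManifold (𝓡 n) ∞ M] (g₀ : SmoothMetric n M)

theorem trace_wEndo (c : M) {u : M → ℝ} {y : EuclideanSpace ℝ (Fin n)}
    (hy : y ∈ (extChartAt (𝓡 n) c).target) :
    (wEndo g₀ c u y).trace = ((gram g₀ c y)⁻¹
        * Matrix.of (hessian (gram g₀ c) (loc n c u) y)).trace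
      - (n / 2 - 1) * gradNormSq (gram g₀ c) (loc n c u) y
      + ((gram g₀ c y)⁻¹ * schouten (gram g₀ c) y).trace := by
  have h1 : ((gram g₀ c y)⁻¹ * Matrix.vecMulVec (grad (loc n c u) y) (grad (loc n c u) y)).trace
      = gradNormSq (gram g₀ c) (loc n c u) y := by
    rw [Matrix.mul_vecMulVec, Matrix.trace_vecMulVec, dotProduct_comm]
    rfl
  rw [wEndo, wTensor, vTensor, mul_add, mul_sub, mul_add, Matrix.mul_smul,
    (isMetricOn_gram g₀ c).inv_mul hy, Matrix.trace_add, Matrix.trace_sub, Matrix.trace_add, h1,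
    Matrix.trace_smul, Matrix.trace_one, Fintype.card_fin, smul_eq_mul]
  ring

theorem gradSq_nonneg (u : M → ℝ) (hu : ContMDiff (𝓡 n) 𝓘(ℝ, ℝ) ∞ u) (x : M) :
    0 ≤ gradSq g₀ u x := by
  have hx : x ∈ (extChartAt (𝓡 n) x).source := mem_extChartAt_source x
  rw [gradSq_eq g₀ x hx hu]
  exact (gram_posDef g₀ x (chart_mem_target x hx)).inv.posSemidef.dotProduct_mulVec_nonneg _

/-- The trace of the background Schouten tensor is σ₁ of g₀ itself, the case u = 0. In this form it
is a continuous function on M, hence bounded. -/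
theorem trace_schouten_eq_sigma1 (hn : 4 < n) (x : M) :
    ((gram g₀ x (extChartAt (𝓡 n) x x))⁻¹
      * schouten (gram g₀ x) (extChartAt (𝓡 n) x x)).trace = sigma1 g₀ (fun _ => 0) x := by
  have hx : x ∈ (extChartAt (𝓡 n) x).source := mem_extChartAt_source x
  have h0 : ∀ k, pd k (loc n x fun _ => 0) = fun _ => 0 := fun k => funext fun z => pd_const 0 k
  have h1 : Matrix.of (hessian (gram g₀ x) (loc n x fun _ => 0) (extChartAt (𝓡 n) x x)) = 0 := by
    ext i j
    simp [hessian, h0, pd_const]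
  have h2 : gradNormSq (gram g₀ x) (loc n x fun _ => 0) (extChartAt (𝓡 n) x x) = 0 := by
    have : grad (loc n x fun _ => 0) (extChartAt (𝓡 n) x x) = 0 := funext fun k =>
      congrFun (h0 k) _
    rw [gradNormSq, this, zero_dotProduct]
  rw [sigma1_eq g₀ x hx hn contMDiff_const, trace_wEndo g₀ x (chart_mem_target x hx), h1, h2]
  simp

variable [CompactSpace M]

/-- `σ₂(g)` is bounded above in terms of a bound for `u` and its first two derivatives. -/
theorem exists_sigma2_le (hn : 4 < n) (K : ℝ) : ∃ C, 0 ≤ C ∧ ∀ u : M → ℝ, IsC1 g₀ u →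
    (∀ x, |u x| + Real.sqrt (gradSq g₀ u x) + hessNorm g₀ u x ≤ K) →
    ∀ x, sigma2 g₀ u x ≤ C := by
  obtain ⟨A, hA⟩ := isCompact_univ.exists_bound_of_continuousOn
    (sigma1_continuous g₀ hn contMDiff_const (v := fun _ => 0)).continuousOn
  refine ⟨Real.exp (4 * K) * ((n * K + A) ^ 2 / 2), by positivity, fun u hu hK x => ?_⟩
  have hx : x ∈ (extChartAt (𝓡 n) x).source := mem_extChartAt_source x
  have hy := chart_mem_target x hx
  set y := extChartAt (𝓡 n) x x
  have hs := loc_smooth x hu.1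
  have hG := isMetricOn_gram g₀ x
  have hP := gram_posDef g₀ x hy
  have hn4 : (4 : ℝ) < n := by exact_mod_cast hn
  have hH : (Matrix.of (hessian (gram g₀ x) (loc n x u) y)).transpose
      = Matrix.of (hessian (gram g₀ x) (loc n x u) y) := by
    ext i j
    simp only [Matrix.transpose_apply, Matrix.of_apply, hessian, pd_comm hG.isOpen hs hy j i,
      fun k => hG.christoffel_symm hy k j i]
  have hW : (wTensor (gram g₀ x) (loc n x u) y).transpose = wTensor (gram g₀ x) (loc n x u) y := by
    ext i j
    exact hG.wTensor_symm hs hy j i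
  have h0 : (0 : ℝ) ≤ hessNorm g₀ u x := Real.sqrt_nonneg _
  have h1 : |u x| ≤ K := by linarith [hK x, Real.sqrt_nonneg (gradSq g₀ u x)]
  have h2 : hessNorm g₀ u x ≤ K := by
    linarith [hK x, Real.sqrt_nonneg (gradSq g₀ u x), abs_nonneg (u x)]
  have hKn : 0 ≤ K := h0.trans h2
  have htr : 0 < (wEndo g₀ x u y).trace := by
    have := hu.2 x
    rw [sigma1_eq g₀ x hx hn hu.1] at this
    exact pos_of_mul_pos_right this (Real.exp_pos _).le
  have h3 : ((gram g₀ x y)⁻¹ * Matrix.of (hessian (gram g₀ x) (loc n x u) y)).trace ≤ n * K := by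
    have h4 := sq_trace_le_trace_mul_self hP hH (by omega)
    have h5 : hessNorm g₀ u x ^ 2 = (((gram g₀ x y)⁻¹ * Matrix.of (hessian (gram g₀ x)
        (loc n x u) y)) * ((gram g₀ x y)⁻¹ * Matrix.of (hessian (gram g₀ x)
        (loc n x u) y))).trace := by
      rw [hessNorm_eq g₀ x hx hu.1, Real.sq_sqrt]
      · rfl
      · exact nonneg_of_mul_nonneg_right ((sq_nonneg _).trans h4) (by linarith)
    rw [← h5] at h4
    refine abs_le_of_sq_le_sq' (h4.trans ?_) (by positivity) |>.2
    have h6 : hessNorm g₀ u x ^ 2 ≤ K ^ 2 := pow_le_pow_left₀ h0 h2 2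
    calc (n : ℝ) * hessNorm g₀ u x ^ 2 ≤ n * K ^ 2 := mul_le_mul_of_nonneg_left h6 (by linarith)
      _ ≤ n * (n * K ^ 2) := mul_le_mul_of_nonneg_left
        (le_mul_of_one_le_left (sq_nonneg K) (by linarith)) (by linarith)
      _ = (n * K) ^ 2 := by ring
  have h7 : (wEndo g₀ x u y).trace ≤ n * K + A := by
    rw [trace_wEndo g₀ x hy, trace_schouten_eq_sigma1 g₀ hn]
    have h8 := gradSq_nonneg g₀ u hu.1 x
    rw [gradSq_eq g₀ x hx hu.1] at h8
    have h9 := (le_abs_self _).trans (hA x (mem_univ x))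
    have : 0 ≤ ((n : ℝ) / 2 - 1) * gradNormSq (gram g₀ x) (loc n x u) y :=
      mul_nonneg (by linarith) h8
    linarith
  have h10 : 0 ≤ (wEndo g₀ x u y * wEndo g₀ x u y).trace :=
    nonneg_of_mul_nonneg_right
      ((sq_nonneg _).trans (sq_trace_le_trace_mul_self hP hW (by omega))) (by linarith)
  rw [sigma2_eq g₀ x hx hn hu.1]
  -- Here 2σ₂ = σ₁² - |B|² ≤ σ₁². The upper bound for σ₁ needs only the Hessian, because the
  -- gradient term enters with a negative sign.
  have h11 : sigmaTwo (wEndo g₀ x u y) ≤ (n * K + A) ^ 2 / 2 := by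
    rw [sigmaTwo]
    have := pow_le_pow_left₀ htr.le h7 2
    linarith
  exact (mul_le_mul_of_nonneg_left h11 (Real.exp_pos _).le).trans
    (mul_le_mul_of_nonneg_right (Real.exp_le_exp.2 (by linarith [le_abs_self (u x)]))
      (by positivity))

variable [T2Space M]

/-- The normalizing constant stays between two positive constants along the flow. -/
theorem exists_rEps_bounds [Nonempty M] (hn : 4 < n) {K : ℝ} (hK : 0 < K) :
    ∃ c C : ℝ, 0 < c ∧ ∀ ε ∈ Ico (0 : ℝ) 1, ((K⁻¹ : ℝ) : EReal) ≤ yamabeConst g₀ ε →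
      ∀ T : ℝ, 0 < T → ∀ u : ℝ → M → ℝ, IsFlowSolution g₀ ε T u → IsC1 g₀ (u 0) →
        (∀ x, |u 0 x| + Real.sqrt (gradSq g₀ (u 0) x) + hessNorm g₀ (u 0) x ≤ K) →
        ∀ t ∈ Icc 0 T, c ≤ rEps g₀ ε (u t) ∧ rEps g₀ ε (u t) ≤ C := by
  borelize M
  obtain ⟨S, hS0, hS⟩ := exists_sigma2_le g₀ hn K
  set m := (volMeasure g₀).real univ with hm
  have hmpos : 0 < m := ENNReal.toReal_pos (volMeasure_univ_ne_zero g₀) (measure_ne_top _ _)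
  -- The exponent α - 1 of the volume lies in [-1, 0] and depends on ε. Since Vmax ≥ 1, the power is
  -- at least Vmax⁻¹ for all such ε.
  set Vmax := max 1 (Real.exp (n * K) * m) with hVmax
  set Vmin := Real.exp (-(n * K)) * m with hVmin
  have hn4 : (4 : ℝ) < n := by exact_mod_cast hn
  have hVmin0 : 0 < Vmin := by positivity
  have hVmax1 : 1 ≤ Vmax := le_max_left _ _
  refine ⟨K⁻¹ * Vmax⁻¹, Real.exp (n * K) * S * m / Vmin, by positivity, ?_⟩
  intro ε hε hY T hT u h h0 hK0 t ht
  have hu0 := h0.1.continuous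
  have hb : ∀ x, |u 0 x| ≤ K := fun x => by
    have h1 : (0 : ℝ) ≤ hessNorm g₀ (u 0) x := Real.sqrt_nonneg _
    linarith [hK0 x, Real.sqrt_nonneg (gradSq g₀ (u 0) x)]
  have hexp : ∀ a : ℝ, |a| ≤ n → ∀ x, -(n * K) ≤ a * u 0 x ∧ a * u 0 x ≤ n * K := by
    intro a ha x
    rw [← abs_le, abs_mul]
    exact mul_le_mul ha (hb x) (abs_nonneg _) (by linarith)
  have hεn : |2 * ε - n| ≤ (n : ℝ) := abs_le.2 ⟨by linarith [hε.1], by linarith [hε.2]⟩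
  have hV := h.pertVol_eq hn hT h0 ht
  have hV1 : Vmin ≤ pertVol g₀ ε (u t) := by
    rw [hV, pertVol_eq_integral hu0]
    exact mul_le_integral (by fun_prop) fun x => Real.exp_le_exp.2 (hexp _ hεn x).1
  have hV2 : pertVol g₀ ε (u t) ≤ Vmax := by
    rw [hV, pertVol_eq_integral hu0]
    refine le_trans ?_ (le_max_right _ _)
    exact integral_le_mul (by fun_prop) fun x => Real.exp_le_exp.2 (hexp _ hεn x).2
  have hVpos : 0 < pertVol g₀ ε (u t) := hVmin0.trans_le hV1
  have hE : energy g₀ (u t) ≤ Real.exp (n * K) * S * m := by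
    refine (h.energy_le hn hT h0 ht).trans ?_
    rw [energy_eq_integral hn h0.1]
    have hc := sigma2_continuous g₀ hn h0.1
    refine integral_le_mul (by fun_prop) fun x => ?_
    refine (mul_le_mul_of_nonneg_left (hS (u 0) h0 hK0 x) (Real.exp_pos _).le).trans
      (mul_le_mul_of_nonneg_right (Real.exp_le_exp.2 ?_) hS0)
    exact (hexp (-n) (by rw [abs_neg, abs_of_pos (by linarith)]) x).2
  constructor
  · set V := pertVol g₀ ε (u t) with hVd
    set α := ((n : ℝ) - 4) / ((n : ℝ) - 2 * ε) with hα
    have h1 : ((K⁻¹ : ℝ) : EReal) ≤ ((V ^ (-α) * energy g₀ (u t) : ℝ) : EReal) :=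
      hY.trans (iInf₂_le (u t) (h.isC1 hn hT h0 ht))
    have h2 : K⁻¹ ≤ V ^ (-α) * energy g₀ (u t) := EReal.coe_le_coe_iff.1 h1
    have hd : (0 : ℝ) < n - 2 * ε := by linarith [hε.2]
    have h3 : -1 ≤ α - 1 := by
      have : 0 ≤ α := div_nonneg (by linarith) hd.le
      linarith
    have h4 : α - 1 ≤ 0 := by
      have : α ≤ 1 := (div_le_one hd).2 (by linarith [hε.2])
      linarith
    -- The metric at time t is a competitor for the Yamabe constant, so its energy is at least
    -- K⁻¹V^α. Division by the conserved volume V gives the lower bound for r.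
    have h5 : K⁻¹ * V ^ (α - 1) ≤ energy g₀ (u t) / V := by
      have e : V ^ (α - 1) = V ^ α / V := by rw [Real.rpow_sub_one hVpos.ne']
      have e2 : K⁻¹ * V ^ α ≤ energy g₀ (u t) := by
        calc K⁻¹ * V ^ α ≤ V ^ (-α) * energy g₀ (u t) * V ^ α :=
              mul_le_mul_of_nonneg_right h2 (Real.rpow_nonneg hVpos.le _)
          _ = energy g₀ (u t) := by
            rw [mul_right_comm, ← Real.rpow_add hVpos, neg_add_cancel, Real.rpow_zero, one_mul]
      rw [e, ← mul_div_assoc]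
      exact div_le_div_of_nonneg_right e2 hVpos.le
    refine le_trans (mul_le_mul_of_nonneg_left ?_ (inv_nonneg.2 hK.le)) h5
    calc Vmax⁻¹ = Vmax ^ (-1 : ℝ) := (Real.rpow_neg_one _).symm
      _ ≤ Vmax ^ (α - 1) := Real.rpow_le_rpow_of_exponent_le hVmax1 h3
      _ ≤ V ^ (α - 1) := Real.rpow_le_rpow_of_nonpos hVpos hV2 h4
  · exact div_le_div₀ (by positivity) hE hVmin0 hV1

end Bounds

end SigmaTwoFlow

end

noncomputable section

namespace SigmaTwoFlow

/-! ### Uniform bounds in normal coordinates -/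

section NormalFamily

variable {n : ℕ} {V : Set (EuclideanSpace ℝ (Fin n))}
  {G : EuclideanSpace ℝ (Fin n) → Matrix (Fin n) (Fin n) ℝ}

/-- The parameters `(y, A, z)`, with `z` in the domain of the normal coordinates at `y` with
frame `A`. -/
def normalFamily (V : Set (EuclideanSpace ℝ (Fin n)))
    (G : EuclideanSpace ℝ (Fin n) → Matrix (Fin n) (Fin n) ℝ) :
    Set ((EuclideanSpace ℝ (Fin n) × (Fin n → Fin n → ℝ)) × EuclideanSpace ℝ (Fin n)) :=
  {q | q.1.1 ∈ V ∧ q.2 ∈ normalDomain V G q.1.1 q.1.2}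

/-- The orthonormal frames over `K`. -/
def frames (K : Set (EuclideanSpace ℝ (Fin n)))
    (G : EuclideanSpace ℝ (Fin n) → Matrix (Fin n) (Fin n) ℝ) :
    Set (EuclideanSpace ℝ (Fin n) × (Fin n → Fin n → ℝ)) :=
  {p | p.1 ∈ K ∧ (Matrix.of p.2).transpose * G p.1 * Matrix.of p.2 = 1}

theorem normalMap_family_smooth (hG : IsMetricOn V G) (i : Fin n) : ContDiffOn ℝ ∞
    (fun q : (EuclideanSpace ℝ (Fin n) × (Fin n → Fin n → ℝ)) × EuclideanSpace ℝ (Fin n) =>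
      normalMap G q.1.1 q.1.2 q.2 i) {q | q.1.1 ∈ V} := by
  have hy : ContDiff ℝ ∞ fun q : (EuclideanSpace ℝ (Fin n) × (Fin n → Fin n → ℝ))
      × EuclideanSpace ℝ (Fin n) => q.1.1 := by fun_prop
  have hΓ : ∀ i j k, ContDiffOn ℝ ∞ (fun q : (EuclideanSpace ℝ (Fin n) × (Fin n → Fin n → ℝ))
      × EuclideanSpace ℝ (Fin n) => christoffel G i j k q.1.1) {q | q.1.1 ∈ V} := fun i j k =>
    (christoffel_smoothOn hG.isOpen hG.smooth hG.det_ne_zero i j k).comp hy.contDiffOn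
      fun q hq => hq
  have hA : ∀ i a, ContDiff ℝ ∞ fun q : (EuclideanSpace ℝ (Fin n) × (Fin n → Fin n → ℝ))
      × EuclideanSpace ℝ (Fin n) => q.1.2 i a := fun i a => by fun_prop
  have hz : ∀ a, ContDiff ℝ ∞ fun q : (EuclideanSpace ℝ (Fin n) × (Fin n → Fin n → ℝ))
      × EuclideanSpace ℝ (Fin n) => q.2 a := fun a => by fun_prop
  simp only [normalMap, quadMap, normalCoeff]
  refine ContDiffOn.sub (ContDiffOn.add (by fun_prop) (ContDiffOn.sum fun a _ =>
    ((hA i a).mul (hz a)).contDiffOn)) (contDiffOn_const.mul (ContDiffOn.sum fun a _ =>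
    ContDiffOn.sum fun b _ => (ContDiffOn.sum fun j _ => ContDiffOn.sum fun k _ =>
      (hΓ i j k).mul ((hA j a).mul (hA k b)).contDiffOn).mul ((hz a).mul (hz b)).contDiffOn))

theorem isOpen_base (hV : IsOpen V) : IsOpen
    {q : (EuclideanSpace ℝ (Fin n) × (Fin n → Fin n → ℝ)) × EuclideanSpace ℝ (Fin n)
      | q.1.1 ∈ V} :=
  hV.preimage (by fun_prop)

theorem jac_normalMap_family_smooth (hG : IsMetricOn V G) : MSmooth {q | q.1.1 ∈ V}
    (fun q : (EuclideanSpace ℝ (Fin n) × (Fin n → Fin n → ℝ)) × EuclideanSpace ℝ (Fin n) =>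
      jac (normalMap G q.1.1 q.1.2) q.2) := fun i a =>
  (FamilyDomain.of_isOpen (isOpen_base hG.isOpen)).pd
    (f := fun p z => normalMap G p.1 p.2 z i) (normalMap_family_smooth hG i) a

theorem normalMap_family_smooth' (hG : IsMetricOn V G) : ContDiffOn ℝ ∞
    (fun q : (EuclideanSpace ℝ (Fin n) × (Fin n → Fin n → ℝ)) × EuclideanSpace ℝ (Fin n) =>
      normalMap G q.1.1 q.1.2 q.2) {q | q.1.1 ∈ V} :=
  contDiffOn_euclidean.2 (normalMap_family_smooth hG)

theorem isOpen_normalFamily (hG : IsMetricOn V G) : IsOpen (normalFamily V G) := by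
  have h0 := isOpen_base (n := n) hG.isOpen
  have h1 := (normalMap_family_smooth' hG).continuousOn.isOpen_inter_preimage h0 hG.isOpen
  have h2 := (jac_normalMap_family_smooth hG).det.continuousOn.isOpen_inter_preimage h0
    (isOpen_ne (x := (0 : ℝ)))
  refine isOpen_iff_mem_nhds.2 fun q hq => ?_
  filter_upwards [(h1.inter h2).mem_nhds ⟨⟨hq.1, hq.2.1⟩, ⟨hq.1, hq.2.2⟩⟩] with q' h
  exact ⟨h.1.1, h.1.2, h.2.2⟩

theorem pullback_normalMap_family_smooth (hG : IsMetricOn V G) : MSmooth (normalFamily V G)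
    (fun q => pullback (normalMap G q.1.1 q.1.2) G q.2) := by
  have hJ := (jac_normalMap_family_smooth hG).mono (T := normalFamily V G) fun q hq => hq.1
  exact (hJ.transpose.mul (hG.smooth.comp ((normalMap_family_smooth' hG).mono fun q hq => hq.1)
    fun q hq => hq.2.1)).mul hJ

theorem pullback_normalMap_family_det (hG : IsMetricOn V G) : ∀ q ∈ normalFamily V G,
    (pullback (normalMap G q.1.1 q.1.2) G q.2).det ≠ 0 := fun q hq =>
  ((isCoordChange_normalMap hG.isOpen q.1.1 q.1.2).isMetricOn hG).det_ne_zero q.2 hq.2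

theorem mem_normalFamily_of_mem_frames (hG : IsMetricOn V G) {K : Set (EuclideanSpace ℝ (Fin n))}
    (hKV : K ⊆ V) {p : EuclideanSpace ℝ (Fin n) × (Fin n → Fin n → ℝ)} (hp : p ∈ frames K G) :
    (p, (0 : EuclideanSpace ℝ (Fin n))) ∈ normalFamily V G :=
  ⟨hKV hp.1, (isNormal_pullback_normalMap hG (hKV hp.1) hp.2).zero_mem⟩

/-- For an orthonormal frame G⁻¹ = AAᵀ, so the squares of the entries of A add up to tr G⁻¹, which
is bounded by R over K. The radius 1 + R suffices because a² ≤ R implies |a| ≤ 1 + R. -/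
theorem isCompact_frames (hG : IsMetricOn V G) {K : Set (EuclideanSpace ℝ (Fin n))}
    (hK : IsCompact K) (hKV : K ⊆ V) : IsCompact (frames K G) := by
  obtain ⟨R, hR⟩ := hK.exists_bound_of_continuousOn
    ((hG.smooth.inv hG.det_ne_zero).trace.continuousOn.mono hKV)
  have hB : IsCompact (K ×ˢ Metric.closedBall (0 : Fin n → Fin n → ℝ) (1 + R)) :=
    hK.prod (isCompact_closedBall _ _)
  have hc : ContinuousOn (fun p : EuclideanSpace ℝ (Fin n) × (Fin n → Fin n → ℝ) =>
      (Matrix.of p.2).transpose * G p.1 * Matrix.of p.2)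
      (K ×ˢ Metric.closedBall (0 : Fin n → Fin n → ℝ) (1 + R)) := by
    have h1 : ∀ i j, ContinuousOn (fun p : EuclideanSpace ℝ (Fin n) × (Fin n → Fin n → ℝ) =>
        G p.1 i j) (K ×ˢ Metric.closedBall (0 : Fin n → Fin n → ℝ) (1 + R)) := fun i j =>
      ((hG.smooth i j).continuousOn.mono hKV).comp continuousOn_fst fun p hp => hp.1
    have hA : ∀ i a, Continuous fun p : EuclideanSpace ℝ (Fin n) × (Fin n → Fin n → ℝ) =>
        p.2 i a := fun i a => by fun_prop
    refine continuousOn_pi.2 fun i => continuousOn_pi.2 fun j => ?_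
    simp only [Matrix.mul_apply, Matrix.transpose_apply, Matrix.of_apply]
    exact continuousOn_finsetSum _ fun a _ => (continuousOn_finsetSum _ fun b _ =>
      (hA b i).continuousOn.mul (h1 b a)).mul (hA a j).continuousOn
  have e : frames K G = (K ×ˢ Metric.closedBall (0 : Fin n → Fin n → ℝ) (1 + R))
      ∩ (fun p : EuclideanSpace ℝ (Fin n) × (Fin n → Fin n → ℝ) =>
        (Matrix.of p.2).transpose * G p.1 * Matrix.of p.2) ⁻¹' {1} := by
    ext p
    refine ⟨fun h => ⟨⟨h.1, ?_⟩, h.2⟩, fun h => ⟨h.1.1, h.2⟩⟩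
    have h1 := hR p.1 h.1
    rw [inv_eq_mul_transpose h.2, trace_mul_eq_sum, Real.norm_eq_abs] at h1
    have hR0 : 0 ≤ R := (abs_nonneg _).trans h1
    have h2 : ∀ i a, p.2 i a ^ 2 ≤ R := fun i a => by
      refine le_trans ?_ ((le_abs_self _).trans h1)
      simp only [Matrix.of_apply, Matrix.transpose_apply, ← sq]
      exact (Finset.single_le_sum (f := fun a => p.2 i a ^ 2) (fun _ _ => sq_nonneg _)
        (Finset.mem_univ a)).trans (Finset.single_le_sum (f := fun i => ∑ a, p.2 i a ^ 2)
          (fun _ _ => Finset.sum_nonneg fun _ _ => sq_nonneg _) (Finset.mem_univ i))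
    rw [mem_closedBall_zero_iff, pi_norm_le_iff_of_nonneg (by linarith)]
    refine fun i => (pi_norm_le_iff_of_nonneg (by linarith)).2 fun a => ?_
    exact abs_le_of_sq_le_sq (by nlinarith [h2 i a]) (by linarith)
  rw [e]
  exact hB.of_isClosed_subset (hc.preimage_isClosed_of_isClosed hB.isClosed isClosed_singleton)
    inter_subset_left

/-- A finite collection of continuous functions on a compact set has a common bound. -/
theorem exists_common_bound {X ι : Type*} [TopologicalSpace X] [Fintype ι] {C : Set X}
    (hC : IsCompact C) {f : ι → X → ℝ} (hf : ∀ i, ContinuousOn (f i) C) :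
    ∃ B, ∀ i, ∀ x ∈ C, |f i x| ≤ B := by
  obtain ⟨B, hB⟩ := hC.exists_bound_of_continuousOn (continuousOn_pi.2 hf)
  exact ⟨B, fun i x hx => (norm_le_pi_norm (fun i => f i x) i).trans (hB x hx)⟩

variable {K : Set (EuclideanSpace ℝ (Fin n))}

/-- Quantities at the origin of normal coordinates depend continuously on the point and the frame,
and these range over a compact set. Uniform bounds thus need no explicit formula. -/
theorem exists_bound_family (hG : IsMetricOn V G) (hK : IsCompact K) (hKV : K ⊆ V) {ι : Type*}
    [Fintype ι] {f : ι → EuclideanSpace ℝ (Fin n) × (Fin n → Fin n → ℝ) →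
      EuclideanSpace ℝ (Fin n) → ℝ}
    (hf : ∀ i, ContDiffOn ℝ ∞ (fun q : (EuclideanSpace ℝ (Fin n) × (Fin n → Fin n → ℝ))
      × EuclideanSpace ℝ (Fin n) => f i q.1 q.2) (normalFamily V G)) :
    ∃ B, ∀ i, ∀ p ∈ frames K G, |f i p 0| ≤ B :=
  exists_common_bound (isCompact_frames hG hK hKV) (f := fun i p => f i p 0) fun i =>
    (hf i).continuousOn.comp (f := fun p => (p, (0 : EuclideanSpace ℝ (Fin n)))) (by fun_prop)
      fun p hp => mem_normalFamily_of_mem_frames hG hKV hp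

theorem exists_jet_bound_family (hG : IsMetricOn V G) (hK : IsCompact K) (hKV : K ⊆ V) {ι : Type*}
    [Fintype ι] {f : ι → EuclideanSpace ℝ (Fin n) × (Fin n → Fin n → ℝ) →
      EuclideanSpace ℝ (Fin n) → ℝ}
    (hf : ∀ i, ContDiffOn ℝ ∞ (fun q : (EuclideanSpace ℝ (Fin n) × (Fin n → Fin n → ℝ))
      × EuclideanSpace ℝ (Fin n) => f i q.1 q.2) (normalFamily V G)) :
    ∃ B, ∀ i, ∀ p ∈ frames K G, |f i p 0| ≤ B ∧ (∀ a, |pd a (f i p) 0| ≤ B) ∧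
      ∀ a b, |pd a (pd b (f i p)) 0| ≤ B := by
  have hF := FamilyDomain.of_isOpen (isOpen_normalFamily hG)
  obtain ⟨B₁, h1⟩ := exists_bound_family hG hK hKV hf
  obtain ⟨B₂, h2⟩ := exists_bound_family hG hK hKV (ι := ι × Fin n)
    (f := fun i p => pd i.2 (f i.1 p)) fun i => hF.pd (hf i.1) i.2
  obtain ⟨B₃, h3⟩ := exists_bound_family hG hK hKV (ι := ι × Fin n × Fin n)
    (f := fun i p => pd i.2.1 (pd i.2.2 (f i.1 p))) fun i =>
      hF.pd (f := fun p => pd i.2.2 (f i.1 p)) (hF.pd (hf i.1) i.2.2) i.2.1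
  refine ⟨max B₁ (max B₂ B₃), fun i p hp => ⟨(h1 i p hp).trans (by simp), fun a =>
    (h2 (i, a) p hp).trans (by simp), fun a b => (h3 (i, a, b) p hp).trans (by simp)⟩⟩

theorem exists_jetBound_family (hG : IsMetricOn V G) (hK : IsCompact K) (hKV : K ⊆ V)
    {F : EuclideanSpace ℝ (Fin n) × (Fin n → Fin n → ℝ) → EuclideanSpace ℝ (Fin n) →
      Matrix (Fin n) (Fin n) ℝ} (hS : MSmooth (normalFamily V G) fun q => F q.1 q.2)
    (hd : ∀ q ∈ normalFamily V G, (F q.1 q.2).det ≠ 0) :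
    ∃ B, ∀ p ∈ frames K G, JetBound (F p) B := by
  have hF := FamilyDomain.of_isOpen (isOpen_normalFamily hG)
  have hI := hS.inv hd
  have hΓ := hF.christoffel hS hd
  have hA := hF.schouten hS hd
  obtain ⟨B₁, h1⟩ := exists_jet_bound_family hG hK hKV (ι := Fin n × Fin n)
    (f := fun i p z => F p z i.1 i.2) fun i => hS i.1 i.2
  obtain ⟨B₂, h2⟩ := exists_jet_bound_family hG hK hKV (ι := Fin n × Fin n)
    (f := fun i p z => (F p z)⁻¹ i.1 i.2) fun i => hI i.1 i.2
  obtain ⟨B₃, h3⟩ := exists_jet_bound_family hG hK hKV (ι := Fin n × Fin n × Fin n)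
    (f := fun i p => christoffel (F p) i.1 i.2.1 i.2.2) fun i => hΓ i.1 i.2.1 i.2.2
  obtain ⟨B₄, h4⟩ := exists_jet_bound_family hG hK hKV (ι := Fin n × Fin n)
    (f := fun i p z => schouten (F p) z i.1 i.2) fun i => hA i.1 i.2
  have e1 : B₁ ≤ max (max B₁ B₂) (max B₃ B₄) := by simp
  have e2 : B₂ ≤ max (max B₁ B₂) (max B₃ B₄) := by simp
  have e3 : B₃ ≤ max (max B₁ B₂) (max B₃ B₄) := by simp
  have e4 : B₄ ≤ max (max B₁ B₂) (max B₃ B₄) := by simp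
  exact ⟨max (max B₁ B₂) (max B₃ B₄), fun p hp =>
    ⟨fun a b i j => ((h1 (i, j) p hp).2.2 a b).trans e1,
      fun a b i j => ((h2 (i, j) p hp).2.2 a b).trans e2,
      fun a k i j => ((h3 (k, i, j) p hp).2.1 a).trans e3,
      fun a b k i j => ((h3 (k, i, j) p hp).2.2 a b).trans e3,
      fun i j => (h4 (i, j) p hp).1.trans e4, fun a i j => ((h4 (i, j) p hp).2.1 a).trans e4,
      fun a b i j => ((h4 (i, j) p hp).2.2 a b).trans e4⟩⟩

/-- The jets of the metric in normal coordinates are uniformly bounded on compact sets. -/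
theorem exists_jetBound (hG : IsMetricOn V G) (hK : IsCompact K) (hKV : K ⊆ V) :
    ∃ B, ∀ p ∈ frames K G, JetBound (pullback (normalMap G p.1 p.2) G) B :=
  exists_jetBound_family hG hK hKV (F := fun p => pullback (normalMap G p.1 p.2) G)
    (pullback_normalMap_family_smooth hG) (pullback_normalMap_family_det hG)

/-- Derivative bounds for squares of cutoff functions, uniformly in normal coordinates. -/
theorem exists_cutoff_bound (hG : IsMetricOn V G) (hK : IsCompact K) (hKV : K ⊆ V)
    {χ : EuclideanSpace ℝ (Fin n) → ℝ} (hχ : ContDiffOn ℝ ∞ χ V) :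
    ∃ L, 0 ≤ L ∧ ∀ p ∈ frames K G,
      (∀ m, pd m (fun z => χ (normalMap G p.1 p.2 z) ^ 2) 0 ^ 2
        ≤ L * χ (normalMap G p.1 p.2 0) ^ 2) ∧
      ∀ l m, |pd l (pd m fun z => χ (normalMap G p.1 p.2 z) ^ 2) 0| ≤ L := by
  have hF := FamilyDomain.of_isOpen (isOpen_normalFamily hG)
  have hf : ContDiffOn ℝ ∞ (fun q : (EuclideanSpace ℝ (Fin n) × (Fin n → Fin n → ℝ))
      × EuclideanSpace ℝ (Fin n) => χ (normalMap G q.1.1 q.1.2 q.2)) (normalFamily V G) :=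
    hχ.comp ((normalMap_family_smooth' hG).mono fun q hq => hq.1) fun q hq => hq.2.1
  obtain ⟨B₁, h1⟩ := exists_bound_family hG hK hKV (ι := Fin n)
    (f := fun m p => pd m fun z => χ (normalMap G p.1 p.2 z)) fun m => hF.pd (f := fun p z => χ (normalMap G p.1 p.2 z)) hf m
  obtain ⟨B₂, h2⟩ := exists_bound_family hG hK hKV (ι := Fin n × Fin n)
    (f := fun i p => pd i.1 (pd i.2 fun z => χ (normalMap G p.1 p.2 z) ^ 2)) fun i =>
      hF.pd (f := fun p => pd i.2 fun z => χ (normalMap G p.1 p.2 z) ^ 2)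
        (hF.pd (f := fun p z => χ (normalMap G p.1 p.2 z) ^ 2) (hf.pow 2) i.2) i.1
  refine ⟨4 * B₁ ^ 2 + |B₂|, by positivity, fun p hp => ⟨fun m => ?_, fun l m => ?_⟩⟩
  · have h0 := (isNormal_pullback_normalMap hG (hKV hp.1) hp.2).zero_mem
    have hc := isCoordChange_normalMap (G := G) hG.isOpen p.1 p.2
    have hs : ContDiffOn ℝ ∞ (fun z => χ (normalMap G p.1 p.2 z)) (normalDomain V G p.1 p.2) :=
      hχ.comp hc.smooth hc.mapsTo
    -- This is why the cutoff is squared: ∂(χ²) = 2χ∂χ gives |∂η|² ≤ 4|∂χ|² η, including at points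
    -- where η vanishes.
    have h3 : pd m (fun z => χ (normalMap G p.1 p.2 z) ^ 2) 0
        = 2 * χ (normalMap G p.1 p.2 0) * pd m (fun z => χ (normalMap G p.1 p.2 z)) 0 := by
      simp only [sq]
      rw [pd_mul hc.isOpen_source hs hs h0]
      ring
    have h4 : pd m (fun z => χ (normalMap G p.1 p.2 z)) 0 ^ 2 ≤ B₁ ^ 2 :=
      sq_le_sq' (abs_le.1 (h1 m p hp)).1 (abs_le.1 (h1 m p hp)).2
    rw [h3]
    have h5 := sq_nonneg (χ (normalMap G p.1 p.2 0))
    calc (2 * χ (normalMap G p.1 p.2 0) * pd m (fun z => χ (normalMap G p.1 p.2 z)) 0) ^ 2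
        = 4 * pd m (fun z => χ (normalMap G p.1 p.2 z)) 0 ^ 2 * χ (normalMap G p.1 p.2 0) ^ 2 := by
          ring
      _ ≤ _ := by
          refine mul_le_mul_of_nonneg_right ?_ h5
          linarith [abs_nonneg B₂]
  · exact (h2 (l, m) p hp).trans ((le_abs_self _).trans (by nlinarith [sq_nonneg B₁]))

end NormalFamily

/-! ### Cutoff functions on geodesic balls -/

section Cutoff

variable {n : ℕ} {M : Type*} [TopologicalSpace M] [ChartedSpace (EuclideanSpace ℝ (Fin n)) M]
  [IsManifold (𝓡 n) ∞ M] [T2Space M] [CompactSpace M] (g₀ : SmoothMetric n M) (p : M)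

-- The triangle inequality, together with the fact that points near x have small Riemannian distance
-- to x. This is all the topology of the balls that the cutoff function requires.
omit [T2Space M] [CompactSpace M] in
theorem exists_nhds_geodesicBall {δ : ℝ} (hδ : 0 < δ) (x : M) :
    ∀ᶠ z in 𝓝 x, ∀ r : ℝ, 0 < r → (z ∈ geodesicBall g₀ p r → x ∈ geodesicBall g₀ p (r + δ)) ∧
      (x ∈ geodesicBall g₀ p r → z ∈ geodesicBall g₀ p (r + δ)) := by
  let _ : Bundle.RiemannianBundle (fun x : M => TangentSpace (𝓡 n) x) := ⟨g₀.toRiemannianMetric⟩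
  have : IsContMDiffRiemannianBundle (𝓡 n) ∞ (EuclideanSpace ℝ (Fin n))
      (fun x : M => TangentSpace (𝓡 n) x) := ⟨g₀.inner, g₀.contMDiff, fun x v w => rfl⟩
  have : IsContinuousRiemannianBundle (EuclideanSpace ℝ (Fin n))
      (fun x : M => TangentSpace (𝓡 n) x) :=
    ⟨g₀.inner, g₀.contMDiff.continuous, fun x v w => rfl⟩
  filter_upwards [eventually_riemannianEDist_lt (𝓡 n) x (ENNReal.ofReal_pos.2 hδ)] with z hz r hr
  rw [geodesicBall, geodesicBall, mem_ofPred_eq, mem_ofPred_eq, mem_ofPred_eq, mem_ofPred_eq,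
    ENNReal.ofReal_add hr.le hδ.le]
  refine ⟨fun h => ?_, fun h => ?_⟩
  · rw [Manifold.riemannianEDist_comm] at hz
    exact (Manifold.riemannianEDist_triangle (y := z)).trans_lt (ENNReal.add_lt_add h hz)
  · exact (Manifold.riemannianEDist_triangle (y := x)).trans_lt (ENNReal.add_lt_add h hz)

/-- Two margins of R/4 place the closure of the half ball inside the interior of the full ball, and
the smooth Urysohn lemma separates them. -/
theorem exists_cutoff {R : ℝ} (hR : 0 < R) : ∃ χ : M → ℝ, ContMDiff (𝓡 n) 𝓘(ℝ, ℝ) ∞ χ ∧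
    (∀ x, χ x ∈ Icc (0 : ℝ) 1) ∧ (∀ x ∈ geodesicBall g₀ p (R / 2), χ x = 1) ∧
    ∀ x, χ x ≠ 0 → x ∈ geodesicBall g₀ p R := by
  set O := interior (geodesicBall g₀ p R) with hO
  have hsub : closure (geodesicBall g₀ p (R / 2)) ⊆ O := by
    intro x hx
    rw [hO, mem_interior_iff_mem_nhds]
    have h1 := exists_nhds_geodesicBall g₀ p (δ := R / 4) (by positivity) x
    obtain ⟨z, hz, hzb⟩ := (mem_closure_iff_nhds.1 hx) _ h1
    have h2 := (hz (R / 2) (by positivity)).1 hzb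
    filter_upwards [h1] with w hw
    have := (hw (R / 2 + R / 4) (by positivity)).2 h2
    rwa [show R / 2 + R / 4 + R / 4 = R by ring] at this
  obtain ⟨χ, h0, h1, h2⟩ := exists_contMDiffMap_zero_one_of_isClosed (n := ⊤) (𝓡 n)
    (isOpen_interior (s := geodesicBall g₀ p R)).isClosed_compl
    (isClosed_closure (s := geodesicBall g₀ p (R / 2)))
    (disjoint_compl_left.mono_right hsub)
  refine ⟨χ, χ.contMDiff, h2, fun x hx => h1 (subset_closure hx), fun x hx => ?_⟩
  by_contra h
  exact hx (h0 fun h' => h (interior_subset h'))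

end Cutoff

end SigmaTwoFlow

end

noncomputable section

namespace SigmaTwoFlow

/-! ### The test function in orthonormal frames -/

section FrameTest

variable {n : ℕ}

/-- The value `V(ξ, ξ) + tr V`, in an orthonormal frame `A` with `ξ = A e_{i₀}`. -/
def frameTest (V A : Matrix (Fin n) (Fin n) ℝ) (i₀ : Fin n) : ℝ :=
  (A.transpose * V * A) i₀ i₀ + (A.transpose * V * A).trace

/-- The value depends only on the column i₀ of the frame, so this is a function on unit tangent
vectors. Whole frames are carried along because a frame is what determines normal coordinates. -/
theorem frameTest_eq {G V A : Matrix (Fin n) (Fin n) ℝ} (hA : A.transpose * G * A = 1)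
    (i₀ : Fin n) : frameTest V A i₀ = A.col i₀ ⬝ᵥ V.mulVec (A.col i₀) + (G⁻¹ * V).trace := by
  rw [frameTest, inv_eq_mul_transpose hA, mul_assoc A, Matrix.trace_mul_comm A]
  congr 1
  rw [mul_assoc]
  rfl

theorem frameTest_conj (V J A : Matrix (Fin n) (Fin n) ℝ) (i₀ : Fin n) :
    frameTest (J.transpose * V * J) A i₀ = frameTest V (J * A) i₀ := by
  rw [frameTest, frameTest, show A.transpose * (J.transpose * V * J) * A
    = (J * A).transpose * V * (J * A) by rw [Matrix.transpose_mul]; noncomm_ring]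

/-- The normalized coordinate vector is completed to an orthonormal frame. In this way a maximum
over all frames becomes a local maximum of `testFn` near the centre of the coordinates. -/
theorem exists_testFn_eq_frameTest {G : EuclideanSpace ℝ (Fin n) → Matrix (Fin n) (Fin n) ℝ}
    {z : EuclideanSpace ℝ (Fin n)} (hG : (G z).PosDef) (v : EuclideanSpace ℝ (Fin n) → ℝ)
    (i₀ : Fin n) : ∃ A : Fin n → Fin n → ℝ, (Matrix.of A).transpose * G z * Matrix.of A = 1 ∧
      testFn G v i₀ z = frameTest (vTensor G v z) (Matrix.of A) i₀ := by
  have h : 0 < G z i₀ i₀ := hG.diag_pos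
  have hs : ((Real.sqrt (G z i₀ i₀))⁻¹) ^ 2 = (G z i₀ i₀)⁻¹ := by
    rw [inv_pow, Real.sq_sqrt h.le]
  have hq : ∀ S : Matrix (Fin n) (Fin n) ℝ, Pi.single i₀ (Real.sqrt (G z i₀ i₀))⁻¹ ⬝ᵥ
      S.mulVec (Pi.single i₀ (Real.sqrt (G z i₀ i₀))⁻¹) = S i₀ i₀ * (G z i₀ i₀)⁻¹ := fun S => by
    rw [single_dotProduct, Matrix.mulVec, dotProduct_single, ← hs]
    ring
  obtain ⟨A, hA, hA0⟩ := exists_frame hG i₀ (Pi.single i₀ (Real.sqrt (G z i₀ i₀))⁻¹)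
    (by rw [hq, mul_inv_cancel₀ h.ne'])
  have hcol : (Matrix.of A).col i₀ = Pi.single i₀ (Real.sqrt (G z i₀ i₀))⁻¹ := funext hA0
  exact ⟨A, hA, by rw [frameTest_eq hA, hcol, hq, testFn]⟩

theorem exists_diagonal_frame {G V : Matrix (Fin n) (Fin n) ℝ} (hG : G.PosDef)
    (hV : V.transpose = V) (i₀ : Fin n) : ∃ (A : Matrix (Fin n) (Fin n) ℝ) (l : Fin n → ℝ),
      A.transpose * G * A = 1 ∧ A.transpose * V * A = Matrix.diagonal l := by
  obtain ⟨ξ, hξ⟩ := exists_unit_vector hG i₀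
  obtain ⟨B, hB, -⟩ := exists_frame hG i₀ ξ hξ
  set A := Matrix.of B
  have hQ : (A.transpose * V * A).IsHermitian := by
    rw [Matrix.IsHermitian, Matrix.conjTranspose_eq_transpose_of_trivial, Matrix.transpose_mul,
      Matrix.transpose_mul, hV, Matrix.transpose_transpose, mul_assoc]
  set O : Matrix (Fin n) (Fin n) ℝ := (hQ.eigenvectorUnitary : Matrix (Fin n) (Fin n) ℝ)
  have hO : O.transpose * O = 1 := Unitary.coe_star_mul_self hQ.eigenvectorUnitary
  have hsp : A.transpose * V * A = O * Matrix.diagonal hQ.eigenvalues * O.transpose :=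
    hQ.spectral_theorem
  refine ⟨A * O, hQ.eigenvalues, ?_, ?_⟩
  · calc (A * O).transpose * G * (A * O) = O.transpose * (A.transpose * G * A) * O := by
          rw [Matrix.transpose_mul]
          noncomm_ring
      _ = 1 := by rw [hB, mul_one, hO]
  · calc (A * O).transpose * V * (A * O) = O.transpose * (A.transpose * V * A) * O := by
          rw [Matrix.transpose_mul]
          noncomm_ring
      _ = O.transpose * (O * Matrix.diagonal hQ.eigenvalues * O.transpose) * O :=
          congrArg (fun X => O.transpose * X * O) hsp
      _ = (O.transpose * O) * Matrix.diagonal hQ.eigenvalues * (O.transpose * O) := by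
          noncomm_ring
      _ = _ := by rw [hO, one_mul, mul_one]

/-- An upper bound for `V = H + p ⊗ p` and a lower bound for its trace control `p` and `H`. -/
theorem norm_le_of_frameTest_le (hn : 4 < n) {G H : Matrix (Fin n) (Fin n) ℝ} {p : Fin n → ℝ}
    {a N₀ N₁ : ℝ} {i₀ : Fin n} (hG : G.PosDef) (hH : H.transpose = H) (ha : a ≤ N₀) (h0 : 0 ≤ N₀)
    (h1 : 0 ≤ N₁)
    (htr : 0 < (G⁻¹ * H).trace - ((n : ℝ) / 2 - 1) * (p ⬝ᵥ G⁻¹.mulVec p) + a)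
    (hf : ∀ A : Fin n → Fin n → ℝ, (Matrix.of A).transpose * G * Matrix.of A = 1 →
      frameTest (H + Matrix.vecMulVec p p) (Matrix.of A) i₀ ≤ N₁) :
    p ⬝ᵥ G⁻¹.mulVec p + Real.sqrt ((G⁻¹ * H) * (G⁻¹ * H)).trace ≤ (n + 1) ^ 2 * (N₀ + N₁) := by
  have hn4 : (4 : ℝ) < n := by exact_mod_cast hn
  set V := H + Matrix.vecMulVec p p with hVd
  have hV : V.transpose = V := by
    rw [hVd, Matrix.transpose_add, hH, Matrix.transpose_vecMulVec]
  obtain ⟨A, l, hA, hD⟩ := exists_diagonal_frame hG hV i₀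
  set q := A.transpose.mulVec p with hq
  set Q := A.transpose * H * A with hQ
  have hVQ : A.transpose * V * A = Q + Matrix.vecMulVec q q := by
    rw [hVd, mul_add, add_mul, Matrix.mul_vecMulVec, Matrix.vecMulVec_mul, hq,
      Matrix.mulVec_transpose]
  have hp : p ⬝ᵥ G⁻¹.mulVec p = ∑ b, q b ^ 2 := by
    rw [inv_eq_mul_transpose hA, ← Matrix.mulVec_mulVec, Matrix.dotProduct_mulVec,
      ← Matrix.mulVec_transpose, ← hq, dotProduct]
    exact Finset.sum_congr rfl fun b _ => (sq _).symm
  have htrQ : (G⁻¹ * H).trace = Q.trace := by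
    rw [inv_eq_mul_transpose hA, mul_assoc, Matrix.trace_mul_comm]
  have htrV : (G⁻¹ * V).trace = ∑ b, l b := by
    rw [inv_eq_mul_transpose hA, mul_assoc, Matrix.trace_mul_comm, hD, Matrix.trace_diagonal]
  have hsum : ∑ b, l b = Q.trace + ∑ b, q b ^ 2 := by
    rw [← Matrix.trace_diagonal, ← hD, hVQ, Matrix.trace_add, Matrix.trace_vecMulVec, dotProduct]
    simp only [sq]
  have hl : ∀ b, l b + ∑ b, l b ≤ N₁ := by
    intro b
    have hb : ∀ S : Matrix (Fin n) (Fin n) ℝ, A.col b ⬝ᵥ S.mulVec (A.col b)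
        = (A.transpose * S * A) b b := fun S => by
      rw [mul_assoc]
      rfl
    -- Each eigenvector of V is a unit vector, so it may be put into the distinguished position of
    -- another frame.
    obtain ⟨B, hB, hBc⟩ := exists_frame hG i₀ (A.col b) (by rw [hb, hA, Matrix.one_apply_eq])
    have h2 := hf B hB
    rwa [frameTest_eq hB, show (Matrix.of B).col i₀ = A.col b from funext hBc, hb, hD, htrV,
      Matrix.diagonal_apply_eq] at h2
  set τ := ∑ b, l b with hτ
  set e := ∑ b, q b ^ 2 with he
  have he0 : 0 ≤ e := Finset.sum_nonneg fun b _ => sq_nonneg _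
  rw [htrQ, hp] at htr
  -- Positivity of σ₁ bounds tr V = τ below in terms of |p|². Summing `hl` over the eigenvalues
  -- gives (n + 1)τ ≤ nN₁, hence an upper bound for τ and then for |p|².
  have hτ1 : (n : ℝ) / 2 * e - N₀ ≤ τ := by linarith
  have hτ2 : τ ≤ N₁ := by
    have h3 : ∑ b, (l b + τ) ≤ ∑ _b : Fin n, N₁ := Finset.sum_le_sum fun b _ => hl b
    rw [Finset.sum_add_distrib, ← hτ] at h3
    simp only [Finset.sum_const, Finset.card_univ, Fintype.card_fin, nsmul_eq_mul] at h3
    by_contra! h4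
    nlinarith
  have hτ0 : -N₀ ≤ τ := by nlinarith
  have heN : e ≤ N₀ + N₁ := by nlinarith
  have hlu : ∀ b, l b ≤ N₀ + N₁ := fun b => by linarith [hl b]
  -- An eigenvalue is τ minus the other n - 1 eigenvalues; τ is bounded below and each of those is
  -- bounded above.
  have hll : ∀ b, -(n * (N₀ + N₁)) ≤ l b := by
    intro b
    have h3 : ∑ c ∈ Finset.univ.erase b, l c ≤ ∑ _c ∈ Finset.univ.erase b, (N₀ + N₁) :=
      Finset.sum_le_sum fun c _ => hlu c
    have h4 := Finset.sum_erase_add Finset.univ l (Finset.mem_univ b)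
    rw [Finset.sum_const, Finset.card_erase_of_mem (Finset.mem_univ b), Finset.card_univ,
      Fintype.card_fin, nsmul_eq_mul, Nat.cast_sub (by omega)] at h3
    push_cast at h3
    linarith
  have hqq : ∀ b c, |q b * q c| ≤ e := by
    intro b c
    have h3 : ∀ b, q b ^ 2 ≤ e := fun b => Finset.single_le_sum (f := fun b => q b ^ 2)
      (fun _ _ => sq_nonneg _) (Finset.mem_univ b)
    rw [abs_le]
    constructor <;> nlinarith [sq_nonneg (q b + q c), sq_nonneg (q b - q c), h3 b, h3 c]
  have hQe : ∀ b c, |Q b c| ≤ (n + 1) * (N₀ + N₁) := by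
    intro b c
    have h3 : Q b c = Matrix.diagonal l b c - q b * q c := by
      rw [← hD, hVQ, Matrix.add_apply, Matrix.vecMulVec_apply, add_sub_cancel_right]
    have h4 : |Matrix.diagonal l b c| ≤ n * (N₀ + N₁) := by
      rw [Matrix.diagonal_apply]
      split_ifs
      · exact abs_le.2 ⟨hll b, (hlu b).trans (le_mul_of_one_le_left (by linarith) (by linarith))⟩
      · rw [abs_zero]
        positivity
    rw [h3]
    refine (abs_sub _ _).trans ?_
    linarith [hqq b c]
  have hQQ : ((G⁻¹ * H) * (G⁻¹ * H)).trace ≤ (n * ((n + 1) * (N₀ + N₁))) ^ 2 := by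
    have h3 : ((G⁻¹ * H) * (G⁻¹ * H)).trace = (Q * Q).trace := by
      rw [inv_eq_mul_transpose hA, hQ, show A * A.transpose * H * (A * A.transpose * H)
        = A * (A.transpose * H * A * (A.transpose * H)) by noncomm_ring, Matrix.trace_mul_comm]
      congr 1
      noncomm_ring
    rw [h3, trace_mul_eq_sum]
    calc ∑ b, ∑ c, Q b c * Q c b
        ≤ ∑ _b : Fin n, ∑ _c : Fin n, ((n + 1) * (N₀ + N₁)) ^ 2 := by
          refine Finset.sum_le_sum fun b _ => Finset.sum_le_sum fun c _ => ?_
          refine (le_abs_self _).trans ?_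
          rw [abs_mul, sq]
          exact mul_le_mul (hQe b c) (hQe c b) (abs_nonneg _) (by positivity)
      _ = _ := by
          simp only [Finset.sum_const, Finset.card_univ, Fintype.card_fin, nsmul_eq_mul]
          ring
  have hs : Real.sqrt ((G⁻¹ * H) * (G⁻¹ * H)).trace ≤ n * ((n + 1) * (N₀ + N₁)) :=
    Real.sqrt_le_iff.2 ⟨by positivity, hQQ⟩
  rw [hp]
  nlinarith

end FrameTest

/-- Only earlier times are compared, through left difference quotients, since the maximum may occur
at the end of the time interval under consideration. -/
theorem HasDerivAt.nonneg_of_forall_le {f : ℝ → ℝ} {f' a t : ℝ} (hf : HasDerivAt f f' t)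
    (hat : a < t) (h : ∀ s ∈ Ioo a t, f s ≤ f t) : 0 ≤ f' := by
  have h1 := (hasDerivWithinAt_iff_tendsto_slope' (by simp)).1 (hf.hasDerivWithinAt (s := Iio t))
  refine ge_of_tendsto h1 ?_
  filter_upwards [Ioo_mem_nhdsLT hat] with s hs
  rw [slope_def_field]
  exact div_nonneg_of_nonpos (by linarith [h s hs]) (by linarith [hs.2])

/-! ### The maximum principle in one chart. -/

section Step

variable {n : ℕ} {V : Set (EuclideanSpace ℝ (Fin n))} {T : ℝ}
  {G : EuclideanSpace ℝ (Fin n) → Matrix (Fin n) (Fin n) ℝ}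

theorem IsCoordChange.frameTest_pullback {U : Set (EuclideanSpace ℝ (Fin n))}
    {Φ : EuclideanSpace ℝ (Fin n) → EuclideanSpace ℝ (Fin n)} (hΦ : IsCoordChange U V Φ)
    (hG : IsMetricOn V G) {f : EuclideanSpace ℝ (Fin n) → ℝ} (hf : ContDiffOn ℝ ∞ f V)
    {y : EuclideanSpace ℝ (Fin n)} (hy : y ∈ U) (A : Matrix (Fin n) (Fin n) ℝ) (i₀ : Fin n) :
    frameTest (vTensor (pullback Φ G) (fun z => f (Φ z)) y) A i₀
      = frameTest (vTensor G f (Φ y)) (jac Φ y * A) i₀ := by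
  rw [hΦ.vTensor_pullback hG hf hy, pullback, frameTest_conj]

theorem frame_transport {Φ : EuclideanSpace ℝ (Fin n) → EuclideanSpace ℝ (Fin n)}
    {y : EuclideanSpace ℝ (Fin n)} {A : Matrix (Fin n) (Fin n) ℝ}
    (hA : A.transpose * pullback Φ G y * A = 1) :
    (jac Φ y * A).transpose * G (Φ y) * (jac Φ y * A) = 1 := by
  rw [← hA, pullback, Matrix.transpose_mul]
  noncomm_ring

/-- The maximum principle at an interior maximum of the localized test function. -/
theorem exists_interior_maximum_estimate (n : ℕ) (hn : 4 < n) (K L : ℝ) (hK : 0 ≤ K)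
    (hL : 0 ≤ L) : ∃ C : ℝ, 0 ≤ C ∧ ∀ (V : Set (EuclideanSpace ℝ (Fin n)))
      (G : EuclideanSpace ℝ (Fin n) → Matrix (Fin n) (Fin n) ℝ)
      (v w : ℝ → EuclideanSpace ℝ (Fin n) → ℝ) (χ : EuclideanSpace ℝ (Fin n) → ℝ)
      (β ρ s t T : ℝ) (i₀ : Fin n) (y : EuclideanSpace ℝ (Fin n)) (A : Fin n → Fin n → ℝ),
      IsMetricOn V G → (∀ z ∈ V, (G z).PosDef) → y ∈ V →
      (Matrix.of A).transpose * G y * Matrix.of A = 1 →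
      JetBound (pullback (normalMap G y A) G) K → ContDiffOn ℝ ∞ χ V → t ∈ Ioo 0 T →
      ContDiffOn ℝ ∞ (fun q : ℝ × EuclideanSpace ℝ (Fin n) => v q.1 q.2) (Ioo 0 T ×ˢ V) →
      (∀ r ∈ Ioo 0 T, ∀ z ∈ V, HasDerivAt (fun s => v s z) (w r z) r) →
      1 ≤ β ∧ β ≤ 2 → 0 ≤ ρ →
      (∀ z ∈ V, 0 < ((G z)⁻¹ * wTensor G (v t) z).trace) →
      (∀ z ∈ V, w t z = sigmaTwo ((G z)⁻¹ * wTensor G (v t) z)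
          / ((G z)⁻¹ * wTensor G (v t) z).trace
        - (ρ * Real.exp (-β * v t z)) ^ 2 / ((G z)⁻¹ * wTensor G (v t) z).trace + s) →
      0 < χ y ^ 2 → χ y ^ 2 ≤ 1 →
      (∀ m, pd m (fun z => χ (normalMap G y A z) ^ 2) 0 ^ 2 ≤ L * χ (normalMap G y A 0) ^ 2) →
      (∀ l m, |pd l (pd m fun z => χ (normalMap G y A z) ^ 2) 0| ≤ L) →
      (∀ z ∈ V, ∀ B : Fin n → Fin n → ℝ, (Matrix.of B).transpose * G z * Matrix.of B = 1 →
        χ z ^ 2 * frameTest (vTensor G (v t) z) (Matrix.of B) i₀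
          ≤ χ y ^ 2 * frameTest (vTensor G (v t) y) (Matrix.of A) i₀) →
      (∀ r ∈ Ioo 0 t, χ y ^ 2 * frameTest (vTensor G (v r) y) (Matrix.of A) i₀
        ≤ χ y ^ 2 * frameTest (vTensor G (v t) y) (Matrix.of A) i₀) →
      χ y ^ 2 * frameTest (vTensor G (v t) y) (Matrix.of A) i₀
        ≤ C * (1 + ρ * Real.exp (-β * v t y)) := by
  obtain ⟨C, hC, hest⟩ := exists_maximum_estimate n hn K L hK hL
  refine ⟨C, hC, ?_⟩
  intro V G v w χ β ρ s t T i₀ y A hG hP hy hA hJ hχ ht hv hw hβ hρ hσ hweq hχ0 hχ1 hd1 hd2 hmax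
    hmaxt
  have hV := hG.isOpen
  have hΦ := isCoordChange_normalMap (G := G) hV y A
  have hN := isNormal_pullback_normalMap hG hy hA
  set Φ := normalMap G y A with hΦd
  set U := normalDomain V G y A with hUd
  have hU : IsOpen U := hΦ.isOpen_source
  have h0 : (0 : EuclideanSpace ℝ (Fin n)) ∈ U := hN.zero_mem
  have hΦ0 : Φ 0 = y := normalMap_zero y A
  have hJ0 : jac Φ 0 = Matrix.of A := jac_normalMap_zero y A
  have hslice : ∀ {f : ℝ → EuclideanSpace ℝ (Fin n) → ℝ}, ContDiffOn ℝ ∞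
      (fun q : ℝ × EuclideanSpace ℝ (Fin n) => f q.1 q.2) (Ioo 0 T ×ˢ V) →
      ∀ r ∈ Ioo 0 T, ContDiffOn ℝ ∞ (f r) V := fun {f} hf r hr =>
    hf.comp (f := fun z : EuclideanSpace ℝ (Fin n) => (r, z))
      (contDiff_const.prodMk contDiff_id).contDiffOn fun _ hz => ⟨hr, hz⟩
  have hws := (hasDerivAt_pd isOpen_Ioo hV hv hw).1
  have hPU : ∀ z ∈ U, (pullback Φ G z).PosDef := fun z hz => by
    have hu : IsUnit (jac Φ z) :=
      (Matrix.isUnit_iff_isUnit_det _).2 (isUnit_iff_ne_zero.2 (hΦ.det_ne_zero z hz))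
    have := (hP (Φ z) (hΦ.mapsTo hz)).conjTranspose_mul_mul_same
      (B := jac Φ z) (Matrix.mulVec_injective_of_isUnit hu)
    rwa [Matrix.conjTranspose_eq_transpose_of_trivial] at this
  have hinv : ∀ z ∈ U, (pullback Φ G z)⁻¹ * wTensor (pullback Φ G) (fun z => v t (Φ z)) z
      = (jac Φ z)⁻¹ * ((G (Φ z))⁻¹ * wTensor G (v t) (Φ z)) * jac Φ z := fun z hz => by
    rw [hΦ.wTensor_pullback hG (hslice hv t ht) hz]
    exact hΦ.inv_pullback_mul hG _ hz
  have htr : ∀ z ∈ U, ((pullback Φ G z)⁻¹ * wTensor (pullback Φ G) (fun z => v t (Φ z)) z).trace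
      = ((G (Φ z))⁻¹ * wTensor G (v t) (Φ z)).trace := fun z hz => by
    rw [hinv z hz, hΦ.trace_conj _ hz]
  have hs2 : ∀ z ∈ U, sigmaTwo ((pullback Φ G z)⁻¹
      * wTensor (pullback Φ G) (fun z => v t (Φ z)) z)
      = sigmaTwo ((G (Φ z))⁻¹ * wTensor G (v t) (Φ z)) := fun z hz => by
    rw [hinv z hz, hΦ.sigmaTwo_conj _ hz]
  have htest : ∀ r ∈ Ioo 0 T, testFn (pullback Φ G) (fun z => v r (Φ z)) i₀ 0
      = frameTest (vTensor G (v r) y) (Matrix.of A) i₀ := fun r hr => by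
    have h1 := hΦ.frameTest_pullback hG (hslice hv r hr) h0 1 i₀
    rw [mul_one, hJ0, hΦ0] at h1
    rw [← h1, hN.testFn_eq, sum_testWeight, frameTest, Matrix.transpose_one, one_mul, mul_one]
    rfl
  have hgoal := hest U (pullback Φ G) (fun z => v t (Φ z)) (fun z => w t (Φ z))
    (fun z => χ (Φ z) ^ 2) β ρ s i₀ hN hJ (fun z hz => (hPU z hz).diag_pos.ne')
    ((hslice hv t ht).comp hΦ.smooth hΦ.mapsTo) ((hslice hws t ht).comp hΦ.smooth hΦ.mapsTo)
    ((hχ.comp hΦ.smooth hΦ.mapsTo).pow 2) hβ hρ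
    (fun z hz => by rw [htr z hz]; exact hσ _ (hΦ.mapsTo hz))
    (fun z hz => by rw [htr z hz, hs2 z hz]; exact hweq _ (hΦ.mapsTo hz))
    (by rwa [hΦ0]) (by rwa [hΦ0]) hd1 hd2 ?_ ?_
  · rwa [htest t ht, hΦ0] at hgoal
  · filter_upwards [hU.mem_nhds h0] with z hz
    obtain ⟨B, hB, hBe⟩ := exists_testFn_eq_frameTest (hPU z hz) (fun z => v t (Φ z)) i₀
    rw [hBe, htest t ht, hΦ0, hΦ.frameTest_pullback hG (hslice hv t ht) hz]
    exact hmax (Φ z) (hΦ.mapsTo hz) _ (frame_transport hB)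
  · have hvU : ContDiffOn ℝ ∞ (fun q : ℝ × EuclideanSpace ℝ (Fin n) => v q.1 (Φ q.2))
        (Ioo 0 T ×ˢ U) :=
      hv.comp (f := fun q : ℝ × EuclideanSpace ℝ (Fin n) => (q.1, Φ q.2))
        (contDiffOn_fst.prodMk (hΦ.smooth.comp contDiffOn_snd fun q hq => hq.2))
        fun q hq => ⟨hq.1, hΦ.mapsTo hq.2⟩
    -- The coordinates are fixed while time varies. At their centre the Christoffel symbols vanish,
    -- so the time derivative of the test function is the weighted sum in the differential
    -- inequality.
    have hder : HasDerivAt (fun r => testFn (pullback Φ G) (fun z => v r (Φ z)) i₀ 0)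
        (∑ a, testWeight i₀ a * (pd a (pd a fun z => w t (Φ z)) 0
          + 2 * pd a (fun z => v t (Φ z)) 0 * pd a (fun z => w t (Φ z)) 0)) t := by
      simp only [hN.testFn_eq]
      refine HasDerivAt.fun_sum fun a _ => HasDerivAt.const_mul _ ?_
      refine (hN.isMetricOn.hasDerivAt_vTensor isOpen_Ioo (v := fun r z => v r (Φ z))
        (w := fun r z => w r (Φ z)) hvU (fun r hr z hz => hw r hr _ (hΦ.mapsTo hz)) ht h0
        a a).congr_deriv ?_
      simp only [hessian, hN.christoffel_eq_zero, zero_mul, Finset.sum_const_zero, sub_zero]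
      ring
    refine HasDerivAt.nonneg_of_forall_le hder ht.1 fun r hr => ?_
    rw [htest t ht, htest r ⟨hr.1, hr.2.trans ht.2⟩]
    exact le_of_mul_le_mul_left (hmaxt r hr) hχ0

end Step

end SigmaTwoFlow

end

noncomputable section

namespace SigmaTwoFlow

/-! ### The test function on the frame bundle -/

section LocalTest

theorem JetBound.mono {n : ℕ} {G : EuclideanSpace ℝ (Fin n) → Matrix (Fin n) (Fin n) ℝ} {K L : ℝ}
    (h : JetBound G K) (hKL : K ≤ L) : JetBound G L where
  metric a b i j := (h.metric a b i j).trans hKL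
  inverse a b i j := (h.inverse a b i j).trans hKL
  christoffel_one a k i j := (h.christoffel_one a k i j).trans hKL
  christoffel_two a b k i j := (h.christoffel_two a b k i j).trans hKL
  schouten_zero i j := (h.schouten_zero i j).trans hKL
  schouten_one a i j := (h.schouten_one a i j).trans hKL
  schouten_two a b i j := (h.schouten_two a b i j).trans hKL

variable {n : ℕ} {M : Type*} [TopologicalSpace M] [ChartedSpace (EuclideanSpace ℝ (Fin n)) M]
  [IsManifold (𝓡 n) ∞ M] (g₀ : SmoothMetric n M)

/-- In an orthonormal frame each diagonal entry of V is at most the Hilbert–Schmidt norm of H plus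
|q|². There are n + 1 such entries: the distinguished one and the n in the trace. -/
theorem frameTest_le {G H A : Matrix (Fin n) (Fin n) ℝ} {q : Fin n → ℝ}
    (hA : A.transpose * G * A = 1) (hH : H.transpose = H) (i₀ : Fin n) :
    frameTest (H + Matrix.vecMulVec q q) A i₀
      ≤ (n + 1) * (Real.sqrt ((G⁻¹ * H) * (G⁻¹ * H)).trace + q ⬝ᵥ G⁻¹.mulVec q) := by
  set Q := A.transpose * H * A with hQ
  set r := A.transpose.mulVec q with hr
  have hVQ : A.transpose * (H + Matrix.vecMulVec q q) * A = Q + Matrix.vecMulVec r r := by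
    rw [mul_add, add_mul, Matrix.mul_vecMulVec, Matrix.vecMulVec_mul, hr, Matrix.mulVec_transpose]
  have hq : q ⬝ᵥ G⁻¹.mulVec q = ∑ b, r b ^ 2 := by
    rw [inv_eq_mul_transpose hA, ← Matrix.mulVec_mulVec, Matrix.dotProduct_mulVec,
      ← Matrix.mulVec_transpose, ← hr, dotProduct]
    exact Finset.sum_congr rfl fun b _ => (sq _).symm
  have hQQ : ((G⁻¹ * H) * (G⁻¹ * H)).trace = (Q * Q).trace := by
    rw [inv_eq_mul_transpose hA, hQ, show A * A.transpose * H * (A * A.transpose * H)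
      = A * (A.transpose * H * A * (A.transpose * H)) by noncomm_ring, Matrix.trace_mul_comm]
    congr 1
    noncomm_ring
  have hsym : Q.transpose = Q := by
    rw [hQ, Matrix.transpose_mul, Matrix.transpose_mul, hH, Matrix.transpose_transpose, mul_assoc]
  have hb : ∀ b, (Q + Matrix.vecMulVec r r) b b
      ≤ Real.sqrt (Q * Q).trace + ∑ b, r b ^ 2 := by
    intro b
    have h1 : Q b b ^ 2 ≤ (Q * Q).trace := (Finset.single_le_sum (f := fun b => Q b b ^ 2)
      (fun _ _ => sq_nonneg _) (Finset.mem_univ b)).trans (sum_sq_diag_le_trace_mul_self hsym)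
    have h2 : r b ^ 2 ≤ ∑ b, r b ^ 2 := Finset.single_le_sum (f := fun b => r b ^ 2)
      (fun _ _ => sq_nonneg _) (Finset.mem_univ b)
    rw [Matrix.add_apply, Matrix.vecMulVec_apply, ← sq]
    exact add_le_add (Real.le_sqrt_of_sq_le h1) h2
  rw [frameTest, hVQ, hQQ, hq]
  have h3 : (Q + Matrix.vecMulVec r r).trace
      ≤ ∑ _b : Fin n, (Real.sqrt (Q * Q).trace + ∑ b, r b ^ 2) := Finset.sum_le_sum fun b _ => hb b
  rw [Finset.sum_const, Finset.card_univ, Fintype.card_fin, nsmul_eq_mul] at h3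
  linarith [hb i₀]

theorem hessian_transpose {U : Set (EuclideanSpace ℝ (Fin n))}
    {G : EuclideanSpace ℝ (Fin n) → Matrix (Fin n) (Fin n) ℝ} (hG : IsMetricOn U G)
    {f : EuclideanSpace ℝ (Fin n) → ℝ} (hf : ContDiffOn ℝ ∞ f U) {y : EuclideanSpace ℝ (Fin n)}
    (hy : y ∈ U) : (Matrix.of (hessian G f y)).transpose = Matrix.of (hessian G f y) := by
  ext i j
  simp only [Matrix.transpose_apply, Matrix.of_apply, hessian, pd_comm hG.isOpen hf hy j i,
    fun k => hG.christoffel_symm hy k j i]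

/-- The test function multiplied by a squared cutoff function, at the point `(y, A)` of the frame
bundle in the chart at `c`. -/
def localTest (χ u : M → ℝ) (i₀ : Fin n) (c : M)
    (q : EuclideanSpace ℝ (Fin n) × (Fin n → Fin n → ℝ)) : ℝ :=
  loc n c χ q.1 ^ 2 * frameTest (vTensor (gram g₀ c) (loc n c u) q.1) (Matrix.of q.2) i₀

/-- The Jacobian carries orthonormal frames to orthonormal frames and preserves the test function.
Hence a supremum over all charts is attained within finitely many compact pieces. -/
theorem localTest_transition (χ : M → ℝ) {u : M → ℝ} (hu : ContMDiff (𝓡 n) 𝓘(ℝ, ℝ) ∞ u)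
    (i₀ : Fin n) (c c' : M) {y : EuclideanSpace ℝ (Fin n)} (hy : y ∈ overlap n c c')
    {A : Fin n → Fin n → ℝ} (hA : (Matrix.of A).transpose * gram g₀ c y * Matrix.of A = 1) :
    ∃ B : Fin n → Fin n → ℝ,
      (Matrix.of B).transpose * gram g₀ c' (transition c c' y) * Matrix.of B = 1 ∧
      localTest g₀ χ u i₀ c (y, A) = localTest g₀ χ u i₀ c' (transition c c' y, B) := by
  refine ⟨fun i a => (jac (transition c c') y * Matrix.of A) i a, ?_, ?_⟩
  · rw [gram_eq_pullback g₀ c c' hy] at hA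
    exact frame_transport hA
  · have h1 := vTensor_congr_on (isOpen_overlap c c') (gram_eqOn_pullback g₀ c c')
      (loc_eq_comp c c' u) hy
    have h2 := (isCoordChange_transition (n := n) c c').frameTest_pullback (isMetricOn_gram g₀ c')
      (loc_smooth c' hu) hy (Matrix.of A) i₀
    rw [localTest, localTest, loc_eq_comp c c' χ hy, h1, h2]
    rfl

theorem localTest_continuousOn (χ : M → ℝ) (hχ : ContMDiff (𝓡 n) 𝓘(ℝ, ℝ) ∞ χ) {I : Set ℝ}
    (hI : UniqueDiffOn ℝ I) {u : ℝ → M → ℝ}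
    (hu : ContMDiffOn (𝓘(ℝ, ℝ).prod (𝓡 n)) 𝓘(ℝ, ℝ) ∞ (fun q : ℝ × M => u q.1 q.2) (I ×ˢ univ))
    (i₀ : Fin n) (c : M) {K : Set (EuclideanSpace ℝ (Fin n))}
    (hK : K ⊆ (extChartAt (𝓡 n) c).target) :
    ContinuousOn (fun q : ℝ × EuclideanSpace ℝ (Fin n) × (Fin n → Fin n → ℝ) =>
      localTest g₀ χ (u q.1) i₀ c q.2) (I ×ˢ frames K (gram g₀ c)) := by
  have h1 := (FamilyDomain.prod hI (isOpen_target (n := n) c)).vTensor (isMetricOn_gram g₀ c)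
    (fun q hq => hq.2) (v := fun t => loc n c (u t)) (loc_family_smooth c hu)
  have hV : ∀ i j, ContinuousOn (fun q : ℝ × EuclideanSpace ℝ (Fin n) × (Fin n → Fin n → ℝ) =>
      vTensor (gram g₀ c) (loc n c (u q.1)) q.2.1 i j) (I ×ˢ frames K (gram g₀ c)) := fun i j =>
    (h1 i j).continuousOn.comp
      (f := fun q : ℝ × EuclideanSpace ℝ (Fin n) × (Fin n → Fin n → ℝ) => (q.1, q.2.1))
      (by fun_prop) fun q hq => ⟨hq.1, hK hq.2.1⟩
  have hA : ∀ i a, Continuous fun q : ℝ × EuclideanSpace ℝ (Fin n) × (Fin n → Fin n → ℝ) =>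
    q.2.2 i a := fun i a => by fun_prop
  have hQ : ∀ a b, ContinuousOn (fun q : ℝ × EuclideanSpace ℝ (Fin n) × (Fin n → Fin n → ℝ) =>
      ((Matrix.of q.2.2).transpose * vTensor (gram g₀ c) (loc n c (u q.1)) q.2.1
        * Matrix.of q.2.2) a b) (I ×ˢ frames K (gram g₀ c)) := fun a b => by
    simp only [Matrix.mul_apply, Matrix.transpose_apply, Matrix.of_apply]
    exact continuousOn_finsetSum _ fun j _ => (continuousOn_finsetSum _ fun i _ =>
      (hA i a).continuousOn.mul (hV i j)).mul (hA j b).continuousOn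
  have hc : ContinuousOn (fun q : ℝ × EuclideanSpace ℝ (Fin n) × (Fin n → Fin n → ℝ) =>
      loc n c χ q.2.1) (I ×ˢ frames K (gram g₀ c)) :=
    (loc_smooth c hχ).continuousOn.comp
      (f := fun q : ℝ × EuclideanSpace ℝ (Fin n) × (Fin n → Fin n → ℝ) => q.2.1)
      (by fun_prop) fun q hq => hK hq.2.1
  unfold localTest frameTest Matrix.trace
  exact (hc.pow 2).mul ((hQ i₀ i₀).add (continuousOn_finsetSum _ fun b _ => hQ b b))

variable [CompactSpace M]

omit [IsManifold (𝓡 n) ∞ M] in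
variable (n M) in
/-- A finite cover by compact subsets of charts. -/
theorem exists_finite_chart_cover : ∃ (s : Finset M) (K : M → Set (EuclideanSpace ℝ (Fin n))),
    (∀ c, IsCompact (K c) ∧ K c ⊆ (extChartAt (𝓡 n) c).target) ∧
    ∀ x : M, ∃ c ∈ s, x ∈ (extChartAt (𝓡 n) c).source ∧ extChartAt (𝓡 n) c x ∈ K c := by
  have h1 : ∀ c : M, ∃ K : Set (EuclideanSpace ℝ (Fin n)), IsCompact K ∧
      extChartAt (𝓡 n) c c ∈ interior K ∧ K ⊆ (extChartAt (𝓡 n) c).target := fun c =>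
    exists_compact_subset (isOpen_target c) (chart_mem_target c (mem_extChartAt_source c))
  choose K hK hc hKV using h1
  obtain ⟨s, -, hs⟩ := (isCompact_univ (X := M)).elim_nhds_subcover
    (fun c => (extChartAt (𝓡 n) c).source ∩ extChartAt (𝓡 n) c ⁻¹' K c) fun c _ =>
      Filter.inter_mem (extChartAt_source_mem_nhds c) ((continuousAt_extChartAt c)
        (mem_interior_iff_mem_nhds.1 (hc c)))
  refine ⟨s, K, fun c => ⟨hK c, hKV c⟩, fun x => ?_⟩
  obtain ⟨c, hcs, hx⟩ := mem_iUnion₂.1 (hs (mem_univ x))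
  exact ⟨c, hcs, hx.1, hx.2⟩

omit [CompactSpace M] in
/-- Over a compact time interval, the test function attains its maximum. -/
theorem exists_isMax_localTest [Nonempty M] {s : Finset M}
    {K : M → Set (EuclideanSpace ℝ (Fin n))}
    (hK : ∀ c, IsCompact (K c) ∧ K c ⊆ (extChartAt (𝓡 n) c).target)
    (hs : ∀ x : M, ∃ c ∈ s, x ∈ (extChartAt (𝓡 n) c).source ∧ extChartAt (𝓡 n) c x ∈ K c)
    {χ : M → ℝ} (hχ : ContMDiff (𝓡 n) 𝓘(ℝ, ℝ) ∞ χ) {T : ℝ} (hT : 0 < T) {u : ℝ → M → ℝ}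
    (hu : ContMDiffOn (𝓘(ℝ, ℝ).prod (𝓡 n)) 𝓘(ℝ, ℝ) ∞ (fun q : ℝ × M => u q.1 q.2)
      (Icc 0 T ×ˢ univ)) (i₀ : Fin n) {t : ℝ} (ht : t ∈ Icc 0 T) :
    ∃ t₀ ∈ Icc 0 t, ∃ c₀ ∈ s, ∃ q₀ ∈ frames (K c₀) (gram g₀ c₀), ∀ r ∈ Icc 0 t, ∀ c,
      ∀ q ∈ frames (extChartAt (𝓡 n) c).target (gram g₀ c),
      localTest g₀ χ (u r) i₀ c q ≤ localTest g₀ χ (u t₀) i₀ c₀ q₀ := by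
  have htT : Icc 0 t ⊆ Icc 0 T := Icc_subset_Icc_right ht.2
  set S := ⋃ c ∈ s, (fun q : ℝ × EuclideanSpace ℝ (Fin n) × (Fin n → Fin n → ℝ) =>
    localTest g₀ χ (u q.1) i₀ c q.2) '' (Icc 0 t ×ˢ frames (K c) (gram g₀ c)) with hS
  have hSc : IsCompact S := s.isCompact_biUnion fun c _ => (isCompact_Icc.prod
    (isCompact_frames (isMetricOn_gram g₀ c) (hK c).1 (hK c).2)).image_of_continuousOn
      ((localTest_continuousOn g₀ χ hχ (uniqueDiffOn_Icc hT) hu i₀ c (hK c).2).mono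
        (prod_mono_left htT))
  -- Any value in any chart can be moved to a chart of the finite cover whose compact piece contains
  -- the point.
  have hmem : ∀ r ∈ Icc 0 t, ∀ c, ∀ q ∈ frames (extChartAt (𝓡 n) c).target (gram g₀ c),
      localTest g₀ χ (u r) i₀ c q ∈ S := by
    rintro r hr c ⟨y, A⟩ ⟨hy, hA⟩
    obtain ⟨c', hc', hx, hxK⟩ := hs ((extChartAt (𝓡 n) c).symm y)
    obtain ⟨B, hB, e⟩ := localTest_transition g₀ χ (slice_smooth hu (htT hr)) i₀ c c'
      (y := y) ⟨hy, hx⟩ hA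
    rw [e]
    exact mem_iUnion₂.2 ⟨c', hc', (r, (transition c c' y, B)), ⟨hr, hxK, hB⟩, rfl⟩
  have hne : S.Nonempty := by
    obtain ⟨x⟩ := ‹Nonempty M›
    have hy := chart_mem_target x (mem_extChartAt_source (I := 𝓡 n) x)
    obtain ⟨ξ, hξ⟩ := exists_unit_vector (gram_posDef g₀ x hy) i₀
    obtain ⟨A, hA, -⟩ := exists_frame (gram_posDef g₀ x hy) i₀ ξ hξ
    exact ⟨_, hmem 0 ⟨le_rfl, ht.1⟩ x (extChartAt (𝓡 n) x x, A) ⟨hy, hA⟩⟩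
  obtain ⟨m, hm, hmax⟩ := hSc.exists_isGreatest hne
  obtain ⟨c₀, hc₀, ⟨t₀, q₀⟩, ⟨ht₀, hq₀⟩, rfl⟩ := mem_iUnion₂.1 hm
  exact ⟨t₀, ht₀, c₀, hc₀, q₀, hq₀, fun r hr c q hq => hmax (hmem r hr c q hq)⟩

omit [CompactSpace M] in
/-- The metric and the cutoff function satisfy uniform bounds in normal coordinates. -/
theorem exists_uniform_bounds (s : Finset M) {K : M → Set (EuclideanSpace ℝ (Fin n))}
    (hK : ∀ c, IsCompact (K c) ∧ K c ⊆ (extChartAt (𝓡 n) c).target) {χ : M → ℝ}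
    (hχ : ContMDiff (𝓡 n) 𝓘(ℝ, ℝ) ∞ χ) : ∃ B L : ℝ, 0 ≤ B ∧ 0 ≤ L ∧ ∀ c ∈ s,
      ∀ q ∈ frames (K c) (gram g₀ c),
      JetBound (pullback (normalMap (gram g₀ c) q.1 q.2) (gram g₀ c)) B ∧
      (∀ m, pd m (fun z => loc n c χ (normalMap (gram g₀ c) q.1 q.2 z) ^ 2) 0 ^ 2
        ≤ L * loc n c χ (normalMap (gram g₀ c) q.1 q.2 0) ^ 2) ∧
      ∀ l m, |pd l (pd m fun z => loc n c χ (normalMap (gram g₀ c) q.1 q.2 z) ^ 2) 0| ≤ L := by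
  choose B hB using fun c => exists_jetBound (isMetricOn_gram g₀ c) (hK c).1 (hK c).2
  choose L hL0 hL using fun c =>
    exists_cutoff_bound (isMetricOn_gram g₀ c) (hK c).1 (hK c).2 (loc_smooth c hχ)
  have hBs : ∀ c ∈ s, B c ≤ ∑ c ∈ s, |B c| := fun c hc => (le_abs_self _).trans
    (Finset.single_le_sum (f := fun c => |B c|) (fun _ _ => abs_nonneg _) hc)
  have hLs : ∀ c ∈ s, L c ≤ ∑ c ∈ s, L c := fun c hc =>
    Finset.single_le_sum (f := L) (fun c _ => hL0 c) hc
  refine ⟨∑ c ∈ s, |B c|, ∑ c ∈ s, L c, Finset.sum_nonneg fun _ _ => abs_nonneg _,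
    Finset.sum_nonneg fun c _ => hL0 c, fun c hc q hq => ⟨(hB c q hq).mono (hBs c hc), fun m => ?_,
      fun l m => ((hL c q hq).2 l m).trans (hLs c hc)⟩⟩
  exact ((hL c q hq).1 m).trans (mul_le_mul_of_nonneg_right (hLs c hc) (sq_nonneg _))

end LocalTest

end SigmaTwoFlow

end

noncomputable section

namespace SigmaTwoFlow

/-! ### The local estimate -/

section Estimate

variable {n : ℕ} {M : Type*} [TopologicalSpace M] [ChartedSpace (EuclideanSpace ℝ (Fin n)) M]
  [IsManifold (𝓡 n) ∞ M] [CompactSpace M] [T2Space M] (g₀ : SmoothMetric n M)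

omit [CompactSpace M] [T2Space M] in
theorem trace_wEndo_pos (hn : 4 < n) (c : M) {v : M → ℝ} (hv : IsC1 g₀ v)
    {y : EuclideanSpace ℝ (Fin n)} (hy : y ∈ (extChartAt (𝓡 n) c).target) :
    0 < (wEndo g₀ c v y).trace := by
  have h := loc_sigma1 g₀ c hn hv.1 hy
  have h1 : 0 < loc n c (sigma1 g₀ v) y := hv.2 _
  rw [h] at h1
  exact (mul_pos_iff_of_pos_left (Real.exp_pos _)).1 h1

/-- The conformal weights e^{4u} of σ₂ and e^{2u} of σ₁ cancel against e^{-2u}. The remaining factor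
e^{(2ε-4)u} is the square of e^{-(2-ε)u}, so ψ = √r e^{-(2-ε)u} and β = 2 - ε. -/
theorem loc_velocity (hn : 4 < n) (c : M) {ε ρ : ℝ} {v : M → ℝ} (hv : IsC1 g₀ v)
    (hρ : ρ ^ 2 = rEps g₀ ε v) {y : EuclideanSpace ℝ (Fin n)}
    (hy : y ∈ (extChartAt (𝓡 n) c).target) :
    loc n c (velocity g₀ ε v) y = sigmaTwo (wEndo g₀ c v y) / (wEndo g₀ c v y).trace
      - (ρ * Real.exp (-(2 - ε) * loc n c v y)) ^ 2 / (wEndo g₀ c v y).trace + sEps g₀ ε v := by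
  have h1 := loc_sigma1 g₀ c hn hv.1 hy
  have h2 := loc_sigma2 g₀ c hn hv.1 hy
  have h3 := trace_wEndo_pos g₀ hn c hv hy
  have e : loc n c (velocity g₀ ε v) y = Real.exp (-2 * loc n c v y)
      * ((loc n c (sigma2 g₀ v) y - rEps g₀ ε v * Real.exp (2 * ε * loc n c v y))
        / loc n c (sigma1 g₀ v) y) + sEps g₀ ε v := rfl
  have e1 : Real.exp (-2 * loc n c v y) * Real.exp (4 * loc n c v y)
      = Real.exp (2 * loc n c v y) := by
    rw [← Real.exp_add]
    ring_nf
  have e2 : Real.exp (-2 * loc n c v y) * Real.exp (2 * ε * loc n c v y)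
      = Real.exp (2 * loc n c v y) * Real.exp (-(2 - ε) * loc n c v y) ^ 2 := by
    rw [← Real.exp_add, ← Real.exp_nat_mul, ← Real.exp_add]
    push_cast
    ring_nf
  have e3 := Real.exp_pos (2 * loc n c v y)
  rw [e, h1, h2, ← hρ, mul_pow, ← sub_div, ← mul_div_assoc, mul_sub, ← mul_assoc, e1,
    mul_left_comm, e2, show Real.exp (2 * loc n c v y) * sigmaTwo (wEndo g₀ c v y)
      - ρ ^ 2 * (Real.exp (2 * loc n c v y) * Real.exp (-(2 - ε) * loc n c v y) ^ 2)
      = Real.exp (2 * loc n c v y) * (sigmaTwo (wEndo g₀ c v y)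
        - ρ ^ 2 * Real.exp (-(2 - ε) * loc n c v y) ^ 2) by ring, mul_div_mul_left _ _ e3.ne']

-- Applied to the initial data, this settles a maximum at time 0; K² is the contribution of du⊗du.
omit [CompactSpace M] [T2Space M] in
theorem localTest_le (χ : M → ℝ) (hχ : ∀ x, χ x ∈ Icc (0 : ℝ) 1) {v : M → ℝ} {K : ℝ}
    (hv : ContMDiff (𝓡 n) 𝓘(ℝ, ℝ) ∞ v)
    (hK : ∀ x, |v x| + Real.sqrt (gradSq g₀ v x) + hessNorm g₀ v x ≤ K) (i₀ : Fin n) (c : M)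
    {q : EuclideanSpace ℝ (Fin n) × (Fin n → Fin n → ℝ)}
    (hq : q ∈ frames (extChartAt (𝓡 n) c).target (gram g₀ c)) :
    localTest g₀ χ v i₀ c q ≤ (n + 1) * (K + K ^ 2) := by
  set x := (extChartAt (𝓡 n) c).symm q.1 with hxd
  have hx : x ∈ (extChartAt (𝓡 n) c).source := (extChartAt (𝓡 n) c).map_target hq.1
  have hxq : extChartAt (𝓡 n) c x = q.1 := (extChartAt (𝓡 n) c).right_inv hq.1
  have hG := isMetricOn_gram g₀ c
  have h1 := gradSq_eq g₀ c hx hv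
  have h2 := hessNorm_eq g₀ c hx hv
  rw [hxq] at h1 h2
  have h3 : frameTest (vTensor (gram g₀ c) (loc n c v) q.1) (Matrix.of q.2) i₀
      ≤ (n + 1) * (hessNorm g₀ v x + gradSq g₀ v x) := by
    rw [h1, h2]
    exact frameTest_le hq.2 (hessian_transpose hG (loc_smooth c hv) hq.1) i₀
  have hh : 0 ≤ hessNorm g₀ v x := Real.sqrt_nonneg _
  have hg := gradSq_nonneg g₀ v hv x
  have hs := Real.sqrt_nonneg (gradSq g₀ v x)
  have h4 : Real.sqrt (gradSq g₀ v x) ≤ K := by linarith [hK x, abs_nonneg (v x)]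
  have h5 : gradSq g₀ v x ≤ K ^ 2 := by
    rw [← Real.sq_sqrt hg]
    exact pow_le_pow_left₀ hs h4 2
  have h6 : hessNorm g₀ v x ≤ K := by linarith [hK x, abs_nonneg (v x)]
  have h7 : frameTest (vTensor (gram g₀ c) (loc n c v) q.1) (Matrix.of q.2) i₀
      ≤ (n + 1) * (K + K ^ 2) := h3.trans (by gcongr)
  have h8 : 0 ≤ (n + 1) * (K + K ^ 2) := by
    have : 0 ≤ K := hh.trans h6
    positivity
  have h9 : loc n c χ q.1 ^ 2 ≤ 1 := pow_le_one₀ (hχ x).1 (hχ x).2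
  rw [localTest]
  exact (mul_le_mul_of_nonneg_left h7 (sq_nonneg _)).trans (mul_le_of_le_one_left h8 h9)

/-- The estimate of the test function along the flow. -/
theorem exists_localTest_bound [Nonempty M] (hn : 4 < n) {χ : M → ℝ}
    (hχ : ContMDiff (𝓡 n) 𝓘(ℝ, ℝ) ∞ χ) (hχ1 : ∀ x, χ x ∈ Icc (0 : ℝ) 1) (K : ℝ) (i₀ : Fin n) :
    ∃ C : ℝ, 0 ≤ C ∧ ∀ ε ∈ Ico (0 : ℝ) 1, ∀ T : ℝ, 0 < T → ∀ u : ℝ → M → ℝ,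
      IsFlowSolution g₀ ε T u → IsC1 g₀ (u 0) →
      (∀ x, |u 0 x| + Real.sqrt (gradSq g₀ (u 0) x) + hessNorm g₀ (u 0) x ≤ K) →
      ∀ D m : ℝ, 0 ≤ D → (∀ t ∈ Icc 0 T, 0 ≤ rEps g₀ ε (u t) ∧ rEps g₀ ε (u t) ≤ D ^ 2) →
      (∀ t ∈ Icc 0 T, ∀ x, χ x ≠ 0 → m ≤ u t x) →
      ∀ t ∈ Ico 0 T, ∀ c, ∀ q ∈ frames (extChartAt (𝓡 n) c).target (gram g₀ c),
        localTest g₀ χ (u t) i₀ c q ≤ C * (1 + D * Real.exp (-(2 - ε) * m)) := by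
  obtain ⟨s, Kc, hKc, hs⟩ := exists_finite_chart_cover n M
  obtain ⟨B, L, hB0, hL0, hBL⟩ := exists_uniform_bounds g₀ s hKc hχ
  obtain ⟨C, hC0, hC⟩ := exists_interior_maximum_estimate n hn B L hB0 hL0
  refine ⟨C + |(n + 1) * (K + K ^ 2)|, by positivity, ?_⟩
  intro ε hε T hT u h h0 hK D m hD hr hm t ht c q hq
  obtain ⟨t₀, ht₀, c₀, hc₀, q₀, hq₀, hmax⟩ := exists_isMax_localTest g₀ hKc hs hχ hT h.smooth i₀
    (Ico_subset_Icc_self ht)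
  refine (hmax t ⟨ht.1, le_rfl⟩ c q hq).trans ?_
  have hy₀ : q₀.1 ∈ (extChartAt (𝓡 n) c₀).target := (hKc c₀).2 hq₀.1
  have he : 0 ≤ D * Real.exp (-(2 - ε) * m) := by positivity
  have hA := abs_nonneg ((n + 1) * (K + K ^ 2))
  rcases le_or_gt (localTest g₀ χ (u t₀) i₀ c₀ q₀) 0 with hneg | hpos
  · exact hneg.trans (by positivity)
  rcases ht₀.1.eq_or_lt with h00 | h0t
  · rw [← h00]
    refine (localTest_le g₀ χ hχ1 h0.1 hK i₀ c₀ ⟨hy₀, hq₀.2⟩).trans ((le_abs_self _).trans ?_)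
    have := mul_nonneg hA he
    have := mul_nonneg hC0 he
    linarith
  -- Restricting to t < T makes t₀ an interior time, where the time derivative is two-sided and the
  -- velocity is known to be smooth.
  have htI : t₀ ∈ Ioo 0 T := ⟨h0t, ht₀.2.trans_lt ht.2⟩
  have htC := Ioo_subset_Icc_self htI
  -- A positive maximum forces χ ≠ 0, so the point lies in the region where u ≥ m is assumed.
  have hχ0 : χ ((extChartAt (𝓡 n) c₀).symm q₀.1) ≠ 0 := fun hz => by
    rw [localTest, loc, hz] at hpos
    simp at hpos
  have hC1 := h.isC1 hn hT h0 htC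
  have hρ := Real.sq_sqrt (hr t₀ htC).1
  have hρD : Real.sqrt (rEps g₀ ε (u t₀)) ≤ D := (Real.sqrt_le_left hD).2 (hr t₀ htC).2
  have h1 := hC (extChartAt (𝓡 n) c₀).target (gram g₀ c₀) (fun r => loc n c₀ (u r))
    (fun r => loc n c₀ (velocity g₀ ε (u r))) (loc n c₀ χ) (2 - ε)
    (Real.sqrt (rEps g₀ ε (u t₀))) (sEps g₀ ε (u t₀)) t₀ T i₀ q₀.1 q₀.2 (isMetricOn_gram g₀ c₀)
    (fun z hz => gram_posDef g₀ c₀ hz) hy₀ hq₀.2 (hBL c₀ hc₀ q₀ hq₀).1 (loc_smooth c₀ hχ) htI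
    ((loc_family_smooth c₀ h.smooth).mono (prod_mono_left Ioo_subset_Icc_self))
    (fun r hr z _ => h.hasDerivAt hr _) ⟨by linarith [hε.2], by linarith [hε.1]⟩
    (Real.sqrt_nonneg _) (fun z hz => trace_wEndo_pos g₀ hn c₀ hC1 hz)
    (fun z hz => loc_velocity g₀ hn c₀ hC1 hρ hz) (by rw [loc]; positivity)
    (pow_le_one₀ (hχ1 _).1 (hχ1 _).2) (hBL c₀ hc₀ q₀ hq₀).2.1 (hBL c₀ hc₀ q₀ hq₀).2.2
    (fun z hz A hA => hmax t₀ ht₀ c₀ (z, A) ⟨hz, hA⟩)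
    (fun r hr => hmax r ⟨hr.1.le, hr.2.le.trans ht₀.2⟩ c₀ q₀ ⟨hy₀, hq₀.2⟩)
  have h2 : Real.exp (-(2 - ε) * loc n c₀ (u t₀) q₀.1) ≤ Real.exp (-(2 - ε) * m) := by
    rw [Real.exp_le_exp]
    have h3 : m ≤ loc n c₀ (u t₀) q₀.1 := hm t₀ htC _ hχ0
    have h4 : 0 < 2 - ε := by linarith [hε.2]
    linarith [mul_le_mul_of_nonneg_left h3 h4.le]
  refine (show localTest g₀ χ (u t₀) i₀ c₀ q₀ ≤ _ from h1).trans ?_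
  refine mul_le_mul (by linarith) ?_ (by positivity) (by positivity)
  exact add_le_add le_rfl (mul_le_mul hρD h2 (Real.exp_pos _).le hD)

omit [CompactSpace M] [T2Space M] in
/-- Where the cutoff function equals one, the test function controls the first two derivatives. -/
theorem gradSq_add_hessNorm_le (hn : 4 < n) {χ : M → ℝ} {v : M → ℝ} (hv : IsC1 g₀ v) {x : M}
    (hx1 : χ x = 1) {i₀ : Fin n} {N₀ N₁ : ℝ} (hN₀ : 0 ≤ N₀) (hN₁ : 0 ≤ N₁)
    (h0 : sigma1 g₀ (fun _ => 0) x ≤ N₀)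
    (h1 : ∀ c, ∀ q ∈ frames (extChartAt (𝓡 n) c).target (gram g₀ c),
      localTest g₀ χ v i₀ c q ≤ N₁) :
    gradSq g₀ v x + hessNorm g₀ v x ≤ (n + 1) ^ 2 * (N₀ + N₁) := by
  have hx : x ∈ (extChartAt (𝓡 n) x).source := mem_extChartAt_source x
  have hy := chart_mem_target x hx
  have hG := isMetricOn_gram g₀ x
  rw [gradSq_eq g₀ x hx hv.1, hessNorm_eq g₀ x hx hv.1]
  refine norm_le_of_frameTest_le (i₀ := i₀) hn (gram_posDef g₀ x hy)
    (hessian_transpose hG (loc_smooth x hv.1) hy)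
    (a := ((gram g₀ x (extChartAt (𝓡 n) x x))⁻¹
      * schouten (gram g₀ x) (extChartAt (𝓡 n) x x)).trace) ?_ hN₀ hN₁ ?_ fun A hA => ?_
  · rwa [trace_schouten_eq_sigma1 g₀ hn x]
  · have h2 := trace_wEndo_pos g₀ hn x hv hy
    rwa [trace_wEndo g₀ x hy] at h2
  · have h2 := h1 x (extChartAt (𝓡 n) x x, A) ⟨hy, hA⟩
    rwa [localTest, loc_chart x hx, hx1, one_pow, one_mul] at h2

-- Continuity in time at a fixed point extends the estimate from t < T to the final time.
omit [CompactSpace M] [T2Space M] in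
theorem gradSq_add_hessNorm_continuousOn {I : Set ℝ} (hI : UniqueDiffOn ℝ I) {u : ℝ → M → ℝ}
    (hu : ContMDiffOn (𝓘(ℝ, ℝ).prod (𝓡 n)) 𝓘(ℝ, ℝ) ∞ (fun q : ℝ × M => u q.1 q.2) (I ×ˢ univ))
    (x : M) : ContinuousOn (fun t => gradSq g₀ (u t) x + hessNorm g₀ (u t) x) I := by
  have hx : x ∈ (extChartAt (𝓡 n) x).source := mem_extChartAt_source x
  have hy := chart_mem_target x hx
  have hG := isMetricOn_gram g₀ x
  have hF := FamilyDomain.prod hI (isOpen_target (n := n) x)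
  have hus := loc_family_smooth x hu
  have hm : MapsTo (fun t : ℝ => (t, extChartAt (𝓡 n) x x)) I
      (I ×ˢ (extChartAt (𝓡 n) x).target) := fun t ht => ⟨ht, hy⟩
  have hc : ContinuousOn (fun t : ℝ => (t, extChartAt (𝓡 n) x x)) I := by fun_prop
  have h1 := (hF.gradNormSq hG (fun q hq => hq.2) (v := fun t => loc n x (u t))
    hus).continuousOn.comp hc hm
  have hH : MSmooth (I ×ˢ (extChartAt (𝓡 n) x).target)
      (fun q : ℝ × EuclideanSpace ℝ (Fin n) =>
        Matrix.of (hessian (gram g₀ x) (loc n x (u q.1)) q.2)) := fun i j =>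
    hF.hessian_of_metric hG (fun q hq => hq.2) (v := fun t => loc n x (u t)) hus i j
  have hQ := ((hG.smooth.inv hG.det_ne_zero).comp contDiffOn_snd
    fun (q : ℝ × EuclideanSpace ℝ (Fin n)) (hq : q ∈ I ×ˢ (extChartAt (𝓡 n) x).target) =>
      hq.2).mul hH
  have h2 := ((hQ.mul hQ).trace.continuousOn.comp hc hm).sqrt
  refine (h1.add h2).congr fun t ht => ?_
  rw [gradSq_eq g₀ x hx (slice_smooth hu ht), hessNorm_eq g₀ x hx (slice_smooth hu ht)]
  rfl

end Estimate

end SigmaTwoFlow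

end

open SigmaTwoFlow in
theorem mainTheorem5 {n : ℕ} (hn : 4 < n) {M : Type*} [TopologicalSpace M] [T2Space M]
    [CompactSpace M] [ChartedSpace (EuclideanSpace ℝ (Fin n)) M] [IsManifold (𝓡 n) ∞ M]
    (g₀ : SigmaTwoFlow.SmoothMetric n M) (p : M) (R : ℝ) (hR : 0 < R) (K : ℝ) (hK : 0 < K) :
    ∃ C : ℝ, ∀ ε ∈ Ico (0 : ℝ) 1,
      ((K⁻¹ : ℝ) : EReal) ≤ SigmaTwoFlow.yamabeConst g₀ ε →
      ∀ T : ℝ, 0 < T → ∀ u : ℝ → M → ℝ,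
        SigmaTwoFlow.IsFlowSolution g₀ ε T u →
        SigmaTwoFlow.IsC1 g₀ (u 0) →
        (∀ x, |u 0 x| + Real.sqrt (SigmaTwoFlow.gradSq g₀ (u 0) x)
          + SigmaTwoFlow.hessNorm g₀ (u 0) x ≤ K) →
        ∀ t ∈ Icc 0 T, ∀ x ∈ SigmaTwoFlow.geodesicBall g₀ p (R / 2),
          SigmaTwoFlow.gradSq g₀ (u t) x + SigmaTwoFlow.hessNorm g₀ (u t) x ≤
            C * (1 + SigmaTwoFlow.rEps g₀ ε (u t) *
              Real.exp (-(2 - ε) * sInf ((fun q : ℝ × M => u q.1 q.2) ''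
                (Icc 0 T ×ˢ SigmaTwoFlow.geodesicBall g₀ p R)))) := by
  have : Nonempty M := ⟨p⟩
  obtain ⟨χ, hχ, hχ1, hχR, hχ0⟩ := exists_cutoff g₀ p hR
  obtain ⟨c, D, hc, hcD⟩ := exists_rEps_bounds g₀ hn hK
  obtain ⟨C, hC, hbound⟩ := exists_localTest_bound g₀ hn hχ hχ1 K ⟨0, by omega⟩
  obtain ⟨N, hN⟩ := isCompact_univ.exists_bound_of_continuousOn
    (sigma1_continuous g₀ hn contMDiff_const (v := fun _ => 0)).continuousOn
  have hN0 : 0 ≤ N := (norm_nonneg _).trans (hN p (mem_univ p))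
  -- The factor (n + 1)² comes from recovering the derivatives from the test function, N bounds σ₁
  -- of g₀, and (|D| + 1)/c converts the bound by √r into one by r.
  refine ⟨(n + 1) ^ 2 * ((N + C) * (1 + (|D| + 1) / c)), ?_⟩
  intro ε hε hY T hT u h h0 hK0 t ht x hx
  set m := sInf ((fun q : ℝ × M => u q.1 q.2) '' (Icc 0 T ×ˢ geodesicBall g₀ p R)) with hm
  have hr := hcD ε hε hY T hT u h h0 hK0
  have hbdd : BddBelow ((fun q : ℝ × M => u q.1 q.2) '' (Icc 0 T ×ˢ geodesicBall g₀ p R)) :=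
    ((isCompact_Icc.prod isCompact_univ).bddBelow_image h.continuousOn).mono
      (image_mono (prod_mono_right (subset_univ _)))
  -- A bound for √r is needed, and r ≤ D ≤ (|D| + 1)². The lower bound m for u is required only
  -- where χ ≠ 0, which lies in the ball of radius R.
  have h1 := hbound ε hε T hT u h h0 hK0 (|D| + 1) m (by positivity)
    (fun r hrI => ⟨hc.le.trans (hr r hrI).1, (hr r hrI).2.trans
      (by nlinarith only [le_abs_self D, abs_nonneg D])⟩)
    fun r hrI z hz => csInf_le hbdd ⟨(r, z), ⟨hrI, hχ0 z hz⟩, rfl⟩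
  set e := Real.exp (-(2 - ε) * m) with he
  have he0 : 0 < e := Real.exp_pos _
  have h2 : ∀ r ∈ Ico 0 T, gradSq g₀ (u r) x + hessNorm g₀ (u r) x
      ≤ (n + 1) ^ 2 * (N + C * (1 + (|D| + 1) * e)) := fun r hrI =>
    gradSq_add_hessNorm_le g₀ hn (h.isC1 hn hT h0 (Ico_subset_Icc_self hrI)) (hχR x hx) hN0
      (by positivity) ((le_abs_self _).trans (hN x (mem_univ x))) (h1 r hrI)
  have h3 : gradSq g₀ (u t) x + hessNorm g₀ (u t) x
      ≤ (n + 1) ^ 2 * (N + C * (1 + (|D| + 1) * e)) := by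
    have hcont := gradSq_add_hessNorm_continuousOn g₀ (uniqueDiffOn_Icc hT) h.smooth x t ht
    have htc : t ∈ closure (Ico 0 T) := by rwa [closure_Ico hT.ne]
    have := mem_closure_iff_nhdsWithin_neBot.1 htc
    exact le_of_tendsto (hcont.mono Ico_subset_Icc_self)
      (Filter.eventually_of_mem self_mem_nhdsWithin h2)
  refine h3.trans ?_
  rw [mul_assoc]
  refine mul_le_mul_of_nonneg_left ?_ (by positivity)
  -- The lower bound c ≤ r at time t inserts the factor r. This is the point at which the Yamabe
  -- constant must be bounded away from zero.
  have h4 : (|D| + 1) * e ≤ (|D| + 1) / c * (rEps g₀ ε (u t) * e) := by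
    rw [div_mul_eq_mul_div, le_div_iff₀ hc]
    have := mul_le_mul_of_nonneg_left (hr t ht).1 (show 0 ≤ (|D| + 1) * e by positivity)
    linarith
  have h5 : 0 ≤ (|D| + 1) / c := by positivity
  have h6 : 0 ≤ rEps g₀ ε (u t) * e := mul_nonneg (hc.le.trans (hr t ht).1) he0.le
  have h7 : 0 ≤ (|D| + 1) * e := by positivity
  calc N + C * (1 + (|D| + 1) * e) ≤ (N + C) * (1 + (|D| + 1) * e) := by
        nlinarith only [mul_nonneg hN0 h7]
    _ ≤ (N + C) * ((1 + (|D| + 1) / c) * (1 + rEps g₀ ε (u t) * e)) :=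
        mul_le_mul_of_nonneg_left (by nlinarith only [h4, h5, h6]) (by positivity)
    _ = _ := by ring
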